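/- Let $\mathbb{K}$ be a perfect field; all categories are $\mathbb{K}$-linear and additive. **Setting.** A *cluster category* is an idempotent complete Frobenius extriangulated category $\mathcal{C}$ which is algebraic (equivalent, as an extriangulated category, to a partial stabilisation $\mathcal{E}/\mathcal{P}$ of an exact category $\mathcal{E}$ by a full additively closed subcategory $\mathcal{P}$ of projective-injective objects), whose stable category $\underline{\mathcal{C}}$ (the quotient by all projective-injectives) is Hom-finite and $2$-Calabi–Yau, and which has a cluster-tilting subcategory. Here a full subcategory $\mathcal{T}$ is *cluster-tilting* if $\mathcal{T}=\{X:\operatorname{Ext}^1(T,X)=0\ \forall T\in\mathcal{T}\}=\{X:\operatorname{Ext}^1(X,T)=0\ \forall T\in\mathcal{T}\}$ and every object has a right $\mathcal{T}$-approximation that is a deflation and a left $\mathcal{T}$-approximation that is an inflation; its image in $\underline{\mathcal{C}}$ is denoted $\underline{\mathcal{T}}$. We say $\underline{\mathcal{C}}$ is *compact* if it is enriched in pseudocompact vector spaces, $\operatorname{End}(X)/\operatorname{rad}\operatorname{End}(X)$ is finite-dimensional for all $X$, and every cluster-tilting subcategory of $\underline{\mathcal{C}}$ is pseudocompact in its radical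 topology; it is *skew-symmetric* if it is Krull–Schmidt and $\dim_{\mathbb{K}}\operatorname{End}(X)/\operatorname{rad}\operatorname{End}(X)=1$ for all indecomposable $X$. For cluster-tilting subcategories $\mathcal{T},\mathcal{U}\subseteq\mathcal{C}$, let $K_0(\mathcal{T})$ be the split Grothendieck group and let $K_0(\operatorname{fpmod}\underline{\mathcal{T}})$ and $K_0(\operatorname{fd}\underline{\mathcal{T}})$ be the Grothendieck groups of finitely presented, respectively finite-dimensional, $\underline{\mathcal{T}}$-modules (a module is a linear functor $\underline{\mathcal{T}}^{\mathrm{op}}\to\operatorname{Mod}\mathbb{K}$; it is finite-dimensional if its values are finite-dimensional and its support is $\operatorname{add}V$ for some object $V$). Define: * $\operatorname{ind}_{\mathcal{U}}^{\mathcal{T}},\operatorname{coind}_{\mathcal{U}}^{\mathcal{T}}\colon K_0(\mathcal{U})\to K_0(\mathcal{T})$ by $[X]\mapsto[R]-[N]$ for a conflation $N\to R\to X$ with $N,R\in\mathcal{T}$, respectively $[X]\mapsto[L]-[L']$ for a conflation $X\to L\to L'$ with $L,L'\in\mathcal{T}$. * $\beta_{\mathcal{T}}\colon K_0(\operatorname{fpmod}\underline{\mathcal{T}})\to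 K_0(\mathcal{T})$ by sending $[M]$ to minus the image in $K_0(\mathcal{T})$ of the alternating sum of the terms of a finite resolution of $M$ by representable $\widehat{\mathcal{T}}$-modules, where $\widehat{\mathcal{T}}$ is the preimage of $\mathcal{T}$ in an exact category $\mathcal{E}$ with $\mathcal{E}/\mathcal{P}\simeq\mathcal{C}$ as above (any choice). * $\overline{\operatorname{Ind}}{}_{\mathcal{U}}^{\mathcal{T}},\overline{\operatorname{Coind}}{}_{\mathcal{U}}^{\mathcal{T}}\colon K_0(\operatorname{fpmod}\underline{\mathcal{U}})\to K_0(\operatorname{fpmod}\underline{\mathcal{T}})$ by $$\overline{\operatorname{Ind}}[\operatorname{Ext}^1(-,X)|_{\mathcal{U}}]=[\operatorname{Ker}\operatorname{Ext}^1(-,i_L)|_{\mathcal{T}}]-[\operatorname{Ker}\operatorname{Ext}^1(-,i_R)|_{\mathcal{T}}],$$ $$\overline{\operatorname{Coind}}[\operatorname{Ext}^1(-,X)|_{\mathcal{U}}]=[\operatorname{Coker}\operatorname{Ext}^1(-,p_R)|_{\mathcal{T}}]-[\operatorname{Coker}\operatorname{Ext}^1(-,p_L)|_{\mathcal{T}}]$$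 for $X\in\mathcal{C}$ and any conflations $X\xrightarrow{i_L}L\xrightarrow{p_L}L'$ and $N\xrightarrow{i_R}R\xrightarrow{p_R}X$ with $L,L',N,R\in\mathcal{U}$. **Theorem.** Let $\mathcal{C}$ be a cluster category such that $\underline{\mathcal{C}}$ is compact or skew-symmetric, and let $\mathcal{T},\mathcal{U}$ be cluster-tilting subcategories of $\mathcal{C}$. Then the prescriptions above determine well-defined unique homomorphisms, and $$\beta_{\mathcal{T}}\circ\overline{\operatorname{Ind}}{}_{\mathcal{U}}^{\mathcal{T}}=\operatorname{ind}_{\mathcal{U}}^{\mathcal{T}}\circ\beta_{\mathcal{U}},\qquad \beta_{\mathcal{T}}\circ\overline{\operatorname{Coind}}{}_{\mathcal{U}}^{\mathcal{T}}=\operatorname{coind}_{\mathcal{U}}^{\mathcal{T}}\circ\beta_{\mathcal{U}}$$ as maps $K_0(\operatorname{fpmod}\underline{\mathcal{U}})\to K_0(\mathcal{T})$. **Corollary.** Suppose moreover that $\mathcal{T}$ and $\mathcal{U}$ are maximally mutable (every indecomposable non-projective object $T_0$ of the subcategory $\mathcal{T}$ can be exchanged for an indecomposable $T_1\not\cong T_0$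 so that $\operatorname{add}(\mathcal{T}\setminus T_0\cup\{T_1\})$ is cluster-tilting, with non-split conflations $T_1\to B^+\to T_0$ and $T_0\to B^-\to T_1$ whose second, respectively first, map is a right, respectively left, $(\mathcal{T}\setminus T_0)$-approximation; likewise for $\mathcal{U}$), and that either $\underline{\mathcal{V}}$ is additively finite for every cluster-tilting $\mathcal{V}\subseteq\mathcal{C}$ or $\mathcal{U}$ is reachable from $\mathcal{T}$ by a finite sequence of such mutations. Here mutability and reachability are taken either in $\mathcal{C}$, assumed Krull–Schmidt, or for $\underline{\mathcal{T}},\underline{\mathcal{U}}$ in $\underline{\mathcal{C}}$, assumed Krull–Schmidt. Then finite-dimensional $\underline{\mathcal{T}}$- and $\underline{\mathcal{U}}$-modules are finitely presented; the adjoints, with respect to the pairings $\langle[M],[X]\rangle=\dim M(X)$, of the coindex and index maps $K_0(\underline{\mathcal{T}})\to K_0(\underline{\mathcal{U}})$ of $\underline{\mathcal{C}}$, which are maps between the numerical Grothendieck groups of locally finite-dimensional modules over $\underline{\mathcal{U}}$ and $\underline{\mathcal{T}}$, restrict to unique homomorphisms $\overline{\operatorname{ind}}{}_{\mathcal{U}}^{\mathcal{T}},\overline{\operatorname{coind}}{}_{\mathcal{U}}^{\mathcal{T}}\colon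 K_0(\operatorname{fd}\underline{\mathcal{U}})\to K_0(\operatorname{fd}\underline{\mathcal{T}})$ respectively; and $$\beta_{\mathcal{T}}\circ\overline{\operatorname{ind}}{}_{\mathcal{U}}^{\mathcal{T}}=\operatorname{ind}_{\mathcal{U}}^{\mathcal{T}}\circ\beta_{\mathcal{U}},\qquad \beta_{\mathcal{T}}\circ\overline{\operatorname{coind}}{}_{\mathcal{U}}^{\mathcal{T}}=\operatorname{coind}_{\mathcal{U}}^{\mathcal{T}}\circ\beta_{\mathcal{U}}$$ as maps $K_0(\operatorname{fd}\underline{\mathcal{U}})\to K_0(\mathcal{T})$. -/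

import Mathlib

open CategoryTheory CategoryTheory.Limits Opposite

universe k u v u' v' w

attribute [-instance] CategoryTheory.catToReflQuiver

noncomputable section

namespace ClusterIso

/-! ### Extriangulated categories -/

/-- The data of an extriangulated structure on a `K`-linear category: a `K`-bilinear bifunctor
`Ext Z X` (extensions of `Z` by `X`, contravariant in `Z` via `pull`, covariant in `X` via `push`)
and a realisation relation: `Real δ x y` says that `X -x→ Y -y→ Z` realises `δ : Ext Z X`. -/
structure ExtData (K : Type k) [Field K] (C : Type u) [Category.{v} C] [Preadditive C]
    [Linear K C] where
  Ext : C → C → Type v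
  [grp : ∀ Z X, AddCommGroup (Ext Z X)]
  [mod : ∀ Z X, Module K (Ext Z X)]
  pull : ∀ {Z' Z : C} (_ : Z' ⟶ Z) (X : C), Ext Z X →ₗ[K] Ext Z' X
  push : ∀ (Z : C) {X X' : C} (_ : X ⟶ X'), Ext Z X →ₗ[K] Ext Z X'
  pull_id : ∀ (Z X : C) (δ : Ext Z X), pull (𝟙 Z) X δ = δ
  pull_comp : ∀ {Z'' Z' Z : C} (f : Z'' ⟶ Z') (g : Z' ⟶ Z) (X : C) (δ : Ext Z X),
    pull (f ≫ g) X δ = pull f X (pull g X δ)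
  pull_add : ∀ {Z' Z : C} (f g : Z' ⟶ Z) (X : C) (δ : Ext Z X),
    pull (f + g) X δ = pull f X δ + pull g X δ
  pull_smul : ∀ {Z' Z : C} (a : K) (f : Z' ⟶ Z) (X : C) (δ : Ext Z X),
    pull (a • f) X δ = a • pull f X δ
  push_id : ∀ (Z X : C) (δ : Ext Z X), push Z (𝟙 X) δ = δ
  push_comp : ∀ (Z : C) {X X' X'' : C} (f : X ⟶ X') (g : X' ⟶ X'') (δ : Ext Z X),
    push Z (f ≫ g) δ = push Z g (push Z f δ)
  push_add : ∀ (Z : C) {X X' : C} (f g : X ⟶ X') (δ : Ext Z X),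
    push Z (f + g) δ = push Z f δ + push Z g δ
  push_smul : ∀ (Z : C) {X X' : C} (a : K) (f : X ⟶ X') (δ : Ext Z X),
    push Z (a • f) δ = a • push Z f δ
  pull_push : ∀ {Z' Z X X' : C} (f : Z' ⟶ Z) (g : X ⟶ X') (δ : Ext Z X),
    pull f X' (push Z g δ) = push Z' g (pull f X δ)
  Real : ∀ {X Y Z : C} (_ : Ext Z X) (_ : X ⟶ Y) (_ : Y ⟶ Z), Prop

attribute [instance] ExtData.grp ExtData.mod

section Basic

variable {K : Type k} [Field K] {C : Type u} [Category.{v} C] [Preadditive C] [Linear K C]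

/-- The axioms of an extriangulated category (Nakaoka–Palu). -/
structure IsExtriangulated [HasZeroObject C] [HasBinaryBiproducts C] (D : ExtData K C) : Prop where
  exists_real : ∀ {X Z : C} (δ : D.Ext Z X), ∃ (Y : C) (x : X ⟶ Y) (y : Y ⟶ Z), D.Real δ x y
  real_iff : ∀ {X Y Y' Z : C} (δ : D.Ext Z X) (x : X ⟶ Y) (y : Y ⟶ Z) (x' : X ⟶ Y') (y' : Y' ⟶ Z),
    D.Real δ x y → (D.Real δ x' y' ↔ ∃ e : Y ≅ Y', x ≫ e.hom = x' ∧ e.hom ≫ y' = y)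
  real_mor : ∀ {X Y Z X' Y' Z' : C} (δ : D.Ext Z X) (δ' : D.Ext Z' X')
    (x : X ⟶ Y) (y : Y ⟶ Z) (x' : X' ⟶ Y') (y' : Y' ⟶ Z') (a : X ⟶ X') (c : Z ⟶ Z'),
    D.Real δ x y → D.Real δ' x' y' → D.push Z a δ = D.pull c X' δ' →
      ∃ b : Y ⟶ Y', x ≫ b = a ≫ x' ∧ b ≫ y' = y ≫ c
  real_zero : ∀ (X Z : C), D.Real (0 : D.Ext Z X) (biprod.inl : X ⟶ X ⊞ Z) biprod.snd
  real_sum : ∀ {X Y Z X' Y' Z' : C} (δ : D.Ext Z X) (δ' : D.Ext Z' X')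
    (x : X ⟶ Y) (y : Y ⟶ Z) (x' : X' ⟶ Y') (y' : Y' ⟶ Z'),
    D.Real δ x y → D.Real δ' x' y' →
      D.Real (X := X ⊞ X') (Z := Z ⊞ Z')
        (D.push _ biprod.inl (D.pull biprod.fst X δ) + D.push _ biprod.inr (D.pull biprod.snd X' δ'))
        (biprod.map x x') (biprod.map y y')
  et3 : ∀ {X Y Z X' Y' Z' : C} (δ : D.Ext Z X) (δ' : D.Ext Z' X')
    (x : X ⟶ Y) (y : Y ⟶ Z) (x' : X' ⟶ Y') (y' : Y' ⟶ Z') (a : X ⟶ X') (b : Y ⟶ Y'),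
    D.Real δ x y → D.Real δ' x' y' → x ≫ b = a ≫ x' →
      ∃ c : Z ⟶ Z', b ≫ y' = y ≫ c ∧ D.push Z a δ = D.pull c X' δ'
  et3_op : ∀ {X Y Z X' Y' Z' : C} (δ : D.Ext Z X) (δ' : D.Ext Z' X')
    (x : X ⟶ Y) (y : Y ⟶ Z) (x' : X' ⟶ Y') (y' : Y' ⟶ Z') (b : Y ⟶ Y') (c : Z ⟶ Z'),
    D.Real δ x y → D.Real δ' x' y' → b ≫ y' = y ≫ c →
      ∃ a : X ⟶ X', x ≫ b = a ≫ x' ∧ D.push Z a δ = D.pull c X' δ'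
  et4 : ∀ {A B B₁ X F : C} (δ : D.Ext X A) (δ' : D.Ext F B)
    (f : A ⟶ B) (f' : B ⟶ X) (g : B ⟶ B₁) (g' : B₁ ⟶ F),
    D.Real δ f f' → D.Real δ' g g' →
      ∃ (E : C) (d : X ⟶ E) (e : E ⟶ F) (h' : B₁ ⟶ E) (δ'' : D.Ext E A),
        D.Real δ'' (f ≫ g) h' ∧ f' ≫ d = g ≫ h' ∧ h' ≫ e = g' ∧
        D.Real (D.push F f' δ') d e ∧ D.pull d A δ'' = δ ∧ D.push E f δ'' = D.pull e B δ'
  et4_op : ∀ {X A B F B₁ : C} (δ : D.Ext B X) (δ' : D.Ext B₁ F)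
    (f' : X ⟶ A) (f : A ⟶ B) (g' : F ⟶ B) (g : B ⟶ B₁),
    D.Real δ f' f → D.Real δ' g' g →
      ∃ (E : C) (d : X ⟶ E) (e : E ⟶ F) (h' : E ⟶ A) (δ'' : D.Ext B₁ E),
        D.Real δ'' h' (f ≫ g) ∧ d ≫ h' = f' ∧ h' ≫ f = e ≫ g' ∧
        D.Real (D.pull g' X δ) d e ∧ D.push B₁ e δ'' = δ' ∧ D.push B d δ = D.pull g E δ''

variable (D : ExtData K C)

/-- `X -x→ Y -y→ Z` is a conflation. -/
def Confl {X Y Z : C} (x : X ⟶ Y) (y : Y ⟶ Z) : Prop := ∃ δ : D.Ext Z X, D.Real δ x y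

def Infl {X Y : C} (x : X ⟶ Y) : Prop := ∃ (Z : C) (y : Y ⟶ Z), Confl D x y

def Defl {Y Z : C} (y : Y ⟶ Z) : Prop := ∃ (X : C) (x : X ⟶ Y), Confl D x y

def IsProj (P : C) : Prop := ∀ X, Subsingleton (D.Ext P X)

def IsInj (P : C) : Prop := ∀ Z, Subsingleton (D.Ext Z P)

/-- The full subcategory of projective-injective objects. -/
def ProjInj : ObjectProperty C := fun P => IsProj D P ∧ IsInj D P

structure IsFrobenius : Prop where
  enough_proj : ∀ X, ∃ (P : C) (p : P ⟶ X), IsProj D P ∧ Defl D p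
  enough_inj : ∀ X, ∃ (I : C) (i : X ⟶ I), IsInj D I ∧ Infl D i
  proj_iff_inj : ∀ P, IsProj D P ↔ IsInj D P

/-- `f : B ⟶ X` is a right `S`-approximation. -/
def RightApprox {C : Type u} [Category.{v} C] (S : ObjectProperty C) {B X : C} (f : B ⟶ X) :
    Prop :=
  S B ∧ ∀ (B' : C) (g : B' ⟶ X), S B' → ∃ h : B' ⟶ B, h ≫ f = g

/-- `f : X ⟶ B` is a left `S`-approximation. -/
def LeftApprox {C : Type u} [Category.{v} C] (S : ObjectProperty C) {X B : C} (f : X ⟶ B) :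
    Prop :=
  S B ∧ ∀ (B' : C) (g : X ⟶ B'), S B' → ∃ h : B ⟶ B', f ≫ h = g

/-- Cluster-tilting subcategories: maximal `Ext`-orthogonality on both sides, and strong functorial
finiteness. -/
structure ClusterTilting (T : ObjectProperty C) : Prop where
  mem_iff_right : ∀ X, T X ↔ ∀ T', T T' → Subsingleton (D.Ext T' X)
  mem_iff_left : ∀ X, T X ↔ ∀ T', T T' → Subsingleton (D.Ext X T')
  right_approx : ∀ X, ∃ (B : C) (f : B ⟶ X), RightApprox T f ∧ Defl D f
  left_approx : ∀ X, ∃ (B : C) (f : X ⟶ B), LeftApprox T f ∧ Infl D f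

end Basic

/-! ### Additive quotients and stable categories -/

section Quot

variable (K : Type k) [Field K] {C : Type u} [Category.{v} C] [Preadditive C] [Linear K C]

/-- The morphisms in the ideal generated by (the identities of) the objects in `P`. -/
def idealHom (P : ObjectProperty C) (X Y : C) : Submodule K (X ⟶ Y) :=
  Submodule.span K {h | ∃ (Q : C) (a : X ⟶ Q) (b : Q ⟶ Y), P Q ∧ a ≫ b = h}

variable {K} in
lemma idealHom_comp_left {P : ObjectProperty C} {X Y Z : C} (f : X ⟶ Y) {g : Y ⟶ Z}
    (hg : g ∈ idealHom K P Y Z) : f ≫ g ∈ idealHom K P X Z := by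
  have : idealHom K P Y Z ≤ (idealHom K P X Z).comap (Linear.leftComp K Z f) := by
    refine Submodule.span_le.2 ?_
    rintro _ ⟨Q, a, b, hQ, rfl⟩
    exact Submodule.subset_span ⟨Q, f ≫ a, b, hQ, by simp⟩
  exact this hg

variable {K} in
lemma idealHom_comp_right {P : ObjectProperty C} {X Y Z : C} {f : X ⟶ Y} (g : Y ⟶ Z)
    (hf : f ∈ idealHom K P X Y) : f ≫ g ∈ idealHom K P X Z := by
  have : idealHom K P X Y ≤ (idealHom K P X Z).comap (Linear.rightComp K X g) := by
    refine Submodule.span_le.2 ?_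
    rintro _ ⟨Q, a, b, hQ, rfl⟩
    exact Submodule.subset_span ⟨Q, a, b ≫ g, hQ, by simp⟩
  exact this hf

def idealRel (P : ObjectProperty C) : HomRel C := fun X Y f g => f - g ∈ idealHom K P X Y

instance idealRel_congruence (P : ObjectProperty C) : Congruence (idealRel K P) where
  equivalence := by
    intro X Y
    refine ⟨fun f => ?_, fun {f g} h => ?_, fun {f g h} h₁ h₂ => ?_⟩
    · simp [idealRel]
    · have := (idealHom K P X Y).neg_mem h
      simpa [idealRel] using this
    · have := (idealHom K P X Y).add_mem h₁ h₂
      simpa [idealRel] using this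
  comp_left f g g' h := by
    have := idealHom_comp_left f h
    simpa [idealRel, Preadditive.comp_sub] using this
  comp_right g h := by
    have := idealHom_comp_right g h
    simpa [idealRel, Preadditive.sub_comp] using this

/-- The additive quotient `C/P`. -/
abbrev AddQuot (P : ObjectProperty C) : Type u := CategoryTheory.Quotient (idealRel K P)

/-- The projection `C ⥤ C/P`. -/
abbrev AddQuot.π (P : ObjectProperty C) : C ⥤ AddQuot K P := Quotient.functor _

instance AddQuot.preadditive (P : ObjectProperty C) : Preadditive (AddQuot K P) :=
  Quotient.preadditive _ (fun X Y f₁ f₂ g₁ g₂ hf hg => by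
    have := (idealHom K P X Y).add_mem hf hg
    have e : f₁ + g₁ - (f₂ + g₂) = f₁ - f₂ + (g₁ - g₂) := by abel
    simpa only [idealRel, e] using this)

instance AddQuot.π_additive (P : ObjectProperty C) : (AddQuot.π K P).Additive :=
  Quotient.functor_additive _ _

instance AddQuot.linear (P : ObjectProperty C) : Linear K (AddQuot K P) :=
  Quotient.linear K _ (fun a X Y f₁ f₂ hf => by
    have := (idealHom K P X Y).smul_mem a hf
    simpa only [idealRel, smul_sub] using this)

instance AddQuot.π_linear (P : ObjectProperty C) : (AddQuot.π K P).Linear K :=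
  Quotient.linear_functor K _ _

end Quot

section QuotData

variable {K : Type k} [Field K] {C : Type u} [Category.{v} C] [Preadditive C] [Linear K C]
  (D : ExtData K C) {P : ObjectProperty C}

lemma pull_eq_zero (hP : P ≤ ProjInj D) {Z' Z : C} {f : Z' ⟶ Z} (hf : f ∈ idealHom K P Z' Z)
    (X : C) (δ : D.Ext Z X) : D.pull f X δ = 0 := by
  induction hf using Submodule.span_induction with
  | mem h hh =>
    obtain ⟨Q, a, b, hQ, rfl⟩ := hh
    rw [D.pull_comp]
    have := (hP Q hQ).1 X
    rw [Subsingleton.elim (D.pull b X δ) 0, map_zero]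
  | zero => simpa using D.pull_smul 0 (0 : Z' ⟶ Z) X δ
  | add f g _ _ h₁ h₂ => rw [D.pull_add, h₁, h₂, add_zero]
  | smul a f _ h => rw [D.pull_smul, h, smul_zero]

lemma push_eq_zero (hP : P ≤ ProjInj D) (Z : C) {X X' : C} {f : X ⟶ X'}
    (hf : f ∈ idealHom K P X X') (δ : D.Ext Z X) : D.push Z f δ = 0 := by
  induction hf using Submodule.span_induction with
  | mem h hh =>
    obtain ⟨Q, a, b, hQ, rfl⟩ := hh
    rw [D.push_comp]
    have := (hP Q hQ).2 Z
    rw [Subsingleton.elim (D.push Z a δ) 0, map_zero]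
  | zero => simpa using D.push_smul Z 0 (0 : X ⟶ X') δ
  | add f g _ _ h₁ h₂ => rw [D.push_add, h₁, h₂, add_zero]
  | smul a f _ h => rw [D.push_smul, h, smul_zero]

lemma pull_congr (hP : P ≤ ProjInj D) {Z' Z : C} {f g : Z' ⟶ Z} (h : idealRel K P f g) (X : C) :
    D.pull f X = D.pull g X := by
  ext δ
  have h1 := D.pull_add (f - g) g X δ
  rw [sub_add_cancel, pull_eq_zero D hP h, zero_add] at h1
  exact h1

lemma push_congr (hP : P ≤ ProjInj D) (Z : C) {X X' : C} {f g : X ⟶ X'} (h : idealRel K P f g) :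
    D.push Z f = D.push Z g := by
  ext δ
  have h1 := D.push_add Z (f - g) g δ
  rw [sub_add_cancel, push_eq_zero D hP Z h, zero_add] at h1
  exact h1

/-- The extriangulated structure on the partial stabilisation `C/P`, for `P` consisting of
projective-injective objects: the extension groups are those of `C`, and the conflations are the
sequences isomorphic (by an isomorphism of middle terms) to images of conflations of `C`. -/
def quotData (hP : P ≤ ProjInj D) : ExtData K (AddQuot K P) where
  Ext Z X := D.Ext Z.as X.as
  pull f X := Quot.lift (fun f => D.pull f X.as)
    (fun _ _ h => pull_congr D hP ((HomRel.compClosure_iff_self _ _ _).1 h) _) f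
  push Z _ _ f := Quot.lift (fun f => D.push Z.as f)
    (fun _ _ h => push_congr D hP _ ((HomRel.compClosure_iff_self _ _ _).1 h)) f
  pull_id _ _ δ := D.pull_id _ _ δ
  pull_comp := by rintro _ _ _ ⟨f⟩ ⟨g⟩ X δ; exact D.pull_comp f g _ δ
  pull_add := by rintro _ _ ⟨f⟩ ⟨g⟩ X δ; exact D.pull_add f g _ δ
  pull_smul := by rintro _ _ a ⟨f⟩ X δ; exact D.pull_smul a f _ δ
  push_id _ _ δ := D.push_id _ _ δ
  push_comp := by rintro Z _ _ _ ⟨f⟩ ⟨g⟩ δ; exact D.push_comp _ f g δ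
  push_add := by rintro Z _ _ ⟨f⟩ ⟨g⟩ δ; exact D.push_add _ f g δ
  push_smul := by rintro Z _ _ a ⟨f⟩ δ; exact D.push_smul _ a f δ
  pull_push := by rintro _ _ _ _ ⟨f⟩ ⟨g⟩ δ; exact D.pull_push f g δ
  Real {X Y Z} δ x y := ∃ (Y' : C) (x' : X.as ⟶ Y') (y' : Y' ⟶ Z.as)
    (e : Y ≅ (AddQuot.π K P).obj Y'),
    D.Real δ x' y' ∧ x ≫ e.hom = (AddQuot.π K P).map x' ∧ e.hom ≫ (AddQuot.π K P).map y' = y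

/-- The stable category of `C`: the quotient by all projective-injective objects. -/
abbrev Stab : Type u := AddQuot K (ProjInj D)

/-- The projection from `C` to its stable category. -/
abbrev stabπ : C ⥤ Stab D := AddQuot.π K (ProjInj D)

/-- The extriangulated structure of the stable category. -/
abbrev stabData : ExtData K (Stab D) := quotData D le_rfl

/-- The image in the stable category of a full subcategory. -/
def stabProp (T : ObjectProperty C) : ObjectProperty (Stab D) := fun X => T X.as

end QuotData

/-! ### Direct sums, Krull–Schmidt categories, radicals -/

section Additive

variable {A : Type u} [Category.{v} A] [Preadditive A]

/-- `add S`: direct summands of finite direct sums of objects in `S`. -/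
def AddClosure (S : ObjectProperty A) : ObjectProperty A := fun X =>
  ∃ (n : ℕ) (f : Fin n → A) (b : Bicone f), Nonempty b.IsBilimit ∧ (∀ i, S (f i)) ∧
    Nonempty (Retract X b.pt)

/-- A full subcategory is additively closed if it contains all summands of finite direct sums of its
objects. -/
def IsAddClosed (S : ObjectProperty A) : Prop := ∀ X, AddClosure S X → S X

/-- `S` is additively finite: `S = add V` for some `V` in `S`. -/
def AddFinite (S : ObjectProperty A) : Prop :=
  ∃ V, S V ∧ ∀ X, S X → AddClosure (fun Y => Y = V) X

def Indec (X : A) : Prop :=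
  ¬ IsZero X ∧ ∀ (Y Z : A) (b : BinaryBicone Y Z), Nonempty b.IsBilimit → Nonempty (X ≅ b.pt) →
    IsZero Y ∨ IsZero Z

variable (A) in
structure IsKrullSchmidt : Prop where
  decomp : ∀ X : A, ∃ (n : ℕ) (f : Fin n → A) (b : Bicone f), Nonempty b.IsBilimit ∧
    (∀ i, Indec (f i)) ∧ Nonempty (X ≅ b.pt)
  isLocalRing : ∀ X : A, Indec X → IsLocalRing (End X)

variable (K : Type k) [Field K] [Linear K A]

/-- The radical of the category `A` (the displayed set is already a subspace). -/
def radHom (X Y : A) : Submodule K (X ⟶ Y) :=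
  Submodule.span K {f | ∀ g : Y ⟶ X, IsIso (𝟙 X - f ≫ g)}

/-- The powers of the radical: `radPow n` is spanned by the composites of `n` radical morphisms. -/
def radPow : ℕ → ∀ X Y : A, Submodule K (X ⟶ Y)
  | 0, _, _ => ⊤
  | n + 1, X, Y => Submodule.span K
      {h | ∃ (W : A) (f : X ⟶ W) (g : W ⟶ Y), f ∈ radHom K X W ∧ g ∈ radPow n W Y ∧ f ≫ g = h}

/-- The radical topology: the cosets of the powers of the radical form a basis. -/
abbrev radTopology (X Y : A) : TopologicalSpace (X ⟶ Y) :=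
  TopologicalSpace.generateFrom {O | ∃ (f : X ⟶ Y) (n : ℕ), O = {g | g - f ∈ radPow K n X Y}}

/-- The top `End X / rad End X` of the endomorphism algebra. -/
abbrev EndTop (X : A) : Type v := (X ⟶ X) ⧸ radHom K X X

end Additive

/-- A topological vector space (over a discrete field) is pseudocompact if it is Hausdorff and
has a directed system of open subspaces of finite codimension such that `V` is the topological
inverse limit of the (discrete) quotients. -/
structure IsPseudocompact (K : Type k) [Field K] (V : Type w) [AddCommGroup V] [Module K V]
    (t : TopologicalSpace V) : Prop where
  add_group : IsTopologicalAddGroup V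
  smul : ContinuousConstSMul K V
  hausdorff : T2Space V
  system : ∃ S : Set (Submodule K V), S.Nonempty ∧ DirectedOn (fun U U' => U' ≤ U) S ∧
    (∀ U ∈ S, IsOpen (U : Set V) ∧ Module.Finite K (V ⧸ U)) ∧
    (∀ O : Set V, IsOpen O → (0 : V) ∈ O → ∃ U ∈ S, (U : Set V) ⊆ O) ∧
    (∀ x : Submodule K V → V, (∀ U ∈ S, ∀ U' ∈ S, U ≤ U' → x U - x U' ∈ U') →
      ∃! y : V, ∀ U ∈ S, y - x U ∈ U)

/-- A topology on the morphism spaces makes the category pseudocompact. -/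
def IsPseudocompactCat (K : Type k) [Field K] (A : Type u) [Category.{v} A] [Preadditive A]
    [Linear K A] (t : ∀ X Y : A, TopologicalSpace (X ⟶ Y)) : Prop :=
  (∀ X Y : A, IsPseudocompact K (X ⟶ Y) (t X Y)) ∧
  ∀ X Y Z : A, Continuous (fun p : (X ⟶ Y) × (Y ⟶ Z) => p.1 ≫ p.2)

/-! ### Cluster categories -/

section Cluster

variable {K : Type k} [Field K] {C : Type u} [Category.{v} C] [Preadditive C] [Linear K C]

/-- A presentation of `C` as a partial stabilisation `E/P` of an exact category `E`. An exact
category is an extriangulated category in which all inflations are monic and all deflations epic. -/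
structure ExactLift (D : ExtData K C) where
  E : Type u'
  [cat : Category.{v'} E]
  [preadd : Preadditive E]
  [lin : Linear K E]
  [zero : HasZeroObject E]
  [biprod : HasBinaryBiproducts E]
  data : ExtData K E
  extri : IsExtriangulated data
  mono_of_infl : ∀ {X Y : E} (x : X ⟶ Y), Infl data x → Mono x
  epi_of_defl : ∀ {Y Z : E} (y : Y ⟶ Z), Defl data y → Epi y
  P : ObjectProperty E
  closed : IsAddClosed P
  projInj : P ≤ ProjInj data
  equiv : AddQuot K P ≌ C
  [additive : equiv.functor.Additive]
  [linear : equiv.functor.Linear K]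
  extEquiv : ∀ Z X : AddQuot K P,
    (quotData data projInj).Ext Z X ≃ₗ[K] D.Ext (equiv.functor.obj Z) (equiv.functor.obj X)
  extEquiv_pull : ∀ {Z' Z : AddQuot K P} (f : Z' ⟶ Z) (X : AddQuot K P)
    (δ : (quotData data projInj).Ext Z X),
    extEquiv Z' X ((quotData data projInj).pull f X δ) =
      D.pull (equiv.functor.map f) (equiv.functor.obj X) (extEquiv Z X δ)
  extEquiv_push : ∀ (Z : AddQuot K P) {X X' : AddQuot K P} (f : X ⟶ X')
    (δ : (quotData data projInj).Ext Z X),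
    extEquiv Z X' ((quotData data projInj).push Z f δ) =
      D.push (equiv.functor.obj Z) (equiv.functor.map f) (extEquiv Z X δ)
  real_iff : ∀ {X Y Z : AddQuot K P} (δ : (quotData data projInj).Ext Z X) (x : X ⟶ Y)
    (y : Y ⟶ Z), (quotData data projInj).Real δ x y ↔
      D.Real (extEquiv Z X δ) (equiv.functor.map x) (equiv.functor.map y)

attribute [instance] ExactLift.cat ExactLift.preadd ExactLift.lin ExactLift.zero ExactLift.biprod
  ExactLift.additive ExactLift.linear

/-- The stable category is Hom-finite and 2-Calabi–Yau: there is a functor `S` (the suspension)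
representing `Ext`, and a natural duality between `Hom(X, Y)` and `Hom(Y, S S X)`. -/
def StablyCY2 (D : ExtData K C) : Prop :=
  (∀ X Y : Stab D, Module.Finite K (X ⟶ Y)) ∧
  ∃ (S : Stab D ⥤ Stab D)
    (φ : ∀ X Y : Stab D, (X ⟶ S.obj Y) ≃ₗ[K] (stabData D).Ext X Y)
    (ψ : ∀ X Y : Stab D, (X ⟶ Y) ≃ₗ[K] Module.Dual K (Y ⟶ S.obj (S.obj X))),
    (∀ (X' X Y : Stab D) (f : X' ⟶ X) (h : X ⟶ S.obj Y),
      φ X' Y (f ≫ h) = (stabData D).pull f Y (φ X Y h)) ∧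
    (∀ (X Y Y' : Stab D) (g : Y ⟶ Y') (h : X ⟶ S.obj Y),
      φ X Y' (h ≫ S.map g) = (stabData D).push X g (φ X Y h)) ∧
    (∀ (X' X Y : Stab D) (f : X' ⟶ X) (h : X ⟶ Y) (l : Y ⟶ S.obj (S.obj X')),
      ψ X' Y (f ≫ h) l = ψ X Y h (l ≫ S.map (S.map f))) ∧
    (∀ (X Y Y' : Stab D) (g : Y ⟶ Y') (h : X ⟶ Y) (l : Y' ⟶ S.obj (S.obj X)),
      ψ X Y' (h ≫ g) l = ψ X Y h (g ≫ l))

/-- Cluster categories: idempotent complete, algebraic, stably 2-Calabi–Yau Frobenius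
extriangulated categories having a cluster-tilting subcategory. -/
structure IsClusterCategory [HasZeroObject C] [HasBinaryBiproducts C] (D : ExtData K C) :
    Prop where
  extriangulated : IsExtriangulated D
  idempotentComplete : IsIdempotentComplete C
  algebraic : Nonempty (ExactLift.{k, u, v, u', v'} D)
  frobenius : IsFrobenius D
  stably2CY : StablyCY2 D
  exists_clusterTilting : ∃ T, ClusterTilting D T

/-- The additional conditions defining compact cluster categories. -/
structure IsCompactCat (D : ExtData K C) : Prop where
  pseudocompact : ∃ t, IsPseudocompactCat K C t
  finite_top : ∀ X : C, Module.Finite K (EndTop K X)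
  radically_pseudocompact : ∀ T : ObjectProperty C, ClusterTilting D T →
    IsPseudocompactCat K T.FullSubcategory (radTopology K)

variable (K C) in
/-- The additional conditions defining skew-symmetric cluster categories. -/
structure IsSkewSymmetric : Prop where
  krullSchmidt : IsKrullSchmidt C
  top_eq_one : ∀ X : C, Indec X → Module.finrank K (EndTop K X) = 1

/-! ### Mutation -/

variable (D : ExtData K C)

/-- For `T₀` indecomposable in a Krull–Schmidt category, the subcategory `T ∖ T₀` of objects of `T`
without summand `T₀`. -/
def RemoveObj (T : ObjectProperty C) (T₀ : C) : ObjectProperty C :=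
  fun X => T X ∧ IsEmpty (Retract T₀ X)

/-- `add ((T ∖ T₀) ∪ {T₁})`. -/
def MutProp (T : ObjectProperty C) (T₀ T₁ : C) : ObjectProperty C :=
  AddClosure (fun X => RemoveObj T T₀ X ∨ X = T₁)

/-- `(T₀, T₁)` is an exchange pair for `T`. -/
structure IsExchangePair (T : ObjectProperty C) (T₀ T₁ : C) : Prop where
  mem : T T₀
  indec : Indec T₀
  indec' : Indec T₁
  not_iso : IsEmpty (T₀ ≅ T₁)
  clusterTilting : ClusterTilting D (MutProp T T₀ T₁)
  exchange_plus : ∃ (B : C) (i : T₁ ⟶ B) (p : B ⟶ T₀) (δ : D.Ext T₀ T₁),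
    D.Real δ i p ∧ δ ≠ 0 ∧ RightApprox (RemoveObj T T₀) p
  exchange_minus : ∃ (B : C) (i : T₀ ⟶ B) (p : B ⟶ T₁) (δ : D.Ext T₁ T₀),
    D.Real δ i p ∧ δ ≠ 0 ∧ LeftApprox (RemoveObj T T₀) i

/-- Every indecomposable non-projective object of `T` is mutable. -/
def MaxMutable (T : ObjectProperty C) : Prop :=
  ∀ T₀, T T₀ → Indec T₀ → ¬ IsProj D T₀ → ∃ T₁, IsExchangePair D T T₀ T₁

def MutationStep (T U : ObjectProperty C) : Prop :=
  ∃ T₀ T₁, IsExchangePair D T T₀ T₁ ∧ U = MutProp T T₀ T₁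

/-- `U` is reachable from `T` by a finite sequence of mutations. -/
def Reachable (T U : ObjectProperty C) : Prop := Relation.ReflTransGen (MutationStep D) T U

def FiniteRank : Prop :=
  ∀ T : ObjectProperty C, ClusterTilting D T → AddFinite (stabProp D T)

end Cluster

/-! ### Modules and Grothendieck groups -/

section K0

/-- The relations `[X ⊕ Y] = [X] + [Y]`. -/
def splitRel (A : Type u) [Category.{v} A] [Preadditive A] : AddSubgroup (FreeAbelianGroup A) :=
  AddSubgroup.closure {r | ∃ (X Y : A) (b : BinaryBicone X Y), Nonempty b.IsBilimit ∧
    r = FreeAbelianGroup.of b.pt - FreeAbelianGroup.of X - FreeAbelianGroup.of Y}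

/-- The split Grothendieck group of an additive category. -/
abbrev K0Split (A : Type u) [Category.{v} A] [Preadditive A] : Type u :=
  FreeAbelianGroup A ⧸ splitRel A

/-- The class of an object in the split Grothendieck group. -/
def K0Split.cls {A : Type u} [Category.{v} A] [Preadditive A] (X : A) : K0Split A :=
  QuotientAddGroup.mk' _ (FreeAbelianGroup.of X)

variable {K : Type k} [Field K] {A : Type u} [Category.{v} A] [Preadditive A] [Linear K A]

/-- `K`-linear functors `Aᵒᵖ ⥤ Mod K`. -/
structure IsModule (M : Aᵒᵖ ⥤ ModuleCat.{w} K) : Prop where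
  map_add : ∀ {X Y : A} (f g : X ⟶ Y), M.map (f + g).op = M.map f.op + M.map g.op
  map_smul : ∀ {X Y : A} (a : K) (f : X ⟶ Y), M.map (a • f).op = a • M.map f.op

/-- Finitely presented modules. -/
def fpMod : ObjectProperty (Aᵒᵖ ⥤ ModuleCat.{v} K) := fun M =>
  ∃ (X Y : A) (f : Y ⟶ X) (p : (linearYoneda K A).obj X ⟶ M) (w : (linearYoneda K A).map f ≫ p = 0),
    (ShortComplex.mk ((linearYoneda K A).map f) p w).Exact ∧ Epi p

/-- Locally finite-dimensional modules. -/
def lfdMod : ObjectProperty (Aᵒᵖ ⥤ ModuleCat.{v} K) := fun M =>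
  IsModule M ∧ ∀ X : A, Module.Finite K (M.obj (op X))

/-- The support of a module: the objects `X` with `M X' ≠ 0` for all nonzero summands `X'` of `X`. -/
def suppMod (M : Aᵒᵖ ⥤ ModuleCat.{v} K) : ObjectProperty A := fun X =>
  ∀ X' : A, Nonempty (Retract X' X) → ¬ IsZero X' → Nontrivial (M.obj (op X'))

/-- Finite-dimensional modules: locally finite-dimensional with support `add V` for an object
`V`. -/
def fdMod : ObjectProperty (Aᵒᵖ ⥤ ModuleCat.{v} K) := fun M =>
  lfdMod M ∧ ∃ V : A, ∀ X, suppMod M X ↔ AddClosure (fun Y => Y = V) X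

/-- The relations `[M₂] = [M₁] + [M₃]` for short exact sequences of modules in `Q`. -/
def exactRel (Q : ObjectProperty (Aᵒᵖ ⥤ ModuleCat.{v} K)) :
    AddSubgroup (FreeAbelianGroup (Subtype Q)) :=
  AddSubgroup.closure {r | ∃ (S : ShortComplex (Aᵒᵖ ⥤ ModuleCat.{v} K)) (h₁ : Q S.X₁) (h₂ : Q S.X₂)
    (h₃ : Q S.X₃), S.ShortExact ∧ r = FreeAbelianGroup.of ⟨S.X₂, h₂⟩ -
      FreeAbelianGroup.of ⟨S.X₁, h₁⟩ - FreeAbelianGroup.of ⟨S.X₃, h₃⟩}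

/-- The Grothendieck group of a full subcategory of the category of modules. -/
abbrev K0Mod (Q : ObjectProperty (Aᵒᵖ ⥤ ModuleCat.{v} K)) : Type _ :=
  FreeAbelianGroup (Subtype Q) ⧸ exactRel Q

def K0Mod.cls {Q : ObjectProperty (Aᵒᵖ ⥤ ModuleCat.{v} K)} (M : Aᵒᵖ ⥤ ModuleCat.{v} K) (h : Q M) :
    K0Mod Q :=
  QuotientAddGroup.mk' _ (FreeAbelianGroup.of ⟨M, h⟩)

/-- The homomorphism of Grothendieck groups induced by an inclusion. -/
def K0Mod.map {Q Q' : ObjectProperty (Aᵒᵖ ⥤ ModuleCat.{v} K)} (h : Q ≤ Q') :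
    K0Mod Q →+ K0Mod Q' :=
  QuotientAddGroup.lift _ (FreeAbelianGroup.lift fun M => K0Mod.cls M.1 (h _ M.2)) (by
    refine (AddSubgroup.closure_le _).2 ?_
    rintro _ ⟨S, h₁, h₂, h₃, hS, rfl⟩
    simp only [SetLike.mem_coe, AddMonoidHom.mem_ker, map_sub, FreeAbelianGroup.lift_apply_of]
    simp only [K0Mod.cls, ← map_sub]
    exact (QuotientAddGroup.eq_zero_iff _).2 (AddSubgroup.subset_closure
      ⟨S, h _ h₁, h _ h₂, h _ h₃, hS, rfl⟩))

lemma finrank_of_exact {V₁ V₂ V₃ : Type*} [AddCommGroup V₁] [Module K V₁] [AddCommGroup V₂]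
    [Module K V₂] [AddCommGroup V₃] [Module K V₃] [Module.Finite K V₂] (f : V₁ →ₗ[K] V₂)
    (g : V₂ →ₗ[K] V₃) (hf : Function.Injective f) (hg : Function.Surjective g)
    (h : Function.Exact f g) :
    Module.finrank K V₂ = Module.finrank K V₁ + Module.finrank K V₃ := by
  have h₁ := LinearMap.finrank_range_add_finrank_ker g
  rw [LinearMap.range_eq_top.2 hg, finrank_top, LinearMap.exact_iff.1 h,
    LinearMap.finrank_range_of_inj hf] at h₁
  omega

lemma finrank_of_bicone (M : Aᵒᵖ ⥤ ModuleCat.{v} K) (hM : lfdMod M) {X Y : A}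
    (b : BinaryBicone X Y) (hb : b.IsBilimit) :
    Module.finrank K (M.obj (op b.pt)) =
      Module.finrank K (M.obj (op X)) + Module.finrank K (M.obj (op Y)) := by
  have := hM.2 b.pt
  have key : ∀ {P Q R : A} (f : P ⟶ Q) (g : Q ⟶ R) (m : M.obj (op R)),
      (M.map f.op).hom ((M.map g.op).hom m) = (M.map (f ≫ g).op).hom m := by
    intro P Q R f g m
    simp
  have hid : ∀ {P : A} (m : M.obj (op P)), (M.map (𝟙 P).op).hom m = m := by
    intro P m
    simp
  have hzero : ∀ {P Q : A} (m : M.obj (op Q)), (M.map (0 : P ⟶ Q).op).hom m = 0 := by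
    intro P Q m
    have := hM.1.map_smul 0 (0 : P ⟶ Q)
    rw [zero_smul, zero_smul] at this
    rw [this]
    rfl
  have htot : ∀ m : M.obj (op b.pt), (M.map b.fst.op).hom ((M.map b.inl.op).hom m) +
      (M.map b.snd.op).hom ((M.map b.inr.op).hom m) = m := by
    intro m
    rw [key, key]
    have h := hM.1.map_add (b.fst ≫ b.inl) (b.snd ≫ b.inr)
    rw [IsBilimit.binary_total hb] at h
    have h' := congrArg (fun φ => φ.hom m) h
    simp only [hid] at h'
    exact h'.symm
  refine finrank_of_exact (K := K) (M.map b.fst.op).hom (M.map b.inr.op).hom ?_ ?_ ?_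
  · intro m m' h
    have h' := congrArg (M.map b.inl.op).hom h
    simpa only [key, b.inl_fst, hid] using h'
  · intro m
    exact ⟨(M.map b.snd.op).hom m, by rw [key, b.inr_snd, hid]⟩
  · intro m
    constructor
    · intro h
      refine ⟨(M.map b.inl.op).hom m, ?_⟩
      have h' := htot m
      rwa [h, map_zero, add_zero] at h'
    · rintro ⟨m', rfl⟩
      rw [key, b.inr_fst, hzero]

/-- `[M] ↦ dim M(X)`. -/
def dimAt (X : A) : K0Mod (lfdMod (K := K) (A := A)) →+ ℤ :=
  QuotientAddGroup.lift _
    (FreeAbelianGroup.lift fun M => (Module.finrank K (M.1.obj (op X)) : ℤ)) (by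
    refine (AddSubgroup.closure_le _).2 ?_
    rintro _ ⟨S, h₁, h₂, h₃, hS, rfl⟩
    simp only [SetLike.mem_coe, AddMonoidHom.mem_ker, map_sub, FreeAbelianGroup.lift_apply_of]
    have hS' := hS.map_of_exact ((evaluation Aᵒᵖ (ModuleCat.{v} K)).obj (op X))
    have : Module.Finite K (S.map ((evaluation Aᵒᵖ (ModuleCat.{v} K)).obj (op X))).X₂ := h₂.2 X
    have hg := (ModuleCat.epi_iff_surjective _).1 hS'.epi_g
    have hf := (ModuleCat.mono_iff_injective _).1 hS'.mono_f
    have hex := (ShortComplex.ShortExact.moduleCat_exact_iff_function_exact _).1 hS'.exact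
    have h := finrank_of_exact (K := K) _ _ hf hg hex
    change Module.finrank K (S.X₂.obj (op X)) = Module.finrank K (S.X₁.obj (op X)) +
      Module.finrank K (S.X₃.obj (op X)) at h
    rw [h]
    push_cast
    ring)

/-- The numerical Grothendieck group of locally finite-dimensional modules: the quotient by the
classes on which all dimensions vanish. -/
abbrev KNum (K : Type k) [Field K] (A : Type u) [Category.{v} A] [Preadditive A] [Linear K A] :
    Type _ :=
  K0Mod (lfdMod (K := K) (A := A)) ⧸ (⨅ X : A, (dimAt (K := K) X).ker)

/-- `⟨[M], [X]⟩ = dim M(X)` as a function of `[M]`. -/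
def KNum.dim (X : A) : KNum K A →+ ℤ :=
  QuotientAddGroup.lift _ (dimAt X) (iInf_le _ X)

/-- The pairing `⟨[M], [X]⟩ = dim M(X)`. -/
def pairing : K0Split A →+ KNum K A →+ ℤ :=
  QuotientAddGroup.lift _ (FreeAbelianGroup.lift fun X => KNum.dim X) (by
    refine (AddSubgroup.closure_le _).2 ?_
    rintro _ ⟨X, Y, b, ⟨hb⟩, rfl⟩
    simp only [SetLike.mem_coe, AddMonoidHom.mem_ker, map_sub, FreeAbelianGroup.lift_apply_of]
    ext M
    have h := finrank_of_bicone M.1 M.2 b hb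
    change (Module.finrank K (M.1.obj (op b.pt)) : ℤ) - Module.finrank K (M.1.obj (op X)) -
      Module.finrank K (M.1.obj (op Y)) = 0
    rw [h]
    push_cast
    ring)

end K0

/-! ### Index, coindex, and exchange maps -/

section Maps

/-- A finite resolution of the `A`-module `N` by representable modules
`0 → Hom(-, X len) → ⋯ → Hom(-, X 0) → N → 0`; by the Yoneda lemma, the maps between
representables are given by morphisms `d i`, and the augmentation by an element `aug`. -/
structure RepResolution {K : Type k} [Field K] {A : Type u} [Category.{v} A] [Preadditive A]
    (N : Aᵒᵖ ⥤ ModuleCat.{w} K) where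
  len : ℕ
  X : ℕ → A
  d : ∀ i, X (i + 1) ⟶ X i
  aug : N.obj (op (X 0))
  isZero : ∀ i, len < i → IsZero (X i)
  aug_surj : ∀ (Y : A) (n : N.obj (op Y)), ∃ f : Y ⟶ X 0, (N.map f.op).hom aug = n
  exact_zero : ∀ (Y : A) (f : Y ⟶ X 0), (N.map f.op).hom aug = 0 ↔ ∃ g : Y ⟶ X 1, g ≫ d 0 = f
  exact_succ : ∀ (i : ℕ) (Y : A) (f : Y ⟶ X (i + 1)),
    f ≫ d i = 0 ↔ ∃ g : Y ⟶ X (i + 2), g ≫ d (i + 1) = f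

variable {K : Type k} [Field K] {C : Type u} [Category.{v} C] [Preadditive C] [Linear K C]
  (D : ExtData K C)

/-- `f` is the index map from `K₀(U)` to `K₀(T)`: `f [X] = [R] - [N]` for each conflation
`N → R → X` with `N, R` in `T`, where `X` is in `U`. -/
def IsIndex (T U : ObjectProperty C)
    (f : K0Split U.FullSubcategory →+ K0Split T.FullSubcategory) : Prop :=
  ∀ X : U.FullSubcategory,
    (∃ (N R : T.FullSubcategory) (i : N.obj ⟶ R.obj) (p : R.obj ⟶ X.obj), Confl D i p) ∧
    ∀ (N R : T.FullSubcategory) (i : N.obj ⟶ R.obj) (p : R.obj ⟶ X.obj), Confl D i p →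
      f (K0Split.cls X) = K0Split.cls R - K0Split.cls N

/-- `f` is the coindex map from `K₀(U)` to `K₀(T)`: `f [X] = [L] - [N]` for each conflation
`X → L → N` with `L, N` in `T`, where `X` is in `U`. -/
def IsCoindex (T U : ObjectProperty C)
    (f : K0Split U.FullSubcategory →+ K0Split T.FullSubcategory) : Prop :=
  ∀ X : U.FullSubcategory,
    (∃ (L N : T.FullSubcategory) (i : X.obj ⟶ L.obj) (p : L.obj ⟶ N.obj), Confl D i p) ∧
    ∀ (L N : T.FullSubcategory) (i : X.obj ⟶ L.obj) (p : L.obj ⟶ N.obj), Confl D i p →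
      f (K0Split.cls X) = K0Split.cls L - K0Split.cls N

/-- The functor `Ext(-, X)` on the full subcategory `T`. -/
def extMod (T : ObjectProperty C) (X : C) : T.FullSubcategoryᵒᵖ ⥤ ModuleCat.{v} K where
  obj Z := ModuleCat.of K (D.Ext Z.unop.obj X)
  map f := ModuleCat.ofHom (D.pull f.unop.hom X)
  map_id Z := by
    ext δ
    exact D.pull_id _ _ δ
  map_comp f g := by
    ext δ
    exact D.pull_comp _ _ _ δ

/-- The natural transformation `Ext(-, g)` on the full subcategory `T`. -/
def extMap (T : ObjectProperty C) {X X' : C} (g : X ⟶ X') : extMod D T X ⟶ extMod D T X' where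
  app Z := ModuleCat.ofHom (D.push Z.unop.obj g)
  naturality Z Z' f := by
    ext δ
    exact (D.pull_push f.unop.hom g δ).symm

/-- The stable category of the full subcategory `T`: the full subcategory of the stable category on
the objects of `T`. -/
abbrev StabSub (T : ObjectProperty C) : Type u := (stabProp D T).FullSubcategory

/-- The module `Ext(-, X)` over the stable category of `T`. -/
abbrev stabExt (T : ObjectProperty C) (X : C) : (StabSub D T)ᵒᵖ ⥤ ModuleCat.{v} K :=
  extMod (stabData D) (stabProp D T) ((stabπ D).obj X)

/-- The map `Ext(-, g)` of modules over the stable category of `T`. -/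
abbrev stabExtMap (T : ObjectProperty C) {X X' : C} (g : X ⟶ X') :
    stabExt D T X ⟶ stabExt D T X' :=
  extMap (stabData D) (stabProp D T) ((stabπ D).map g)

/-- The finitely presented modules over the stable category of `T`. -/
abbrev stabFp (T : ObjectProperty C) : ObjectProperty ((StabSub D T)ᵒᵖ ⥤ ModuleCat.{v} K) := fpMod

/-- The finite-dimensional modules over the stable category of `T`. -/
abbrev stabFd (T : ObjectProperty C) : ObjectProperty ((StabSub D T)ᵒᵖ ⥤ ModuleCat.{v} K) := fdMod

namespace ExactLift

variable {D} (L : ExactLift.{k, u, v, u', v'} D)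

/-- The projection from the exact lift to `C`. -/
def proj : L.E ⥤ C := AddQuot.π K L.P ⋙ L.equiv.functor

/-- The preimage of `T` in the exact lift. -/
def preimage (T : ObjectProperty C) : ObjectProperty L.E := fun X => T (L.proj.obj X)

/-- The projection from the preimage of `T` to `T`. -/
def toSub (T : ObjectProperty C) : (L.preimage T).FullSubcategory ⥤ T.FullSubcategory :=
  T.lift ((L.preimage T).ι ⋙ L.proj) (fun X => X.property)

/-- The projection from the preimage of `T` to the stable category of `T`. -/
def toStab (T : ObjectProperty C) : (L.preimage T).FullSubcategory ⥤ StabSub D T :=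
  (stabProp D T).lift ((L.preimage T).ι ⋙ L.proj ⋙ stabπ D) (fun X => X.property)

end ExactLift

/-- `β` is minus the map sending a finitely presented module over the stable category of `T` to the
class in `K₀(T)` of a finite projective resolution over the preimage of `T` in an exact category
of which `C` is a partial stabilisation. -/
def IsExchangeMap (T : ObjectProperty C)
    (β : K0Mod (stabFp D T) →+ K0Split T.FullSubcategory) : Prop :=
  ∀ (L : ExactLift.{k, u, v, u', v'} D) (M : (StabSub D T)ᵒᵖ ⥤ ModuleCat.{v} K) (hM : stabFp D T M),
    Nonempty (RepResolution ((L.toStab T).op ⋙ M)) ∧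
    ∀ r : RepResolution ((L.toStab T).op ⋙ M),
      β (K0Mod.cls M hM) =
        - ∑ i ∈ Finset.range (r.len + 1), (-1 : ℤ) ^ i • K0Split.cls ((L.toSub T).obj (r.X i))

/-- `f` sends `[Ext(-, X)|_U]` to the difference of the classes of the restrictions to `T` of
`Ker (Ext(-, X) → Ext(-, L))` and `Ker (Ext(-, N) → Ext(-, R))`, for all conflations
`X → L → L'` and `N → R → X` with `L, L', N, R` in `U`. -/
def IsIndBar (T U : ObjectProperty C) (f : K0Mod (stabFp D U) →+ K0Mod (stabFp D T)) : Prop :=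
  ∀ (X L L' N R : C) (iL : X ⟶ L) (pL : L ⟶ L') (iR : N ⟶ R) (pR : R ⟶ X),
    U L → U L' → U N → U R → Confl D iL pL → Confl D iR pR →
    ∃ (hX : stabFp D U (stabExt D U X)) (hl : stabFp D T (kernel (stabExtMap D T iL)))
      (hr : stabFp D T (kernel (stabExtMap D T iR))),
      f (K0Mod.cls _ hX) = K0Mod.cls _ hl - K0Mod.cls _ hr

/-- `f` sends `[Ext(-, X)|_U]` to the difference of the classes of the restrictions to `T` of
`Coker (Ext(-, R) → Ext(-, X))` and `Coker (Ext(-, L) → Ext(-, L'))`, for all conflations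
`X → L → L'` and `N → R → X` with `L, L', N, R` in `U`. -/
def IsCoindBar (T U : ObjectProperty C) (f : K0Mod (stabFp D U) →+ K0Mod (stabFp D T)) : Prop :=
  ∀ (X L L' N R : C) (iL : X ⟶ L) (pL : L ⟶ L') (iR : N ⟶ R) (pR : R ⟶ X),
    U L → U L' → U N → U R → Confl D iL pL → Confl D iR pR →
    ∃ (hX : stabFp D U (stabExt D U X)) (hl : stabFp D T (cokernel (stabExtMap D T pL)))
      (hr : stabFp D T (cokernel (stabExtMap D T pR))),
      f (K0Mod.cls _ hX) = K0Mod.cls _ hr - K0Mod.cls _ hl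

/-- The class in the numerical Grothendieck group. -/
def fdToNum (T : ObjectProperty C) : K0Mod (stabFd D T) →+ KNum K (StabSub D T) :=
  (QuotientAddGroup.mk' _).comp (K0Mod.map (fun _ h => h.1))

/-- `f` is adjoint to `g` for the pairings of numerical with split Grothendieck groups. -/
def IsAdjointPair {T U : ObjectProperty C}
    (f : KNum K (StabSub D U) →+ KNum K (StabSub D T))
    (g : K0Split (StabSub D T) →+ K0Split (StabSub D U)) : Prop :=
  ∀ m t, pairing t (f m) = pairing (g t) m

/-- `f` is the restriction to finite-dimensional modules of the adjoint of the coindex map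
`K₀(stab T) → K₀(stab U)` of the stable category. -/
def IsFdIndBar (T U : ObjectProperty C) (f : K0Mod (stabFd D U) →+ K0Mod (stabFd D T)) : Prop :=
  ∃ (F : KNum K (StabSub D U) →+ KNum K (StabSub D T))
    (g : K0Split (StabSub D T) →+ K0Split (StabSub D U)),
    IsCoindex (stabData D) (stabProp D U) (stabProp D T) g ∧ IsAdjointPair D F g ∧
      ∀ m, fdToNum D T (f m) = F (fdToNum D U m)

/-- `f` is the restriction to finite-dimensional modules of the adjoint of the index map
`K₀(stab T) → K₀(stab U)` of the stable category. -/
def IsFdCoindBar (T U : ObjectProperty C) (f : K0Mod (stabFd D U) →+ K0Mod (stabFd D T)) : Prop :=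
  ∃ (F : KNum K (StabSub D U) →+ KNum K (StabSub D T))
    (g : K0Split (StabSub D T) →+ K0Split (StabSub D U)),
    IsIndex (stabData D) (stabProp D U) (stabProp D T) g ∧ IsAdjointPair D F g ∧
      ∀ m, fdToNum D T (f m) = F (fdToNum D U m)

end Maps

end ClusterIso

end

/-! In the stable category of a Frobenius category every morphism is a deflation, so every finitely
presented module over the stable category of U is isomorphic to some Ext(-, X)
(`exists_iso_extMod`). All classes can then be computed from conflations X → L → L' and N → R → X
with outer terms in U. Write ind and coind for [R] - [N] and [L] - [L'].

The exchange map is an Euler characteristic. A conflation X → Y → Z of C lifts to the exact category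
E. Over the preimage of T, the lift gives an exact sequence 0 → Hom(-, X) → Hom(-, Y) → Hom(-, Z) →
Ker(Ext(-, X) → Ext(-, Y)) → 0. Since ind X is itself the Euler characteristic of Hom(-, X), the
kernel has Euler characteristic ind X - ind Y + ind Z (`hasChi_of_confl`). Hence the exchange map
sends Ext(-, X) to coind X - ind X. Euler characteristics do not depend on the resolution
(`HasEuler.unique`), because a bounded acyclic complex has alternating sum zero. This makes index,
coindex and exchange map well defined, whichever exact lift is used.

The square for Ind is now a cancellation (`exchange_comp_indBar`). The two kernels contribute -(ind
X - ind L + ind L') and ind N - ind R + ind X, where ind is taken in T. The term ind X disappears,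
and what is left is ind applied to coind X - ind X taken in U. The square for Coind is the same with
cokernels, whose exchange classes are alternating sums of coindices (`exchange_comp_coindBar`).

That Ind and Coind respect short exact sequences is the harder point. Choose for every t in T a
coresolution t → L_t → L'_t in U; it is functorial in t up to homotopy (`TwoTerm`). A U-module M
then yields two T-modules, the kernel and the cokernel of M(L'_t) → M(L_t), and the snake lemma
makes [coker] - [ker] additive in M (`TwoTerm.cls_add`). For M = Ext(-, X) these modules are the two
kernels that define Ind (`exists_iso_coker_coindexComplex`, `exists_iso_ker_coindexComplex`).
Resolutions N_t → R_t → t give Coind in the same way, up to sign.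

For the corollary the same complexes are applied to locally finite-dimensional modules. Counting
dimensions shows that the result is adjoint to the coindex or the index (`TwoTerm.exists_adjoint`).
It preserves finite-dimensional modules, because the complex splits at objects of T lying in U, and
all but finitely many indecomposables of T do (or T has only finitely many). It is determined by the
adjoint because classes of finite-dimensional modules are determined by dimensions
(`eq_zero_of_dimAt_eq_zero`). Finite-dimensional modules are finitely presented by dévissage, as
exchange conflations provide presentations of the simple ones (`fdMod_le_fpMod`). The squares then
restrict from finitely presented modules. -/

noncomputable section

namespace ClusterIso

/-! ### Exact sequences attached to conflations -/

section LES

variable {K : Type k} [Field K] {C : Type u} [Category.{v} C] [Preadditive C] [Linear K C]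

lemma ExtData.pull_zero (D : ExtData K C) {Z' Z : C} (X : C) (δ : D.Ext Z X) :
    D.pull (0 : Z' ⟶ Z) X δ = 0 := by
  simpa using D.pull_smul 0 (0 : Z' ⟶ Z) X δ

lemma ExtData.push_zero (D : ExtData K C) (Z : C) {X X' : C} (δ : D.Ext Z X) :
    D.push Z (0 : X ⟶ X') δ = 0 := by
  simpa using D.push_smul Z 0 (0 : X ⟶ X') δ

lemma ExtData.pull_sub (D : ExtData K C) {Z' Z : C} (f g : Z' ⟶ Z) (X : C) (δ : D.Ext Z X) :
    D.pull (f - g) X δ = D.pull f X δ - D.pull g X δ := by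
  have h := D.pull_add (f - g) g X δ
  rw [sub_add_cancel] at h
  rw [h, add_sub_cancel_right]

lemma ExtData.push_sub (D : ExtData K C) (Z : C) {X X' : C} (f g : X ⟶ X') (δ : D.Ext Z X) :
    D.push Z (f - g) δ = D.push Z f δ - D.push Z g δ := by
  have h := D.push_add Z (f - g) g δ
  rw [sub_add_cancel] at h
  rw [h, add_sub_cancel_right]

/-- The exact sequences of morphism and extension spaces attached to the conflations, together with
the completion of partial morphisms of conflations. -/
structure HasExactConfl (D : ExtData K C) : Prop where
  comp_zero : ∀ {X Y Z : C} {δ : D.Ext Z X} {x : X ⟶ Y} {y : Y ⟶ Z}, D.Real δ x y → x ≫ y = 0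
  pull_zero : ∀ {X Y Z : C} {δ : D.Ext Z X} {x : X ⟶ Y} {y : Y ⟶ Z}, D.Real δ x y →
    D.pull y X δ = 0
  push_zero : ∀ {X Y Z : C} {δ : D.Ext Z X} {x : X ⟶ Y} {y : Y ⟶ Z}, D.Real δ x y →
    D.push Z x δ = 0
  lift_left : ∀ {X Y Z : C} {δ : D.Ext Z X} {x : X ⟶ Y} {y : Y ⟶ Z}, D.Real δ x y →
    ∀ {W : C} (f : W ⟶ Y), f ≫ y = 0 → ∃ g : W ⟶ X, g ≫ x = f
  desc_right : ∀ {X Y Z : C} {δ : D.Ext Z X} {x : X ⟶ Y} {y : Y ⟶ Z}, D.Real δ x y →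
    ∀ {W : C} (f : Y ⟶ W), x ≫ f = 0 → ∃ g : Z ⟶ W, y ≫ g = f
  lift_mid : ∀ {X Y Z : C} {δ : D.Ext Z X} {x : X ⟶ Y} {y : Y ⟶ Z}, D.Real δ x y →
    ∀ {W : C} (f : W ⟶ Z), D.pull f X δ = 0 → ∃ g : W ⟶ Y, g ≫ y = f
  desc_mid : ∀ {X Y Z : C} {δ : D.Ext Z X} {x : X ⟶ Y} {y : Y ⟶ Z}, D.Real δ x y →
    ∀ {W : C} (f : X ⟶ W), D.push Z f δ = 0 → ∃ g : Y ⟶ W, x ≫ g = f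
  eq_pull : ∀ {X Y Z : C} {δ : D.Ext Z X} {x : X ⟶ Y} {y : Y ⟶ Z}, D.Real δ x y →
    ∀ {W : C} (ε : D.Ext W X), D.push W x ε = 0 → ∃ f : W ⟶ Z, D.pull f X δ = ε
  eq_push : ∀ {X Y Z : C} {δ : D.Ext Z X} {x : X ⟶ Y} {y : Y ⟶ Z}, D.Real δ x y →
    ∀ {W : C} (ε : D.Ext Z W), D.pull y W ε = 0 → ∃ f : X ⟶ W, D.push Z f δ = ε
  ext_push : ∀ {X Y Z : C} {δ : D.Ext Z X} {x : X ⟶ Y} {y : Y ⟶ Z}, D.Real δ x y →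
    ∀ {W : C} (ε : D.Ext W Y), D.push W y ε = 0 → ∃ ε' : D.Ext W X, D.push W x ε' = ε
  ext_pull : ∀ {X Y Z : C} {δ : D.Ext Z X} {x : X ⟶ Y} {y : Y ⟶ Z}, D.Real δ x y →
    ∀ {W : C} (ε : D.Ext Y W), D.pull x W ε = 0 → ∃ ε' : D.Ext Z W, D.pull y W ε' = ε
  mor_right : ∀ {X Y Z X' Y' Z' : C} {δ : D.Ext Z X} {δ' : D.Ext Z' X'}
    {x : X ⟶ Y} {y : Y ⟶ Z} {x' : X' ⟶ Y'} {y' : Y' ⟶ Z'},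
    D.Real δ x y → D.Real δ' x' y' → ∀ (a : X ⟶ X') (b : Y ⟶ Y'), x ≫ b = a ≫ x' →
      ∃ c : Z ⟶ Z', b ≫ y' = y ≫ c ∧ D.push Z a δ = D.pull c X' δ'
  mor_left : ∀ {X Y Z X' Y' Z' : C} {δ : D.Ext Z X} {δ' : D.Ext Z' X'}
    {x : X ⟶ Y} {y : Y ⟶ Z} {x' : X' ⟶ Y'} {y' : Y' ⟶ Z'},
    D.Real δ x y → D.Real δ' x' y' → ∀ (b : Y ⟶ Y') (c : Z ⟶ Z'), b ≫ y' = y ≫ c →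
      ∃ a : X ⟶ X', x ≫ b = a ≫ x' ∧ D.push Z a δ = D.pull c X' δ'

namespace IsExtriangulated

variable [HasZeroObject C] [HasBinaryBiproducts C] {D : ExtData K C} (h : IsExtriangulated D)

include h

open ZeroObject

/-- Split conflations with a zero end term. Comparing an arbitrary conflation with them through
`et3` and `et3_op` is what yields vanishing of composites and exactness at the middle. -/
lemma real_of_isZero_right (X : C) {W : C} (hW : IsZero W) :
    D.Real (0 : D.Ext W X) (𝟙 X) (0 : X ⟶ W) := by
  refine (h.real_iff _ _ _ _ _ (h.real_zero X W)).2 ⟨⟨biprod.fst, biprod.inl, ?_, by simp⟩, ?_, ?_⟩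
  · apply biprod.hom_ext'
    · simp
    · exact hW.eq_of_src _ _
  · simp
  · exact hW.eq_of_tgt _ _

lemma real_of_isZero_left (Z : C) {W : C} (hW : IsZero W) :
    D.Real (0 : D.Ext Z W) (0 : W ⟶ Z) (𝟙 Z) := by
  refine (h.real_iff _ _ _ _ _ (h.real_zero W Z)).2 ⟨⟨biprod.snd, biprod.inr, ?_, by simp⟩, ?_, ?_⟩
  · apply biprod.hom_ext'
    · exact hW.eq_of_src _ _
    · simp
  · exact hW.eq_of_src _ _
  · simp

lemma desc_mid {X Y Z : C} {δ : D.Ext Z X} {x : X ⟶ Y} {y : Y ⟶ Z} (hr : D.Real δ x y)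
    {W : C} (f : X ⟶ W) (hf : D.push Z f δ = 0) : ∃ g : Y ⟶ W, x ≫ g = f := by
  obtain ⟨b, hb, -⟩ := h.real_mor δ (0 : D.Ext Z W) x y biprod.inl biprod.snd f (𝟙 Z) hr
    (h.real_zero W Z) (by rw [hf, map_zero])
  exact ⟨b ≫ biprod.fst, by rw [← Category.assoc, hb]; simp⟩

lemma lift_mid {X Y Z : C} {δ : D.Ext Z X} {x : X ⟶ Y} {y : Y ⟶ Z} (hr : D.Real δ x y)
    {W : C} (f : W ⟶ Z) (hf : D.pull f X δ = 0) : ∃ g : W ⟶ Y, g ≫ y = f := by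
  obtain ⟨b, -, hb⟩ := h.real_mor (0 : D.Ext W X) δ biprod.inl biprod.snd x y (𝟙 X) f
    (h.real_zero X W) hr (by rw [hf, map_zero])
  exact ⟨biprod.inr ≫ b, by rw [Category.assoc, hb]; simp⟩

/-- Exactness on the Hom side comes from morphisms to or from conflations that are split or have a
zero end. Exactness at the first Ext terms comes from realising the given extension. Only `ext_push`
and `ext_pull` need the octahedral axioms. -/
theorem hasExactConfl : HasExactConfl D where
  comp_zero {X Y Z δ x y} hr := by
    obtain ⟨c, hc, -⟩ := h.et3 _ δ (𝟙 X) (0 : X ⟶ 0) x y (𝟙 X) x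
      (h.real_of_isZero_right X (isZero_zero C)) hr (by simp)
    rw [hc, zero_comp]
  pull_zero {X Y Z δ x y} hr := by
    obtain ⟨a, -, ha⟩ := h.et3_op _ δ (0 : 0 ⟶ Y) (𝟙 Y) x y (𝟙 Y) y
      (h.real_of_isZero_left Y (isZero_zero C)) hr (by simp)
    rw [← ha, map_zero]
  push_zero {X Y Z δ x y} hr := by
    obtain ⟨c, -, hc⟩ := h.et3 δ _ x y (𝟙 Y) (0 : Y ⟶ 0) x (𝟙 Y) hr
      (h.real_of_isZero_right Y (isZero_zero C)) (by simp)
    rw [hc, map_zero]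
  lift_left {X Y Z δ x y} hr W f hf := by
    obtain ⟨a, ha, -⟩ := h.et3_op _ δ (𝟙 W) (0 : W ⟶ 0) x y f 0
      (h.real_of_isZero_right W (isZero_zero C)) hr (by simp [hf])
    exact ⟨a, by rw [← ha, Category.id_comp]⟩
  desc_right {X Y Z δ x y} hr W f hf := by
    obtain ⟨c, hc, -⟩ := h.et3 δ _ x y (0 : 0 ⟶ W) (𝟙 W) 0 f hr
      (h.real_of_isZero_left W (isZero_zero C)) (by simp [hf])
    exact ⟨c, by rw [← hc, Category.comp_id]⟩
  lift_mid hr _ f hf := h.lift_mid hr f hf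
  desc_mid hr _ f hf := h.desc_mid hr f hf
  eq_pull {X Y Z δ x y} hr W ε hε := by
    obtain ⟨A, a, b, hA⟩ := h.exists_real ε
    obtain ⟨g, hg⟩ := h.desc_mid hA x hε
    obtain ⟨c, -, hc⟩ := h.et3 ε δ a b x y (𝟙 X) g hA hr (by simp [hg])
    exact ⟨c, by rw [← hc, D.push_id]⟩
  eq_push {X Y Z δ x y} hr W ε hε := by
    obtain ⟨A, a, b, hA⟩ := h.exists_real ε
    obtain ⟨g, hg⟩ := h.lift_mid hA y hε
    obtain ⟨c, -, hc⟩ := h.et3_op δ ε x y a b g (𝟙 Z) hr hA (by simp [hg])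
    exact ⟨c, by rw [hc, D.pull_id]⟩
  ext_push {X Y Z δ x y} hr W ε hε := by
    obtain ⟨B, g, g', hB⟩ := h.exists_real ε
    -- The octahedron contains a conflation Z → E → W realising the push-forward of `ε` along `y`,
    -- which is zero. Its section `s` pulls the extension `δ''` of E by X back to a preimage of `ε`.
    obtain ⟨E, d, e, h', δ'', -, -, -, hde, -, hpush⟩ := h.et4 δ ε x y g g' hr hB
    obtain ⟨s, hs⟩ := h.lift_mid hde (𝟙 W) (by rw [hε, map_zero])
    refine ⟨D.pull s X δ'', ?_⟩
    rw [← D.pull_push, hpush, ← D.pull_comp, hs, D.pull_id]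
  ext_pull {X Y Z δ x y} hr W ε hε := by
    obtain ⟨B, g, g', hB⟩ := h.exists_real ε
    obtain ⟨E, d, e, h', δ'', -, -, -, hde, -, hpush⟩ := h.et4_op ε δ g g' x y hB hr
    obtain ⟨s, hs⟩ := h.desc_mid hde (𝟙 W) (by rw [hε, map_zero])
    refine ⟨D.push Z s δ'', ?_⟩
    rw [D.pull_push, ← hpush, ← D.push_comp, hs, D.push_id]
  mor_right hr hr' a b hab := h.et3 _ _ _ _ _ _ a b hr hr' hab
  mor_left hr hr' b c hbc := h.et3_op _ _ _ _ _ _ b c hr hr' hbc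

lemma real_congr_iso {X Y Y' Z : C} {δ : D.Ext Z X} {x : X ⟶ Y} {y : Y ⟶ Z} (hr : D.Real δ x y)
    (e : Y ≅ Y') : D.Real δ (x ≫ e.hom) (e.inv ≫ y) :=
  (h.real_iff _ _ _ _ _ hr).2 ⟨e, rfl, by simp⟩

/-- If `i : X ⟶ I` is an inflation, then so is `(f, i) : X ⟶ Y ⊞ I`, for all `f : X ⟶ Y`. -/
lemma infl_lift {X Y I : C} (f : X ⟶ Y) {i : X ⟶ I} (hi : Infl D i) :
    Infl D (biprod.lift f i) := by
  obtain ⟨Z, p, δ, hr⟩ := hi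
  -- The map (f, i) is the composite of (f, 1) with 1 ⊕ i. The first is the canonical split
  -- inflation followed by this shear isomorphism, the second is a sum of inflations, and `et4`
  -- composes them.
  let e : X ⊞ Y ≅ Y ⊞ X :=
    { hom := biprod.desc (biprod.lift f (𝟙 X)) biprod.inl
      inv := biprod.desc biprod.inr (biprod.lift (𝟙 X) (-f))
      hom_inv_id := by
        apply biprod.hom_ext' <;> apply biprod.hom_ext <;> simp
      inv_hom_id := by
        apply biprod.hom_ext' <;> apply biprod.hom_ext <;> simp }
  have h₁ := h.real_congr_iso (h.real_zero X Y) e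
  have h₂ := h.real_sum _ _ _ _ _ _ (h.real_of_isZero_right Y (isZero_zero C)) hr
  obtain ⟨E, d, e', h', δ'', hreal, -⟩ := h.et4 _ _ _ _ _ _ h₁ h₂
  refine ⟨E, h', δ'', ?_⟩
  convert! hreal using 1
  apply biprod.hom_ext <;> simp [e]

/-- If `p : P ⟶ Z` is a deflation, then so is `(f, p) : Y ⊞ P ⟶ Z`, for all `f : Y ⟶ Z`. -/
lemma defl_desc {Y P Z : C} (f : Y ⟶ Z) {p : P ⟶ Z} (hp : Defl D p) :
    Defl D (biprod.desc f p) := by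
  obtain ⟨X, i, δ, hr⟩ := hp
  let e : Y ⊞ Z ≅ Y ⊞ Z :=
    { hom := biprod.desc (biprod.lift (𝟙 Y) (-f)) biprod.inr
      inv := biprod.desc (biprod.lift (𝟙 Y) f) biprod.inr
      hom_inv_id := by
        apply biprod.hom_ext' <;> apply biprod.hom_ext <;> simp
      inv_hom_id := by
        apply biprod.hom_ext' <;> apply biprod.hom_ext <;> simp }
  have h₁ := h.real_congr_iso (h.real_zero Y Z) e
  have h₂ := h.real_sum _ _ _ _ _ _ (h.real_of_isZero_left Y (isZero_zero C)) hr
  obtain ⟨E, d, e', h', δ'', hreal, -⟩ := h.et4_op _ _ _ _ _ _ h₂ h₁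
  refine ⟨E, h', δ'', ?_⟩
  convert! hreal using 1
  apply biprod.hom_ext' <;> simp [e]

end IsExtriangulated

/-! ### Exact sequences in quotients by projective-injective objects -/

lemma quotData_real_map (D : ExtData K C) {P : ObjectProperty C} (hP : P ≤ ProjInj D)
    {X Y Z : C} {δ : D.Ext Z X} {x : X ⟶ Y} {y : Y ⟶ Z} (h : D.Real δ x y) :
    (quotData D hP).Real (X := (AddQuot.π K P).obj X) (Z := (AddQuot.π K P).obj Z) δ
      ((AddQuot.π K P).map x) ((AddQuot.π K P).map y) :=
  ⟨Y, x, y, Iso.refl _, h, by simp, by simp⟩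

lemma AddQuot.map_surj {P : ObjectProperty C} {X Y : AddQuot K P} (f : X ⟶ Y) :
    ∃ g : X.as ⟶ Y.as, (AddQuot.π K P).map g = f :=
  (Quotient.full_functor (idealRel K P)).map_surjective f

lemma AddQuot.map_eq_zero_iff {P : ObjectProperty C} {X Y : C} (f : X ⟶ Y) :
    (AddQuot.π K P).map f = 0 ↔ f ∈ idealHom K P X Y := by
  rw [← (AddQuot.π K P).map_zero X Y, Quotient.functor_map_eq_iff]
  simp [idealRel]

lemma AddQuot.map_eq_iff {P : ObjectProperty C} {X Y : C} (f g : X ⟶ Y) :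
    (AddQuot.π K P).map f = (AddQuot.π K P).map g ↔ f - g ∈ idealHom K P X Y :=
  Quotient.functor_map_eq_iff _ f g

/-- Objects of P are projective, so a map through one lifts along any deflation. That the lift stays
in the ideal is essential: it may then be subtracted without changing anything in the quotient. -/
lemma HasExactConfl.ideal_lift {D : ExtData K C} (h : HasExactConfl D) {P : ObjectProperty C}
    (hP : P ≤ ProjInj D) {X Y Z : C} {δ : D.Ext Z X} {x : X ⟶ Y} {y : Y ⟶ Z} (hr : D.Real δ x y)
    {W : C} {f : W ⟶ Z} (hf : f ∈ idealHom K P W Z) :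
    ∃ g ∈ idealHom K P W Y, g ≫ y = f := by
  induction hf using Submodule.span_induction with
  | mem f hf =>
    obtain ⟨Q, a, b, hQ, rfl⟩ := hf
    obtain ⟨g, hg⟩ := h.lift_mid hr b (by
      have := (hP Q hQ).1 X
      exact Subsingleton.elim _ _)
    exact ⟨a ≫ g, Submodule.subset_span ⟨Q, a, g, hQ, rfl⟩, by rw [Category.assoc, hg]⟩
  | zero => exact ⟨0, zero_mem _, zero_comp⟩
  | add f g _ _ h₁ h₂ =>
    obtain ⟨a, ha, rfl⟩ := h₁
    obtain ⟨b, hb, rfl⟩ := h₂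
    exact ⟨a + b, add_mem ha hb, Preadditive.add_comp _ _ _ _ _ _⟩
  | smul c f _ h₁ =>
    obtain ⟨a, ha, rfl⟩ := h₁
    exact ⟨c • a, Submodule.smul_mem _ _ ha, Linear.smul_comp _ _ _ _ _ _⟩

lemma HasExactConfl.ideal_desc {D : ExtData K C} (h : HasExactConfl D) {P : ObjectProperty C}
    (hP : P ≤ ProjInj D) {X Y Z : C} {δ : D.Ext Z X} {x : X ⟶ Y} {y : Y ⟶ Z} (hr : D.Real δ x y)
    {W : C} {f : X ⟶ W} (hf : f ∈ idealHom K P X W) :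
    ∃ g ∈ idealHom K P Y W, x ≫ g = f := by
  induction hf using Submodule.span_induction with
  | mem f hf =>
    obtain ⟨Q, a, b, hQ, rfl⟩ := hf
    obtain ⟨g, hg⟩ := h.desc_mid hr a (by
      have := (hP Q hQ).2 Z
      exact Subsingleton.elim _ _)
    exact ⟨g ≫ b, Submodule.subset_span ⟨Q, g, b, hQ, rfl⟩, by rw [← Category.assoc, hg]⟩
  | zero => exact ⟨0, zero_mem _, Limits.comp_zero⟩
  | add f g _ _ h₁ h₂ =>
    obtain ⟨a, ha, rfl⟩ := h₁
    obtain ⟨b, hb, rfl⟩ := h₂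
    exact ⟨a + b, add_mem ha hb, Preadditive.comp_add _ _ _ _ _ _⟩
  | smul c f _ h₁ =>
    obtain ⟨a, ha, rfl⟩ := h₁
    exact ⟨c • a, Submodule.smul_mem _ _ ha, Linear.comp_smul _ _ _ _ _ _⟩

/-- Every conflation of the quotient is isomorphic to the image of a conflation. -/
lemma quotData_real_iff (D : ExtData K C) {P : ObjectProperty C} (hP : P ≤ ProjInj D)
    {X Y Z : AddQuot K P} (δ : (quotData D hP).Ext Z X) (x : X ⟶ Y) (y : Y ⟶ Z) :
    (quotData D hP).Real δ x y ↔ ∃ (Y' : C) (x' : X.as ⟶ Y') (y' : Y' ⟶ Z.as)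
      (e : Y ≅ (AddQuot.π K P).obj Y'), D.Real δ x' y' ∧
      x = (AddQuot.π K P).map x' ≫ e.inv ∧ y = e.hom ≫ (AddQuot.π K P).map y' := by
  constructor
  · rintro ⟨Y', x', y', e, h, h₁, h₂⟩
    exact ⟨Y', x', y', e, h, by rw [← h₁]; simp, h₂.symm⟩
  · rintro ⟨Y', x', y', e, h, rfl, rfl⟩
    exact ⟨Y', x', y', e, h, by simp, rfl⟩

/-- Transfers the exact sequences to C/P without verifying the extriangulated axioms there. An
equation in the quotient holds in C up to a map in the ideal. This error is lifted along the
deflation or extended along the inflation, and subtracting it makes the equation exact in C. -/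
theorem HasExactConfl.quotData {D : ExtData K C} (h : HasExactConfl D) {P : ObjectProperty C}
    (hP : P ≤ ProjInj D) : HasExactConfl (quotData D hP) where
  comp_zero {X Y Z δ x y} hq := by
    obtain ⟨Y', x', y', e, hr, rfl, rfl⟩ := (quotData_real_iff D hP _ _ _).1 hq
    rw [Category.assoc, e.inv_hom_id_assoc, ← Functor.map_comp, h.comp_zero hr, Functor.map_zero]
  pull_zero {X Y Z δ x y} hq := by
    obtain ⟨Y', x', y', e, hr, rfl, rfl⟩ := (quotData_real_iff D hP _ _ _).1 hq
    rw [ExtData.pull_comp]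
    exact (congrArg _ (h.pull_zero hr)).trans (map_zero _)
  push_zero {X Y Z δ x y} hq := by
    obtain ⟨Y', x', y', e, hr, rfl, rfl⟩ := (quotData_real_iff D hP _ _ _).1 hq
    rw [ExtData.push_comp]
    exact (congrArg _ (h.push_zero hr)).trans (map_zero _)
  lift_left {X Y Z δ x y} hq W f hf := by
    obtain ⟨Y', x', y', e, hr, rfl, rfl⟩ := (quotData_real_iff D hP _ _ _).1 hq
    obtain ⟨(f' : W.as ⟶ Y'), hf'⟩ := AddQuot.map_surj (f ≫ e.hom)
    rw [← Category.assoc, ← hf', ← Functor.map_comp, AddQuot.map_eq_zero_iff] at hf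
    obtain ⟨g, hg, hgf⟩ := h.ideal_lift hP hr hf
    obtain ⟨l, hl⟩ := h.lift_left hr (f' - g) (by rw [Preadditive.sub_comp, hgf, sub_self])
    refine ⟨(AddQuot.π K P).map l, ?_⟩
    rw [← Category.assoc, Iso.comp_inv_eq, ← hf', ← Functor.map_comp, hl, Functor.map_sub,
      (AddQuot.map_eq_zero_iff g).2 hg, sub_zero]
  desc_right {X Y Z δ x y} hq W f hf := by
    obtain ⟨Y', x', y', e, hr, rfl, rfl⟩ := (quotData_real_iff D hP _ _ _).1 hq
    obtain ⟨(f' : Y' ⟶ W.as), hf'⟩ := AddQuot.map_surj (e.inv ≫ f)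
    rw [Category.assoc, ← hf', ← Functor.map_comp, AddQuot.map_eq_zero_iff] at hf
    obtain ⟨g, hg, hgf⟩ := h.ideal_desc hP hr hf
    obtain ⟨l, hl⟩ := h.desc_right hr (f' - g) (by rw [Preadditive.comp_sub, hgf, sub_self])
    refine ⟨(AddQuot.π K P).map l, ?_⟩
    rw [Category.assoc, ← Iso.eq_inv_comp, ← hf', ← Functor.map_comp, hl, Functor.map_sub,
      (AddQuot.map_eq_zero_iff g).2 hg, sub_zero]
  lift_mid {X Y Z δ x y} hq W f hf := by
    obtain ⟨Y', x', y', e, hr, rfl, rfl⟩ := (quotData_real_iff D hP _ _ _).1 hq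
    obtain ⟨f', rfl⟩ := AddQuot.map_surj f
    obtain ⟨g, rfl⟩ := h.lift_mid hr f' hf
    exact ⟨(AddQuot.π K P).map g ≫ e.inv, by simp⟩
  desc_mid {X Y Z δ x y} hq W f hf := by
    obtain ⟨Y', x', y', e, hr, rfl, rfl⟩ := (quotData_real_iff D hP _ _ _).1 hq
    obtain ⟨f', rfl⟩ := AddQuot.map_surj f
    obtain ⟨g, rfl⟩ := h.desc_mid hr f' hf
    exact ⟨e.hom ≫ (AddQuot.π K P).map g, by simp⟩
  eq_pull {X Y Z δ x y} hq W ε hε := by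
    obtain ⟨Y', x', y', e, hr, rfl, rfl⟩ := (quotData_real_iff D hP _ _ _).1 hq
    rw [ExtData.push_comp] at hε
    have hε' := congrArg ((ClusterIso.quotData D hP).push W e.hom) hε
    rw [← ExtData.push_comp, e.inv_hom_id, ExtData.push_id, map_zero] at hε'
    obtain ⟨f, hf⟩ := h.eq_pull hr (W := W.as) ε hε'
    exact ⟨(AddQuot.π K P).map f, hf⟩
  eq_push {X Y Z δ x y} hq W ε hε := by
    obtain ⟨Y', x', y', e, hr, rfl, rfl⟩ := (quotData_real_iff D hP _ _ _).1 hq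
    rw [ExtData.pull_comp] at hε
    have hε' := congrArg ((ClusterIso.quotData D hP).pull e.inv W) hε
    rw [← ExtData.pull_comp, e.inv_hom_id, ExtData.pull_id, map_zero] at hε'
    obtain ⟨f, hf⟩ := h.eq_push hr (W := W.as) ε hε'
    exact ⟨(AddQuot.π K P).map f, hf⟩
  ext_push {X Y Z δ x y} hq W ε hε := by
    obtain ⟨Y', x', y', e, hr, rfl, rfl⟩ := (quotData_real_iff D hP _ _ _).1 hq
    rw [ExtData.push_comp] at hε
    obtain ⟨(ε' : (ClusterIso.quotData D hP).Ext W X), hε'⟩ := h.ext_push hr (W := W.as) _ hε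
    refine ⟨ε', ?_⟩
    rw [ExtData.push_comp]
    refine (congrArg _ hε').trans ?_
    rw [← ExtData.push_comp, e.hom_inv_id, ExtData.push_id]
  ext_pull {X Y Z δ x y} hq W ε hε := by
    obtain ⟨Y', x', y', e, hr, rfl, rfl⟩ := (quotData_real_iff D hP _ _ _).1 hq
    rw [ExtData.pull_comp] at hε
    obtain ⟨(ε' : (ClusterIso.quotData D hP).Ext Z W), hε'⟩ := h.ext_pull hr (W := W.as) _ hε
    refine ⟨ε', ?_⟩
    rw [ExtData.pull_comp]
    refine (congrArg _ hε').trans ?_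
    rw [← ExtData.pull_comp, e.hom_inv_id, ExtData.pull_id]
  mor_right {X Y Z X' Y' Z' δ δ' x y x' y'} hq hq' a b hab := by
    obtain ⟨Y₁, x₁, y₁, e, hr, rfl, rfl⟩ := (quotData_real_iff D hP _ _ _).1 hq
    obtain ⟨Y₂, x₂, y₂, e', hr', rfl, rfl⟩ := (quotData_real_iff D hP _ _ _).1 hq'
    obtain ⟨a, rfl⟩ := AddQuot.map_surj a
    obtain ⟨(b' : Y₁ ⟶ Y₂), hb'⟩ := AddQuot.map_surj (e.inv ≫ b ≫ e'.hom)
    have hab' : (AddQuot.π K P).map (x₁ ≫ b') = (AddQuot.π K P).map (a ≫ x₂) := by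
      rw [Functor.map_comp, Functor.map_comp, hb']
      simpa using congrArg (· ≫ e'.hom) hab
    rw [AddQuot.map_eq_iff] at hab'
    obtain ⟨g, hg, hgx⟩ := h.ideal_desc hP hr hab'
    obtain ⟨c, hc, hc'⟩ := h.mor_right hr hr' a (b' - g) (by
      rw [Preadditive.comp_sub, hgx, sub_sub_cancel])
    refine ⟨(AddQuot.π K P).map c, ?_, hc'⟩
    have := congrArg (AddQuot.π K P).map hc
    rw [Functor.map_comp, Functor.map_sub, (AddQuot.map_eq_zero_iff g).2 hg, sub_zero, hb',
      Functor.map_comp] at this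
    simpa using congrArg (e.hom ≫ ·) this
  mor_left {X Y Z X' Y' Z' δ δ' x y x' y'} hq hq' b c hbc := by
    obtain ⟨Y₁, x₁, y₁, e, hr, rfl, rfl⟩ := (quotData_real_iff D hP _ _ _).1 hq
    obtain ⟨Y₂, x₂, y₂, e', hr', rfl, rfl⟩ := (quotData_real_iff D hP _ _ _).1 hq'
    obtain ⟨c, rfl⟩ := AddQuot.map_surj c
    obtain ⟨(b' : Y₁ ⟶ Y₂), hb'⟩ := AddQuot.map_surj (e.inv ≫ b ≫ e'.hom)
    have hbc' : (AddQuot.π K P).map (b' ≫ y₂) = (AddQuot.π K P).map (y₁ ≫ c) := by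
      rw [Functor.map_comp, Functor.map_comp, hb']
      simpa using congrArg (e.inv ≫ ·) hbc
    rw [AddQuot.map_eq_iff] at hbc'
    obtain ⟨g, hg, hgx⟩ := h.ideal_lift hP hr' hbc'
    obtain ⟨a, ha, ha'⟩ := h.mor_left hr hr' (b' - g) c (by
      rw [Preadditive.sub_comp, hgx, sub_sub_cancel])
    refine ⟨(AddQuot.π K P).map a, ?_, ha'⟩
    have := congrArg (AddQuot.π K P).map ha
    rw [Functor.map_comp, Functor.map_sub, (AddQuot.map_eq_zero_iff g).2 hg, sub_zero, hb',
      Functor.map_comp] at this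
    simpa using congrArg (· ≫ e'.inv) this

end LES

end ClusterIso

namespace ClusterIso

/-! ### Split Grothendieck groups -/

section SplitK0

variable {A : Type u} [Category.{v} A] [Preadditive A]

lemma K0Split.cls_bicone {X Y : A} (b : BinaryBicone X Y) (hb : b.IsBilimit) :
    K0Split.cls b.pt = K0Split.cls X + K0Split.cls Y := by
  have : FreeAbelianGroup.of b.pt - FreeAbelianGroup.of X - FreeAbelianGroup.of Y ∈ splitRel A :=
    AddSubgroup.subset_closure ⟨X, Y, b, ⟨hb⟩, rfl⟩
  have h := (QuotientAddGroup.eq_zero_iff _).2 this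
  change K0Split.cls b.pt - K0Split.cls X - K0Split.cls Y = 0 at h
  rw [sub_sub, sub_eq_zero] at h
  exact h

lemma K0Split.cls_biprod [HasBinaryBiproducts A] (X Y : A) :
    K0Split.cls (X ⊞ Y) = K0Split.cls X + K0Split.cls Y :=
  K0Split.cls_bicone _ (BinaryBiproduct.isBilimit X Y)

/-- A zero object is a biproduct of itself with itself, so its class equals its double. -/
lemma K0Split.cls_isZero {X : A} (hX : IsZero X) : K0Split.cls X = 0 := by
  have h := K0Split.cls_bicone (X := X) (Y := X) ⟨X, 0, 0, 0, 0, hX.eq_of_src _ _, by simp, by simp,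
    hX.eq_of_src _ _⟩ (isBinaryBilimitOfTotal _ (hX.eq_of_src _ _))
  simpa using h

/-- The defining relations only mention biproducts; an object isomorphic to Y is a biproduct of Y
and a zero object. -/
lemma K0Split.cls_iso [HasZeroObject A] {X Y : A} (e : X ≅ Y) :
    K0Split.cls X = K0Split.cls Y := by
  obtain ⟨O, hO⟩ := HasZeroObject.zero (C := A)
  have h := K0Split.cls_bicone (X := Y) (Y := O) ⟨X, e.hom, 0, e.inv, 0, by simp, by simp, by simp,
    hO.eq_of_src _ _⟩ (isBinaryBilimitOfTotal _ (by simp))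
  simpa [K0Split.cls_isZero hO] using h

lemma K0Split.hom_ext {G : Type*} [AddCommGroup G] {f g : K0Split A →+ G}
    (h : ∀ X, f (K0Split.cls X) = g (K0Split.cls X)) : f = g := by
  apply QuotientAddGroup.addMonoidHom_ext
  ext X
  exact h X

/-- A homomorphism out of the split Grothendieck group, from an additive function on objects. -/
def K0Split.lift {G : Type*} [AddCommGroup G] (φ : A → G)
    (h : ∀ {X Y : A} (b : BinaryBicone X Y), b.IsBilimit → φ b.pt = φ X + φ Y) :
    K0Split A →+ G :=
  QuotientAddGroup.lift _ (FreeAbelianGroup.lift φ) (by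
    refine (AddSubgroup.closure_le _).2 ?_
    rintro _ ⟨X, Y, b, ⟨hb⟩, rfl⟩
    simp [h b hb])

@[simp]
lemma K0Split.lift_cls {G : Type*} [AddCommGroup G] (φ : A → G)
    (h : ∀ {X Y : A} (b : BinaryBicone X Y), b.IsBilimit → φ b.pt = φ X + φ Y) (X : A) :
    K0Split.lift φ h (K0Split.cls X) = φ X := by
  change FreeAbelianGroup.lift φ (FreeAbelianGroup.of X) = φ X
  simp

variable {B : Type u'} [Category.{v'} B] [Preadditive B]

/-- The map of split Grothendieck groups induced by an additive functor. -/
def K0Split.map (F : A ⥤ B) [F.Additive] : K0Split A →+ K0Split B :=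
  K0Split.lift (fun X => K0Split.cls (F.obj X)) (fun {X Y} b hb =>
    K0Split.cls_bicone (X := F.obj X) (Y := F.obj Y)
      ⟨F.obj b.pt, F.map b.fst, F.map b.snd, F.map b.inl, F.map b.inr,
        by rw [← F.map_comp, b.inl_fst, F.map_id], by rw [← F.map_comp, b.inl_snd, F.map_zero],
        by rw [← F.map_comp, b.inr_fst, F.map_zero], by rw [← F.map_comp, b.inr_snd, F.map_id]⟩
      (isBinaryBilimitOfTotal _ (by
        change F.map b.fst ≫ F.map b.inl + F.map b.snd ≫ F.map b.inr = 𝟙 (F.obj b.pt)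
        rw [← F.map_comp, ← F.map_comp, ← F.map_add, IsBilimit.binary_total hb, F.map_id])))

@[simp]
lemma K0Split.map_cls (F : A ⥤ B) [F.Additive] (X : A) :
    K0Split.map F (K0Split.cls X) = K0Split.cls (F.obj X) := by
  change FreeAbelianGroup.lift (fun X => K0Split.cls (F.obj X)) (FreeAbelianGroup.of X) = _
  simp

end SplitK0

/-! ### Grothendieck groups of modules -/

section ModK0

variable {K : Type k} [Field K] {A : Type u} [Category.{v} A]
  {Q : ObjectProperty (Aᵒᵖ ⥤ ModuleCat.{v} K)}

lemma K0Mod.cls_shortExact {S : ShortComplex (Aᵒᵖ ⥤ ModuleCat.{v} K)} (hS : S.ShortExact)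
    (h₁ : Q S.X₁) (h₂ : Q S.X₂) (h₃ : Q S.X₃) :
    K0Mod.cls S.X₂ h₂ = K0Mod.cls S.X₁ h₁ + K0Mod.cls S.X₃ h₃ := by
  have hmem : FreeAbelianGroup.of ⟨S.X₂, h₂⟩ - FreeAbelianGroup.of ⟨S.X₁, h₁⟩ -
      FreeAbelianGroup.of ⟨S.X₃, h₃⟩ ∈ exactRel Q :=
    AddSubgroup.subset_closure ⟨S, h₁, h₂, h₃, hS, rfl⟩
  have h := (QuotientAddGroup.eq_zero_iff _).2 hmem
  change K0Mod.cls S.X₂ h₂ - K0Mod.cls S.X₁ h₁ - K0Mod.cls S.X₃ h₃ = 0 at h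
  rw [sub_sub, sub_eq_zero] at h
  exact h

lemma K0Mod.hom_ext {G : Type*} [AddCommGroup G] {f g : K0Mod Q →+ G}
    (h : ∀ M (hM : Q M), f (K0Mod.cls M hM) = g (K0Mod.cls M hM)) : f = g := by
  apply QuotientAddGroup.addMonoidHom_ext
  ext X
  exact h X.1 X.2

/-- A homomorphism out of the Grothendieck group, from an additive function on modules. -/
def K0Mod.lift {G : Type*} [AddCommGroup G] (φ : ∀ M, Q M → G)
    (h : ∀ (S : ShortComplex (Aᵒᵖ ⥤ ModuleCat.{v} K)) (h₁ : Q S.X₁) (h₂ : Q S.X₂) (h₃ : Q S.X₃),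
      S.ShortExact → φ S.X₂ h₂ = φ S.X₁ h₁ + φ S.X₃ h₃) : K0Mod Q →+ G :=
  QuotientAddGroup.lift _ (FreeAbelianGroup.lift (fun M => φ M.1 M.2)) (by
    refine (AddSubgroup.closure_le _).2 ?_
    rintro _ ⟨S, h₁, h₂, h₃, hS, rfl⟩
    simp [h S h₁ h₂ h₃ hS])

@[simp]
lemma K0Mod.lift_cls {G : Type*} [AddCommGroup G] (φ : ∀ M, Q M → G)
    (h : ∀ (S : ShortComplex (Aᵒᵖ ⥤ ModuleCat.{v} K)) (h₁ : Q S.X₁) (h₂ : Q S.X₂) (h₃ : Q S.X₃),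
      S.ShortExact → φ S.X₂ h₂ = φ S.X₁ h₁ + φ S.X₃ h₃) (M) (hM : Q M) :
    K0Mod.lift φ h (K0Mod.cls M hM) = φ M hM := by
  change FreeAbelianGroup.lift (fun M : Subtype Q => φ M.1 M.2) (FreeAbelianGroup.of ⟨M, hM⟩) = _
  simp

@[simp]
lemma K0Mod.map_cls {Q' : ObjectProperty (Aᵒᵖ ⥤ ModuleCat.{v} K)} (h : Q ≤ Q') (M) (hM : Q M) :
    K0Mod.map h (K0Mod.cls M hM) = K0Mod.cls M (h M hM) := by
  change FreeAbelianGroup.lift (fun M : Subtype Q => K0Mod.cls M.1 (h _ M.2))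
    (FreeAbelianGroup.of ⟨M, hM⟩) = _
  simp

lemma K0Mod.cls_isZero {M : Aᵒᵖ ⥤ ModuleCat.{v} K} (hM : Q M) (h0 : IsZero M) :
    K0Mod.cls M hM = 0 := by
  have hS : (ShortComplex.mk (0 : M ⟶ M) (0 : M ⟶ M) (by simp)).ShortExact :=
    { exact := ShortComplex.exact_of_isZero_X₂ _ h0
      mono_f := ⟨fun _ _ _ => h0.eq_of_tgt _ _⟩
      epi_g := ⟨fun _ _ _ => h0.eq_of_src _ _⟩ }
  simpa using K0Mod.cls_shortExact hS hM hM hM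

/-- An isomorphism is a short exact sequence with zero third term; this is why some zero module `O`
must belong to the class. -/
lemma K0Mod.cls_iso {M M' : Aᵒᵖ ⥤ ModuleCat.{v} K} (e : M ≅ M') (hM : Q M) (hM' : Q M')
    {O : Aᵒᵖ ⥤ ModuleCat.{v} K} (hO : Q O) (h0 : IsZero O) :
    K0Mod.cls M hM = K0Mod.cls M' hM' := by
  have hS : (ShortComplex.mk e.hom (0 : M' ⟶ O) (by simp)).ShortExact :=
    { exact := by
        rw [ShortComplex.exact_iff_epi _ rfl]
        infer_instance
      mono_f := inferInstance
      epi_g := ⟨fun _ _ _ => h0.eq_of_src _ _⟩ }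
  have := K0Mod.cls_shortExact hS hM hM' hO
  rw [K0Mod.cls_isZero hO h0, add_zero] at this
  exact this.symm

end ModK0

/-! ### Exactness of complexes of modules, tested objectwise. -/

section Pointwise

variable {K : Type k} [Field K] {A : Type u} [Category.{v} A]

/-- Exactness of complexes of modules is pointwise. -/
lemma exact_of_app {S : ShortComplex (Aᵒᵖ ⥤ ModuleCat.{w} K)}
    (h : ∀ X, Function.Exact (S.f.app X).hom (S.g.app X).hom) : S.Exact := by
  rw [ShortComplex.exact_iff_isZero_homology, Functor.isZero_iff]
  intro X
  refine IsZero.of_iso ?_ (S.mapHomologyIso ((evaluation Aᵒᵖ (ModuleCat.{w} K)).obj X)).symm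
  rw [← ShortComplex.exact_iff_isZero_homology]
  exact (ShortComplex.ShortExact.moduleCat_exact_iff_function_exact _).2 (h X)

lemma app_of_exact {S : ShortComplex (Aᵒᵖ ⥤ ModuleCat.{w} K)} (h : S.Exact) (X : Aᵒᵖ) :
    Function.Exact (S.f.app X).hom (S.g.app X).hom :=
  (ShortComplex.ShortExact.moduleCat_exact_iff_function_exact _).1
    (h.map ((evaluation Aᵒᵖ (ModuleCat.{w} K)).obj X))

lemma injective_app {M N : Aᵒᵖ ⥤ ModuleCat.{w} K} (f : M ⟶ N) [Mono f] (X : Aᵒᵖ) :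
    Function.Injective (f.app X).hom :=
  (ModuleCat.mono_iff_injective _).1 inferInstance

lemma surjective_app {M N : Aᵒᵖ ⥤ ModuleCat.{w} K} (f : M ⟶ N) [Epi f] (X : Aᵒᵖ) :
    Function.Surjective (f.app X).hom :=
  (ModuleCat.epi_iff_surjective _).1 inferInstance

/-- Short exactness of complexes of modules is pointwise. -/
lemma shortExact_of_app {M₁ M₂ M₃ : Aᵒᵖ ⥤ ModuleCat.{w} K} (f : M₁ ⟶ M₂) (g : M₂ ⟶ M₃)
    (hf : ∀ X, Function.Injective (f.app X).hom) (hg : ∀ X, Function.Surjective (g.app X).hom)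
    (hfg : ∀ X, Function.Exact (f.app X).hom (g.app X).hom) :
    ∃ w : f ≫ g = 0, (ShortComplex.mk f g w).ShortExact := by
  have w : f ≫ g = 0 := by
    ext X m
    exact (hfg X).apply_apply_eq_zero m
  have hm : ∀ X, Mono (f.app X) := fun X => (ModuleCat.mono_iff_injective _).2 (hf X)
  have he : ∀ X, Epi (g.app X) := fun X => (ModuleCat.epi_iff_surjective _).2 (hg X)
  exact ⟨w, { exact := exact_of_app hfg
              mono_f := NatTrans.mono_of_mono_app f
              epi_g := NatTrans.epi_of_epi_app g }⟩

lemma exact_kernel_app {M N : Aᵒᵖ ⥤ ModuleCat.{w} K} (f : M ⟶ N) (X : Aᵒᵖ) :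
    Function.Exact ((kernel.ι f).app X).hom (f.app X).hom :=
  app_of_exact (S := ShortComplex.mk _ _ (kernel.condition f)) (ShortComplex.exact_kernel f) X

lemma exact_cokernel_app {M N : Aᵒᵖ ⥤ ModuleCat.{w} K} (f : M ⟶ N) (X : Aᵒᵖ) :
    Function.Exact (f.app X).hom ((cokernel.π f).app X).hom :=
  app_of_exact (S := ShortComplex.mk _ _ (cokernel.condition f)) (ShortComplex.exact_cokernel f) X

/-- A pointwise bijective map of modules is an isomorphism. -/
def isoOfBijective {M N : Aᵒᵖ ⥤ ModuleCat.{w} K} (f : M ⟶ N)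
    (h : ∀ X, Function.Bijective (f.app X).hom) : M ≅ N :=
  have : ∀ X, IsIso (f.app X) := fun X => (ConcreteCategory.isIso_iff_bijective _).2 (h X)
  have := NatIso.isIso_of_isIso_app f
  asIso f

end Pointwise


end ClusterIso

namespace ClusterIso

universe w' w''

/-! ### Euler characteristics of finite resolutions by representable modules -/

section Euler

variable {A : Type u} [Category.{v} A] [Preadditive A]

/-- The alternating sum of the first `n` terms of a sequence of objects. -/
def eulerSum (X : ℕ → A) (n : ℕ) : K0Split A :=
  ∑ i ∈ Finset.range n, (-1 : ℤ) ^ i • K0Split.cls (X i)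

lemma eulerSum_eq_of_isZero {X : ℕ → A} {n : ℕ} (h : ∀ i, n < i → IsZero (X i)) {m : ℕ}
    (hm : n < m) : eulerSum X m = eulerSum X (n + 1) := by
  induction m, hm using Nat.le_induction with
  | base => rfl
  | succ m hm ih =>
    rw [eulerSum, Finset.sum_range_succ, K0Split.cls_isZero (h m hm), smul_zero, add_zero]
    exact ih

lemma exists_biprod_lift [HasBinaryBiproducts A] {X Y Z : A} (f : Z ⟶ X ⊞ Y) : ∃ u v, f = biprod.lift u v :=
  ⟨f ≫ biprod.fst, f ≫ biprod.snd, by apply biprod.hom_ext <;> simp⟩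

lemma biprod_lift_eq_iff [HasBinaryBiproducts A] {X Y Z : A} (u u' : Z ⟶ X) (v v' : Z ⟶ Y) :
    biprod.lift u v = biprod.lift u' v' ↔ u = u' ∧ v = v' := by
  constructor
  · intro h
    exact ⟨by simpa using congrArg (· ≫ biprod.fst) h, by simpa using congrArg (· ≫ biprod.snd) h⟩
  · rintro ⟨rfl, rfl⟩
    rfl

section Acyclic

variable [HasBinaryBiproducts A] [HasZeroObject A]

/-- The objects of the complex obtained from an acyclic complex by cancelling the term of
degree `0`. -/
def cancelObj (X : ℕ → A) : ℕ → A
  | 0 => X 1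
  | 1 => X 2 ⊞ X 0
  | i + 2 => X (i + 3)

/-- The differentials of the complex obtained from an acyclic complex by cancelling the term of
degree `0`. -/
def cancelD (X : ℕ → A) (d : ∀ i, X (i + 1) ⟶ X i) (s : X 0 ⟶ X 1) :
    ∀ i, cancelObj X (i + 1) ⟶ cancelObj X i
  | 0 => biprod.desc (d 1) s
  | 1 => biprod.lift (d 2) 0
  | i + 2 => d (i + 3)

/-- The Euler characteristic of a bounded acyclic complex vanishes. -/
lemma eulerSum_eq_zero (n : ℕ) : ∀ (X : ℕ → A) (d : ∀ i, X (i + 1) ⟶ X i),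
    (∀ i, n < i → IsZero (X i)) → (∀ (Y : A) (f : Y ⟶ X 0), ∃ g : Y ⟶ X 1, g ≫ d 0 = f) →
    (∀ (i : ℕ) (Y : A) (f : Y ⟶ X (i + 1)), f ≫ d i = 0 ↔ ∃ g : Y ⟶ X (i + 2), g ≫ d (i + 1) = f) →
    eulerSum X (n + 1) = 0 := by
  induction n using Nat.strong_induction_on with
  | _ n ih =>
    intro X d hX h₀ h₁
    -- The complex is exact after applying every Hom(Y, -), so `d 0` is a split epimorphism. Its
    -- kernel need not be an object. Instead X 0 is moved up to degree 2 by means of `s`: this gives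
    -- an acyclic complex one step shorter, with opposite Euler sum.
    obtain ⟨s, hs⟩ := h₀ _ (𝟙 (X 0))
    have hdd : ∀ i, d (i + 1) ≫ d i = 0 := fun i => (h₁ i _ _).2 ⟨𝟙 _, Category.id_comp _⟩
    match n, ih, hX with
    | 0, _, hX =>
      have : IsZero (X 0) := by
        rw [IsZero.iff_id_eq_zero, ← hs, (hX 1 one_pos).eq_of_tgt s 0, zero_comp]
      simp [eulerSum, K0Split.cls_isZero this]
    | 1, _, hX =>
      have e : X 0 ≅ X 1 := ⟨s, d 0, hs, by
        obtain ⟨g, hg⟩ := (h₁ 0 (X 1) (d 0 ≫ s - 𝟙 _)).1 (by simp [hs])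
        rw [(hX 2 (by norm_num)).eq_of_tgt g 0, zero_comp] at hg
        exact (sub_eq_zero.1 hg.symm)⟩
      simp [eulerSum, Finset.sum_range_succ, K0Split.cls_iso e]
    | n + 2, ih, hX =>
      have := ih (n + 1) (by omega) (cancelObj X) (cancelD X d s)
        (by
          rintro (_ | _ | i) hi
          · omega
          · omega
          · exact hX _ (by omega))
        (by
          intro Y (f : Y ⟶ X 1)
          -- Subtracting the part of `f` that passes through `s` leaves a map killed by `d 0`, which
          -- comes from X 2.
          obtain ⟨g, hg⟩ := (h₁ 0 Y (f - f ≫ d 0 ≫ s)).1 (by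
            simp only [Preadditive.sub_comp, Category.assoc, hs, Category.comp_id, sub_self])
          refine ⟨biprod.lift g (f ≫ d 0), ?_⟩
          change biprod.lift g (f ≫ d 0) ≫ biprod.desc (d 1) s = f
          rw [biprod.lift_desc, hg]
          simp)
        (by
          rintro (_ | _ | i) Y f
          · obtain ⟨p, q, rfl⟩ := exists_biprod_lift (X := X 2) (Y := X 0) f
            change biprod.lift p q ≫ biprod.desc (d 1) s = 0 ↔
              ∃ g : Y ⟶ X 3, g ≫ biprod.lift (d 2) 0 = biprod.lift p q
            rw [biprod.lift_desc]
            constructor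
            · intro hf
              -- Composing with `d 0` isolates the component in X 0, since `s ≫ d 0` is the identity
              -- and `d 1 ≫ d 0` vanishes.
              obtain rfl : q = 0 := by
                have := congrArg (· ≫ d 0) hf
                simpa [Preadditive.add_comp, hs, hdd 0] using this
              rw [zero_comp, add_zero] at hf
              obtain ⟨g, rfl⟩ := (h₁ 1 Y _).1 hf
              exact ⟨g, by apply biprod.hom_ext <;> simp⟩
            · rintro ⟨g, hg⟩
              have hp : g ≫ d 2 = p := by simpa using congrArg (· ≫ biprod.fst) hg
              have hq : 0 = q := by simpa using congrArg (· ≫ biprod.snd) hg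
              rw [← hp, ← hq]
              simp [hdd 1]
          · change Y ⟶ X 3 at f
            change f ≫ biprod.lift (d 2) 0 = 0 ↔ ∃ g : Y ⟶ X 4, g ≫ d 3 = f
            rw [← h₁ 2]
            constructor
            · intro hf
              simpa using congrArg (· ≫ biprod.fst) hf
            · intro hf
              apply biprod.hom_ext <;> simp [hf]
          · exact h₁ (i + 3) Y f)
      rw [eulerSum, Finset.sum_range_succ', Finset.sum_range_succ'] at this
      rw [eulerSum, Finset.sum_range_succ', Finset.sum_range_succ', Finset.sum_range_succ']
      simp only [cancelObj, K0Split.cls_biprod, pow_succ, zero_add, pow_zero, mul_neg,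
        mul_one, neg_neg, neg_smul, one_smul, Finset.sum_neg_distrib] at this ⊢
      rw [← neg_eq_zero, ← this]
      abel

end Acyclic

variable {K : Type k} [Field K]

/-- `N` has a finite resolution by representable modules, with Euler characteristic `c`. -/
def HasEuler (N : Aᵒᵖ ⥤ ModuleCat.{w} K) (c : K0Split A) : Prop :=
  ∃ r : RepResolution N, eulerSum r.X (r.len + 1) = c

namespace RepResolution

variable {N : Aᵒᵖ ⥤ ModuleCat.{w} K} (r : RepResolution N)

lemma d_comp_d (i : ℕ) : r.d (i + 1) ≫ r.d i = 0 :=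
  (r.exact_succ i _ _).2 ⟨𝟙 _, Category.id_comp _⟩

lemma map_d_aug : (N.map (r.d 0).op).hom r.aug = 0 :=
  (r.exact_zero _ _).2 ⟨𝟙 _, Category.id_comp _⟩

end RepResolution

lemma map_comp_apply {A : Type u} [Category.{v} A] (N : Aᵒᵖ ⥤ ModuleCat.{w} K) {X Y Z : A} (f : X ⟶ Y) (g : Y ⟶ Z)
    (n : N.obj (op Z)) : (N.map (f ≫ g).op).hom n = (N.map f.op).hom ((N.map g.op).hom n) := by
  simp

/-! ### Mapping cones of lifts between resolutions. -/

section Cone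

variable {N' : Aᵒᵖ ⥤ ModuleCat.{w} K} {N : Aᵒᵖ ⥤ ModuleCat.{w'} K} {N'' : Aᵒᵖ ⥤ ModuleCat.{w''} K}

/-- A chain map lifting a map of modules. -/
lemma RepResolution.exists_chainMap (r' : RepResolution N') (r : RepResolution N)
    (φ : ∀ Y : A, N'.obj (op Y) →ₗ[K] N.obj (op Y))
    (hφ : ∀ {Y Z : A} (f : Y ⟶ Z) (n : N'.obj (op Z)),
      φ Y ((N'.map f.op).hom n) = (N.map f.op).hom (φ Z n)) :
    ∃ f : ∀ i, r'.X i ⟶ r.X i, (N.map (f 0).op).hom r.aug = φ _ r'.aug ∧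
      ∀ i, f (i + 1) ≫ r.d i = r'.d i ≫ f i := by
  obtain ⟨f₀, hf₀⟩ := r.aug_surj _ (φ _ r'.aug)
  have h₀ : ∃ g : r'.X 1 ⟶ r.X 1, g ≫ r.d 0 = r'.d 0 ≫ f₀ := by
    refine (r.exact_zero _ _).1 ?_
    rw [map_comp_apply, hf₀, ← hφ, r'.map_d_aug, map_zero]
  -- The recursion runs over maps bundled with the existence of a further lift, so that each choice
  -- can be continued.
  have hs : ∀ (i : ℕ) (f : {f : r'.X i ⟶ r.X i // ∃ g : r'.X (i + 1) ⟶ r.X (i + 1),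
      g ≫ r.d i = r'.d i ≫ f}), ∃ g : {g : r'.X (i + 1) ⟶ r.X (i + 1) //
      ∃ k : r'.X (i + 2) ⟶ r.X (i + 2), k ≫ r.d (i + 1) = r'.d (i + 1) ≫ g},
      g.1 ≫ r.d i = r'.d i ≫ f.1 := by
    rintro i ⟨f, g, hg⟩
    refine ⟨⟨g, (r.exact_succ i _ _).1 ?_⟩, hg⟩
    rw [Category.assoc, hg, ← Category.assoc, r'.d_comp_d, zero_comp]
  choose next hnext using hs
  let f : ∀ i, {f : r'.X i ⟶ r.X i // ∃ g : r'.X (i + 1) ⟶ r.X (i + 1),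
      g ≫ r.d i = r'.d i ≫ f} := fun i => Nat.rec ⟨f₀, h₀⟩ next i
  exact ⟨fun i => (f i).1, hf₀, fun i => hnext i (f i)⟩

variable [HasBinaryBiproducts A]

/-- The objects of the mapping cone. -/
def coneObj (X' X : ℕ → A) : ℕ → A
  | 0 => X 0
  | i + 1 => X (i + 1) ⊞ X' i

/-- The differentials of the mapping cone. -/
def coneD {X' X : ℕ → A} (d' : ∀ i, X' (i + 1) ⟶ X' i) (d : ∀ i, X (i + 1) ⟶ X i)
    (f : ∀ i, X' i ⟶ X i) : ∀ i, coneObj X' X (i + 1) ⟶ coneObj X' X i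
  | 0 => biprod.desc (d 0) (f 0)
  | i + 1 => biprod.desc (biprod.lift (d (i + 1)) 0) (biprod.lift (f (i + 1)) (-d' i))

lemma comp_coneD_zero {X' X : ℕ → A} (d' : ∀ i, X' (i + 1) ⟶ X' i) (d : ∀ i, X (i + 1) ⟶ X i)
    (f : ∀ i, X' i ⟶ X i) {Y : A} (u : Y ⟶ X 1) (v : Y ⟶ X' 0) :
    biprod.lift u v ≫ (show X 1 ⊞ X' 0 ⟶ X 0 from coneD d' d f 0) = u ≫ d 0 + v ≫ f 0 :=
  biprod.lift_desc

lemma comp_coneD_succ {X' X : ℕ → A} (d' : ∀ i, X' (i + 1) ⟶ X' i) (d : ∀ i, X (i + 1) ⟶ X i)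
    (f : ∀ i, X' i ⟶ X i) (i : ℕ) {Y : A} (u : Y ⟶ X (i + 2)) (v : Y ⟶ X' (i + 1)) :
    biprod.lift u v ≫ (show X (i + 2) ⊞ X' (i + 1) ⟶ X (i + 1) ⊞ X' i from coneD d' d f (i + 1)) =
      biprod.lift (u ≫ d (i + 1) + v ≫ f (i + 1)) (-(v ≫ d' i)) := by
  change biprod.lift u v ≫ biprod.desc _ _ = _
  rw [biprod.lift_desc]
  apply biprod.hom_ext <;> simp

/-- The mapping cone of a lift of an injective map of modules resolves the cokernel. -/
lemma HasEuler.cone [HasZeroObject A] {c' c : K0Split A} (hN' : HasEuler N' c') (hN : HasEuler N c)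
    (hadd : ∀ {Y Z : A} (f g : Y ⟶ Z), N.map (f + g).op = N.map f.op + N.map g.op)
    (φ : ∀ Y : A, N'.obj (op Y) →ₗ[K] N.obj (op Y))
    (hφ : ∀ {Y Z : A} (f : Y ⟶ Z) (n : N'.obj (op Z)),
      φ Y ((N'.map f.op).hom n) = (N.map f.op).hom (φ Z n))
    (ψ : ∀ Y : A, N.obj (op Y) →ₗ[K] N''.obj (op Y))
    (hψ : ∀ {Y Z : A} (f : Y ⟶ Z) (n : N.obj (op Z)),
      ψ Y ((N.map f.op).hom n) = (N''.map f.op).hom (ψ Z n))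
    (hinj : ∀ Y, Function.Injective (φ Y)) (hsurj : ∀ Y, Function.Surjective (ψ Y))
    (hex : ∀ Y, Function.Exact (φ Y) (ψ Y)) : HasEuler N'' (c - c') := by
  obtain ⟨r', rfl⟩ := hN'
  obtain ⟨r, rfl⟩ := hN
  -- Maps of modules enter as natural families of linear maps, since the three modules may take
  -- values in different universes.
  obtain ⟨f, hf₀, hf⟩ := r'.exists_chainMap r φ hφ
  have hsub : ∀ {Y Z : A} (f g : Y ⟶ Z) (n : N.obj (op Z)),
      (N.map (f - g).op).hom n = (N.map f.op).hom n - (N.map g.op).hom n := by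
    intro Y Z f g n
    have := congrArg (fun F => F.hom n) (hadd (f - g) g)
    simp only [sub_add_cancel] at this
    rw [this]
    simp
  have hzero : ∀ {Y Z : A} (n : N.obj (op Z)), (N.map (0 : Y ⟶ Z).op).hom n = 0 := by
    intro Y Z n
    simpa using hsub (0 : Y ⟶ Z) 0 n
  -- The term `r'.X i` sits in degree i + 1 of the cone, whence the length and the sign of `c'`.
  refine ⟨⟨max r.len (r'.len + 1), coneObj r'.X r.X, coneD r'.d r.d f, ψ _ r.aug, ?_, ?_, ?_, ?_⟩,
    ?_⟩
  · rintro (_ | i) hi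
    · simp at hi
    · exact (biprod_isZero_iff _ _).2 ⟨r.isZero _ (by omega), r'.isZero _ (by omega)⟩
  · intro Y n
    obtain ⟨m, rfl⟩ := hsurj Y n
    obtain ⟨g, rfl⟩ := r.aug_surj Y m
    exact ⟨g, (hψ g r.aug).symm⟩
  · intro Y (g : Y ⟶ r.X 0)
    refine Iff.trans (b := (N.map g.op).hom r.aug ∈ Set.range (φ Y)) ?_ ?_
    · rw [← hex Y, hψ]
      rfl
    constructor
    · rintro ⟨n, hn⟩
      obtain ⟨v, rfl⟩ := r'.aug_surj Y n
      obtain ⟨u, hu⟩ := (r.exact_zero Y (g - v ≫ f 0)).1 (by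
        rw [hsub, map_comp_apply, hf₀, ← hφ, hn, sub_self])
      refine ⟨biprod.lift u v, (comp_coneD_zero _ _ _ u v).trans ?_⟩
      rw [hu, sub_add_cancel]
    · rintro ⟨g', rfl⟩
      obtain ⟨u, v, rfl⟩ := exists_biprod_lift (X := r.X 1) (Y := r'.X 0) g'
      refine ⟨(N'.map v.op).hom r'.aug, ?_⟩
      rw [hφ, ← hf₀, ← map_comp_apply]
      have h1 := comp_coneD_zero r'.d r.d f u v
      have h2 : (N.map (u ≫ r.d 0).op).hom r.aug = 0 := by
        rw [map_comp_apply, r.map_d_aug, map_zero]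
      have h3 := hsub (u ≫ r.d 0 + v ≫ f 0) (u ≫ r.d 0) r.aug
      rw [h2, sub_zero, add_sub_cancel_left] at h3
      rw [h3]
      exact congrArg (fun t => (N.map (Quiver.Hom.op t)).hom r.aug) h1.symm
  · rintro (_ | i) Y g
    · obtain ⟨u, v, rfl⟩ := exists_biprod_lift (X := r.X 1) (Y := r'.X 0) g
      have e1 := comp_coneD_zero r'.d r.d f u v
      constructor
      · intro h
        have h := e1.symm.trans h
        -- Injectivity of `φ` is used here only. If (u, v) is a cycle, then the element of N' given
        -- by `v` maps to minus the one given by `u ≫ r.d 0`, which is zero; so `v` is a boundary.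
        obtain ⟨v', hv'⟩ := (r'.exact_zero Y v).1 (by
          apply hinj
          rw [hφ, ← hf₀, ← map_comp_apply, map_zero, eq_neg_of_add_eq_zero_right h,
            ← zero_sub, hsub, hzero, map_comp_apply, r.map_d_aug, map_zero, sub_zero])
        obtain ⟨u', hu'⟩ := (r.exact_succ 0 Y (u + v' ≫ f 1)).1 (by
          rw [Preadditive.add_comp, Category.assoc, hf 0, ← Category.assoc, hv', h]
          rfl)
        refine ⟨biprod.lift u' (-v'), (comp_coneD_succ r'.d r.d f 0 u' (-v')).trans ?_⟩
        rw [hu', biprod_lift_eq_iff]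
        simp [hv']
      · rintro ⟨g, hg⟩
        obtain ⟨u', v', rfl⟩ := exists_biprod_lift (X := r.X 2) (Y := r'.X 1) g
        have e2 := (comp_coneD_succ r'.d r.d f 0 u' v').symm.trans hg
        rw [biprod_lift_eq_iff] at e2
        refine e1.trans ?_
        rw [← e2.1, ← e2.2]
        simp [r.d_comp_d, hf 0]
        rfl
    · obtain ⟨u, v, rfl⟩ := exists_biprod_lift (X := r.X (i + 2)) (Y := r'.X (i + 1)) g
      have e1 := comp_coneD_succ r'.d r.d f i u v
      have e0 : (0 : Y ⟶ r.X (i + 1) ⊞ r'.X i) = biprod.lift 0 0 := by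
        apply biprod.hom_ext <;> simp
      constructor
      · intro h
        have h := e1.symm.trans h
        have h := h.trans e0
        rw [biprod_lift_eq_iff, neg_eq_zero] at h
        obtain ⟨v', hv'⟩ := (r'.exact_succ i Y v).1 h.2
        obtain ⟨u', hu'⟩ := (r.exact_succ (i + 1) Y (u + v' ≫ f (i + 2))).1 (by
          rw [Preadditive.add_comp, Category.assoc, hf (i + 1), ← Category.assoc, hv', h.1])
        refine ⟨biprod.lift u' (-v'), (comp_coneD_succ r'.d r.d f (i + 1) u' (-v')).trans ?_⟩
        rw [hu', biprod_lift_eq_iff]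
        simp [hv']
      · rintro ⟨g, hg⟩
        obtain ⟨u', v', rfl⟩ := exists_biprod_lift (X := r.X (i + 3)) (Y := r'.X (i + 2)) g
        have e2 := (comp_coneD_succ r'.d r.d f (i + 1) u' v').symm.trans hg
        rw [biprod_lift_eq_iff] at e2
        refine e1.trans (Eq.trans ?_ e0.symm)
        rw [← e2.1, ← e2.2, biprod_lift_eq_iff]
        simp [r.d_comp_d, r'.d_comp_d, hf (i + 1)]
  · change eulerSum (coneObj r'.X r.X) (max r.len (r'.len + 1) + 1) = _
    -- Zero terms pad both sums to the length of the cone; the sum for `r'` is one term shorter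
    -- because of the shift.
    have hr := eulerSum_eq_of_isZero r.isZero (m := max r.len (r'.len + 1) + 1) (by omega)
    have hr' := eulerSum_eq_of_isZero r'.isZero (m := max r.len (r'.len + 1)) (by omega)
    rw [← hr, ← hr', eulerSum, Finset.sum_range_succ', eulerSum, Finset.sum_range_succ', eulerSum]
    simp only [coneObj, K0Split.cls_biprod, pow_succ, mul_neg, mul_one, neg_smul, smul_add,
      Finset.sum_add_distrib, Finset.sum_neg_distrib, pow_zero, one_smul]
    abel

/-- The Euler characteristic of a module does not depend on the resolution. -/
lemma HasEuler.unique [HasZeroObject A] {c c' : K0Split A} (hN : HasEuler N c) (hN' : HasEuler N c')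
    (hadd : ∀ {Y Z : A} (f g : Y ⟶ Z), N.map (f + g).op = N.map f.op + N.map g.op) : c = c' := by
  -- The cone of a lift of the identity resolves the zero module. It is a bounded acyclic complex,
  -- and its Euler sum is `c - c'`.
  obtain ⟨r, hr⟩ := HasEuler.cone (N'' := (Functor.const _).obj (ModuleCat.of K PUnit.{1})) hN' hN
    hadd (fun Y => LinearMap.id) (fun _ _ => rfl) (fun Y => 0) (fun _ _ => rfl)
    (fun _ => Function.injective_id) (fun _ _ => ⟨0, rfl⟩)
    (fun Y n => ⟨fun _ => ⟨n, rfl⟩, fun _ => rfl⟩)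
  have := eulerSum_eq_zero r.len r.X r.d r.isZero (fun Y f => (r.exact_zero Y f).1 rfl) r.exact_succ
  rw [this] at hr
  exact (sub_eq_zero.1 hr.symm)

end Cone

/-- Representable modules are resolved by themselves. -/
lemma HasEuler.representable [HasZeroObject A] (N : Aᵒᵖ ⥤ ModuleCat.{w} K) (X : A)
    (n : N.obj (op X)) (h : ∀ Y, Function.Bijective fun f : Y ⟶ X => (N.map f.op).hom n)
    (hzero : ∀ Y, (N.map (0 : Y ⟶ X).op).hom n = 0) :
    HasEuler N (K0Split.cls X) := by
  obtain ⟨O, hO⟩ := HasZeroObject.zero (C := A)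
  refine ⟨⟨0, fun | 0 => X | _ + 1 => O, fun | 0 => 0 | _ + 1 => 0, n, ?_,
    fun Y m => (h Y).2 m, ?_, ?_⟩, by simp [eulerSum]⟩
  · rintro (_ | i) hi
    · simp at hi
    · exact hO
  · intro Y f
    constructor
    · intro hf
      refine ⟨0, ?_⟩
      rw [zero_comp]
      exact (h Y).1 ((hzero Y).trans hf.symm)
    · rintro ⟨g, rfl⟩
      rw [hO.eq_of_tgt g 0, zero_comp]
      exact hzero Y
  · intro i Y f
    constructor
    · intro _
      exact ⟨0, hO.eq_of_tgt _ _⟩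
    · intro _
      rw [hO.eq_of_tgt f 0, zero_comp]

end Euler

end ClusterIso

namespace ClusterIso

/-! ### Isomorphisms of conflations -/

section Iso

variable {K : Type k} [Field K] {C : Type u} [Category.{v} C] [Preadditive C] [Linear K C]

/-- A five lemma. The outer terms of a conflation are only a weak kernel and a weak cokernel, so a
left and a right inverse are built separately: choose a map that is correct modulo one end, then
correct it through the other end. -/
lemma HasExactConfl.isIso_mid {D : ExtData K C} (h : HasExactConfl D) {X Y Z X' Y' Z' : C}
    {δ : D.Ext Z X} {δ' : D.Ext Z' X'} {x : X ⟶ Y} {y : Y ⟶ Z} {x' : X' ⟶ Y'} {y' : Y' ⟶ Z'}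
    (hr : D.Real δ x y) (hr' : D.Real δ' x' y') (a : X ≅ X') (b : Y ⟶ Y') (c : Z ≅ Z')
    (hab : x ≫ b = a.hom ≫ x') (hbc : b ≫ y' = y ≫ c.hom)
    (hac : D.push Z a.hom δ = D.pull c.hom X' δ') : IsIso b := by
  have h₁ : ∃ s : Y' ⟶ Y, s ≫ b = 𝟙 Y' := by
    obtain ⟨g, hg⟩ := h.lift_mid hr (y' ≫ c.inv) (by
      have : D.push _ a.hom (D.pull (y' ≫ c.inv) X δ) = 0 := by
        rw [← D.pull_push, hac, ← D.pull_comp]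
        simpa using h.pull_zero hr'
      have := congrArg (D.push Y' a.inv) this
      rwa [← D.push_comp, a.hom_inv_id, D.push_id, map_zero] at this)
    obtain ⟨l, hl⟩ := h.lift_left hr' (𝟙 Y' - g ≫ b) (by
      rw [Preadditive.sub_comp, Category.assoc, hbc, ← Category.assoc, hg]
      simp)
    refine ⟨g + l ≫ a.inv ≫ x, ?_⟩
    rw [Preadditive.add_comp, Category.assoc, Category.assoc, hab, a.inv_hom_id_assoc, hl,
      add_sub_cancel]
  have h₂ : ∃ s : Y' ⟶ Y, b ≫ s = 𝟙 Y := by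
    obtain ⟨g, hg⟩ := h.desc_mid hr' (a.inv ≫ x) (by
      have : D.pull c.hom _ (D.push Z' (a.inv ≫ x) δ') = 0 := by
        rw [D.pull_push, ← hac, ← D.push_comp]
        simpa using h.push_zero hr
      have := congrArg (D.pull c.inv Y) this
      rwa [← D.pull_comp, c.inv_hom_id, D.pull_id, map_zero] at this)
    obtain ⟨l, hl⟩ := h.desc_right hr (𝟙 Y - b ≫ g) (by
      rw [Preadditive.comp_sub, ← Category.assoc, hab, Category.assoc, hg]
      simp)
    refine ⟨g + y' ≫ c.inv ≫ l, ?_⟩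
    rw [Preadditive.comp_add, ← Category.assoc b, hbc, Category.assoc, c.hom_inv_id_assoc, hl,
      add_sub_cancel]
  obtain ⟨s, hs⟩ := h₁
  obtain ⟨t, ht⟩ := h₂
  have hst : s = t := by
    rw [← Category.comp_id s, ← ht, ← Category.assoc, hs, Category.id_comp]
  exact ⟨s, by rw [hst, ht], hs⟩

/-- The axioms only allow the middle term to vary, so the transported extension is realised afresh
and compared with the given sequence by `isIso_mid`. -/
lemma IsExtriangulated.real_iso [HasZeroObject C] [HasBinaryBiproducts C] {D : ExtData K C}
    (h : IsExtriangulated D) {X Y Z X' Z' : C} {δ : D.Ext Z X} {x : X ⟶ Y} {y : Y ⟶ Z}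
    (hr : D.Real δ x y) (a : X ≅ X') (c : Z ≅ Z') :
    D.Real (D.push Z' a.hom (D.pull c.inv X δ)) (a.inv ≫ x) (y ≫ c.hom) := by
  obtain ⟨Y', x', y', hr'⟩ := h.exists_real (D.push Z' a.hom (D.pull c.inv X δ))
  have hac : D.push Z a.hom δ = D.pull c.hom X' (D.push Z' a.hom (D.pull c.inv X δ)) := by
    rw [D.pull_push, ← D.pull_comp, c.hom_inv_id, D.pull_id]
  obtain ⟨b, hab, hbc⟩ := h.real_mor _ _ _ _ _ _ a.hom c.hom hr hr' hac
  have := h.hasExactConfl.isIso_mid hr hr' a b c hab hbc hac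
  refine (h.real_iff _ _ _ _ _ hr').2 ⟨(asIso b).symm, ?_, ?_⟩
  · simp only [Iso.symm_hom, asIso_inv, IsIso.comp_inv_eq, Category.assoc, hab,
      a.inv_hom_id_assoc]
  · simp [hbc]

end Iso

/-! ### Cluster-tilting subcategories -/

section Tilting

variable {K : Type k} [Field K] {C : Type u} [Category.{v} C] [Preadditive C] [Linear K C]
  {D : ExtData K C} {T : ObjectProperty C}

namespace ClusterTilting

variable (hT : ClusterTilting D T)

include hT

lemma ext_eq_zero {X Y : C} (hX : T X) (hY : T Y) (δ : D.Ext X Y) : δ = 0 :=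
  have := (hT.mem_iff_right Y).1 hY X hX
  Subsingleton.elim _ _

lemma of_retract {X Y : C} (hY : T Y) (i : X ⟶ Y) (r : Y ⟶ X) (hir : i ≫ r = 𝟙 X) : T X := by
  refine (hT.mem_iff_right X).2 fun T' hT' => ⟨fun δ δ' => ?_⟩
  have key : ∀ δ : D.Ext T' X, δ = 0 := fun δ => by
    rw [← D.push_id _ _ δ, ← hir, D.push_comp, hT.ext_eq_zero hT' hY (D.push T' i δ), map_zero]
  rw [key δ, key δ']

lemma of_iso {X Y : C} (hY : T Y) (e : X ≅ Y) : T X :=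
  hT.of_retract hY e.hom e.inv e.hom_inv_id

lemma of_projInj {X : C} (hX : ProjInj D X) : T X :=
  (hT.mem_iff_right X).2 fun T' _ => hX.2 T'

lemma of_isZero {X : C} (hX : IsZero X) : T X := by
  refine (hT.mem_iff_right X).2 fun T' hT' => ⟨fun δ δ' => ?_⟩
  have key : ∀ δ : D.Ext T' X, δ = 0 := fun δ => by
    rw [← D.push_id _ _ δ, hX.eq_of_src (𝟙 X) 0, D.push_zero]
  rw [key δ, key δ']

lemma of_total {X Y Z : C} (hX : T X) (hY : T Y) (f : Z ⟶ X) (f' : X ⟶ Z) (g : Z ⟶ Y) (g' : Y ⟶ Z)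
    (h : f ≫ f' + g ≫ g' = 𝟙 Z) : T Z := by
  refine (hT.mem_iff_right _).2 fun T' hT' => ⟨fun δ δ' => ?_⟩
  have key : ∀ δ : D.Ext T' Z, δ = 0 := fun δ => by
    rw [← D.push_id _ _ δ, ← h, D.push_add, D.push_comp, D.push_comp,
      hT.ext_eq_zero hT' hX (D.push T' f δ), hT.ext_eq_zero hT' hY (D.push T' g δ),
      map_zero, map_zero, add_zero]
  rw [key δ, key δ']

lemma of_biprod [HasBinaryBiproducts C] {X Y : C} (hX : T X) (hY : T Y) : T (X ⊞ Y) :=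
  hT.of_total hX hY _ _ _ _ biprod.total

/-- Every object has a resolution of length one by objects of `T`. -/
lemma exists_index (hD : HasExactConfl D) (X : C) :
    ∃ (N R : T.FullSubcategory) (i : N.obj ⟶ R.obj) (p : R.obj ⟶ X), Confl D i p := by
  obtain ⟨R, p, ⟨hR, hp⟩, N, i, δ, hr⟩ := hT.right_approx X
  refine ⟨⟨N, (hT.mem_iff_right N).2 fun T' hT' => ⟨fun ε ε' => ?_⟩⟩, ⟨R, hR⟩, i, p, δ, hr⟩
  -- An extension by N dies in Ext(T', R) = 0, hence is a pullback of `δ` along a map T' → X. That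
  -- map factors through the approximation `p`, along which `δ` vanishes.
  have key : ∀ ε : D.Ext T' N, ε = 0 := fun ε => by
    obtain ⟨f, rfl⟩ := hD.eq_pull hr ε (hT.ext_eq_zero hT' hR _)
    obtain ⟨g, rfl⟩ := hp T' f hT'
    rw [D.pull_comp, hD.pull_zero hr, map_zero]
  rw [key ε, key ε']

/-- Every object has a coresolution of length one by objects of `T`. -/
lemma exists_coindex (hD : HasExactConfl D) (X : C) :
    ∃ (L N : T.FullSubcategory) (i : X ⟶ L.obj) (p : L.obj ⟶ N.obj), Confl D i p := by
  obtain ⟨L, i, ⟨hL, hi⟩, N, p, δ, hr⟩ := hT.left_approx X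
  refine ⟨⟨L, hL⟩, ⟨N, (hT.mem_iff_left N).2 fun T' hT' => ⟨fun ε ε' => ?_⟩⟩, i, p, δ, hr⟩
  have key : ∀ ε : D.Ext N T', ε = 0 := fun ε => by
    obtain ⟨f, rfl⟩ := hD.eq_push hr ε (hT.ext_eq_zero hL hT' _)
    obtain ⟨g, rfl⟩ := hi T' f hT'
    rw [D.push_comp, hD.push_zero hr, map_zero]
  rw [key ε, key ε']

end ClusterTilting

lemma hasBinaryBiproducts_fullSubcategory {A : Type u} [Category.{v} A] [Preadditive A]
    [HasBinaryBiproducts A] {P : ObjectProperty A} (h : ∀ X Y, P X → P Y → P (X ⊞ Y)) :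
    HasBinaryBiproducts P.FullSubcategory where
  has_binary_biproduct X Y := by
    refine HasBinaryBiproduct.mk ⟨⟨⟨X.obj ⊞ Y.obj, h _ _ X.2 Y.2⟩,
      ObjectProperty.homMk biprod.fst, ObjectProperty.homMk biprod.snd,
      ObjectProperty.homMk biprod.inl, ObjectProperty.homMk biprod.inr, ?_, ?_, ?_, ?_⟩,
      isBinaryBilimitOfTotal _ ?_⟩
    · ext; simp
    · ext; simp
    · ext; simp
    · ext; simp
    · exact ObjectProperty.hom_ext _ biprod.total

lemma hasZeroObject_fullSubcategory {A : Type u} [Category.{v} A] {P : ObjectProperty A} {X : A}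
    (hX : IsZero X) (h : P X) : HasZeroObject P.FullSubcategory :=
  have : P.ContainsZero := ⟨⟨X, hX, h⟩⟩
  inferInstance

lemma hasBinaryBiproducts_addQuot [HasBinaryBiproducts C] (P : ObjectProperty C) :
    HasBinaryBiproducts (AddQuot K P) where
  has_binary_biproduct X Y := by
    have total : (AddQuot.π K P).map (biprod.fst : X.as ⊞ Y.as ⟶ X.as) ≫
        (AddQuot.π K P).map (biprod.inl : X.as ⟶ X.as ⊞ Y.as) +
        (AddQuot.π K P).map (biprod.snd : X.as ⊞ Y.as ⟶ Y.as) ≫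
        (AddQuot.π K P).map (biprod.inr : Y.as ⟶ X.as ⊞ Y.as) = 𝟙 _ := by
      rw [← Functor.map_comp, ← Functor.map_comp, ← Functor.map_add, biprod.total,
        CategoryTheory.Functor.map_id]
    refine HasBinaryBiproduct.mk ⟨⟨(AddQuot.π K P).obj (X.as ⊞ Y.as),
      (AddQuot.π K P).map biprod.fst, (AddQuot.π K P).map biprod.snd,
      (AddQuot.π K P).map biprod.inl, (AddQuot.π K P).map biprod.inr, ?_, ?_, ?_, ?_⟩,
      isBinaryBilimitOfTotal _ total⟩
    · rw [← Functor.map_comp, biprod.inl_fst]; rfl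
    · rw [← Functor.map_comp, biprod.inl_snd, Functor.map_zero]
    · rw [← Functor.map_comp, biprod.inr_fst, Functor.map_zero]
    · rw [← Functor.map_comp, biprod.inr_snd]; rfl

end Tilting

end ClusterIso

namespace ClusterIso

/-! ### Euler characteristics via exact lifts -/

lemma exists_linearMap_lift {K : Type*} [Field K] {V W M : Type*} [AddCommGroup V] [Module K V]
    [AddCommGroup W] [Module K W] [AddCommGroup M] [Module K M] (j : M →ₗ[K] W)
    (hj : Function.Injective j) (θ : V →ₗ[K] W) (h : ∀ v, ∃ m, j m = θ v) :
    ∃ ψ : V →ₗ[K] M, ∀ v, j (ψ v) = θ v := by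
  refine ⟨(LinearEquiv.ofInjective j hj).symm.toLinearMap ∘ₗ θ.codRestrict (LinearMap.range j) h,
    fun v => ?_⟩
  have := LinearEquiv.apply_symm_apply (LinearEquiv.ofInjective j hj)
    (θ.codRestrict (LinearMap.range j) h v)
  exact congrArg Subtype.val this

/-! ### Restricted Hom functors and their Euler characteristics. -/

section HomMod

variable {K : Type k} [Field K] {E : Type u'} [Category.{v'} E] [Preadditive E] [Linear K E]

variable (K) in
/-- The restriction of `Hom(-, X)` to a full subcategory. -/
def homMod (P : ObjectProperty E) (X : E) : P.FullSubcategoryᵒᵖ ⥤ ModuleCat.{v'} K where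
  obj Y := ModuleCat.of K (Y.unop.obj ⟶ X)
  map f := ModuleCat.ofHom (Linear.leftComp K X f.unop.hom)

lemma homMod_map_add (P : ObjectProperty E) (X : E) {Y Z : P.FullSubcategory} (f g : Y ⟶ Z) :
    (homMod K P X).map (f + g).op = (homMod K P X).map f.op + (homMod K P X).map g.op := by
  ext h
  exact Preadditive.add_comp _ _ _ _ _ _

variable (K) in
/-- The submodule of `Hom(-, Z)` of morphisms factoring through `y : Y ⟶ Z`. -/
def imageMod (P : ObjectProperty E) {Y Z : E} (y : Y ⟶ Z) :
    P.FullSubcategoryᵒᵖ ⥤ ModuleCat.{v'} K where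
  obj W := ModuleCat.of K (LinearMap.range (Linear.rightComp K W.unop.obj y))
  map {W W'} f := ModuleCat.ofHom ((Linear.leftComp K Z f.unop.hom).restrict (by
    rintro _ ⟨g, rfl⟩
    exact ⟨f.unop.hom ≫ g, by simp⟩))
  map_id W := by
    ext ⟨g, hg⟩
    exact Category.id_comp _
  map_comp f g := by
    ext ⟨h, hh⟩
    exact Category.assoc _ _ _

variable {P : ObjectProperty E} [HasZeroObject P.FullSubcategory]

lemma hasEuler_homMod_of_mem (X : P.FullSubcategory) :
    HasEuler (homMod K P X.obj) (K0Split.cls X) := by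
  refine HasEuler.representable _ X (𝟙 X.obj) (fun Y => ?_) (fun Y => zero_comp)
  have : (fun f : Y ⟶ X => ((homMod K P X.obj).map f.op).hom (𝟙 X.obj)) = fun f => f.hom := by
    ext f
    exact Category.comp_id _
  rw [this]
  exact ⟨fun f g h => ObjectProperty.hom_ext _ h, fun f => ⟨ObjectProperty.homMk f, rfl⟩⟩

/-- The Euler characteristic of the cokernel of a map of `Hom`-functors with trivial left part. -/
lemma HasEuler.of_left_exact [HasBinaryBiproducts P.FullSubcategory] {X Y Z : E} {x : X ⟶ Y} {y : Y ⟶ Z} [Mono x]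
    (hxy : x ≫ y = 0) (hlift : ∀ {W : E} (f : W ⟶ Y), f ≫ y = 0 → ∃ g : W ⟶ X, g ≫ x = f)
    {cX cY cZ : K0Split P.FullSubcategory} (hX : HasEuler (homMod K P X) cX)
    (hY : HasEuler (homMod K P Y) cY) (hZ : HasEuler (homMod K P Z) cZ)
    {N : P.FullSubcategoryᵒᵖ ⥤ ModuleCat.{w} K}
    (ψ : ∀ W : P.FullSubcategory, (W.obj ⟶ Z) →ₗ[K] N.obj (op W))
    (hψ : ∀ {W W' : P.FullSubcategory} (f : W ⟶ W') (g : W'.obj ⟶ Z),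
      ψ W (f.hom ≫ g) = (N.map f.op).hom (ψ W' g))
    (hsurj : ∀ W, Function.Surjective (ψ W))
    (hker : ∀ W (f : W.obj ⟶ Z), ψ W f = 0 ↔ ∃ g : W.obj ⟶ Y, g ≫ y = f) :
    HasEuler N (cZ - (cY - cX)) := by
  -- The sequence 0 → Hom(-, X) → Hom(-, Y) → Hom(-, Z) → N → 0 is cut at the image of the third
  -- map, and each half is resolved by a cone.
  have hI : HasEuler (imageMod K P y) (cY - cX) := by
    refine HasEuler.cone hX hY (homMod_map_add P Y) (fun W => Linear.rightComp K W.obj x)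
      (fun f n => Category.assoc _ _ _) (fun W => (Linear.rightComp K W.obj y).rangeRestrict)
      (fun f n => Subtype.ext (Category.assoc _ _ _)) ?_ ?_ ?_
    · intro W f g h
      exact (cancel_mono x).1 h
    · rintro W ⟨_, g, hg⟩
      exact ⟨g, Subtype.ext hg⟩
    · intro W f
      constructor
      · intro h
        exact hlift f (congrArg Subtype.val h)
      · rintro ⟨(g : W.obj ⟶ X), rfl⟩
        refine Subtype.ext ((Category.assoc _ _ _).trans ?_)
        rw [hxy]
        exact comp_zero
  refine HasEuler.cone hI hZ (homMod_map_add P Z) (fun W => Submodule.subtype _)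
    (fun f n => rfl) ψ hψ (fun W => Subtype.val_injective) hsurj ?_
  intro W f
  refine (hker W f).trans ?_
  constructor
  · rintro ⟨g, hg⟩
    exact ⟨⟨f, g, hg⟩, rfl⟩
  · rintro ⟨⟨_, g, hg⟩, rfl⟩
    exact ⟨g, hg⟩

end HomMod

namespace ExactLift

variable {K : Type k} [Field K] {C : Type u} [Category.{v} C] [Preadditive C] [Linear K C]
  {D : ExtData K C} (L : ExactLift.{k, u, v, u', v'} D)

instance : L.proj.Additive := by unfold proj; infer_instance

instance : L.proj.Full := by unfold proj; infer_instance

instance : L.proj.EssSurj := by unfold proj; infer_instance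

/-- The comparison of extension groups. -/
def ext (Z X : L.E) : L.data.Ext Z X ≃ₗ[K] D.Ext (L.proj.obj Z) (L.proj.obj X) :=
  L.extEquiv ((AddQuot.π K L.P).obj Z) ((AddQuot.π K L.P).obj X)

lemma ext_pull {Z' Z : L.E} (f : Z' ⟶ Z) (X : L.E) (δ : L.data.Ext Z X) :
    L.ext Z' X (L.data.pull f X δ) = D.pull (L.proj.map f) _ (L.ext Z X δ) :=
  L.extEquiv_pull ((AddQuot.π K L.P).map f) ((AddQuot.π K L.P).obj X) δ

lemma real_proj {X Y Z : L.E} {δ : L.data.Ext Z X} {x : X ⟶ Y} {y : Y ⟶ Z}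
    (h : L.data.Real δ x y) : D.Real (L.ext Z X δ) (L.proj.map x) (L.proj.map y) :=
  (L.real_iff _ _ _).1 (quotData_real_map L.data L.projInj h)

lemma exists_obj (X : C) : ∃ X' : L.E, Nonempty (L.proj.obj X' ≅ X) :=
  ⟨L.proj.objPreimage X, ⟨L.proj.objObjPreimageIso X⟩⟩

variable [HasZeroObject C] [HasBinaryBiproducts C]

/-- Conflations lift along `E ⥤ C`. -/
lemma exists_real_lift (hD : IsExtriangulated D) {X Y Z : C} {δ : D.Ext Z X} {x : X ⟶ Y}
    {y : Y ⟶ Z} (hr : D.Real δ x y) {X' Z' : L.E} (a : L.proj.obj X' ≅ X) (c : L.proj.obj Z' ≅ Z) :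
    ∃ (δ' : L.data.Ext Z' X') (Y' : L.E) (x' : X' ⟶ Y') (y' : Y' ⟶ Z'), L.data.Real δ' x' y' ∧
      L.ext Z' X' δ' = D.push _ a.inv (D.pull c.hom X δ) ∧ Nonempty (L.proj.obj Y' ≅ Y) := by
  have h := hD.real_iso hr a.symm c.symm
  -- The extension, transported to ends coming from E, corresponds to an extension in E, which is
  -- realised there. Uniqueness of realisations in C identifies the middle terms.
  obtain ⟨Y', x', y', hr'⟩ := L.extri.exists_real
    ((L.ext Z' X').symm (D.push _ a.inv (D.pull c.hom X δ)))
  have h' := L.real_proj hr'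
  rw [LinearEquiv.apply_symm_apply] at h'
  obtain ⟨e, -⟩ := (hD.real_iff _ _ _ _ _ h').1 h
  exact ⟨_, Y', x', y', hr', LinearEquiv.apply_symm_apply _ _, ⟨e⟩⟩

section Sub

variable {T : ObjectProperty C} (hT : ClusterTilting D T)

include hT

omit [HasZeroObject C] [HasBinaryBiproducts C] in
lemma hasZeroObject_preimage : HasZeroObject (L.preimage T).FullSubcategory := by
  obtain ⟨O, hO⟩ := HasZeroObject.zero (C := L.E)
  exact hasZeroObject_fullSubcategory hO (hT.of_isZero (L.proj.map_isZero hO))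

omit [HasZeroObject C] [HasBinaryBiproducts C] in
lemma hasBinaryBiproducts_preimage : HasBinaryBiproducts (L.preimage T).FullSubcategory :=
  hasBinaryBiproducts_fullSubcategory fun X Y hX hY =>
    hT.of_total hX hY (L.proj.map biprod.fst) (L.proj.map biprod.inl) (L.proj.map biprod.snd)
      (L.proj.map biprod.inr) (by
        rw [← Functor.map_comp, ← Functor.map_comp, ← Functor.map_add, biprod.total,
          CategoryTheory.Functor.map_id])

end Sub

instance (T : ObjectProperty C) : (L.toSub T).Additive where
  map_add {_ _ f g} := ObjectProperty.hom_ext _ (L.proj.map_add (f := f.hom) (g := g.hom))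

/-- The `T`-module `N` on the preimage of `T` has Euler characteristic `c` in `K₀(T)`. -/
def HasChi (T : ObjectProperty C) (N : (L.preimage T).FullSubcategoryᵒᵖ ⥤ ModuleCat.{w} K)
    (c : K0Split T.FullSubcategory) : Prop :=
  ∃ c₀, HasEuler N c₀ ∧ K0Split.map (L.toSub T) c₀ = c

end ExactLift

/-! ### Indices as Euler characteristics, and kernels of maps between Ext functors. -/

section Index

variable {K : Type k} [Field K] {C : Type u} [Category.{v} C] [Preadditive C] [Linear K C]

/-- `c` is the index of `X` with respect to `T`, computed from some conflation. -/
def IsIndexOf (D : ExtData K C) (T : ObjectProperty C) (X : C) (c : K0Split T.FullSubcategory) :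
    Prop :=
  ∃ (N R : T.FullSubcategory) (i : N.obj ⟶ R.obj) (p : R.obj ⟶ X), Confl D i p ∧
    c = K0Split.cls R - K0Split.cls N

variable [HasZeroObject C] [HasBinaryBiproducts C] {D : ExtData K C} (hD : IsExtriangulated D)
  {T : ObjectProperty C} (hT : ClusterTilting D T) (L : ExactLift.{k, u, v, u', v'} D)

include hT

omit [HasBinaryBiproducts C] in
lemma hasZeroObject_sub : HasZeroObject T.FullSubcategory := by
  obtain ⟨O, hO⟩ := HasZeroObject.zero (C := C)
  exact hasZeroObject_fullSubcategory hO (hT.of_isZero hO)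

omit [HasBinaryBiproducts C] in
lemma K0Split.cls_congr {X Y : T.FullSubcategory} (e : X.obj ≅ Y.obj) :
    K0Split.cls X = K0Split.cls Y :=
  have := hasZeroObject_sub hT
  K0Split.cls_iso (ObjectProperty.isoMk _ e)

omit [HasZeroObject C] [HasBinaryBiproducts C] in
/-- Euler characteristics are unique. -/
lemma ExactLift.HasChi.unique {N : (L.preimage T).FullSubcategoryᵒᵖ ⥤ ModuleCat.{w} K}
    {c c' : K0Split T.FullSubcategory} (h : L.HasChi T N c) (h' : L.HasChi T N c')
    (hadd : ∀ {Y Z : (L.preimage T).FullSubcategory} (f g : Y ⟶ Z),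
      N.map (f + g).op = N.map f.op + N.map g.op) : c = c' := by
  have := L.hasZeroObject_preimage hT
  have := L.hasBinaryBiproducts_preimage hT
  obtain ⟨c₀, h, rfl⟩ := h
  obtain ⟨c₀', h', rfl⟩ := h'
  rw [h.unique h' hadd]

include hD

/-- The index of an object is the Euler characteristic of `Hom(-, X)` on the exact lift. -/
lemma IsIndexOf.hasChi {X : C} {c : K0Split T.FullSubcategory} (hc : IsIndexOf D T X c) {X' : L.E}
    (e : L.proj.obj X' ≅ X) : L.HasChi T (homMod K (L.preimage T) X') c := by
  have := L.hasZeroObject_preimage hT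
  have := L.hasBinaryBiproducts_preimage hT
  obtain ⟨N, R, i, p, ⟨δ, hr⟩, rfl⟩ := hc
  obtain ⟨N', ⟨a⟩⟩ := L.exists_obj N.obj
  obtain ⟨δ', R', i', p', hr', -, ⟨b⟩⟩ := L.exists_real_lift hD hr a e
  have hN' : L.preimage T N' := hT.of_iso N.2 a
  have hR' : L.preimage T R' := hT.of_iso R.2 b
  -- The lifted conflation gives 0 → Hom(-, N') → Hom(-, R') → Hom(-, X') → 0 over the preimage of
  -- T. It is exact on the left because inflations of E are monic, and on the right because Ext
  -- vanishes between objects of T.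
  have hmono := L.mono_of_infl i' ⟨X', p', δ', hr'⟩
  have hE := L.extri.hasExactConfl
  refine ⟨K0Split.cls ⟨R', hR'⟩ - K0Split.cls ⟨N', hN'⟩, ?_, ?_⟩
  · refine HasEuler.cone (hasEuler_homMod_of_mem (K := K) ⟨N', hN'⟩)
      (hasEuler_homMod_of_mem (K := K) ⟨R', hR'⟩)
      (homMod_map_add _ R') (fun W => Linear.rightComp K W.obj i')
      (fun f n => Category.assoc _ _ _) (fun W => Linear.rightComp K W.obj p')
      (fun f n => Category.assoc _ _ _) ?_ ?_ ?_
    · intro W f g h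
      exact (cancel_mono i').1 h
    · intro W f
      refine hE.lift_mid hr' f ?_
      apply (L.ext _ _).injective
      rw [map_zero]
      exact hT.ext_eq_zero W.2 hN' _
    · intro W f
      constructor
      · intro h
        exact hE.lift_left hr' f h
      · rintro ⟨(g : W.obj ⟶ N'), rfl⟩
        refine (Category.assoc _ _ _).trans ?_
        rw [hE.comp_zero hr']
        exact comp_zero
  · rw [map_sub, K0Split.map_cls, K0Split.map_cls]
    congr 1
    · exact K0Split.cls_congr hT b
    · exact K0Split.cls_congr hT a

/-- Both values are the Euler characteristic of one functor Hom(-, X'), where X' is a lift of X to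
the exact category. -/
lemma IsIndexOf.unique (hL : Nonempty (ExactLift.{k, u, v, u', v'} D)) {X : C}
    {c c' : K0Split T.FullSubcategory}
    (h : IsIndexOf D T X c) (h' : IsIndexOf D T X c') : c = c' := by
  obtain ⟨L⟩ := hL
  obtain ⟨X', ⟨e⟩⟩ := L.exists_obj X
  exact ExactLift.HasChi.unique hT L (h.hasChi hD hT L e) (h'.hasChi hD hT L e)
    (homMod_map_add _ _)

lemma exists_isIndexOf (X : C) : ∃ c, IsIndexOf D T X c := by
  obtain ⟨N, R, i, p, h⟩ := hT.exists_index hD.hasExactConfl X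
  exact ⟨_, N, R, i, p, h, rfl⟩

lemma isIndexOf_of_mem (X : T.FullSubcategory) : IsIndexOf D T X.obj (K0Split.cls X) := by
  obtain ⟨O, hO⟩ := HasZeroObject.zero (C := C)
  refine ⟨⟨O, hT.of_isZero hO⟩, X, 0, 𝟙 _, ⟨0, hD.real_of_isZero_left _ hO⟩, ?_⟩
  have : K0Split.cls (⟨O, hT.of_isZero hO⟩ : T.FullSubcategory) = 0 :=
    K0Split.cls_isZero (IsZero.of_full_of_faithful_of_isZero T.ι _ hO)
  rw [this, sub_zero]

/-- The Euler characteristic of the kernel of `Ext(-, X) ⟶ Ext(-, Y)`, for a conflation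
`X ⟶ Y ⟶ Z`. -/
lemma hasChi_of_confl {X Y Z : C} {x : X ⟶ Y} {y : Y ⟶ Z} (hr : Confl D x y)
    {cX cY cZ : K0Split T.FullSubcategory} (hX : IsIndexOf D T X cX) (hY : IsIndexOf D T Y cY)
    (hZ : IsIndexOf D T Z cZ) {M : (StabSub D T)ᵒᵖ ⥤ ModuleCat.{v} K} (j : M ⟶ stabExt D T X)
    (hj : ∀ W, Function.Injective (j.app W).hom)
    (hex : ∀ W, Function.Exact (j.app W).hom ((stabExtMap D T x).app W).hom) :
    L.HasChi T ((L.toStab T).op ⋙ M) (cX - cY + cZ) := by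
  have := L.hasZeroObject_preimage hT
  have := L.hasBinaryBiproducts_preimage hT
  have hD' := hD.hasExactConfl
  have hE := L.extri.hasExactConfl
  obtain ⟨δ, hr⟩ := hr
  obtain ⟨X', ⟨a⟩⟩ := L.exists_obj X
  obtain ⟨Z', ⟨c⟩⟩ := L.exists_obj Z
  obtain ⟨δ', Y', x', y', hr', hδ', ⟨b⟩⟩ := L.exists_real_lift hD hr a c
  have hmono := L.mono_of_infl x' ⟨Z', y', δ', hr'⟩
  obtain ⟨c₁, h₁, rfl⟩ := hX.hasChi hD hT L a
  obtain ⟨c₂, h₂, rfl⟩ := hY.hasChi hD hT L b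
  obtain ⟨c₃, h₃, rfl⟩ := hZ.hasChi hD hT L c
  -- The connecting map of the lifted conflation, with values compared to extensions in C.
  let θ : ∀ W : (L.preimage T).FullSubcategory, (W.obj ⟶ Z') →ₗ[K] D.Ext (L.proj.obj W.obj) X :=
    fun W =>
    { toFun f := D.push _ a.hom (L.ext W.obj X' (L.data.pull f X' δ'))
      map_add' f g := by rw [L.data.pull_add, map_add, map_add]
      map_smul' r f := by rw [L.data.pull_smul, map_smul, map_smul]; rfl }
  have hθ : ∀ W f, θ W f = D.pull (L.proj.map f ≫ c.hom) X δ := by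
    intro W f
    change D.push _ a.hom (L.ext W.obj X' (L.data.pull f X' δ')) = _
    rw [L.ext_pull, hδ', D.pull_push, ← D.push_comp, a.inv_hom_id, D.push_id, ← D.pull_comp]
  have hθ0 : ∀ W f, θ W f = 0 ↔ L.data.pull f X' δ' = 0 := by
    intro W f
    constructor
    · intro h
      have h' := congrArg (D.push _ a.inv) h
      change D.push _ a.inv (D.push _ a.hom _) = _ at h'
      rw [← D.push_comp, a.hom_inv_id, D.push_id, map_zero] at h'
      exact (LinearEquiv.map_eq_zero_iff _).1 h'
    · intro h
      change D.push _ a.hom (L.ext W.obj X' (L.data.pull f X' δ')) = 0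
      rw [h, map_zero, map_zero]
  -- By the long exact sequence the image of `θ` is the kernel of Ext(-, X) → Ext(-, Y), that is M.
  -- This gives the surjection ending the four-term sequence.
  have hlift : ∀ W : (L.preimage T).FullSubcategory, ∃ ψ : (W.obj ⟶ Z') →ₗ[K]
      M.obj (op ((L.toStab T).obj W)), ∀ f, (j.app (op ((L.toStab T).obj W))).hom (ψ f) = θ W f := by
    intro W
    refine exists_linearMap_lift _ (hj (op ((L.toStab T).obj W))) (θ W) (fun f => ?_)
    refine (hex _ _).1 ?_
    change D.push _ x (θ W f) = 0
    rw [hθ, ← D.pull_push, hD'.push_zero hr, map_zero]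
  choose ψ hψ using hlift
  refine ⟨c₃ - (c₂ - c₁), HasEuler.of_left_exact (hE.comp_zero hr') (hE.lift_left hr') h₁ h₂ h₃ ψ
    ?_ ?_ ?_, by rw [map_sub, map_sub]; abel⟩
  · intro W W' f g
    apply hj
    refine (hψ W (f.hom ≫ g)).trans ?_
    rw [hθ]
    have := congrArg (fun φ => φ.hom (ψ W' g)) (j.naturality ((L.toStab T).map f).op)
    refine Eq.trans ?_ this.symm
    change _ = D.pull (L.proj.map f.hom) X ((j.app (op ((L.toStab T).obj W'))).hom (ψ W' g))
    rw [hψ W' g, hθ, ← D.pull_comp, Functor.map_comp, Category.assoc]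
  · intro W m
    obtain ⟨g, hg⟩ := hD'.eq_pull hr (W := L.proj.obj W.obj)
      ((j.app (op ((L.toStab T).obj W))).hom m) ((hex _ _).2 ⟨m, rfl⟩)
    obtain ⟨f, hf⟩ := L.proj.map_surjective (g ≫ c.inv)
    refine ⟨f, hj _ ?_⟩
    refine (hψ W f).trans ?_
    rw [hθ, hf, Category.assoc, c.inv_hom_id, Category.comp_id]
    exact hg
  · intro W f
    have h1 : ψ W f = 0 ↔ θ W f = 0 := by
      rw [← hψ]
      exact ⟨fun h => (congrArg _ h).trans (map_zero _), fun h => hj _ (h.trans (map_zero _).symm)⟩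
    rw [h1, hθ0]
    constructor
    · exact hE.lift_mid hr' f
    · rintro ⟨g, rfl⟩
      rw [L.data.pull_comp, hE.pull_zero hr', map_zero]

end Index

end ClusterIso

namespace ClusterIso

/-! ### Finitely presented modules -/

section Modules

variable {K : Type k} [Field K] {A : Type u} [Category.{v} A]

lemma naturality_apply {M N : Aᵒᵖ ⥤ ModuleCat.{w} K} (α : M ⟶ N) {X Y : A} (f : X ⟶ Y)
    (m : M.obj (op Y)) :
    (α.app (op X)).hom ((M.map f.op).hom m) = (N.map f.op).hom ((α.app (op Y)).hom m) :=
  congrArg (fun φ => φ.hom m) (α.naturality f.op)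

lemma map_id_apply (M : Aᵒᵖ ⥤ ModuleCat.{w} K) {X : A} (m : M.obj (op X)) :
    (M.map (𝟙 X).op).hom m = m := by
  simp

variable [Preadditive A] [Linear K A]

namespace IsModule

variable {M : Aᵒᵖ ⥤ ModuleCat.{w} K} (hM : IsModule M)

include hM

lemma add_apply {X Y : A} (f g : X ⟶ Y) (m : M.obj (op Y)) :
    (M.map (f + g).op).hom m = (M.map f.op).hom m + (M.map g.op).hom m :=
  congrArg (fun φ => φ.hom m) (hM.map_add f g)

lemma smul_apply {X Y : A} (a : K) (f : X ⟶ Y) (m : M.obj (op Y)) :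
    (M.map (a • f).op).hom m = a • (M.map f.op).hom m :=
  congrArg (fun φ => φ.hom m) (hM.map_smul a f)

lemma zero_apply {X Y : A} (m : M.obj (op Y)) : (M.map (0 : X ⟶ Y).op).hom m = 0 := by
  simpa using hM.smul_apply 0 (0 : X ⟶ Y) m

lemma neg_apply {X Y : A} (f : X ⟶ Y) (m : M.obj (op Y)) :
    (M.map (-f).op).hom m = -(M.map f.op).hom m := by
  simpa using hM.smul_apply (-1) f m

lemma sub_apply {X Y : A} (f g : X ⟶ Y) (m : M.obj (op Y)) :
    (M.map (f - g).op).hom m = (M.map f.op).hom m - (M.map g.op).hom m := by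
  rw [sub_eq_add_neg, hM.add_apply, hM.neg_apply, sub_eq_add_neg]

lemma of_injective {N : Aᵒᵖ ⥤ ModuleCat.{w} K} (j : N ⟶ M)
    (hj : ∀ X, Function.Injective (j.app X).hom) : IsModule N where
  map_add {X Y} f g := by
    ext n
    refine hj (op X) (((naturality_apply j (f + g) n).trans (hM.add_apply f g _)).trans ?_)
    rw [← naturality_apply, ← naturality_apply]
    exact (_root_.map_add (j.app (op X)).hom _ _).symm
  map_smul {X Y} a f := by
    ext n
    refine hj (op X) (((naturality_apply j (a • f) n).trans (hM.smul_apply a f _)).trans ?_)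
    rw [← naturality_apply]
    exact (_root_.map_smul (j.app (op X)).hom _ _).symm

lemma of_surjective {N : Aᵒᵖ ⥤ ModuleCat.{w} K} (q : M ⟶ N)
    (hq : ∀ X, Function.Surjective (q.app X).hom) : IsModule N where
  map_add {X Y} f g := by
    ext n
    obtain ⟨m, rfl⟩ := hq (op Y) n
    refine (naturality_apply q (f + g) m).symm.trans ?_
    rw [hM.add_apply, _root_.map_add, naturality_apply, naturality_apply]
    rfl
  map_smul {X Y} a f := by
    ext n
    obtain ⟨m, rfl⟩ := hq (op Y) n
    refine (naturality_apply q (a • f) m).symm.trans ?_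
    rw [hM.smul_apply, _root_.map_smul, naturality_apply]
    rfl

end IsModule

lemma isModule_linearYoneda (X : A) : IsModule ((linearYoneda K A).obj X) where
  map_add f g := by
    ext h
    exact Preadditive.add_comp _ _ _ _ _ _
  map_smul a f := by
    ext h
    exact Linear.smul_comp _ _ _ _ _ _

/-- The element `m` generates `M`. -/
def Generates {M : Aᵒᵖ ⥤ ModuleCat.{w} K} {X : A} (m : M.obj (op X)) : Prop :=
  ∀ (Z : A) (n : M.obj (op Z)), ∃ g : Z ⟶ X, (M.map g.op).hom m = n

/-- The relations satisfied by the element `m` are generated by `f`. -/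
def Relations {M : Aᵒᵖ ⥤ ModuleCat.{w} K} {X Y : A} (m : M.obj (op X)) (f : Y ⟶ X) : Prop :=
  ∀ (Z : A) (g : Z ⟶ X), (M.map g.op).hom m = 0 ↔ ∃ h : Z ⟶ Y, h ≫ f = g

/-- The map out of a representable module given by an element. -/
def yonedaMap {M : Aᵒᵖ ⥤ ModuleCat.{v} K} (hM : IsModule M) {X : A} (m : M.obj (op X)) :
    (linearYoneda K A).obj X ⟶ M where
  app Z := ModuleCat.ofHom
    { toFun (g : Z.unop ⟶ X) := (M.map g.op).hom m
      map_add' f g := hM.add_apply f g m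
      map_smul' a f := hM.smul_apply a f m }
  naturality Z Z' f := by
    ext g
    exact map_comp_apply M f.unop g m

/-- The Yoneda lemma turns a presentation by representables into an element and a morphism. In this
form the closure properties below are calculations with elements. -/
theorem fpMod_iff (M : Aᵒᵖ ⥤ ModuleCat.{v} K) : fpMod M ↔ IsModule M ∧
    ∃ (X Y : A) (f : Y ⟶ X) (m : M.obj (op X)), Generates m ∧ Relations m f := by
  constructor
  · rintro ⟨X, Y, f, p, w, hex, hp⟩
    have hs := surjective_app p
    have hex' := app_of_exact hex
    have hm : ∀ (Z : A) (g : Z ⟶ X), (p.app (op Z)).hom g =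
        (M.map g.op).hom ((p.app (op X)).hom (𝟙 X)) := fun Z g =>
      (congrArg (p.app (op Z)).hom (Category.comp_id g).symm).trans
        (naturality_apply p g (𝟙 X : X ⟶ X))
    refine ⟨(isModule_linearYoneda X).of_surjective p hs, X, Y, f, (p.app (op X)).hom (𝟙 X),
      fun Z n => ?_, fun Z g => ?_⟩
    · obtain ⟨g, rfl⟩ := hs (op Z) n
      exact ⟨g, (hm Z g).symm⟩
    · rw [← hm]
      exact hex' (op Z) g
  · rintro ⟨hM, X, Y, f, m, hgen, hrel⟩
    refine ⟨X, Y, f, yonedaMap hM m, ?_, exact_of_app fun Z g => hrel Z.unop g, ?_⟩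
    · ext Z g
      exact (hrel Z.unop (g ≫ f)).2 ⟨g, rfl⟩
    · have : ∀ Z, Epi ((yonedaMap hM m).app Z) := fun Z =>
        (ModuleCat.epi_iff_surjective _).2 (hgen Z.unop)
      exact NatTrans.epi_of_epi_app _

/-- Two modules with generators satisfying the same relations are isomorphic. -/
lemma exists_iso_of_generates {M N : Aᵒᵖ ⥤ ModuleCat.{w} K} (hM : IsModule M) (hN : IsModule N)
    {X : A} {m : M.obj (op X)} {n : N.obj (op X)} (hm : Generates m) (hn : Generates n)
    (h : ∀ (Z : A) (g : Z ⟶ X), (M.map g.op).hom m = 0 ↔ (N.map g.op).hom n = 0) :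
    Nonempty (M ≅ N) := by
  choose l hl using hm
  have key : ∀ (Z : A) (g g' : Z ⟶ X), (M.map g.op).hom m = (M.map g'.op).hom m ↔
      (N.map g.op).hom n = (N.map g'.op).hom n := fun Z g g' => by
    rw [← sub_eq_zero, ← hM.sub_apply, h, hN.sub_apply, sub_eq_zero]
  let η : M ⟶ N :=
    { app Z := ModuleCat.ofHom
        { toFun x := (N.map (l Z.unop x).op).hom n
          map_add' x y := by
            rw [← hN.add_apply, ← key, hM.add_apply, hl, hl, hl]
          map_smul' a x := by
            rw [RingHom.id_apply, ← hN.smul_apply, ← key, hM.smul_apply, hl, hl] }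
      naturality Z Z' f := by
        ext x
        change (N.map (l Z'.unop ((M.map f).hom x)).op).hom n =
          (N.map f.unop.op).hom ((N.map (l Z.unop x).op).hom n)
        rw [← map_comp_apply, ← key, map_comp_apply, hl, hl]
        rfl }
  refine ⟨isoOfBijective η fun Z => ⟨fun x y hxy => ?_, fun y => ?_⟩⟩
  · change (N.map (l Z.unop x).op).hom n = (N.map (l Z.unop y).op).hom n at hxy
    rw [← key, hl, hl] at hxy
    exact hxy
  · obtain ⟨g, rfl⟩ := hn Z.unop y
    refine ⟨(M.map g.op).hom m, ?_⟩
    change (N.map (l Z.unop _).op).hom n = _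
    rw [← key, hl]

lemma fpMod.isModule {M : Aᵒᵖ ⥤ ModuleCat.{v} K} (h : fpMod M) : IsModule M :=
  ((fpMod_iff M).1 h).1

/-! ### Closure of finitely presented modules under cokernels, kernels and extensions. -/

section Closure

variable {L M N : Aᵒᵖ ⥤ ModuleCat.{v} K}

lemma fpMod.of_isZero [HasZeroObject A] (hM : ∀ X, Subsingleton (M.obj X)) : fpMod M := by
  obtain ⟨O, hO⟩ := HasZeroObject.zero (C := A)
  refine (fpMod_iff M).2 ⟨⟨fun f g => ?_, fun a f => ?_⟩, O, O, 𝟙 O, 0, fun Z n => ⟨0, ?_⟩,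
    fun Z g => ⟨fun _ => ⟨g, Category.comp_id g⟩, fun _ => ?_⟩⟩
  · ext x
    exact Subsingleton.elim _ _
  · ext x
    exact Subsingleton.elim _ _
  · exact Subsingleton.elim _ _
  · exact Subsingleton.elim _ _

variable [HasBinaryBiproducts A]

/-- The relations of the cokernel are those of N together with the image of the generator of M. -/
lemma fpMod.coker (hM : fpMod M) (hN : fpMod N) (α : M ⟶ N) (q : N ⟶ L)
    (hq : ∀ X, Function.Surjective (q.app X).hom)
    (hex : ∀ X, Function.Exact (α.app X).hom (q.app X).hom) : fpMod L := by
  obtain ⟨hM, X, Y, f, m, hgen, hrel⟩ := (fpMod_iff M).1 hM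
  obtain ⟨hN, X', Y', f', n, hgen', hrel'⟩ := (fpMod_iff N).1 hN
  obtain ⟨a, ha⟩ := hgen' X ((α.app (op X)).hom m)
  refine (fpMod_iff L).2 ⟨hN.of_surjective q hq, X', X ⊞ Y', biprod.desc a f',
    (q.app (op X')).hom n, fun Z l => ?_, fun Z g => ?_⟩
  · obtain ⟨y, rfl⟩ := hq _ l
    obtain ⟨g, rfl⟩ := hgen' Z y
    exact ⟨g, (naturality_apply q g n).symm⟩
  · rw [← naturality_apply, hex (op Z)]
    constructor
    · rintro ⟨x, hx⟩
      obtain ⟨h, rfl⟩ := hgen Z x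
      rw [naturality_apply, ← ha, ← map_comp_apply, ← sub_eq_zero, ← hN.sub_apply, hrel'] at hx
      obtain ⟨l, hl⟩ := hx
      refine ⟨biprod.lift h (-l), ?_⟩
      rw [biprod.lift_desc, Preadditive.neg_comp, hl]
      abel
    · rintro ⟨h, rfl⟩
      obtain ⟨u, v, rfl⟩ := exists_biprod_lift h
      refine ⟨(M.map u.op).hom m, ?_⟩
      rw [naturality_apply, ← ha, biprod.lift_desc, hN.add_apply, (hrel' _ (v ≫ f')).2 ⟨v, rfl⟩,
        add_zero, map_comp_apply]

variable (A) in
/-- Existence of weak kernels. -/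
def HasWeakKernels : Prop :=
  ∀ {X Y : A} (f : X ⟶ Y), ∃ (W : A) (i : W ⟶ X), i ≫ f = 0 ∧
    ∀ (Z : A) (g : Z ⟶ X), g ≫ f = 0 → ∃ h : Z ⟶ W, h ≫ i = g

lemma HasWeakKernels.pullback (hA : HasWeakKernels A) {X Y Z : A} (f : X ⟶ Z) (g : Y ⟶ Z) :
    ∃ (W : A) (i : W ⟶ X), ∀ (V : A) (h : V ⟶ X), (∃ l : V ⟶ W, l ≫ i = h) ↔
      ∃ l : V ⟶ Y, l ≫ g = h ≫ f := by
  obtain ⟨W, i, hi, hW⟩ := hA (biprod.desc f (-g))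
  refine ⟨W, i ≫ biprod.fst, fun V h => ⟨?_, ?_⟩⟩
  · rintro ⟨l, rfl⟩
    refine ⟨l ≫ i ≫ biprod.snd, ?_⟩
    have : i ≫ biprod.fst ≫ f = i ≫ biprod.snd ≫ g := by
      obtain ⟨u, v, rfl⟩ := exists_biprod_lift i
      rw [biprod.lift_desc] at hi
      simpa [sub_eq_zero, ← sub_eq_add_neg] using hi
    simp [this]
  · rintro ⟨l, hl⟩
    obtain ⟨k, hk⟩ := hW V (biprod.lift h l) (by rw [biprod.lift_desc]; simp [hl])
    exact ⟨k, by rw [← Category.assoc, hk, biprod.lift_fst]⟩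

/-- Two weak pullbacks. The first describes the multiples of the generator of M that are killed by
`α`, hence a generator of the kernel; the second describes the relations of that generator. -/
lemma fpMod.ker (hA : HasWeakKernels A) (hM : fpMod M) (hN : fpMod N) (j : L ⟶ M) (α : M ⟶ N)
    (hj : ∀ X, Function.Injective (j.app X).hom)
    (hex : ∀ X, Function.Exact (j.app X).hom (α.app X).hom) : fpMod L := by
  obtain ⟨hM, X, Y, f, m, hgen, hrel⟩ := (fpMod_iff M).1 hM
  obtain ⟨hN, X', Y', f', n, hgen', hrel'⟩ := (fpMod_iff N).1 hN
  obtain ⟨a, ha⟩ := hgen' X ((α.app (op X)).hom m)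
  obtain ⟨W, i, hW⟩ := hA.pullback a f'
  obtain ⟨V, i', hV⟩ := hA.pullback i f
  have hα : ∀ (Z : A) (g : Z ⟶ X), (α.app (op Z)).hom ((M.map g.op).hom m) = 0 ↔
      ∃ l : Z ⟶ W, l ≫ i = g := fun Z g => by
    rw [hW, naturality_apply, ← ha, ← map_comp_apply, hrel']
  obtain ⟨l, hl⟩ := (hex (op W) _).1 ((hα W i).2 ⟨𝟙 W, Category.id_comp i⟩)
  refine (fpMod_iff L).2 ⟨hM.of_injective j hj, W, V, i', l, fun Z z => ?_, fun Z g => ?_⟩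
  · obtain ⟨g, hg⟩ := hgen Z ((j.app (op Z)).hom z)
    obtain ⟨h, hh⟩ := (hα Z g).1 (by rw [hg]; exact (hex (op Z)).apply_apply_eq_zero z)
    refine ⟨h, hj _ ?_⟩
    rw [naturality_apply, hl, ← map_comp_apply, hh, hg]
  · have : (L.map g.op).hom l = 0 ↔ (M.map (g ≫ i).op).hom m = 0 := by
      rw [map_comp_apply, ← hl, ← naturality_apply]
      exact ⟨fun h => by rw [h, map_zero], fun h => hj _ (h.trans (map_zero _).symm)⟩
    rw [this, hrel, hV]

/-- The horseshoe lemma. The relation `f'` of N holds in M only up to an element of L; a map `c`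
producing that element becomes the off-diagonal entry of the presentation of M. -/
lemma fpMod.ext_closed (hL : fpMod L) (hN : fpMod N) (hM : IsModule M) (i : L ⟶ M) (p : M ⟶ N)
    (hi : ∀ X, Function.Injective (i.app X).hom) (hp : ∀ X, Function.Surjective (p.app X).hom)
    (hex : ∀ X, Function.Exact (i.app X).hom (p.app X).hom) : fpMod M := by
  obtain ⟨hL, X, Y, f, l, hgen, hrel⟩ := (fpMod_iff L).1 hL
  obtain ⟨hN, X', Y', f', n, hgen', hrel'⟩ := (fpMod_iff N).1 hN
  obtain ⟨m, rfl⟩ := hp _ n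
  have hc : ∃ c : Y' ⟶ X, (i.app (op Y')).hom ((L.map c.op).hom l) = (M.map f'.op).hom m := by
    obtain ⟨x, hx⟩ := (hex (op Y') ((M.map f'.op).hom m)).1 (by
      rw [naturality_apply]
      exact (hrel' _ _).2 ⟨𝟙 _, Category.id_comp _⟩)
    obtain ⟨c, rfl⟩ := hgen _ x
    exact ⟨c, hx⟩
  obtain ⟨c, hc⟩ := hc
  have hgenM : ∀ {Z : A} (u : Z ⟶ X) (v : Z ⟶ X'), (M.map (biprod.lift u v).op).hom
      ((M.map biprod.fst.op).hom ((i.app (op X)).hom l) + (M.map biprod.snd.op).hom m) =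
      (i.app (op Z)).hom ((L.map u.op).hom l) + (M.map v.op).hom m := fun u v => by
    rw [map_add, ← map_comp_apply, ← map_comp_apply, biprod.lift_fst, biprod.lift_snd,
      naturality_apply]
  refine (fpMod_iff M).2 ⟨hM, X ⊞ X', Y ⊞ Y',
    biprod.desc (biprod.lift f 0) (biprod.lift (-c) f'),
    (M.map biprod.fst.op).hom ((i.app (op X)).hom l) + (M.map biprod.snd.op).hom m,
    fun Z z => ?_, fun Z g => ?_⟩
  · obtain ⟨v, hv⟩ := hgen' Z ((p.app (op Z)).hom z)
    obtain ⟨x, hx⟩ := (hex (op Z) (z - (M.map v.op).hom m)).1 (by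
      rw [map_sub, naturality_apply, hv, sub_self])
    obtain ⟨u, rfl⟩ := hgen Z x
    exact ⟨biprod.lift u v, by rw [hgenM, hx, sub_add_cancel]⟩
  · obtain ⟨u, v, rfl⟩ := exists_biprod_lift g
    rw [hgenM]
    have hd : ∀ (a : Z ⟶ Y) (b : Z ⟶ Y'), biprod.lift a b ≫
        biprod.desc (biprod.lift f 0) (biprod.lift (-c) f') =
        biprod.lift (a ≫ f - b ≫ c) (b ≫ f') := fun a b => by
      rw [biprod.lift_desc]
      apply biprod.hom_ext <;> simp [sub_eq_add_neg]
    constructor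
    · intro h
      obtain ⟨b, rfl⟩ := (hrel' Z v).1 (by
        have h' := congrArg (p.app (op Z)).hom h
        rwa [map_add, (hex _).apply_apply_eq_zero, zero_add, map_zero, naturality_apply] at h')
      obtain ⟨a, ha⟩ := (hrel Z (u + b ≫ c)).1 (by
        apply hi
        rw [hL.add_apply, map_add, map_zero, map_comp_apply, naturality_apply i b, hc,
          ← map_comp_apply, h])
      exact ⟨biprod.lift a b, by rw [hd, ha, add_sub_cancel_right]⟩
    · rintro ⟨h, hh⟩
      obtain ⟨a, b, rfl⟩ := exists_biprod_lift h
      rw [hd, biprod_lift_eq_iff] at hh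
      obtain ⟨rfl, rfl⟩ := hh
      rw [hL.sub_apply, map_sub, (hrel Z (a ≫ f)).2 ⟨a, rfl⟩, map_zero, map_comp_apply L,
        naturality_apply i b, hc, map_comp_apply M]
      simp

end Closure

end Modules

end ClusterIso

namespace ClusterIso

/-! ### Grothendieck groups of exact classes of modules -/

section ModuleClasses

variable {K : Type k} [Field K] {A : Type u} [Category.{v} A]

/-- A class of modules closed under kernels and cokernels (in particular under isomorphisms),
and containing the zero modules. -/
structure IsAbelianClass (Q : ObjectProperty (Aᵒᵖ ⥤ ModuleCat.{v} K)) : Prop where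
  of_isZero : ∀ {M : Aᵒᵖ ⥤ ModuleCat.{v} K}, (∀ X, Subsingleton (M.obj X)) → Q M
  ker : ∀ {L M N : Aᵒᵖ ⥤ ModuleCat.{v} K} (j : L ⟶ M) (α : M ⟶ N), Q M → Q N →
    (∀ X, Function.Injective (j.app X).hom) →
    (∀ X, Function.Exact (j.app X).hom (α.app X).hom) → Q L
  coker : ∀ {L M N : Aᵒᵖ ⥤ ModuleCat.{v} K} (α : M ⟶ N) (q : N ⟶ L), Q M → Q N →
    (∀ X, Function.Surjective (q.app X).hom) →
    (∀ X, Function.Exact (α.app X).hom (q.app X).hom) → Q L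

lemma K0Mod.cls_of_app {Q : ObjectProperty (Aᵒᵖ ⥤ ModuleCat.{v} K)}
    {M₁ M₂ M₃ : Aᵒᵖ ⥤ ModuleCat.{v} K} (h₁ : Q M₁) (h₂ : Q M₂) (h₃ : Q M₃) (f : M₁ ⟶ M₂)
    (g : M₂ ⟶ M₃) (hf : ∀ X, Function.Injective (f.app X).hom)
    (hg : ∀ X, Function.Surjective (g.app X).hom)
    (hfg : ∀ X, Function.Exact (f.app X).hom (g.app X).hom) :
    K0Mod.cls M₂ h₂ = K0Mod.cls M₁ h₁ + K0Mod.cls M₃ h₃ := by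
  obtain ⟨w, hS⟩ := shortExact_of_app f g hf hg hfg
  exact K0Mod.cls_shortExact hS h₁ h₂ h₃

namespace IsAbelianClass

variable {Q : ObjectProperty (Aᵒᵖ ⥤ ModuleCat.{v} K)} (hQ : IsAbelianClass Q)

include hQ

lemma of_bijective {M N : Aᵒᵖ ⥤ ModuleCat.{v} K} (hN : Q N) (α : M ⟶ N)
    (hα : ∀ X, Function.Bijective (α.app X).hom) : Q M :=
  hQ.ker α (0 : N ⟶ N) hN hN (fun X => (hα X).1) fun X n =>
    ⟨fun _ => (hα X).2 n, fun _ => rfl⟩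

lemma of_iso {M N : Aᵒᵖ ⥤ ModuleCat.{v} K} (hN : Q N) (e : M ≅ N) : Q M :=
  hQ.of_bijective hN e.hom fun X => ⟨injective_app e.hom X, surjective_app e.hom X⟩

lemma cls_eq {M N : Aᵒᵖ ⥤ ModuleCat.{v} K} (hM : Q M) (hN : Q N) (e : M ≅ N) :
    K0Mod.cls M hM = K0Mod.cls N hN :=
  K0Mod.cls_iso e hM hN (O := (Functor.const _).obj (ModuleCat.of K PUnit))
    (hQ.of_isZero fun _ => ⟨fun _ _ => rfl⟩)
    ((Functor.isZero_iff _).2 fun _ => ModuleCat.isZero_of_subsingleton (ModuleCat.of K PUnit))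

lemma kernel {M N : Aᵒᵖ ⥤ ModuleCat.{v} K} (hM : Q M) (hN : Q N) (α : M ⟶ N) :
    Q (Limits.kernel α) :=
  hQ.ker (kernel.ι α) α hM hN (injective_app _) (exact_kernel_app α)

lemma cokernel {M N : Aᵒᵖ ⥤ ModuleCat.{v} K} (hM : Q M) (hN : Q N) (α : M ⟶ N) :
    Q (Limits.cokernel α) :=
  hQ.coker α (cokernel.π α) hM hN (surjective_app _) (exact_cokernel_app α)

lemma cls_sub_cls {M N : Aᵒᵖ ⥤ ModuleCat.{v} K} (hM : Q M) (hN : Q N) (α : M ⟶ N) :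
    K0Mod.cls M hM - K0Mod.cls N hN =
      K0Mod.cls _ (hQ.kernel hM hN α) - K0Mod.cls _ (hQ.cokernel hM hN α) := by
  have hI : Q (Abelian.image α) :=
    hQ.kernel hN (hQ.cokernel hM hN α) (cokernel.π α)
  have h₁ := K0Mod.cls_of_app (hQ.kernel hM hN α) hM hI (kernel.ι α) (Abelian.factorThruImage α)
    (injective_app _) (surjective_app _) fun X m => by
      rw [← exact_kernel_app α X m, ← (injective_app (Abelian.image.ι α) X).eq_iff, map_zero]
      have := congrArg (fun φ => (φ.app X).hom m) (Abelian.image.fac α)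
      change (((Abelian.image.ι α).app X).hom (((Abelian.factorThruImage α).app X).hom m)) = _
        at this
      rw [this]
  have h₂ := K0Mod.cls_of_app hI hN (hQ.cokernel hM hN α) (Abelian.image.ι α) (cokernel.π α)
    (injective_app _) (surjective_app _) (exact_kernel_app (cokernel.π α))
  rw [h₁, h₂]
  abel

/-- The alternating sum of classes in a six-term exact sequence. -/
lemma cls_six_term {K₁ K₂ K₃ C₁ C₂ C₃ : Aᵒᵖ ⥤ ModuleCat.{v} K} (hK₁ : Q K₁) (hK₂ : Q K₂)
    (hK₃ : Q K₃) (hC₁ : Q C₁) (hC₂ : Q C₂) (hC₃ : Q C₃) (f : K₁ ⟶ K₂) (g : K₂ ⟶ K₃) (δ : K₃ ⟶ C₁)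
    (f' : C₁ ⟶ C₂) (g' : C₂ ⟶ C₃) (hf : ∀ X, Function.Injective (f.app X).hom)
    (hfg : ∀ X, Function.Exact (f.app X).hom (g.app X).hom)
    (hgδ : ∀ X, Function.Exact (g.app X).hom (δ.app X).hom)
    (hδf : ∀ X, Function.Exact (δ.app X).hom (f'.app X).hom)
    (hfg' : ∀ X, Function.Exact (f'.app X).hom (g'.app X).hom)
    (hg' : ∀ X, Function.Surjective (g'.app X).hom) :
    K0Mod.cls C₂ hC₂ - K0Mod.cls K₂ hK₂ = (K0Mod.cls C₁ hC₁ - K0Mod.cls K₁ hK₁) +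
      (K0Mod.cls C₃ hC₃ - K0Mod.cls K₃ hK₃) := by
  have hw : g ≫ δ = 0 := by
    ext X m
    exact (hgδ X).apply_apply_eq_zero m
  have hw' : δ ≫ f' = 0 := by
    ext X m
    exact (hδf X).apply_apply_eq_zero m
  have hl : ∀ X m, ((kernel.ι δ).app X).hom (((kernel.lift δ g hw).app X).hom m) =
      (g.app X).hom m := fun X m => congrArg (fun φ => (φ.app X).hom m) (kernel.lift_ι δ g hw)
  have hd : ∀ X m, ((cokernel.desc δ f' hw').app X).hom (((cokernel.π δ).app X).hom m) =
      (f'.app X).hom m := fun X m => congrArg (fun φ => (φ.app X).hom m) (cokernel.π_desc δ f' hw')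
  -- The sequence is cut at `δ`: one short exact sequence ends in its kernel, another begins with
  -- its cokernel, and `cls_sub_cls` compares the two.
  have h₁ := K0Mod.cls_of_app hK₁ hK₂ (hQ.kernel hK₃ hC₁ δ) f (kernel.lift δ g hw) hf
    (fun X n => by
      obtain ⟨m, hm⟩ := (hgδ X (((kernel.ι δ).app X).hom n)).1
        ((exact_kernel_app δ X).apply_apply_eq_zero n)
      exact ⟨m, injective_app (kernel.ι δ) X ((hl X m).trans hm)⟩)
    (fun X m => by
      rw [← hfg X m, ← hl, map_eq_zero_iff _ (injective_app (kernel.ι δ) X)])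
  have h₂ := K0Mod.cls_of_app (hQ.cokernel hK₃ hC₁ δ) hC₂ hC₃ (cokernel.desc δ f' hw') g'
    (fun X => by
      rw [injective_iff_map_eq_zero]
      intro n hn
      obtain ⟨m, rfl⟩ := surjective_app (cokernel.π δ) X n
      rw [hd, hδf X] at hn
      exact (exact_cokernel_app δ X m).2 hn) hg'
    (fun X m => by
      rw [hfg' X]
      constructor
      · rintro ⟨n, rfl⟩
        exact ⟨_, hd X n⟩
      · rintro ⟨n, rfl⟩
        obtain ⟨n, rfl⟩ := surjective_app (cokernel.π δ) X n
        exact ⟨n, (hd X n).symm⟩)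
  have h₃ := hQ.cls_sub_cls hK₃ hC₁ δ
  have h₄ := sub_eq_iff_eq_add.1 h₃
  rw [h₁, h₂, h₄]
  abel

end IsAbelianClass

lemma exists_linearMap_desc {V W M : Type*} [AddCommGroup V] [Module K V] [AddCommGroup W]
    [Module K W] [AddCommGroup M] [Module K M] (s : V →ₗ[K] W) (hs : Function.Surjective s)
    (g : V →ₗ[K] M) (h : ∀ v, s v = 0 → g v = 0) : ∃ ψ : W →ₗ[K] M, ∀ v, ψ (s v) = g v := by
  refine ⟨(LinearMap.ker s).liftQ g (fun v hv => h v hv) ∘ₗ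
    (s.quotKerEquivOfSurjective hs).symm.toLinearMap, fun v => ?_⟩
  have : (s.quotKerEquivOfSurjective hs).symm (s v) = Submodule.Quotient.mk v := by
    rw [LinearEquiv.symm_apply_eq]
    rfl
  rw [LinearMap.comp_apply, LinearEquiv.coe_coe, this]
  exact Submodule.liftQ_apply _ _ _

/-- A map of modules defined on generators. -/
lemma exists_natTrans {M N : Aᵒᵖ ⥤ ModuleCat.{w} K} (V : A → Type*) [∀ X, AddCommGroup (V X)]
    [∀ X, Module K (V X)] (s : ∀ X, V X →ₗ[K] M.obj (op X)) (hs : ∀ X, Function.Surjective (s X))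
    (g : ∀ X, V X →ₗ[K] N.obj (op X)) (h : ∀ X v, s X v = 0 → g X v = 0)
    (hnat : ∀ {X Y : A} (f : X ⟶ Y) (v : V Y), ∃ v' : V X,
      s X v' = (M.map f.op).hom (s Y v) ∧ g X v' = (N.map f.op).hom (g Y v)) :
    ∃ α : M ⟶ N, ∀ X v, (α.app (op X)).hom (s X v) = g X v := by
  choose ψ hψ using fun X => exists_linearMap_desc (s X) (hs X) (g X) (h X)
  refine ⟨{ app X := ModuleCat.ofHom (ψ X.unop), naturality X Y f := ?_ }, hψ⟩
  ext m
  -- The spaces V need not form a functor: some representative of each transported element suffices.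
  obtain ⟨v, rfl⟩ := hs X.unop m
  obtain ⟨v', h₁, h₂⟩ := hnat f.unop v
  change ψ Y.unop ((M.map f.unop.op).hom (s X.unop v)) =
    (N.map f.unop.op).hom (ψ X.unop (s X.unop v))
  rw [← h₁, hψ, hψ, h₂]

/-- Two modules with the same generators and relations. -/
lemma exists_iso_of_same_kernel {M N : Aᵒᵖ ⥤ ModuleCat.{w} K} (V : A → Type*)
    [∀ X, AddCommGroup (V X)] [∀ X, Module K (V X)] (s : ∀ X, V X →ₗ[K] M.obj (op X))
    (hs : ∀ X, Function.Surjective (s X)) (g : ∀ X, V X →ₗ[K] N.obj (op X))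
    (hg : ∀ X, Function.Surjective (g X)) (h : ∀ X v, s X v = 0 ↔ g X v = 0)
    (hnat : ∀ {X Y : A} (f : X ⟶ Y) (v : V Y), ∃ v' : V X,
      s X v' = (M.map f.op).hom (s Y v) ∧ g X v' = (N.map f.op).hom (g Y v)) :
    Nonempty (M ≅ N) := by
  obtain ⟨α, hα⟩ := exists_natTrans V s hs g (fun X v => (h X v).1) hnat
  refine ⟨isoOfBijective α fun X => ⟨?_, fun n => ?_⟩⟩
  · rw [injective_iff_map_eq_zero]
    intro m hm
    obtain ⟨v, rfl⟩ := hs X.unop m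
    exact (h _ v).2 ((hα X.unop v).symm.trans hm)
  · obtain ⟨v, rfl⟩ := hg X.unop n
    exact ⟨s _ v, hα X.unop v⟩

/-- Kernels are determined up to isomorphism. -/
lemma exists_iso_kernel {L M N : Aᵒᵖ ⥤ ModuleCat.{w} K} (j : L ⟶ M) (α : M ⟶ N)
    (hj : ∀ X, Function.Injective (j.app X).hom)
    (hex : ∀ X, Function.Exact (j.app X).hom (α.app X).hom) : Nonempty (L ≅ kernel α) := by
  have hw : j ≫ α = 0 := by
    ext X m
    exact (hex X).apply_apply_eq_zero m
  have hl : ∀ X m, ((kernel.ι α).app X).hom (((kernel.lift α j hw).app X).hom m) =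
      (j.app X).hom m := fun X m => congrArg (fun φ => (φ.app X).hom m) (kernel.lift_ι α j hw)
  refine ⟨isoOfBijective (kernel.lift α j hw) fun X => ⟨fun m m' h => hj X ?_, fun n => ?_⟩⟩
  · rw [← hl, ← hl, h]
  · obtain ⟨m, hm⟩ := (hex X (((kernel.ι α).app X).hom n)).1
      ((exact_kernel_app α X).apply_apply_eq_zero n)
    exact ⟨m, injective_app (kernel.ι α) X ((hl X m).trans hm)⟩

end ModuleClasses

/-! ### The modules `Ext(-, X)` over a cluster-tilting subcategory -/

section ExtModules

variable {K : Type k} [Field K] {C : Type u} [Category.{v} C] [Preadditive C] [Linear K C]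
  {D : ExtData K C} {T : ObjectProperty C}

lemma isModule_extMod (X : C) : IsModule (extMod D T X) where
  map_add f g := by
    ext δ
    exact D.pull_add f.hom g.hom X δ
  map_smul a f := by
    ext δ
    exact D.pull_smul a f.hom X δ

variable (hD : HasExactConfl D) (hT : ClusterTilting D T)

include hD hT

/-- As Ext(-, L) vanishes on T, the long exact sequence becomes a presentation Hom(-, L) → Hom(-,
L') → Ext(-, X) → 0. -/
lemma extMod_generates {X L L' : C} (hL : T L) (hL' : T L') {i : X ⟶ L} {p : L ⟶ L'}
    {δ : D.Ext L' X} (hr : D.Real δ i p) :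
    Generates (M := extMod D T X) (X := ⟨L', hL'⟩) δ ∧
      Relations (M := extMod D T X) (X := ⟨L', hL'⟩) (Y := ⟨L, hL⟩) δ (ObjectProperty.homMk p) := by
  constructor
  · intro Z ε
    obtain ⟨f, hf⟩ := hD.eq_pull hr (W := Z.obj) ε (hT.ext_eq_zero Z.2 hL _)
    exact ⟨ObjectProperty.homMk f, hf⟩
  · intro Z g
    change D.pull g.hom X δ = 0 ↔ _
    constructor
    · intro h
      obtain ⟨f, hf⟩ := hD.lift_mid hr _ h
      exact ⟨ObjectProperty.homMk f, ObjectProperty.hom_ext _ hf⟩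
    · rintro ⟨f, rfl⟩
      change D.pull (f.hom ≫ p) X δ = 0
      rw [D.pull_comp, hD.pull_zero hr, map_zero]

lemma fpMod_extMod (X : C) : fpMod (extMod D T X) := by
  obtain ⟨L, L', i, p, δ, hr⟩ := hT.exists_coindex hD X
  obtain ⟨h₁, h₂⟩ := extMod_generates hD hT L.2 L'.2 hr
  exact (fpMod_iff _).2 ⟨isModule_extMod X, L', L, _, _, h₁, h₂⟩

variable (hd : ∀ {X Y : C} (f : X ⟶ Y), Defl D f)

include hd

/-- If all morphisms are deflations, then every finitely presented module is of the form
`Ext(-, X)`. -/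
lemma exists_iso_extMod {M : T.FullSubcategoryᵒᵖ ⥤ ModuleCat.{v} K} (hM : fpMod M) :
    ∃ X : C, Nonempty (M ≅ extMod D T X) := by
  obtain ⟨hM, Y, Z, f, m, hgen, hrel⟩ := (fpMod_iff M).1 hM
  -- Completing the presenting map to a conflation X → Z → Y gives Ext(-, X) the same presentation
  -- as M.
  obtain ⟨X, x, δ, hr⟩ := hd f.hom
  obtain ⟨h₁, h₂⟩ := extMod_generates hD hT Z.2 Y.2 hr
  exact ⟨X, exists_iso_of_generates hM (isModule_extMod X) hgen h₁ fun W g =>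
    (hrel W g).trans (h₂ W g).symm⟩

/-- The weak kernel in the ambient category, supplied by a conflation, is covered by a right
T-approximation. -/
lemma hasWeakKernels : HasWeakKernels T.FullSubcategory := by
  intro X Y f
  obtain ⟨W, i, δ, hr⟩ := hd f.hom
  obtain ⟨R, p, ⟨hR, hp⟩, -⟩ := hT.right_approx W
  refine ⟨⟨R, hR⟩, ObjectProperty.homMk (p ≫ i), ?_, fun Z g hg => ?_⟩
  · apply ObjectProperty.hom_ext
    change (p ≫ i) ≫ f.hom = 0
    rw [Category.assoc, hD.comp_zero hr, Limits.comp_zero]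
  · obtain ⟨l, hl⟩ := hD.lift_left hr g.hom (congrArg (fun φ => φ.hom) hg)
    obtain ⟨h, hh⟩ := hp Z.obj l Z.2
    refine ⟨ObjectProperty.homMk h, ObjectProperty.hom_ext _ ?_⟩
    change h ≫ p ≫ i = g.hom
    rw [← Category.assoc, hh, hl]

lemma isAbelianClass_fpMod [HasZeroObject C] [HasBinaryBiproducts C] :
    IsAbelianClass (fpMod (K := K) (A := T.FullSubcategory)) :=
  have := hasZeroObject_sub hT
  have : HasBinaryBiproducts T.FullSubcategory :=
    hasBinaryBiproducts_fullSubcategory fun _ _ => hT.of_biprod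
  { of_isZero := fpMod.of_isZero
    ker := fun j α hM hN => fpMod.ker (hasWeakKernels hD hT hd) hM hN j α
    coker := fun α q hM hN => fpMod.coker hM hN α q }

end ExtModules

end ClusterIso

namespace ClusterIso

/-! ### Two-term complexes of representable modules, functorial up to homotopy -/

/-- A family of morphisms `p t : P t ⟶ Q t` in `B` indexed by the objects of `A`, functorial
up to homotopy: `Lift f a b` says that `(a, b)` is a map of two-term complexes induced by `f`. -/
structure TwoTerm (K : Type k) [Field K] (A : Type u) [Category.{v} A] [Preadditive A] [Linear K A]
    (B : Type u') [Category.{v'} B] [Preadditive B] [Linear K B] where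
  P : A → B
  Q : A → B
  p : ∀ t, P t ⟶ Q t
  Lift : ∀ {t t' : A} (_ : t ⟶ t') (_ : P t ⟶ P t') (_ : Q t ⟶ Q t'), Prop
  comm : ∀ {t t' : A} {f : t ⟶ t'} {a : P t ⟶ P t'} {b : Q t ⟶ Q t'}, Lift f a b →
    p t ≫ b = a ≫ p t'
  exists_lift : ∀ {t t' : A} (f : t ⟶ t'), ∃ ab : (P t ⟶ P t') × (Q t ⟶ Q t'), Lift f ab.1 ab.2
  id : ∀ t, Lift (𝟙 t) (𝟙 _) (𝟙 _)
  comp : ∀ {t t' t'' : A} {f : t ⟶ t'} {a : P t ⟶ P t'} {b : Q t ⟶ Q t'} {f' : t' ⟶ t''}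
    {a' : P t' ⟶ P t''} {b' : Q t' ⟶ Q t''}, Lift f a b → Lift f' a' b' →
    Lift (f ≫ f') (a ≫ a') (b ≫ b')
  add : ∀ {t t' : A} {f f' : t ⟶ t'} {a a' : P t ⟶ P t'} {b b' : Q t ⟶ Q t'}, Lift f a b →
    Lift f' a' b' → Lift (f + f') (a + a') (b + b')
  smul : ∀ {t t' : A} {f : t ⟶ t'} {a : P t ⟶ P t'} {b : Q t ⟶ Q t'} (c : K), Lift f a b →
    Lift (c • f) (c • a) (c • b)
  homotopy : ∀ {t t' : A} {a : P t ⟶ P t'} {b : Q t ⟶ Q t'}, Lift 0 a b →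
    (∃ h : Q t ⟶ P t', p t ≫ h = a) ∧ ∃ h : Q t ⟶ P t', h ≫ p t' = b

namespace TwoTerm

variable {K : Type k} [Field K] {A : Type u} [Category.{v} A] [Preadditive A] [Linear K A]
  {B : Type u'} [Category.{v'} B] [Preadditive B] [Linear K B] (S : TwoTerm K A B)

/-- The two homotopies need not coincide: cokernel modules use only the first, kernel modules only
the second. -/
lemma homotopy' {t t' : A} {f : t ⟶ t'} {a a' : S.P t ⟶ S.P t'} {b b' : S.Q t ⟶ S.Q t'}
    (h : S.Lift f a b) (h' : S.Lift f a' b') :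
    (∃ h : S.Q t ⟶ S.P t', a = a' + S.p t ≫ h) ∧ ∃ h : S.Q t ⟶ S.P t', b = b' + h ≫ S.p t' := by
  have h₀ := S.add h (S.smul (-1) h')
  rw [neg_one_smul, neg_one_smul, neg_one_smul, add_neg_cancel] at h₀
  obtain ⟨⟨l, hl⟩, l', hl'⟩ := S.homotopy h₀
  exact ⟨⟨l, by rw [hl]; abel⟩, l', by rw [hl']; abel⟩

variable {M : Bᵒᵖ ⥤ ModuleCat.{w} K} (hM : IsModule M)

/-- A chosen map of complexes inducing `f`, on the first terms. -/
def a {t t' : A} (f : t ⟶ t') : S.P t ⟶ S.P t' := (S.exists_lift f).choose.1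

/-- A chosen map of complexes inducing `f`, on the second terms. -/
def b {t t' : A} (f : t ⟶ t') : S.Q t ⟶ S.Q t' := (S.exists_lift f).choose.2

lemma lift {t t' : A} (f : t ⟶ t') : S.Lift f (S.a f) (S.b f) := (S.exists_lift f).choose_spec

-- Different lifts of `f` differ on the second term by a map through `S.p t'`, which is invisible to
-- elements killed by `S.p t'`. So `kerMod` is a functor although lifts are chosen arbitrarily.
include hM in
lemma map_b_eq {t t' : A} {f : t ⟶ t'} {a a' : S.P t ⟶ S.P t'} {b b' : S.Q t ⟶ S.Q t'}
    (h : S.Lift f a b) (h' : S.Lift f a' b') (m : M.obj (op (S.Q t')))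
    (hm : (M.map (S.p t').op).hom m = 0) : (M.map b.op).hom m = (M.map b'.op).hom m := by
  obtain ⟨-, l, rfl⟩ := S.homotopy' h h'
  rw [hM.add_apply, map_comp_apply, hm, map_zero, add_zero]

include hM in
lemma map_a_eq {t t' : A} {f : t ⟶ t'} {a a' : S.P t ⟶ S.P t'} {b b' : S.Q t ⟶ S.Q t'}
    (h : S.Lift f a b) (h' : S.Lift f a' b') (m : M.obj (op (S.P t'))) :
    (M.map a.op).hom m - (M.map a'.op).hom m ∈ LinearMap.range (M.map (S.p t).op).hom := by
  obtain ⟨⟨l, rfl⟩, -⟩ := S.homotopy' h h'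
  rw [hM.add_apply, map_comp_apply, add_sub_cancel_left]
  exact ⟨_, rfl⟩

lemma map_p_map_b {t t' : A} {f : t ⟶ t'} {a : S.P t ⟶ S.P t'} {b : S.Q t ⟶ S.Q t'}
    (h : S.Lift f a b) (m : M.obj (op (S.Q t'))) :
    (M.map (S.p t).op).hom ((M.map b.op).hom m) = (M.map a.op).hom ((M.map (S.p t').op).hom m) := by
  rw [← map_comp_apply, S.comm h, map_comp_apply]

/-- The kernel of `M(Q t) ⟶ M(P t)`, as a functor of `t`. -/
def kerMod : Aᵒᵖ ⥤ ModuleCat.{w} K where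
  obj t := ModuleCat.of K (LinearMap.ker (M.map (S.p t.unop).op).hom)
  map f := ModuleCat.ofHom ((M.map (S.b f.unop).op).hom.restrict fun m hm => by
    rw [LinearMap.mem_ker] at hm ⊢
    rw [S.map_p_map_b (S.lift f.unop), hm, map_zero])
  map_id t := by
    ext ⟨m, hm⟩
    exact (S.map_b_eq hM (S.lift _) (S.id _) m hm).trans (map_id_apply M m)
  map_comp f g := by
    ext ⟨m, hm⟩
    exact (S.map_b_eq hM (S.lift _) (S.comp (S.lift g.unop) (S.lift f.unop)) m
      hm).trans (map_comp_apply M _ _ m)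

/-- The cokernel of `M(Q t) ⟶ M(P t)`, as a functor of `t`. -/
def cokerMod : Aᵒᵖ ⥤ ModuleCat.{w} K where
  obj t := ModuleCat.of K (M.obj (op (S.P t.unop)) ⧸ LinearMap.range (M.map (S.p t.unop).op).hom)
  map f := ModuleCat.ofHom (Submodule.mapQ _ _ (M.map (S.a f.unop).op).hom (by
    rintro _ ⟨m, rfl⟩
    exact ⟨_, S.map_p_map_b (S.lift f.unop) m⟩))
  map_id t := by
    ext m
    refine ((Submodule.Quotient.eq _).2 (S.map_a_eq hM (S.lift _) (S.id _) m)).trans ?_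
    rw [map_id_apply]
    rfl
  map_comp f g := by
    ext m
    refine ((Submodule.Quotient.eq _).2 (S.map_a_eq hM (S.lift _)
      (S.comp (S.lift g.unop) (S.lift f.unop)) m)).trans ?_
    rw [map_comp_apply]
    rfl

/-- The inclusion of the values of the kernel module. -/
def kerι (t : A) : (S.kerMod hM).obj (op t) →ₗ[K] M.obj (op (S.Q t)) :=
  (LinearMap.ker (M.map (S.p t).op).hom).subtype

lemma kerι_injective (t : A) : Function.Injective (S.kerι hM t) := Subtype.val_injective

lemma exact_kerι (t : A) : Function.Exact (S.kerι hM t) (M.map (S.p t).op).hom := fun m =>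
  ⟨fun h => ⟨⟨m, h⟩, rfl⟩, by rintro ⟨m, rfl⟩; exact m.2⟩

lemma kerι_map {t t' : A} {f : t ⟶ t'} {a : S.P t ⟶ S.P t'} {b : S.Q t ⟶ S.Q t'}
    (h : S.Lift f a b) (m : (S.kerMod hM).obj (op t')) :
    S.kerι hM t (((S.kerMod hM).map f.op).hom m) = (M.map b.op).hom (S.kerι hM t' m) :=
  S.map_b_eq hM (S.lift f) h _ m.2

/-- The projection onto the values of the cokernel module. -/
def cokerπ (t : A) : M.obj (op (S.P t)) →ₗ[K] (S.cokerMod hM).obj (op t) :=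
  (LinearMap.range (M.map (S.p t).op).hom).mkQ

lemma cokerπ_surjective (t : A) : Function.Surjective (S.cokerπ hM t) :=
  Submodule.mkQ_surjective _

lemma exact_cokerπ (t : A) : Function.Exact (M.map (S.p t).op).hom (S.cokerπ hM t) := fun _ =>
  (Submodule.Quotient.mk_eq_zero _).trans LinearMap.mem_range

lemma cokerπ_map {t t' : A} {f : t ⟶ t'} {a : S.P t ⟶ S.P t'} {b : S.Q t ⟶ S.Q t'}
    (h : S.Lift f a b) (m : M.obj (op (S.P t'))) :
    ((S.cokerMod hM).map f.op).hom (S.cokerπ hM t' m) = S.cokerπ hM t ((M.map a.op).hom m) :=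
  (Submodule.Quotient.eq _).2 (S.map_a_eq hM (S.lift f) h m)

lemma isModule_kerMod : IsModule (S.kerMod hM) where
  map_add {t t'} f g := by
    ext m
    apply S.kerι_injective hM
    refine (S.kerι_map hM (S.add (S.lift f) (S.lift g)) m).trans ?_
    rw [hM.add_apply, ← S.kerι_map hM (S.lift f), ← S.kerι_map hM (S.lift g)]
    exact (map_add (S.kerι hM t) _ _).symm
  map_smul {t t'} c f := by
    ext m
    apply S.kerι_injective hM
    refine (S.kerι_map hM (S.smul c (S.lift f)) m).trans ?_
    rw [hM.smul_apply, ← S.kerι_map hM (S.lift f)]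
    exact (map_smul (S.kerι hM t) _ _).symm

lemma isModule_cokerMod : IsModule (S.cokerMod hM) where
  map_add {t t'} f g := by
    ext m
    obtain ⟨m, rfl⟩ := S.cokerπ_surjective hM t' m
    refine (S.cokerπ_map hM (S.add (S.lift f) (S.lift g)) m).trans ?_
    rw [hM.add_apply, map_add, ← S.cokerπ_map hM (S.lift f), ← S.cokerπ_map hM (S.lift g)]
    rfl
  map_smul {t t'} c f := by
    ext m
    obtain ⟨m, rfl⟩ := S.cokerπ_surjective hM t' m
    refine (S.cokerπ_map hM (S.smul c (S.lift f)) m).trans ?_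
    rw [hM.smul_apply, map_smul, ← S.cokerπ_map hM (S.lift f)]
    rfl

section Map

variable {N : Bᵒᵖ ⥤ ModuleCat.{w} K} (hN : IsModule N) (α : M ⟶ N)

lemma exists_kerMap : ∃ φ : S.kerMod hM ⟶ S.kerMod hN, ∀ t m,
    S.kerι hN t ((φ.app (op t)).hom m) = (α.app (op (S.Q t))).hom (S.kerι hM t m) := by
  have h : ∀ t : A, ∃ ψ : (S.kerMod hM).obj (op t) →ₗ[K] (S.kerMod hN).obj (op t), ∀ m,
      S.kerι hN t (ψ m) = (α.app (op (S.Q t))).hom (S.kerι hM t m) := fun t =>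
    exists_linearMap_lift (S.kerι hN t) (S.kerι_injective hN t)
      ((α.app (op (S.Q t))).hom ∘ₗ S.kerι hM t) fun m => (S.exact_kerι hN t _).1 (by
        rw [LinearMap.comp_apply, ← naturality_apply, (S.exact_kerι hM t).apply_apply_eq_zero,
          map_zero])
  choose ψ hψ using h
  refine ⟨{ app t := ModuleCat.ofHom (ψ t.unop), naturality t t' f := ?_ }, hψ⟩
  ext m
  apply S.kerι_injective hN
  refine (hψ _ _).trans (Eq.trans ?_ (S.kerι_map hN (S.lift f.unop) (ψ _ m)).symm)
  rw [hψ, ← naturality_apply, ← S.kerι_map hM (S.lift f.unop)]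
  rfl

lemma exists_cokerMap : ∃ φ : S.cokerMod hM ⟶ S.cokerMod hN, ∀ t m,
    (φ.app (op t)).hom (S.cokerπ hM t m) = S.cokerπ hN t ((α.app (op (S.P t))).hom m) := by
  refine exists_natTrans (fun t => M.obj (op (S.P t))) (S.cokerπ hM) (S.cokerπ_surjective hM)
    (fun t => S.cokerπ hN t ∘ₗ (α.app (op (S.P t))).hom) (fun t m hm => ?_) fun {t t'} f m =>
      ⟨(M.map (S.a f).op).hom m, (S.cokerπ_map hM (S.lift f) m).symm, ?_⟩
  · obtain ⟨m, rfl⟩ := (S.exact_cokerπ hM t _).1 hm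
    rw [LinearMap.comp_apply, naturality_apply, (S.exact_cokerπ hN t).apply_apply_eq_zero]
  · rw [LinearMap.comp_apply, naturality_apply, ← S.cokerπ_map hN (S.lift f)]
    rfl

variable (hα : ∀ X, Function.Bijective (α.app X).hom)

include hα

lemma exists_kerIso : Nonempty (S.kerMod hM ≅ S.kerMod hN) := by
  obtain ⟨φ, hφ⟩ := S.exists_kerMap hM hN α
  refine ⟨isoOfBijective φ fun t => ⟨fun m m' h => S.kerι_injective hM t.unop ((hα _).1 ?_),
    fun n => ?_⟩⟩
  · exact (hφ t.unop m).symm.trans ((congrArg _ h).trans (hφ t.unop m'))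
  · obtain ⟨m, hm⟩ := (hα (op (S.Q t.unop))).2 (S.kerι hN t.unop n)
    obtain ⟨m, rfl⟩ := (S.exact_kerι hM t.unop m).1 ((hα _).1 (by
      rw [naturality_apply, hm, (S.exact_kerι hN t.unop).apply_apply_eq_zero, map_zero]))
    exact ⟨m, S.kerι_injective hN t.unop ((hφ t.unop m).trans hm)⟩

lemma exists_cokerIso : Nonempty (S.cokerMod hM ≅ S.cokerMod hN) := by
  obtain ⟨φ, hφ⟩ := S.exists_cokerMap hM hN α
  refine ⟨isoOfBijective φ fun t => ⟨?_, fun n => ?_⟩⟩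
  · rw [injective_iff_map_eq_zero]
    intro m hm
    obtain ⟨m, rfl⟩ := S.cokerπ_surjective hM t.unop m
    obtain ⟨n, hn⟩ := (S.exact_cokerπ hN t.unop _).1 ((hφ t.unop m).symm.trans hm)
    obtain ⟨n, rfl⟩ := (hα _).2 n
    rw [← naturality_apply] at hn
    obtain rfl := (hα _).1 hn
    exact (S.exact_cokerπ hM t.unop).apply_apply_eq_zero n
  · obtain ⟨n, rfl⟩ := S.cokerπ_surjective hN t.unop n
    obtain ⟨m, rfl⟩ := (hα _).2 n
    exact ⟨_, hφ t.unop m⟩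

end Map

/-! ### The connecting homomorphism of the snake lemma. -/

section Snake

variable {M₁ M₂ M₃ : Bᵒᵖ ⥤ ModuleCat.{w} K} (h₁ : IsModule M₁) (h₂ : IsModule M₂) (h₃ : IsModule M₃)
  (f : M₁ ⟶ M₂) (g : M₂ ⟶ M₃) (hf : ∀ X, Function.Injective (f.app X).hom)
  (hg : ∀ X, Function.Surjective (g.app X).hom)
  (hfg : ∀ X, Function.Exact (f.app X).hom (g.app X).hom)

include hf hg hfg

/-- The connecting homomorphism. -/
lemma exists_connecting : ∃ δ : S.kerMod h₃ ⟶ S.cokerMod h₁, ∀ (t : A) (x : (S.kerMod h₃).obj (op t))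
    (y : M₂.obj (op (S.Q t))) (z : M₁.obj (op (S.P t))),
    (g.app (op (S.Q t))).hom y = S.kerι h₃ t x →
    (f.app (op (S.P t))).hom z = (M₂.map (S.p t).op).hom y →
    (δ.app (op t)).hom x = S.cokerπ h₁ t z := by
  -- The connecting relation as a space: `y` lifts `x`, and `z` lifts the restriction of `y`. It
  -- projects onto the `x`, and the class of `z` vanishes when `x` does.
  let V : ∀ t : A, Submodule K (((S.kerMod h₃).obj (op t)) ×
      (M₂.obj (op (S.Q t)) × M₁.obj (op (S.P t)))) := fun t =>
    { carrier := {v | (g.app (op (S.Q t))).hom v.2.1 = S.kerι h₃ t v.1 ∧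
        (f.app (op (S.P t))).hom v.2.2 = (M₂.map (S.p t).op).hom v.2.1}
      add_mem' := by
        rintro v w ⟨hv, hv'⟩ ⟨hw, hw'⟩
        exact ⟨by simp [hv, hw], by simp [hv', hw']⟩
      zero_mem' := by simp
      smul_mem' := by
        rintro c v ⟨hv, hv'⟩
        exact ⟨by simp [hv], by simp [hv']⟩ }
  obtain ⟨δ, hδ⟩ := exists_natTrans (M := S.kerMod h₃) (N := S.cokerMod h₁) (fun t => V t)
    (fun t => LinearMap.fst K _ _ ∘ₗ (V t).subtype) (fun t x => by
      obtain ⟨y, hy⟩ := hg _ (S.kerι h₃ t x)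
      obtain ⟨z, hz⟩ := (hfg _ ((M₂.map (S.p t).op).hom y)).1 (by
        rw [naturality_apply, hy, (S.exact_kerι h₃ t).apply_apply_eq_zero])
      exact ⟨⟨(x, y, z), hy, hz⟩, rfl⟩)
    (fun t => S.cokerπ h₁ t ∘ₗ LinearMap.snd K _ _ ∘ₗ LinearMap.snd K _ _ ∘ₗ (V t).subtype)
    (fun t => by
      rintro ⟨⟨x, y, z⟩, hy, hz⟩ hx
      change x = 0 at hx
      subst hx
      change S.cokerπ h₁ t z = 0
      rw [map_zero] at hy
      obtain ⟨y, rfl⟩ := (hfg _ _).1 hy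
      dsimp only at hz
      rw [← naturality_apply] at hz
      obtain rfl := hf _ hz
      exact (S.exact_cokerπ h₁ t).apply_apply_eq_zero y)
    (fun {t t'} φ => by
      rintro ⟨⟨x, y, z⟩, hy, hz⟩
      dsimp only at hy hz
      refine ⟨⟨(((S.kerMod h₃).map φ.op).hom x, (M₂.map (S.b φ).op).hom y,
        (M₁.map (S.a φ).op).hom z), ?_, ?_⟩, rfl, (S.cokerπ_map h₁ (S.lift φ) z).symm⟩
      · dsimp only
        rw [naturality_apply, hy, S.kerι_map h₃ (S.lift φ)]
      · dsimp only
        rw [naturality_apply, hz, S.map_p_map_b (S.lift φ)])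
  exact ⟨δ, fun t x y z hy hz => hδ t ⟨(x, y, z), hy, hz⟩⟩

end Snake

/-- The six-term exact sequence, in Grothendieck groups. -/
lemma cls_add {M₁ M₂ M₃ : Bᵒᵖ ⥤ ModuleCat.{v} K} (h₁ : IsModule M₁) (h₂ : IsModule M₂)
    (h₃ : IsModule M₃) (f : M₁ ⟶ M₂) (g : M₂ ⟶ M₃) (hf : ∀ X, Function.Injective (f.app X).hom)
    (hg : ∀ X, Function.Surjective (g.app X).hom)
    (hfg : ∀ X, Function.Exact (f.app X).hom (g.app X).hom)
    {Q : ObjectProperty (Aᵒᵖ ⥤ ModuleCat.{v} K)} (hQ : IsAbelianClass Q)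
    (hK₁ : Q (S.kerMod h₁)) (hK₂ : Q (S.kerMod h₂)) (hK₃ : Q (S.kerMod h₃))
    (hC₁ : Q (S.cokerMod h₁)) (hC₂ : Q (S.cokerMod h₂)) (hC₃ : Q (S.cokerMod h₃)) :
    K0Mod.cls _ hC₂ - K0Mod.cls _ hK₂ = (K0Mod.cls _ hC₁ - K0Mod.cls _ hK₁) +
      (K0Mod.cls _ hC₃ - K0Mod.cls _ hK₃) := by
  obtain ⟨φ, hφ⟩ := S.exists_kerMap h₁ h₂ f
  obtain ⟨ψ, hψ⟩ := S.exists_kerMap h₂ h₃ g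
  obtain ⟨φ', hφ'⟩ := S.exists_cokerMap h₁ h₂ f
  obtain ⟨ψ', hψ'⟩ := S.exists_cokerMap h₂ h₃ g
  obtain ⟨δ, hδ⟩ := S.exists_connecting h₁ h₃ f g hf hg hfg
  have hz : ∀ (t : A) (x : (S.kerMod h₃).obj (op t)) (y : M₂.obj (op (S.Q t))),
      (g.app (op (S.Q t))).hom y = S.kerι h₃ t x → ∃ z : M₁.obj (op (S.P t)),
        (f.app (op (S.P t))).hom z = (M₂.map (S.p t).op).hom y := fun t x y hy =>
    (hfg _ ((M₂.map (S.p t).op).hom y)).1 (by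
      rw [naturality_apply, hy, (S.exact_kerι h₃ t).apply_apply_eq_zero])
  refine hQ.cls_six_term hK₁ hK₂ hK₃ hC₁ hC₂ hC₃ φ ψ δ φ' ψ' ?_ ?_ ?_ ?_ ?_ ?_
  · intro t m m' h
    exact S.kerι_injective h₁ t.unop (hf _ ((hφ t.unop m).symm.trans
      ((congrArg _ h).trans (hφ t.unop m'))))
  · intro t m
    obtain ⟨t⟩ := t
    rw [← map_eq_zero_iff _ (S.kerι_injective h₃ t), hψ]
    constructor
    · intro h
      obtain ⟨x, hx⟩ := (hfg _ _).1 h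
      obtain ⟨x, rfl⟩ := (S.exact_kerι h₁ t x).1 (hf _ (by
        rw [naturality_apply, hx, (S.exact_kerι h₂ t).apply_apply_eq_zero, map_zero]))
      exact ⟨x, S.kerι_injective h₂ t ((hφ t x).trans hx)⟩
    · rintro ⟨x, rfl⟩
      rw [hφ, (hfg _).apply_apply_eq_zero]
  · intro t m
    obtain ⟨t⟩ := t
    constructor
    · intro h
      obtain ⟨y, hy⟩ := hg _ (S.kerι h₃ t m)
      obtain ⟨z, hz⟩ := hz t m y hy
      rw [hδ t m y z hy hz] at h
      obtain ⟨z, rfl⟩ := (S.exact_cokerπ h₁ t z).1 h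
      -- When `z` is a boundary, subtracting it from `y` gives another lift, now inside the kernel
      -- for the middle module.
      obtain ⟨x, hx⟩ := (S.exact_kerι h₂ t (y - (f.app _).hom z)).1 (by
        rw [map_sub, ← hz, naturality_apply, sub_self])
      refine ⟨x, S.kerι_injective h₃ t ?_⟩
      rw [hψ, hx, map_sub, hy, (hfg _).apply_apply_eq_zero, sub_zero]
    · rintro ⟨x, rfl⟩
      rw [hδ t _ (S.kerι h₂ t x) 0 (hψ t x).symm (by
        rw [map_zero, (S.exact_kerι h₂ t).apply_apply_eq_zero]), map_zero]
  · intro t m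
    obtain ⟨t⟩ := t
    obtain ⟨m, rfl⟩ := S.cokerπ_surjective h₁ t m
    rw [hφ']
    constructor
    · intro h
      obtain ⟨y, hy⟩ := (S.exact_cokerπ h₂ t _).1 h
      obtain ⟨x, hx⟩ := (S.exact_kerι h₃ t ((g.app _).hom y)).1 (by
        rw [← naturality_apply, hy, (hfg _).apply_apply_eq_zero])
      exact ⟨x, hδ t x y m hx.symm hy.symm⟩
    · rintro ⟨x, hx⟩
      obtain ⟨y, hy⟩ := hg _ (S.kerι h₃ t x)
      obtain ⟨z, hz⟩ := hz t x y hy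
      rw [hδ t x y z hy hz] at hx
      rw [← hφ', ← hx, hφ', hz, (S.exact_cokerπ h₂ t).apply_apply_eq_zero]
  · intro t m
    obtain ⟨t⟩ := t
    obtain ⟨m, rfl⟩ := S.cokerπ_surjective h₂ t m
    rw [hψ']
    constructor
    · intro h
      obtain ⟨y, hy⟩ := (S.exact_cokerπ h₃ t _).1 h
      obtain ⟨y, rfl⟩ := hg _ y
      obtain ⟨x, hx⟩ := (hfg _ (m - (M₂.map (S.p t).op).hom y)).1 (by
        rw [map_sub, naturality_apply, hy, sub_self])
      refine ⟨S.cokerπ h₁ t x, ?_⟩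
      rw [hφ', hx, map_sub, (S.exact_cokerπ h₂ t).apply_apply_eq_zero, sub_zero]
    · rintro ⟨x, hx⟩
      obtain ⟨x, rfl⟩ := S.cokerπ_surjective h₁ t x
      rw [hφ'] at hx
      rw [← hψ', ← hx, hψ', (hfg _).apply_apply_eq_zero, map_zero]
  · intro t m
    obtain ⟨m, rfl⟩ := S.cokerπ_surjective h₃ t.unop m
    obtain ⟨m, rfl⟩ := hg _ m
    exact ⟨_, hψ' t.unop m⟩

end TwoTerm

end ClusterIso

namespace ClusterIso

/-! ### Homomorphisms of Grothendieck groups from two-term complexes -/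

section Euler

variable {K : Type k} [Field K] {A : Type u} [Category.{v} A] [Preadditive A] [Linear K A]
  {B : Type u'} [Category.{v} B] [Preadditive B] [Linear K B] (S : TwoTerm K A B)
  {Q : ObjectProperty (Aᵒᵖ ⥤ ModuleCat.{v} K)} (hQ : IsAbelianClass Q)
  {Q' : ObjectProperty (Bᵒᵖ ⥤ ModuleCat.{v} K)} (hQ' : ∀ M, Q' M → IsModule M)
  (hker : ∀ M (hM : Q' M), Q (S.kerMod (hQ' M hM)))
  (hcoker : ∀ M (hM : Q' M), Q (S.cokerMod (hQ' M hM)))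

/-- `[M]` is sent to the class of the cokernel minus the class of the kernel of
`M(Q t) ⟶ M(P t)`. -/
def TwoTerm.eulerMap : K0Mod Q' →+ K0Mod Q :=
  K0Mod.lift (fun M hM => K0Mod.cls _ (hcoker M hM) - K0Mod.cls _ (hker M hM))
    fun X _ _ _ hX => S.cls_add _ _ _ X.f X.g
      (have := hX.mono_f; injective_app X.f) (have := hX.epi_g; surjective_app X.g)
      (app_of_exact hX.exact) hQ _ _ _ _ _ _

@[simp]
lemma TwoTerm.eulerMap_cls (M) (hM : Q' M) :
    S.eulerMap hQ hQ' hker hcoker (K0Mod.cls M hM) =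
      K0Mod.cls _ (hcoker M hM) - K0Mod.cls _ (hker M hM) :=
  K0Mod.lift_cls _ _ M hM

end Euler

/-! ### The two-term complexes attached to a cluster-tilting subcategory -/

section Complexes

variable {K : Type k} [Field K] {C : Type u} [Category.{v} C] [Preadditive C] [Linear K C]

/-- The linear map `f ↦ push f δ`. -/
def ExtData.pushₗ (D : ExtData K C) {Z X : C} (δ : D.Ext Z X) (X' : C) :
    (X ⟶ X') →ₗ[K] D.Ext Z X' where
  toFun f := D.push Z f δ
  map_add' f g := D.push_add Z f g δ
  map_smul' a f := D.push_smul Z a f δ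

/-- The linear map `f ↦ pull f δ`. -/
def ExtData.pullₗ (D : ExtData K C) {Z X : C} (δ : D.Ext Z X) (Z' : C) :
    (Z' ⟶ Z) →ₗ[K] D.Ext Z' X where
  toFun f := D.pull f X δ
  map_add' f g := D.pull_add f g X δ
  map_smul' a f := D.pull_smul a f X δ

/-- A conflation `X ⟶ L ⟶ L'` with `L, L'` in `U`. -/
structure Coresolution (D : ExtData K C) (U : ObjectProperty C) (X : C) where
  L : U.FullSubcategory
  L' : U.FullSubcategory
  i : X ⟶ L.obj
  p : L.obj ⟶ L'.obj
  δ : D.Ext L'.obj X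
  real : D.Real δ i p

/-- A conflation `N ⟶ R ⟶ X` with `N, R` in `U`. -/
structure Resolution (D : ExtData K C) (U : ObjectProperty C) (X : C) where
  N : U.FullSubcategory
  R : U.FullSubcategory
  i : N.obj ⟶ R.obj
  p : R.obj ⟶ X
  δ : D.Ext X N.obj
  real : D.Real δ i p

variable {D : ExtData K C} {T U : ObjectProperty C} (hD : HasExactConfl D)
  (hU : ClusterTilting D U)

include hD hU

lemma nonempty_coresolution (X : C) : Nonempty (Coresolution D U X) := by
  obtain ⟨L, L', i, p, δ, hr⟩ := hU.exists_coindex hD X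
  exact ⟨⟨L, L', i, p, δ, hr⟩⟩

lemma nonempty_resolution (X : C) : Nonempty (Resolution D U X) := by
  obtain ⟨N, R, i, p, δ, hr⟩ := hU.exists_index hD X
  exact ⟨⟨N, R, i, p, δ, hr⟩⟩

lemma Coresolution.extend {X : C} (c : Coresolution D U X) {W : C} (hW : U W) (f : X ⟶ W) :
    ∃ g : c.L.obj ⟶ W, c.i ≫ g = f :=
  hD.desc_mid c.real f (hU.ext_eq_zero c.L'.2 hW _)

lemma Resolution.factor {X : C} (r : Resolution D U X) {W : C} (hW : U W) (f : W ⟶ X) :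
    ∃ g : W ⟶ r.R.obj, g ≫ r.p = f :=
  hD.lift_mid r.real f (hU.ext_eq_zero hW r.N.2 _)

/-- The coresolutions by objects of `U` as two-term complexes. -/
def coindexComplex (c : ∀ t : T.FullSubcategory, Coresolution D U t.obj) :
    TwoTerm K T.FullSubcategory U.FullSubcategory where
  P t := (c t).L
  Q t := (c t).L'
  p t := ObjectProperty.homMk (c t).p
  -- A lift is a morphism of conflations including the extension classes. For zero `f`, the first
  -- equation makes `a` null-homotopic and the last one does so for `b`.
  Lift {t t'} f a b := (c t).i ≫ a.hom = f.hom ≫ (c t').i ∧ (c t).p ≫ b.hom = a.hom ≫ (c t').p ∧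
    D.push _ f.hom (c t).δ = D.pull b.hom _ (c t').δ
  comm h := ObjectProperty.hom_ext _ h.2.1
  exists_lift {t t'} f := by
    obtain ⟨a, ha⟩ := (c t).extend hD hU (c t').L.2 (f.hom ≫ (c t').i)
    obtain ⟨b, hb, hb'⟩ := hD.mor_right (c t).real (c t').real f.hom a ha
    exact ⟨(ObjectProperty.homMk a, ObjectProperty.homMk b), ha, hb.symm, hb'⟩
  id t := by
    refine ⟨?_, ?_, ?_⟩
    · exact (Category.comp_id _).trans (Category.id_comp _).symm
    · exact (Category.comp_id _).trans (Category.id_comp _).symm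
    · exact (D.push_id _ _ _).trans (D.pull_id _ _ _).symm
  comp {t t' t'' f a b f' a' b'} h h' := by
    obtain ⟨h₁, h₂, h₃⟩ := h
    obtain ⟨h₁', h₂', h₃'⟩ := h'
    refine ⟨?_, ?_, ?_⟩
    · change _ ≫ a.hom ≫ a'.hom = (f.hom ≫ f'.hom) ≫ _
      rw [← Category.assoc, h₁, Category.assoc, h₁', Category.assoc]
    · change _ ≫ b.hom ≫ b'.hom = (a.hom ≫ a'.hom) ≫ _
      rw [← Category.assoc, h₂, Category.assoc, h₂', Category.assoc]
    · change D.push _ (f.hom ≫ f'.hom) _ = D.pull (b.hom ≫ b'.hom) _ _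
      rw [D.push_comp, h₃, D.pull_comp, ← h₃', D.pull_push]
  add {t t' f f' a a' b b'} h h' := by
    obtain ⟨h₁, h₂, h₃⟩ := h
    obtain ⟨h₁', h₂', h₃'⟩ := h'
    refine ⟨?_, ?_, ?_⟩
    · change _ ≫ (a.hom + a'.hom) = (f.hom + f'.hom) ≫ _
      rw [Preadditive.comp_add, Preadditive.add_comp, h₁, h₁']
    · change _ ≫ (b.hom + b'.hom) = (a.hom + a'.hom) ≫ _
      rw [Preadditive.comp_add, Preadditive.add_comp, h₂, h₂']
    · change D.push _ (f.hom + f'.hom) _ = D.pull (b.hom + b'.hom) _ _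
      rw [D.push_add, D.pull_add, h₃, h₃']
  smul {t t' f a b} s h := by
    obtain ⟨h₁, h₂, h₃⟩ := h
    refine ⟨?_, ?_, ?_⟩
    · change _ ≫ (s • a.hom) = (s • f.hom) ≫ _
      rw [Linear.comp_smul, Linear.smul_comp, h₁]
    · change _ ≫ (s • b.hom) = (s • a.hom) ≫ _
      rw [Linear.comp_smul, Linear.smul_comp, h₂]
    · change D.push _ (s • f.hom) _ = D.pull (s • b.hom) _ _
      rw [D.push_smul, D.pull_smul, h₃]
  homotopy {t t' a b} h := by
    obtain ⟨h₁, -, h₃⟩ := h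
    constructor
    · obtain ⟨l, hl⟩ := hD.desc_right (c t).real a.hom (h₁.trans zero_comp)
      exact ⟨ObjectProperty.homMk l, ObjectProperty.hom_ext _ hl⟩
    · obtain ⟨l, hl⟩ := hD.lift_mid (c t').real b.hom (h₃.symm.trans (D.push_zero _ _))
      exact ⟨ObjectProperty.homMk l, ObjectProperty.hom_ext _ hl⟩

/-- The resolutions by objects of `U` as two-term complexes. -/
def indexComplex (r : ∀ t : T.FullSubcategory, Resolution D U t.obj) :
    TwoTerm K T.FullSubcategory U.FullSubcategory where
  P t := (r t).N
  Q t := (r t).R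
  p t := ObjectProperty.homMk (r t).i
  -- Here the extension classes are what makes `a` null-homotopic for zero `f`, while the first
  -- equation serves for `b`.
  Lift {t t'} f a b := b.hom ≫ (r t').p = (r t).p ≫ f.hom ∧ (r t).i ≫ b.hom = a.hom ≫ (r t').i ∧
    D.push _ a.hom (r t).δ = D.pull f.hom _ (r t').δ
  comm h := ObjectProperty.hom_ext _ h.2.1
  exists_lift {t t'} f := by
    obtain ⟨b, hb⟩ := (r t').factor hD hU (r t).R.2 ((r t).p ≫ f.hom)
    obtain ⟨a, ha, ha'⟩ := hD.mor_left (r t).real (r t').real b f.hom hb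
    exact ⟨(ObjectProperty.homMk a, ObjectProperty.homMk b), hb, ha, ha'⟩
  id t := by
    refine ⟨?_, ?_, ?_⟩
    · exact (Category.id_comp _).trans (Category.comp_id _).symm
    · exact (Category.comp_id _).trans (Category.id_comp _).symm
    · exact (D.push_id _ _ _).trans (D.pull_id _ _ _).symm
  comp {t t' t'' f a b f' a' b'} h h' := by
    obtain ⟨h₁, h₂, h₃⟩ := h
    obtain ⟨h₁', h₂', h₃'⟩ := h'
    refine ⟨?_, ?_, ?_⟩
    · change (b.hom ≫ b'.hom) ≫ _ = _ ≫ f.hom ≫ f'.hom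
      rw [← Category.assoc _ f.hom, ← h₁, Category.assoc, h₁', Category.assoc]
    · change _ ≫ b.hom ≫ b'.hom = (a.hom ≫ a'.hom) ≫ _
      rw [← Category.assoc, h₂, Category.assoc, h₂', Category.assoc]
    · change D.push _ (a.hom ≫ a'.hom) _ = D.pull (f.hom ≫ f'.hom) _ _
      rw [D.push_comp, h₃, D.pull_comp, ← h₃', D.pull_push]
  add {t t' f f' a a' b b'} h h' := by
    obtain ⟨h₁, h₂, h₃⟩ := h
    obtain ⟨h₁', h₂', h₃'⟩ := h'
    refine ⟨?_, ?_, ?_⟩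
    · change (b.hom + b'.hom) ≫ _ = _ ≫ (f.hom + f'.hom)
      rw [Preadditive.comp_add, Preadditive.add_comp, h₁, h₁']
    · change _ ≫ (b.hom + b'.hom) = (a.hom + a'.hom) ≫ _
      rw [Preadditive.comp_add, Preadditive.add_comp, h₂, h₂']
    · change D.push _ (a.hom + a'.hom) _ = D.pull (f.hom + f'.hom) _ _
      rw [D.push_add, D.pull_add, h₃, h₃']
  smul {t t' f a b} s h := by
    obtain ⟨h₁, h₂, h₃⟩ := h
    refine ⟨?_, ?_, ?_⟩
    · change (s • b.hom) ≫ _ = _ ≫ (s • f.hom)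
      rw [Linear.comp_smul, Linear.smul_comp, h₁]
    · change _ ≫ (s • b.hom) = (s • a.hom) ≫ _
      rw [Linear.comp_smul, Linear.smul_comp, h₂]
    · change D.push _ (s • a.hom) _ = D.pull (s • f.hom) _ _
      rw [D.push_smul, D.pull_smul, h₃]
  homotopy {t t' a b} h := by
    obtain ⟨h₁, -, h₃⟩ := h
    constructor
    · obtain ⟨l, hl⟩ := hD.desc_mid (r t).real a.hom (h₃.trans (D.pull_zero _ _))
      exact ⟨ObjectProperty.homMk l, ObjectProperty.hom_ext _ hl⟩
    · obtain ⟨l, hl⟩ := hD.lift_left (r t').real b.hom (h₁.trans comp_zero)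
      exact ⟨ObjectProperty.homMk l, ObjectProperty.hom_ext _ hl⟩

/-! ### Kernel and cokernel modules of Ext(-, X) for coresolutions. -/

section Coindex

variable (c : ∀ t : T.FullSubcategory, Coresolution D U t.obj)

lemma exists_lift_coindexComplex {t t' : T.FullSubcategory} (f : t ⟶ t') :
    ∃ (a : (c t).L.obj ⟶ (c t').L.obj) (b : (c t).L'.obj ⟶ (c t').L'.obj),
      (coindexComplex hD hU c).Lift f (ObjectProperty.homMk a) (ObjectProperty.homMk b) ∧
      (c t).i ≫ a = f.hom ≫ (c t').i ∧ D.push _ f.hom (c t).δ = D.pull b _ (c t').δ :=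
  have h := (coindexComplex hD hU c).lift f
  ⟨_, _, h, h.1, h.2.2⟩

/-- Restriction along t → L_t embeds the cokernel of Ext(L'_t, X) → Ext(L_t, X) into Ext(t, X). Its
image dies in Ext(t, L), since Ext(L_t, L) = 0. Conversely, an extension dying there is induced by a
map t → L', and this map extends over L_t. -/
lemma exists_iso_coker_coindexComplex {X : C} (x : Coresolution D U X) :
    Nonempty ((coindexComplex hD hU c).cokerMod (isModule_extMod (D := D) X) ≅
      kernel (extMap D T x.i)) := by
  set S := coindexComplex hD hU c
  have hM := isModule_extMod (D := D) (T := U) X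
  obtain ⟨j, hj⟩ := exists_natTrans (M := S.cokerMod hM) (N := extMod D T X)
    (fun t => D.Ext (c t).L.obj X) (S.cokerπ hM) (S.cokerπ_surjective hM)
    (fun t => D.pull (c t).i X)
    (fun t ε hε => by
      obtain ⟨(ε : D.Ext (c t).L'.obj X), rfl⟩ := (S.exact_cokerπ hM t _).1 hε
      have : D.pull (c t).i X (D.pull (c t).p X ε) = 0 := by
        rw [← D.pull_comp, hD.comp_zero (c t).real, D.pull_zero]
      exact this)
    (fun {t t'} f ε => by
      obtain ⟨a, b, hl, ha, -⟩ := exists_lift_coindexComplex hD hU c f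
      refine ⟨D.pull a X ε, (S.cokerπ_map hM hl ε).symm, ?_⟩
      have : D.pull (c t).i X (D.pull a X ε) = D.pull f.hom X (D.pull (c t').i X ε) := by
        rw [← D.pull_comp, ha, D.pull_comp]
      exact this)
  refine exists_iso_kernel j _ (fun t => ?_) fun t ε => ?_
  · rw [injective_iff_map_eq_zero]
    intro m hm
    obtain ⟨t⟩ := t
    obtain ⟨(ε : D.Ext (c t).L.obj X), rfl⟩ := S.cokerπ_surjective hM t m
    obtain ⟨ε, rfl⟩ := hD.ext_pull (c t).real ε ((hj t ε).symm.trans hm)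
    exact (S.exact_cokerπ hM t).apply_apply_eq_zero ε
  · obtain ⟨t⟩ := t
    constructor
    · intro h
      obtain ⟨f, rfl⟩ := hD.eq_pull x.real (W := t.obj) ε h
      obtain ⟨g, rfl⟩ := (c t).extend hD hU x.L'.2 f
      exact ⟨S.cokerπ hM t (D.pull g X x.δ), (hj t _).trans (D.pull_comp _ _ _ _).symm⟩
    · rintro ⟨m, rfl⟩
      obtain ⟨(ε : D.Ext (c t).L.obj X), rfl⟩ := S.cokerπ_surjective hM t m
      have : D.push t.obj x.i (D.pull (c t).i X ε) = 0 := by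
        rw [← D.pull_push, hU.ext_eq_zero (c t).L.2 x.L.2 (D.push _ x.i ε), map_zero]
      exact (congrArg (D.push t.obj x.i) (hj t ε)).trans this

/-- Both modules are quotients of Hom(t, X): push forward the class of the coresolution of t, or
pull back the class of the resolution of X. A map dies on one side when it extends over L_t and on
the other when it lifts to R; each implies the other by vanishing of Ext on U. -/
lemma exists_iso_ker_coindexComplex {X : C} (x : Resolution D U X) :
    Nonempty ((coindexComplex hD hU c).kerMod (isModule_extMod (D := D) X) ≅
      kernel (extMap D T x.i)) := by
  set S := coindexComplex hD hU c
  have hM := isModule_extMod (D := D) (T := U) X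
  choose s hs using fun t : T.FullSubcategory =>
    exists_linearMap_lift (S.kerι hM t) (S.kerι_injective hM t) (D.pushₗ (c t).δ X) fun f =>
      (S.exact_kerι hM t _).1 (by
        have : D.pull (c t).p X (D.push _ f (c t).δ) = 0 := by
          rw [D.pull_push, hD.pull_zero (c t).real, map_zero]
        exact this)
  choose g hg using fun t : T.FullSubcategory =>
    exists_linearMap_lift ((kernel.ι (extMap D T x.i)).app (op t)).hom (injective_app _ _)
      (D.pullₗ x.δ t.obj) fun f => (exact_kernel_app (extMap D T x.i) (op t) _).1 (by
        have : D.push t.obj x.i (D.pull f _ x.δ) = 0 := by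
          rw [← D.pull_push, hD.push_zero x.real, map_zero]
        exact this)
  have hs0 : ∀ t f, s t f = 0 ↔ D.push _ f (c t).δ = 0 := fun t f => by
    rw [← map_eq_zero_iff _ (S.kerι_injective hM t), hs]
    rfl
  have hg0 : ∀ t f, g t f = 0 ↔ D.pull f _ x.δ = 0 := fun t f => by
    rw [← map_eq_zero_iff _ (injective_app (kernel.ι (extMap D T x.i)) (op t)), hg]
    rfl
  refine exists_iso_of_same_kernel (fun t => (t.obj ⟶ X)) s (fun t m => ?_) g (fun t m => ?_)
    (fun t f => ?_) fun {t t'} f φ => ⟨f.hom ≫ φ, ?_, ?_⟩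
  · obtain ⟨f, hf⟩ := hD.eq_push (c t).real (S.kerι hM t m)
      ((S.exact_kerι hM t).apply_apply_eq_zero m)
    exact ⟨f, S.kerι_injective hM t ((hs t f).trans hf)⟩
  · obtain ⟨f, hf⟩ := hD.eq_pull x.real (W := t.obj) (((kernel.ι (extMap D T x.i)).app (op t)).hom m)
      ((exact_kernel_app (extMap D T x.i) (op t)).apply_apply_eq_zero m)
    exact ⟨f, injective_app _ _ ((hg t f).trans hf)⟩
  · rw [hs0, hg0]
    constructor
    · intro h
      obtain ⟨l, rfl⟩ := hD.desc_mid (c t).real f h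
      rw [D.pull_comp, hU.ext_eq_zero (c t).L.2 x.N.2 (D.pull l _ x.δ), map_zero]
    · intro h
      obtain ⟨l, rfl⟩ := hD.lift_mid x.real f h
      rw [D.push_comp, hU.ext_eq_zero (c t).L'.2 x.R.2 (D.push _ l _), map_zero]
  · obtain ⟨a, b, hl, -, hb⟩ := exists_lift_coindexComplex hD hU c f
    apply S.kerι_injective hM
    refine (hs _ _).trans (Eq.trans ?_ (S.kerι_map hM hl _).symm)
    rw [hs]
    have : D.push _ (f.hom ≫ φ) (c t).δ = D.pull b _ (D.push _ φ (c t').δ) := by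
      rw [D.push_comp, D.pull_push, hb]
    exact this
  · apply injective_app (kernel.ι (extMap D T x.i)) (op t)
    refine (hg _ _).trans (Eq.trans ?_ (naturality_apply (kernel.ι (extMap D T x.i)) f _).symm)
    rw [hg]
    exact D.pull_comp _ _ _ _

end Coindex

/-! ### Kernel and cokernel modules of Ext(-, X) for resolutions. -/

section Index

variable (r : ∀ t : T.FullSubcategory, Resolution D U t.obj)

lemma exists_lift_indexComplex {t t' : T.FullSubcategory} (f : t ⟶ t') :
    ∃ (a : (r t).N.obj ⟶ (r t').N.obj) (b : (r t).R.obj ⟶ (r t').R.obj),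
      (indexComplex hD hU r).Lift f (ObjectProperty.homMk a) (ObjectProperty.homMk b) ∧
      b ≫ (r t').p = (r t).p ≫ f.hom ∧ D.push _ a (r t).δ = D.pull f.hom _ (r t').δ :=
  have h := (indexComplex hD hU r).lift f
  ⟨_, _, h, h.1, h.2.2⟩

/-- Pullback along R_t → t maps Ext(t, X) onto the kernel of Ext(R_t, X) → Ext(N_t, X). What it
kills comes from maps N_t → X; these factor through R, so it is the image of Ext(t, R). -/
lemma exists_iso_ker_indexComplex {X : C} (x : Resolution D U X) :
    Nonempty ((indexComplex hD hU r).kerMod (isModule_extMod (D := D) X) ≅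
      cokernel (extMap D T x.p)) := by
  set S := indexComplex hD hU r
  have hM := isModule_extMod (D := D) (T := U) X
  choose s hs using fun t : T.FullSubcategory =>
    exists_linearMap_lift (S.kerι hM t) (S.kerι_injective hM t) (D.pull (r t).p X) fun ε =>
      (S.exact_kerι hM t _).1 (by
        have : D.pull (r t).i X (D.pull (r t).p X ε) = 0 := by
          rw [← D.pull_comp, hD.comp_zero (r t).real, D.pull_zero]
        exact this)
  have hs0 : ∀ t ε, s t ε = 0 ↔ D.pull (r t).p X ε = 0 := fun t f => by
    rw [← map_eq_zero_iff _ (S.kerι_injective hM t), hs]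
    rfl
  refine exists_iso_of_same_kernel (fun t => D.Ext t.obj X) s (fun t m => ?_)
    (fun t => ((cokernel.π (extMap D T x.p)).app (op t)).hom) (fun t => surjective_app _ _)
    (fun t ε => ?_) fun {t t'} f ε => ⟨D.pull f.hom X ε, ?_, ?_⟩
  · obtain ⟨ε, hε⟩ := hD.ext_pull (r t).real (S.kerι hM t m)
      ((S.exact_kerι hM t).apply_apply_eq_zero m)
    exact ⟨ε, S.kerι_injective hM t ((hs t ε).trans hε)⟩
  · refine Iff.trans ?_ (exact_cokernel_app (extMap D T x.p) (op t) ε).symm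
    rw [hs0]
    constructor
    · intro h
      obtain ⟨n, rfl⟩ := hD.eq_push (r t).real ε h
      obtain ⟨m, rfl⟩ := x.factor hD hU (r t).N.2 n
      exact ⟨D.push _ m (r t).δ, (D.push_comp _ _ _ _).symm⟩
    · rintro ⟨(η : D.Ext t.obj x.R.obj), rfl⟩
      have : D.pull (r t).p X (D.push _ x.p η) = 0 := by
        rw [D.pull_push, hU.ext_eq_zero (r t).R.2 x.R.2 (D.pull _ _ η), map_zero]
      exact this
  · obtain ⟨a, b, hl, hb, -⟩ := exists_lift_indexComplex hD hU r f
    apply S.kerι_injective hM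
    refine (hs _ _).trans (Eq.trans ?_ (S.kerι_map hM hl _).symm)
    rw [hs]
    have : D.pull (r t).p X (D.pull f.hom X ε) = D.pull b X (D.pull (r t').p X ε) := by
      rw [← D.pull_comp, ← hb, D.pull_comp]
    exact this
  · exact naturality_apply (cokernel.π (extMap D T x.p)) f ε

/-- Both modules are quotients of Hom(N_t, L'). On either side a map is killed exactly when it is
the sum of a map through N_t → R_t and a map through L → L'. -/
lemma exists_iso_coker_indexComplex {X : C} (x : Coresolution D U X) :
    Nonempty ((indexComplex hD hU r).cokerMod (isModule_extMod (D := D) X) ≅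
      cokernel (extMap D T x.p)) := by
  set S := indexComplex hD hU r
  have hM := isModule_extMod (D := D) (T := U) X
  let s : ∀ t : T.FullSubcategory, ((r t).N.obj ⟶ x.L'.obj) →ₗ[K] (S.cokerMod hM).obj (op t) :=
    fun t => S.cokerπ hM t ∘ₗ D.pullₗ x.δ (r t).N.obj
  let g : ∀ t : T.FullSubcategory, ((r t).N.obj ⟶ x.L'.obj) →ₗ[K]
      (cokernel (extMap D T x.p)).obj (op t) :=
    fun t => ((cokernel.π (extMap D T x.p)).app (op t)).hom ∘ₗ D.pushₗ (r t).δ x.L'.obj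
  have hs : ∀ t n, s t n = S.cokerπ hM t (D.pull n X x.δ) := fun _ _ => rfl
  have hg : ∀ t n, g t n = ((cokernel.π (extMap D T x.p)).app (op t)).hom
    (D.push _ n (r t).δ) := fun _ _ => rfl
  refine exists_iso_of_same_kernel (fun t => ((r t).N.obj ⟶ x.L'.obj)) s (fun t m => ?_) g
    (fun t m => ?_) (fun t n => ?_) fun {t t'} f n => ?_
  · obtain ⟨(ε : D.Ext (r t).N.obj X), rfl⟩ := S.cokerπ_surjective hM t m
    obtain ⟨n, rfl⟩ := hD.eq_pull x.real ε (hU.ext_eq_zero (r t).N.2 x.L.2 _)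
    exact ⟨n, rfl⟩
  · obtain ⟨(ε : D.Ext t.obj x.L'.obj), rfl⟩ := surjective_app (cokernel.π (extMap D T x.p)) (op t) m
    obtain ⟨n, rfl⟩ := hD.eq_push (r t).real ε (hU.ext_eq_zero (r t).R.2 x.L'.2 _)
    exact ⟨n, rfl⟩
  · refine (S.exact_cokerπ hM t _).trans
      (Iff.trans ?_ (exact_cokernel_app (extMap D T x.p) (op t) _).symm)
    constructor
    · rintro ⟨(ε : D.Ext (r t).R.obj X), hε⟩
      obtain ⟨m, rfl⟩ := hD.eq_pull x.real ε (hU.ext_eq_zero (r t).R.2 x.L.2 _)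
      obtain ⟨l, hl⟩ := hD.lift_mid x.real (n - (r t).i ≫ m) (by
        rw [D.pull_sub, D.pull_comp, sub_eq_zero]
        exact hε.symm)
      refine ⟨D.push _ l (r t).δ, ?_⟩
      have : D.push _ x.p (D.push _ l (r t).δ) = D.push _ n (r t).δ := by
        rw [← D.push_comp, hl, D.push_sub, D.push_comp, hD.push_zero (r t).real, map_zero, sub_zero]
      exact this
    · rintro ⟨(η : D.Ext t.obj x.L.obj), hη⟩
      obtain ⟨l, rfl⟩ := hD.eq_push (r t).real η (hU.ext_eq_zero (r t).R.2 x.L.2 _)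
      obtain ⟨m, hm⟩ := hD.desc_mid (r t).real (n - l ≫ x.p) (by
        rw [D.push_sub, D.push_comp, sub_eq_zero]
        exact hη.symm)
      refine ⟨D.pull m X x.δ, ?_⟩
      have : D.pull (r t).i X (D.pull m X x.δ) = D.pull n X x.δ := by
        rw [← D.pull_comp, hm, D.pull_sub, D.pull_comp, hD.pull_zero x.real, map_zero, sub_zero]
      exact this
  · obtain ⟨a, b, hl, -, ha⟩ := exists_lift_indexComplex hD hU r f
    refine ⟨a ≫ n, ?_, ?_⟩
    · rw [hs, hs, D.pull_comp]
      exact (S.cokerπ_map hM hl _).symm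
    · have : D.push _ (a ≫ n) (r t).δ = D.pull f.hom _ (D.push _ n (r t').δ) := by
        rw [D.push_comp, D.pull_push, ha]
      exact (congrArg _ this).trans (naturality_apply (cokernel.π (extMap D T x.p)) f _)

end Index

/-! ### Ind and Coind on finitely presented modules. -/

section Bar

variable (hT : ClusterTilting D T) (hd : ∀ {X Y : C} (f : X ⟶ Y), Defl D f)
  [HasZeroObject C] [HasBinaryBiproducts C]

include hT hd

/-- Writing M as Ext(-, X) identifies the module with the kernel of a map between finitely presented
T-modules. The three variants below rest on the other identifications. -/
lemma fpMod_kerMod_coindexComplex (c : ∀ t : T.FullSubcategory, Coresolution D U t.obj)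
    {M : U.FullSubcategoryᵒᵖ ⥤ ModuleCat.{v} K} (hM : fpMod M) :
    fpMod ((coindexComplex hD hU c).kerMod hM.isModule) := by
  obtain ⟨X, ⟨e⟩⟩ := exists_iso_extMod hD hU hd hM
  obtain ⟨e'⟩ := (coindexComplex hD hU c).exists_kerIso hM.isModule (isModule_extMod X) e.hom
    fun _ => ⟨injective_app _ _, surjective_app _ _⟩
  obtain ⟨x⟩ := nonempty_resolution hD hU X
  obtain ⟨e''⟩ := exists_iso_ker_coindexComplex hD hU c x
  have hQ := isAbelianClass_fpMod (K := K) hD hT hd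
  exact hQ.of_iso (hQ.kernel (fpMod_extMod hD hT _) (fpMod_extMod hD hT _) _) (e' ≪≫ e'')

lemma fpMod_cokerMod_coindexComplex (c : ∀ t : T.FullSubcategory, Coresolution D U t.obj)
    {M : U.FullSubcategoryᵒᵖ ⥤ ModuleCat.{v} K} (hM : fpMod M) :
    fpMod ((coindexComplex hD hU c).cokerMod hM.isModule) := by
  obtain ⟨X, ⟨e⟩⟩ := exists_iso_extMod hD hU hd hM
  obtain ⟨e'⟩ := (coindexComplex hD hU c).exists_cokerIso hM.isModule (isModule_extMod X) e.hom
    fun _ => ⟨injective_app _ _, surjective_app _ _⟩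
  obtain ⟨x⟩ := nonempty_coresolution hD hU X
  obtain ⟨e''⟩ := exists_iso_coker_coindexComplex hD hU c x
  have hQ := isAbelianClass_fpMod (K := K) hD hT hd
  exact hQ.of_iso (hQ.kernel (fpMod_extMod hD hT _) (fpMod_extMod hD hT _) _) (e' ≪≫ e'')

lemma fpMod_kerMod_indexComplex (r : ∀ t : T.FullSubcategory, Resolution D U t.obj)
    {M : U.FullSubcategoryᵒᵖ ⥤ ModuleCat.{v} K} (hM : fpMod M) :
    fpMod ((indexComplex hD hU r).kerMod hM.isModule) := by
  obtain ⟨X, ⟨e⟩⟩ := exists_iso_extMod hD hU hd hM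
  obtain ⟨e'⟩ := (indexComplex hD hU r).exists_kerIso hM.isModule (isModule_extMod X) e.hom
    fun _ => ⟨injective_app _ _, surjective_app _ _⟩
  obtain ⟨x⟩ := nonempty_resolution hD hU X
  obtain ⟨e''⟩ := exists_iso_ker_indexComplex hD hU r x
  have hQ := isAbelianClass_fpMod (K := K) hD hT hd
  exact hQ.of_iso (hQ.cokernel (fpMod_extMod hD hT _) (fpMod_extMod hD hT _) _) (e' ≪≫ e'')

lemma fpMod_cokerMod_indexComplex (r : ∀ t : T.FullSubcategory, Resolution D U t.obj)
    {M : U.FullSubcategoryᵒᵖ ⥤ ModuleCat.{v} K} (hM : fpMod M) :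
    fpMod ((indexComplex hD hU r).cokerMod hM.isModule) := by
  obtain ⟨X, ⟨e⟩⟩ := exists_iso_extMod hD hU hd hM
  obtain ⟨e'⟩ := (indexComplex hD hU r).exists_cokerIso hM.isModule (isModule_extMod X) e.hom
    fun _ => ⟨injective_app _ _, surjective_app _ _⟩
  obtain ⟨x⟩ := nonempty_coresolution hD hU X
  obtain ⟨e''⟩ := exists_iso_coker_indexComplex hD hU r x
  have hQ := isAbelianClass_fpMod (K := K) hD hT hd
  exact hQ.of_iso (hQ.cokernel (fpMod_extMod hD hT _) (fpMod_extMod hD hT _) _) (e' ≪≫ e'')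

/-- The homomorphism of Grothendieck groups of finitely presented modules given by the
coresolutions. -/
def fpIndBar (c : ∀ t : T.FullSubcategory, Coresolution D U t.obj) :
    K0Mod (fpMod (K := K) (A := U.FullSubcategory)) →+
      K0Mod (fpMod (K := K) (A := T.FullSubcategory)) :=
  (coindexComplex hD hU c).eulerMap (isAbelianClass_fpMod hD hT hd) (fun _ h => h.isModule)
    (fun _ => fpMod_kerMod_coindexComplex hD hU hT hd c)
    (fun _ => fpMod_cokerMod_coindexComplex hD hU hT hd c)

/-- The homomorphism of Grothendieck groups of finitely presented modules given by the
resolutions. -/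
def fpCoindBar (r : ∀ t : T.FullSubcategory, Resolution D U t.obj) :
    K0Mod (fpMod (K := K) (A := U.FullSubcategory)) →+
      K0Mod (fpMod (K := K) (A := T.FullSubcategory)) :=
  -(indexComplex hD hU r).eulerMap (isAbelianClass_fpMod hD hT hd) (fun _ h => h.isModule)
    (fun _ => fpMod_kerMod_indexComplex hD hU hT hd r)
    (fun _ => fpMod_cokerMod_indexComplex hD hU hT hd r)

omit hU in
lemma fpMod_kernel_extMap {X Y : C} (x : X ⟶ Y) : fpMod (kernel (extMap D T x)) :=
  (isAbelianClass_fpMod hD hT hd).kernel (fpMod_extMod hD hT _) (fpMod_extMod hD hT _) _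

omit hU in
lemma fpMod_cokernel_extMap {X Y : C} (x : X ⟶ Y) : fpMod (cokernel (extMap D T x)) :=
  (isAbelianClass_fpMod hD hT hd).cokernel (fpMod_extMod hD hT _) (fpMod_extMod hD hT _) _

lemma fpIndBar_cls (c : ∀ t : T.FullSubcategory, Coresolution D U t.obj) {X : C}
    (x : Coresolution D U X) (y : Resolution D U X) :
    fpIndBar hD hU hT hd c (K0Mod.cls _ (fpMod_extMod hD hU X)) =
      K0Mod.cls _ (fpMod_kernel_extMap hD hT hd x.i) -
        K0Mod.cls _ (fpMod_kernel_extMap hD hT hd y.i) := by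
  obtain ⟨e⟩ := exists_iso_coker_coindexComplex hD hU c x
  obtain ⟨e'⟩ := exists_iso_ker_coindexComplex hD hU c y
  have hQ := isAbelianClass_fpMod (K := K) hD hT hd
  refine (TwoTerm.eulerMap_cls _ _ _ _ _ _ _).trans ?_
  rw [hQ.cls_eq _ (fpMod_kernel_extMap hD hT hd x.i) e,
    hQ.cls_eq _ (fpMod_kernel_extMap hD hT hd y.i) e']

lemma fpCoindBar_cls (r : ∀ t : T.FullSubcategory, Resolution D U t.obj) {X : C}
    (x : Coresolution D U X) (y : Resolution D U X) :
    fpCoindBar hD hU hT hd r (K0Mod.cls _ (fpMod_extMod hD hU X)) =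
      K0Mod.cls _ (fpMod_cokernel_extMap hD hT hd y.p) -
        K0Mod.cls _ (fpMod_cokernel_extMap hD hT hd x.p) := by
  obtain ⟨e⟩ := exists_iso_coker_indexComplex hD hU r x
  obtain ⟨e'⟩ := exists_iso_ker_indexComplex hD hU r y
  have hQ := isAbelianClass_fpMod (K := K) hD hT hd
  refine (congrArg (fun z => -z) (TwoTerm.eulerMap_cls _ hQ _ _ _ _ _)).trans ?_
  rw [neg_sub, hQ.cls_eq _ (fpMod_cokernel_extMap hD hT hd x.p) e,
    hQ.cls_eq _ (fpMod_cokernel_extMap hD hT hd y.p) e']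

end Bar

end Complexes

end ClusterIso

namespace ClusterIso

/-! ### The stable category -/

section Stable

variable {K : Type k} [Field K] {C : Type u} [Category.{v} C] [Preadditive C] [Linear K C]
  {D : ExtData K C}

lemma hasZeroObject_stab [HasZeroObject C] : HasZeroObject (Stab D) := by
  obtain ⟨O, hO⟩ := HasZeroObject.zero (C := C)
  exact ⟨_, (stabπ D).map_isZero hO⟩

lemma clusterTilting_stabProp {T : ObjectProperty C} (hT : ClusterTilting D T) :
    ClusterTilting (stabData D) (stabProp D T) where
  mem_iff_right X := (hT.mem_iff_right X.as).trans
    ⟨fun h T' hT' => h T'.as hT', fun h T' hT' => h ((stabπ D).obj T') hT'⟩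
  mem_iff_left X := (hT.mem_iff_left X.as).trans
    ⟨fun h T' hT' => h T'.as hT', fun h T' hT' => h ((stabπ D).obj T') hT'⟩
  right_approx X := by
    obtain ⟨B, f, ⟨hB, hf⟩, Y, i, δ, hr⟩ := hT.right_approx X.as
    refine ⟨(stabπ D).obj B, (stabπ D).map f, ⟨hB, fun B' g hB' => ?_⟩, (stabπ D).obj Y,
      (stabπ D).map i, δ, quotData_real_map D le_rfl hr⟩
    obtain ⟨g, rfl⟩ := AddQuot.map_surj g
    obtain ⟨h, rfl⟩ := hf B'.as g hB'
    exact ⟨(stabπ D).map h, ((stabπ D).map_comp h f).symm⟩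
  left_approx X := by
    obtain ⟨B, f, ⟨hB, hf⟩, Y, p, δ, hr⟩ := hT.left_approx X.as
    refine ⟨(stabπ D).obj B, (stabπ D).map f, ⟨hB, fun B' g hB' => ?_⟩, (stabπ D).obj Y,
      (stabπ D).map p, δ, quotData_real_map D le_rfl hr⟩
    obtain ⟨g, rfl⟩ := AddQuot.map_surj g
    obtain ⟨h, rfl⟩ := hf B'.as g hB'
    exact ⟨(stabπ D).map h, ((stabπ D).map_comp f h).symm⟩

variable [HasZeroObject C] [HasBinaryBiproducts C]

/-- Adding a projective-injective summand does not change the object in the stable category. -/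
def stabBiprodIso (X : C) {P : C} (hP : ProjInj D P) : (stabπ D).obj X ≅ (stabπ D).obj (X ⊞ P) where
  hom := (stabπ D).map biprod.inl
  inv := (stabπ D).map biprod.fst
  hom_inv_id := by
    rw [← Functor.map_comp, biprod.inl_fst]
    rfl
  inv_hom_id := by
    rw [← Functor.map_comp]
    refine ((AddQuot.map_eq_iff _ (𝟙 (X ⊞ P))).2 ?_).trans ((stabπ D).map_id _)
    have : biprod.fst ≫ biprod.inl - 𝟙 (X ⊞ P) = -(biprod.snd ≫ biprod.inr) := by
      rw [← biprod.total]
      abel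
    rw [this]
    exact Submodule.neg_mem _ (Submodule.subset_span ⟨P, _, _, hP, rfl⟩)

/-- In the stable category of a Frobenius category, all morphisms are deflations. -/
lemma defl_stab (hD : IsExtriangulated D) (hF : IsFrobenius D) {X Y : Stab D} (f : X ⟶ Y) :
    Defl (stabData D) f := by
  obtain ⟨g, rfl⟩ := AddQuot.map_surj f
  obtain ⟨P, p, hP, hp⟩ := hF.enough_proj Y.as
  -- A projective summand turns `g` into a deflation from X ⊕ P, and X ⊕ P is stably isomorphic to
  -- X.
  obtain ⟨W, i, δ, hr⟩ := hD.defl_desc g hp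
  have hPI : ProjInj D P := ⟨hP, (hF.proj_iff_inj P).1 hP⟩
  refine ⟨(stabπ D).obj W, (stabπ D).map i ≫ (stabBiprodIso X.as hPI).inv, δ,
    (quotData_real_iff D le_rfl _ _ _).2 ⟨_, i, _, stabBiprodIso X.as hPI, hr, rfl, ?_⟩⟩
  change _ = (stabπ D).map biprod.inl ≫ (stabπ D).map (biprod.desc g p)
  rw [← Functor.map_comp, biprod.inl_desc]

end Stable

/-! ### Euler characteristics of modules over the stable category -/

section Chi

variable {K : Type k} [Field K] {C : Type u} [Category.{v} C] [Preadditive C] [Linear K C]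
  {D : ExtData K C} {T : ObjectProperty C}

instance (L : ExactLift.{k, u, v, u', v'} D) : (L.toStab T).Additive where
  map_add {_ _ f g} := ObjectProperty.hom_ext _
    ((congrArg (stabπ D).map (L.proj.map_add (f := f.hom) (g := g.hom))).trans
      ((stabπ D).map_add))

lemma map_add_toStab (L : ExactLift.{k, u, v, u', v'} D) {M : (StabSub D T)ᵒᵖ ⥤ ModuleCat.{v} K}
    (hM : IsModule M) {Y Z : (L.preimage T).FullSubcategory} (f g : Y ⟶ Z) :
    ((L.toStab T).op ⋙ M).map (f + g).op =
      ((L.toStab T).op ⋙ M).map f.op + ((L.toStab T).op ⋙ M).map g.op :=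
  Eq.trans (congrArg (fun h : (L.toStab T).obj Y ⟶ (L.toStab T).obj Z => M.map h.op)
    ((L.toStab T).map_add (f := f) (g := g))) (hM.map_add _ _)

/-- `c` is the Euler characteristic of `M` over all exact lifts. -/
def IsChi (D : ExtData K C) (T : ObjectProperty C) (M : (StabSub D T)ᵒᵖ ⥤ ModuleCat.{v} K)
    (c : K0Split T.FullSubcategory) : Prop :=
  ∀ L : ExactLift.{k, u, v, u', v'} D, L.HasChi T ((L.toStab T).op ⋙ M) c

variable (hT : ClusterTilting D T) (hL : Nonempty (ExactLift.{k, u, v, u', v'} D))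

include hT hL

lemma IsChi.unique {M : (StabSub D T)ᵒᵖ ⥤ ModuleCat.{v} K} (hM : IsModule M)
    {c c' : K0Split T.FullSubcategory} (h : IsChi.{k, u, v, u', v'} D T M c)
    (h' : IsChi.{k, u, v, u', v'} D T M c') : c = c' := by
  obtain ⟨L⟩ := hL
  exact (h L).unique hT L (h' L) (map_add_toStab L hM)

omit hL in
lemma IsChi.sub {M₁ M₂ M₃ : (StabSub D T)ᵒᵖ ⥤ ModuleCat.{v} K} (hM₂ : IsModule M₂)
    {c₁ c₂ : K0Split T.FullSubcategory} (h₁ : IsChi.{k, u, v, u', v'} D T M₁ c₁)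
    (h₂ : IsChi.{k, u, v, u', v'} D T M₂ c₂) (f : M₁ ⟶ M₂) (g : M₂ ⟶ M₃)
    (hf : ∀ X, Function.Injective (f.app X).hom)
    (hg : ∀ X, Function.Surjective (g.app X).hom)
    (hfg : ∀ X, Function.Exact (f.app X).hom (g.app X).hom) :
    IsChi.{k, u, v, u', v'} D T M₃ (c₂ - c₁) := by
  intro L
  have := L.hasZeroObject_preimage hT
  have := L.hasBinaryBiproducts_preimage hT
  obtain ⟨e₁, h₁', rfl⟩ := h₁ L
  obtain ⟨e₂, h₂', rfl⟩ := h₂ L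
  refine ⟨e₂ - e₁, HasEuler.cone h₁' h₂' (map_add_toStab L hM₂)
    (fun Y => (f.app (op ((L.toStab T).obj Y))).hom)
    (fun φ n => naturality_apply f ((L.toStab T).map φ) n)
    (fun Y => (g.app (op ((L.toStab T).obj Y))).hom)
    (fun φ n => naturality_apply g ((L.toStab T).map φ) n)
    (fun Y => hf _) (fun Y => hg _) (fun Y => hfg _), map_sub _ _ _⟩

omit hT in
lemma IsExchangeMap.eq_neg {β : K0Mod (stabFp D T) →+ K0Split T.FullSubcategory}
    (hβ : IsExchangeMap.{k, u, v, u', v'} D T β) {M : (StabSub D T)ᵒᵖ ⥤ ModuleCat.{v} K}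
    (hM : stabFp D T M) {c : K0Split T.FullSubcategory} (hc : IsChi.{k, u, v, u', v'} D T M c) :
    β (K0Mod.cls M hM) = -c := by
  obtain ⟨L⟩ := hL
  obtain ⟨_, ⟨r, rfl⟩, rfl⟩ := hc L
  rw [(hβ L M hM).2 r, eulerSum, map_sum]
  simp only [map_zsmul, K0Split.map_cls]

variable [HasZeroObject C] [HasBinaryBiproducts C] (hD : IsExtriangulated D)

include hD

omit hL in
lemma isChi_kernel {X Y Z : C} {x : X ⟶ Y} {y : Y ⟶ Z} (hr : Confl D x y)
    {cX cY cZ : K0Split T.FullSubcategory} (hX : IsIndexOf D T X cX) (hY : IsIndexOf D T Y cY)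
    (hZ : IsIndexOf D T Z cZ) :
    IsChi.{k, u, v, u', v'} D T (kernel (stabExtMap D T x)) (cX - cY + cZ) := fun L =>
  hasChi_of_confl hD hT L hr hX hY hZ (kernel.ι _) (injective_app _) (exact_kernel_app _)

-- Ext(-, L) vanishes on T, so Ext(-, X) is the whole kernel of Ext(-, X) → Ext(-, L). Its Euler
-- characteristic is therefore index minus coindex of X.
omit hL in
lemma isChi_of_iso_stabExt {X : C} {cX : K0Split T.FullSubcategory} (hX : IsIndexOf D T X cX)
    (x : Coresolution D T X) {M : (StabSub D T)ᵒᵖ ⥤ ModuleCat.{v} K} (e : M ≅ stabExt D T X) :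
    IsChi.{k, u, v, u', v'} D T M (cX - K0Split.cls x.L + K0Split.cls x.L') := fun L =>
  hasChi_of_confl hD hT L ⟨x.δ, x.real⟩ hX (isIndexOf_of_mem hD hT x.L) (isIndexOf_of_mem hD hT x.L')
    e.hom (injective_app _) fun W m =>
      ⟨fun _ => surjective_app e.hom W m, fun _ => hT.ext_eq_zero W.unop.2 x.L.2 _⟩

variable (hF : IsFrobenius D)

include hF

omit hL in
lemma exists_iso_stabExt {M : (StabSub D T)ᵒᵖ ⥤ ModuleCat.{v} K} (hM : stabFp D T M) :
    ∃ X : C, Nonempty (M ≅ stabExt D T X) := by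
  obtain ⟨X, e⟩ := exists_iso_extMod (hD.hasExactConfl.quotData le_rfl) (clusterTilting_stabProp hT)
    (defl_stab hD hF) hM
  exact ⟨X.as, e⟩

omit hL in
lemma exists_isChi {M : (StabSub D T)ᵒᵖ ⥤ ModuleCat.{v} K} (hM : stabFp D T M) :
    ∃ c, IsChi.{k, u, v, u', v'} D T M c := by
  obtain ⟨X, ⟨e⟩⟩ := exists_iso_stabExt hT hD hF hM
  obtain ⟨x⟩ := nonempty_coresolution hD.hasExactConfl hT X
  obtain ⟨c, hc⟩ := exists_isIndexOf hD hT X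
  exact ⟨_, isChi_of_iso_stabExt hT hD hc x e⟩

/-- Each finitely presented module has an Euler characteristic expressed by indices in C, hence the
same for all exact lifts. Additivity is the cone construction together with uniqueness. -/
theorem existsUnique_isExchangeMap : ∃! β, IsExchangeMap.{k, u, v, u', v'} D T β := by
  choose χ hχ using fun M : Subtype (stabFp D T) =>
    exists_isChi.{k, u, v, u', v'} hT hD hF M.2
  refine existsUnique_of_exists_of_unique ⟨K0Mod.lift (fun M hM => -χ ⟨M, hM⟩) ?_, ?_⟩ ?_
  · intro S h₁ h₂ h₃ hS
    have := hS.mono_f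
    have := hS.epi_g
    have h := (hχ ⟨_, h₃⟩).unique hT hL (fpMod.isModule h₃) ((hχ ⟨_, h₁⟩).sub hT
      (fpMod.isModule h₂) (hχ ⟨_, h₂⟩) S.f S.g (injective_app _) (surjective_app _)
      (app_of_exact hS.exact))
    rw [h]
    abel
  · intro L M hM
    obtain ⟨_, ⟨r, rfl⟩, h⟩ := hχ ⟨M, hM⟩ L
    refine ⟨⟨r⟩, fun r' => ?_⟩
    have h' : L.HasChi T ((L.toStab T).op ⋙ M) (K0Split.map (L.toSub T) (eulerSum r'.X (r'.len + 1))) :=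
      ⟨_, ⟨r', rfl⟩, rfl⟩
    rw [K0Mod.lift_cls, (hχ ⟨M, hM⟩ L).unique hT L h' (map_add_toStab L (fpMod.isModule hM)),
      eulerSum, map_sum]
    simp only [map_zsmul, K0Split.map_cls]
  · intro β β' h h'
    exact K0Mod.hom_ext fun M hM => by
      rw [h.eq_neg hL hM (hχ ⟨M, hM⟩), h'.eq_neg hL hM (hχ ⟨M, hM⟩)]

end Chi

end ClusterIso

namespace ClusterIso

/-! ### Additive invariants of objects -/

section AdditiveRel

variable {C : Type u} [Category.{v} C] [Preadditive C] [HasBinaryBiproducts C] {G : Type*}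
  [AddCommGroup G]

/-- A relation between objects and elements of an abelian group which is an additive function. -/
structure IsAdditiveRel (R : C → G → Prop) : Prop where
  exists_rel : ∀ X, ∃ c, R X c
  unique : ∀ {X c c'}, R X c → R X c' → c = c'
  of_iso : ∀ {X Y c}, (X ≅ Y) → R X c → R Y c
  add : ∀ {X Y c c'}, R X c → R Y c' → R (X ⊞ Y) (c + c')

/-- Index and coindex are computed from arbitrary conflations, so they are naturally relations.
Functionality and additivity are all that is needed for a homomorphism. -/
lemma IsAdditiveRel.exists_hom {R : C → G → Prop} (hR : IsAdditiveRel R) (U : ObjectProperty C) :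
    ∃ f : K0Split U.FullSubcategory →+ G, ∀ (X : U.FullSubcategory) c, R X.obj c →
      f (K0Split.cls X) = c := by
  choose φ hφ using hR.exists_rel
  refine ⟨K0Split.lift (fun X => φ X.obj) fun {X Y} b hb => ?_, fun X c hc => ?_⟩
  · let e : X.obj ⊞ Y.obj ≅ b.pt.obj :=
      { hom := biprod.desc b.inl.hom b.inr.hom
        inv := biprod.lift b.fst.hom b.snd.hom
        hom_inv_id := by
          have h₁ := congrArg (fun f => f.hom) b.inl_fst
          have h₂ := congrArg (fun f => f.hom) b.inl_snd
          have h₃ := congrArg (fun f => f.hom) b.inr_fst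
          have h₄ := congrArg (fun f => f.hom) b.inr_snd
          dsimp at h₁ h₂ h₃ h₄
          apply biprod.hom_ext' <;> apply biprod.hom_ext <;> simp [h₁, h₂, h₃, h₄]
        inv_hom_id := by
          rw [biprod.lift_desc]
          exact congrArg (fun f => f.hom) (IsBilimit.binary_total hb) }
    exact hR.unique (hφ _) (hR.of_iso e (hR.add (hφ _) (hφ _)))
  · rw [K0Split.lift_cls]
    exact hR.unique (hφ _) hc

end AdditiveRel

/-! ### Index and coindex -/

section Index

variable {K : Type k} [Field K] {C : Type u} [Category.{v} C] [Preadditive C] [Linear K C]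

/-- `c` is the coindex of `X` with respect to `T`, computed from some conflation. -/
def IsCoindexOf (D : ExtData K C) (T : ObjectProperty C) (X : C) (c : K0Split T.FullSubcategory) :
    Prop :=
  ∃ x : Coresolution D T X, c = K0Split.cls x.L - K0Split.cls x.L'

variable {D : ExtData K C} {T : ObjectProperty C}

lemma IsIndex.eq {U : ObjectProperty C}
    {f : K0Split U.FullSubcategory →+ K0Split T.FullSubcategory} (hf : IsIndex D T U f)
    (X : U.FullSubcategory) {c : K0Split T.FullSubcategory} (hc : IsIndexOf D T X.obj c) :
    f (K0Split.cls X) = c := by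
  obtain ⟨N, R, i, p, h, rfl⟩ := hc
  exact (hf X).2 N R i p h

lemma IsCoindex.eq {U : ObjectProperty C}
    {f : K0Split U.FullSubcategory →+ K0Split T.FullSubcategory} (hf : IsCoindex D T U f)
    (X : U.FullSubcategory) {c : K0Split T.FullSubcategory} (hc : IsCoindexOf D T X.obj c) :
    f (K0Split.cls X) = c := by
  obtain ⟨x, rfl⟩ := hc
  exact (hf X).2 x.L x.L' x.i x.p ⟨x.δ, x.real⟩

variable (hT : ClusterTilting D T)

include hT in
lemma existsUnique_isIndex_of_hom (hD : HasExactConfl D) {U : ObjectProperty C}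
    (h : ∃ f : K0Split U.FullSubcategory →+ K0Split T.FullSubcategory,
      ∀ (X : U.FullSubcategory) c, IsIndexOf D T X.obj c → f (K0Split.cls X) = c) :
    ∃! f, IsIndex D T U f := by
  obtain ⟨f, hf⟩ := h
  refine ⟨f, fun X => ⟨hT.exists_index hD X.obj, fun N R i p h =>
    hf X _ ⟨N, R, i, p, h, rfl⟩⟩, fun g hg => K0Split.hom_ext fun X => ?_⟩
  obtain ⟨N, R, i, p, h⟩ := hT.exists_index hD X.obj
  rw [(hg X).2 N R i p h, hf X _ ⟨N, R, i, p, h, rfl⟩]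

include hT in
lemma existsUnique_isCoindex_of_hom (hD : HasExactConfl D) {U : ObjectProperty C}
    (h : ∃ f : K0Split U.FullSubcategory →+ K0Split T.FullSubcategory,
      ∀ (X : U.FullSubcategory) c, IsCoindexOf D T X.obj c → f (K0Split.cls X) = c) :
    ∃! f, IsCoindex D T U f := by
  obtain ⟨f, hf⟩ := h
  refine ⟨f, fun X => ⟨hT.exists_coindex hD X.obj, fun L N i p ⟨δ, h⟩ =>
    hf X _ ⟨⟨L, N, i, p, δ, h⟩, rfl⟩⟩, fun g hg => K0Split.hom_ext fun X => ?_⟩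
  obtain ⟨x⟩ := nonempty_coresolution hD hT X.obj
  rw [hg.eq X ⟨x, rfl⟩, hf X _ ⟨x, rfl⟩]

variable [HasZeroObject C] [HasBinaryBiproducts C] (hD : IsExtriangulated D)

include hT

omit [HasZeroObject C] in
lemma K0Split.cls_of_biprod (X Y : T.FullSubcategory) :
    K0Split.cls (⟨X.obj ⊞ Y.obj, hT.of_biprod X.2 Y.2⟩ : T.FullSubcategory) =
      K0Split.cls X + K0Split.cls Y :=
  K0Split.cls_bicone (X := X) (Y := Y) ⟨⟨X.obj ⊞ Y.obj, hT.of_biprod X.2 Y.2⟩,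
    ObjectProperty.homMk biprod.fst, ObjectProperty.homMk biprod.snd,
    ObjectProperty.homMk biprod.inl, ObjectProperty.homMk biprod.inr,
    ObjectProperty.hom_ext _ biprod.inl_fst, ObjectProperty.hom_ext _ biprod.inl_snd,
    ObjectProperty.hom_ext _ biprod.inr_fst, ObjectProperty.hom_ext _ biprod.inr_snd⟩
    (isBinaryBilimitOfTotal _ (ObjectProperty.hom_ext _ biprod.total))

include hD

lemma isAdditiveRel_isIndexOf (hL : Nonempty (ExactLift.{k, u, v, u', v'} D)) :
    IsAdditiveRel (IsIndexOf D T) where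
  exists_rel := exists_isIndexOf hD hT
  unique := IsIndexOf.unique hD hT hL
  of_iso e := by
    rintro ⟨N, R, i, p, ⟨δ, h⟩, rfl⟩
    exact ⟨N, R, _, _, ⟨_, hD.real_iso h (Iso.refl _) e⟩, rfl⟩
  add {X Y c c'} := by
    rintro ⟨N, R, i, p, ⟨δ, h⟩, rfl⟩ ⟨N', R', i', p', ⟨δ', h'⟩, rfl⟩
    refine ⟨⟨_, hT.of_biprod N.2 N'.2⟩, ⟨_, hT.of_biprod R.2 R'.2⟩, _, _,
      ⟨_, hD.real_sum _ _ _ _ _ _ h h'⟩, ?_⟩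
    rw [K0Split.cls_of_biprod hT, K0Split.cls_of_biprod hT]
    abel

lemma isAdditiveRel_isCoindexOf (hL : Nonempty (ExactLift.{k, u, v, u', v'} D)) :
    IsAdditiveRel (IsCoindexOf D T) where
  exists_rel X :=
    have ⟨x⟩ := nonempty_coresolution hD.hasExactConfl hT X
    ⟨_, x, rfl⟩
  unique {X} := by
    rintro _ _ ⟨x, rfl⟩ ⟨y, rfl⟩
    obtain ⟨c, hc⟩ := exists_isIndexOf hD hT X
    -- Index minus coindex is the Euler characteristic of Ext(-, X), so uniqueness of the coindex
    -- follows by fixing one index.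
    have h := (isChi_of_iso_stabExt.{k, u, v, u', v'} hT hD hc x (Iso.refl _)).unique hT hL
      (isModule_extMod _) (isChi_of_iso_stabExt hT hD hc y (Iso.refl _))
    rw [sub_add, sub_add] at h
    exact sub_right_injective h
  of_iso e := by
    rintro ⟨x, rfl⟩
    exact ⟨⟨x.L, x.L', _, _, _, hD.real_iso x.real e (Iso.refl _)⟩, rfl⟩
  add {X Y c c'} := by
    rintro ⟨x, rfl⟩ ⟨y, rfl⟩
    refine ⟨⟨⟨_, hT.of_biprod x.L.2 y.L.2⟩, ⟨_, hT.of_biprod x.L'.2 y.L'.2⟩, _, _, _,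
      hD.real_sum _ _ _ _ _ _ x.real y.real⟩, ?_⟩
    rw [K0Split.cls_of_biprod hT, K0Split.cls_of_biprod hT]
    abel

theorem existsUnique_isIndex (hL : Nonempty (ExactLift.{k, u, v, u', v'} D)) (U : ObjectProperty C) :
    ∃! f, IsIndex D T U f :=
  existsUnique_isIndex_of_hom hT hD.hasExactConfl ((isAdditiveRel_isIndexOf hT hD hL).exists_hom U)

theorem existsUnique_isCoindex (hL : Nonempty (ExactLift.{k, u, v, u', v'} D))
    (U : ObjectProperty C) : ∃! f, IsCoindex D T U f :=
  existsUnique_isCoindex_of_hom hT hD.hasExactConfl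
    ((isAdditiveRel_isCoindexOf hT hD hL).exists_hom U)

end Index

/-! ### The squares on finitely presented modules -/

section Squares

variable {K : Type k} [Field K] {C : Type u} [Category.{v} C] [Preadditive C] [Linear K C]

/-- The long exact sequence Ext(-, X) → Ext(-, Y) → Ext(-, Z), completed by the kernel of its first
map and the cokernel of its last, has alternating sum zero. -/
lemma cls_cokernel_extMap {D : ExtData K C} (hD : HasExactConfl D) {T : ObjectProperty C}
    {Q : ObjectProperty (T.FullSubcategoryᵒᵖ ⥤ ModuleCat.{v} K)} (hQ : IsAbelianClass Q)
    {X Y Z : C} {x : X ⟶ Y} {y : Y ⟶ Z} (hr : Confl D x y) (hX : Q (extMod D T X))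
    (hY : Q (extMod D T Y)) (hZ : Q (extMod D T Z)) :
    K0Mod.cls _ (hQ.cokernel hY hZ (extMap D T y)) = K0Mod.cls _ hX - K0Mod.cls _ hY +
      K0Mod.cls _ hZ - K0Mod.cls _ (hQ.kernel hX hY (extMap D T x)) := by
  obtain ⟨δ, hr⟩ := hr
  have hw : extMap D T x ≫ extMap D T y = 0 := by
    ext W (ε : D.Ext W.unop.obj X)
    have : D.push _ y (D.push _ x ε) = 0 := by
      rw [← D.push_comp, hD.comp_zero hr, D.push_zero]
    exact this
  have hl : ∀ W m, ((kernel.ι (extMap D T y)).app W).hom (((kernel.lift _ _ hw).app W).hom m) =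
      ((extMap D T x).app W).hom m := fun W m =>
    congrArg (fun φ => (φ.app W).hom m) (kernel.lift_ι _ _ hw)
  have h₁ := K0Mod.cls_of_app (hQ.kernel hX hY (extMap D T x)) hX (hQ.kernel hY hZ (extMap D T y))
    (kernel.ι _) (kernel.lift _ _ hw) (injective_app _)
    (fun W n => by
      obtain ⟨ε, hε⟩ := hD.ext_push hr (W := W.unop.obj) (((kernel.ι (extMap D T y)).app W).hom n)
        ((exact_kernel_app (extMap D T y) W).apply_apply_eq_zero n)
      exact ⟨ε, injective_app (kernel.ι (extMap D T y)) W ((hl W ε).trans hε)⟩)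
    (fun W m => by
      rw [← exact_kernel_app (extMap D T x) W m, ← hl,
        map_eq_zero_iff _ (injective_app (kernel.ι (extMap D T y)) W)])
  have h₂ := hQ.cls_sub_cls hY hZ (extMap D T y)
  rw [h₁, sub_eq_iff_eq_add.1 h₂]
  abel

variable {D : ExtData K C} {T U : ObjectProperty C} [HasZeroObject C] [HasBinaryBiproducts C]
  (hD : IsExtriangulated D) (hF : IsFrobenius D) (hT : ClusterTilting D T)
  (hU : ClusterTilting D U)

/-- The image of a coresolution in the stable category. -/
def Coresolution.stab {X : C} (x : Coresolution D U X) :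
    Coresolution (stabData D) (stabProp D U) ((stabπ D).obj X) :=
  ⟨⟨(stabπ D).obj x.L.obj, x.L.2⟩, ⟨(stabπ D).obj x.L'.obj, x.L'.2⟩, (stabπ D).map x.i,
    (stabπ D).map x.p, x.δ, quotData_real_map D le_rfl x.real⟩

/-- The image of a resolution in the stable category. -/
def Resolution.stab {X : C} (x : Resolution D U X) :
    Resolution (stabData D) (stabProp D U) ((stabπ D).obj X) :=
  ⟨⟨(stabπ D).obj x.N.obj, x.N.2⟩, ⟨(stabπ D).obj x.R.obj, x.R.2⟩, (stabπ D).map x.i,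
    (stabπ D).map x.p, x.δ, quotData_real_map D le_rfl x.real⟩

include hD hF hT

lemma isAbelianClass_stabFp : IsAbelianClass (stabFp D T) :=
  have := hasZeroObject_stab (D := D)
  have := hasBinaryBiproducts_addQuot (K := K) (ProjInj D)
  isAbelianClass_fpMod (hD.hasExactConfl.quotData le_rfl) (clusterTilting_stabProp hT)
    (defl_stab hD hF)

include hU

/-- The map `Ind` given by coresolutions in the stable category. -/
def indBar (c : ∀ t : StabSub D T, Coresolution (stabData D) (stabProp D U) t.obj) :
    K0Mod (stabFp D U) →+ K0Mod (stabFp D T) :=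
  have := hasZeroObject_stab (D := D)
  have := hasBinaryBiproducts_addQuot (K := K) (ProjInj D)
  fpIndBar (hD.hasExactConfl.quotData le_rfl) (clusterTilting_stabProp hU)
    (clusterTilting_stabProp hT) (defl_stab hD hF) c

/-- The map `Coind` given by resolutions in the stable category. -/
def coindBar (r : ∀ t : StabSub D T, Resolution (stabData D) (stabProp D U) t.obj) :
    K0Mod (stabFp D U) →+ K0Mod (stabFp D T) :=
  have := hasZeroObject_stab (D := D)
  have := hasBinaryBiproducts_addQuot (K := K) (ProjInj D)
  fpCoindBar (hD.hasExactConfl.quotData le_rfl) (clusterTilting_stabProp hU)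
    (clusterTilting_stabProp hT) (defl_stab hD hF) r

lemma isIndBar_indBar (c : ∀ t : StabSub D T, Coresolution (stabData D) (stabProp D U) t.obj) :
    IsIndBar D T U (indBar hD hF hT hU c) := by
  rintro X L L' N R iL pL iR pR hL hL' hN hR ⟨δ, h⟩ ⟨δ', h'⟩
  have := hasZeroObject_stab (D := D)
  have := hasBinaryBiproducts_addQuot (K := K) (ProjInj D)
  let x : Coresolution D U X := ⟨⟨L, hL⟩, ⟨L', hL'⟩, iL, pL, δ, h⟩
  let y : Resolution D U X := ⟨⟨N, hN⟩, ⟨R, hR⟩, iR, pR, δ', h'⟩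
  exact ⟨_, _, _, fpIndBar_cls (hD.hasExactConfl.quotData le_rfl) (clusterTilting_stabProp hU)
    (clusterTilting_stabProp hT) (defl_stab hD hF) c x.stab y.stab⟩

lemma isCoindBar_coindBar (r : ∀ t : StabSub D T, Resolution (stabData D) (stabProp D U) t.obj) :
    IsCoindBar D T U (coindBar hD hF hT hU r) := by
  rintro X L L' N R iL pL iR pR hL hL' hN hR ⟨δ, h⟩ ⟨δ', h'⟩
  have := hasZeroObject_stab (D := D)
  have := hasBinaryBiproducts_addQuot (K := K) (ProjInj D)
  let x : Coresolution D U X := ⟨⟨L, hL⟩, ⟨L', hL'⟩, iL, pL, δ, h⟩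
  let y : Resolution D U X := ⟨⟨N, hN⟩, ⟨R, hR⟩, iR, pR, δ', h'⟩
  exact ⟨_, _, _, fpCoindBar_cls (hD.hasExactConfl.quotData le_rfl) (clusterTilting_stabProp hU)
    (clusterTilting_stabProp hT) (defl_stab hD hF) r x.stab y.stab⟩

omit hT in
/-- Homomorphisms out of `K₀(fpmod)` are determined by the classes of the modules `Ext(-, X)`. -/
lemma hom_ext_of_stabExt {G : Type*} [AddCommGroup G] {f g : K0Mod (stabFp D U) →+ G}
    (h : ∀ (X : C) (_ : Coresolution D U X) (_ : Resolution D U X)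
      (hX : stabFp D U (stabExt D U X)), f (K0Mod.cls _ hX) = g (K0Mod.cls _ hX)) : f = g := by
  refine K0Mod.hom_ext fun M hM => ?_
  obtain ⟨X, ⟨e⟩⟩ := exists_iso_stabExt hU hD hF hM
  obtain ⟨x⟩ := nonempty_coresolution hD.hasExactConfl hU X
  obtain ⟨y⟩ := nonempty_resolution hD.hasExactConfl hU X
  have hQ := isAbelianClass_stabFp hD hF hU
  have hX : stabFp D U (stabExt D U X) := hQ.of_iso hM e.symm
  rw [hQ.cls_eq hM hX e]
  exact h X x y hX

theorem existsUnique_isIndBar : ∃! f, IsIndBar D T U f := by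
  have c := fun t : StabSub D T => Classical.choice (nonempty_coresolution (hD.hasExactConfl.quotData le_rfl)
    (clusterTilting_stabProp hU) t.obj)
  refine ⟨indBar hD hF hT hU c, isIndBar_indBar hD hF hT hU _, fun g hg =>
    hom_ext_of_stabExt hD hF hU fun X x y hX => ?_⟩
  obtain ⟨_, _, _, h⟩ := hg X _ _ _ _ x.i x.p y.i y.p x.L.2 x.L'.2 y.N.2 y.R.2 ⟨_, x.real⟩
    ⟨_, y.real⟩
  obtain ⟨_, _, _, h'⟩ := isIndBar_indBar hD hF hT hU c X _ _ _ _ x.i x.p y.i y.p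
    x.L.2 x.L'.2 y.N.2 y.R.2 ⟨_, x.real⟩ ⟨_, y.real⟩
  rw [h, h']

theorem existsUnique_isCoindBar : ∃! f, IsCoindBar D T U f := by
  have r := fun t : StabSub D T => Classical.choice (nonempty_resolution (hD.hasExactConfl.quotData le_rfl)
    (clusterTilting_stabProp hU) t.obj)
  refine ⟨coindBar hD hF hT hU r, isCoindBar_coindBar hD hF hT hU _, fun g hg =>
    hom_ext_of_stabExt hD hF hU fun X x y hX => ?_⟩
  obtain ⟨_, _, _, h⟩ := hg X _ _ _ _ x.i x.p y.i y.p x.L.2 x.L'.2 y.N.2 y.R.2 ⟨_, x.real⟩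
    ⟨_, y.real⟩
  obtain ⟨_, _, _, h'⟩ := isCoindBar_coindBar hD hF hT hU r X _ _ _ _ x.i x.p y.i y.p
    x.L.2 x.L'.2 y.N.2 y.R.2 ⟨_, x.real⟩ ⟨_, y.real⟩
  rw [h, h']

variable (hL : Nonempty (ExactLift.{k, u, v, u', v'} D))
  {βT : K0Mod (stabFp D T) →+ K0Split T.FullSubcategory}
  {βU : K0Mod (stabFp D U) →+ K0Split U.FullSubcategory}
  (hβT : IsExchangeMap.{k, u, v, u', v'} D T βT) (hβU : IsExchangeMap.{k, u, v, u', v'} D U βU)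

include hL hβT hβU

/-- The two kernels have Euler characteristics ind X - ind L + ind L' and ind N - ind R + ind X. In
their difference ind X cancels, and only indices of objects of U remain. -/
theorem exchange_comp_indBar {ind : K0Split U.FullSubcategory →+ K0Split T.FullSubcategory}
    {Ind : K0Mod (stabFp D U) →+ K0Mod (stabFp D T)} (hind : IsIndex D T U ind)
    (hInd : IsIndBar D T U Ind) : βT.comp Ind = ind.comp βU := by
  refine hom_ext_of_stabExt hD hF hU fun X x y hX => ?_
  obtain ⟨_, hl, hr, h⟩ := hInd X _ _ _ _ x.i x.p y.i y.p x.L.2 x.L'.2 y.N.2 y.R.2 ⟨_, x.real⟩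
    ⟨_, y.real⟩
  obtain ⟨cX, hcX⟩ := exists_isIndexOf hD hT X
  obtain ⟨cL, hcL⟩ := exists_isIndexOf hD hT x.L.obj
  obtain ⟨cL', hcL'⟩ := exists_isIndexOf hD hT x.L'.obj
  obtain ⟨cN, hcN⟩ := exists_isIndexOf hD hT y.N.obj
  obtain ⟨cR, hcR⟩ := exists_isIndexOf hD hT y.R.obj
  have hX' : IsIndexOf D U X (K0Split.cls y.R - K0Split.cls y.N) :=
    ⟨y.N, y.R, y.i, y.p, ⟨_, y.real⟩, rfl⟩
  rw [AddMonoidHom.comp_apply, AddMonoidHom.comp_apply, h, map_sub,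
    hβT.eq_neg hL hl (isChi_kernel hT hD ⟨_, x.real⟩ hcX hcL hcL'),
    hβT.eq_neg hL hr (isChi_kernel hT hD ⟨_, y.real⟩ hcN hcR hcX),
    hβU.eq_neg hL hX (isChi_of_iso_stabExt hU hD hX' x (Iso.refl _))]
  simp only [map_neg, map_add, map_sub]
  rw [hind.eq _ hcL, hind.eq _ hcL', hind.eq _ hcN, hind.eq _ hcR]
  abel

/-- The cancellation of `exchange_comp_indBar`, with coindices: this time coind X drops out of the
difference of the two cokernels. -/
theorem exchange_comp_coindBar {coind : K0Split U.FullSubcategory →+ K0Split T.FullSubcategory}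
    {Coind : K0Mod (stabFp D U) →+ K0Mod (stabFp D T)} (hcoind : IsCoindex D T U coind)
    (hCoind : IsCoindBar D T U Coind) : βT.comp Coind = coind.comp βU := by
  have hQ := isAbelianClass_stabFp hD hF hT
  have hfp : ∀ X, stabFp D T (stabExt D T X) := fun X =>
    fpMod_extMod (hD.hasExactConfl.quotData le_rfl) (clusterTilting_stabProp hT) _
  have hext : ∀ {X c d}, IsCoindexOf D T X c → IsIndexOf D T X d →
      βT (K0Mod.cls _ (hfp X)) = c - d := by
    rintro X _ d ⟨x, rfl⟩ hd
    rw [hβT.eq_neg hL _ (isChi_of_iso_stabExt hT hD hd x (Iso.refl _))]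
    abel
  -- Each Ext(-, X) contributes coindex minus index, and the kernel in the exact sequence
  -- contributes minus its alternating sum of indices. All indices cancel.
  have hcoker : ∀ {X Y Z : C} {x : X ⟶ Y} {y : Y ⟶ Z} {cX cY cZ} (h : stabFp D T _), Confl D x y →
      IsCoindexOf D T X cX → IsCoindexOf D T Y cY → IsCoindexOf D T Z cZ →
      βT (K0Mod.cls (cokernel (stabExtMap D T y)) h) = cX - cY + cZ := by
    intro X Y Z x y cX cY cZ _ hr hX hY hZ
    obtain ⟨dX, hdX⟩ := exists_isIndexOf hD hT X
    obtain ⟨dY, hdY⟩ := exists_isIndexOf hD hT Y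
    obtain ⟨dZ, hdZ⟩ := exists_isIndexOf hD hT Z
    have hk := isChi_kernel.{k, u, v, u', v'} hT hD hr hdX hdY hdZ
    obtain ⟨δ, hr⟩ := hr
    have h := cls_cokernel_extMap (hD.hasExactConfl.quotData le_rfl) hQ
      ⟨δ, quotData_real_map D le_rfl hr⟩ (hfp X) (hfp Y) (hfp Z)
    have h₁ := hext hX hdX
    have h₂ := hext hY hdY
    have h₃ := hext hZ hdZ
    have h₄ := hβT.eq_neg hL (hQ.kernel (hfp X) (hfp Y) _) hk
    refine (congrArg βT h).trans ?_
    rw [map_sub, map_add, map_sub]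
    refine (congrArg₂ _ (congrArg₂ _ (congrArg₂ _ h₁ h₂) h₃) h₄).trans ?_
    abel
  refine hom_ext_of_stabExt hD hF hU fun X x y hX => ?_
  obtain ⟨_, hl, hr, h⟩ := hCoind X _ _ _ _ x.i x.p y.i y.p x.L.2 x.L'.2 y.N.2 y.R.2 ⟨_, x.real⟩
    ⟨_, y.real⟩
  have hrel := isAdditiveRel_isCoindexOf hT hD hL
  obtain ⟨cX, hcX⟩ := hrel.exists_rel X
  obtain ⟨cL, hcL⟩ := hrel.exists_rel x.L.obj
  obtain ⟨cL', hcL'⟩ := hrel.exists_rel x.L'.obj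
  obtain ⟨cN, hcN⟩ := hrel.exists_rel y.N.obj
  obtain ⟨cR, hcR⟩ := hrel.exists_rel y.R.obj
  have hX' : IsIndexOf D U X (K0Split.cls y.R - K0Split.cls y.N) :=
    ⟨y.N, y.R, y.i, y.p, ⟨_, y.real⟩, rfl⟩
  rw [AddMonoidHom.comp_apply, AddMonoidHom.comp_apply, h, map_sub,
    hcoker _ ⟨_, x.real⟩ hcX hcL hcL', hcoker _ ⟨_, y.real⟩ hcN hcR hcX,
    hβU.eq_neg hL hX (isChi_of_iso_stabExt hU hD hX' x (Iso.refl _))]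
  simp only [map_neg, map_add, map_sub]
  rw [hcoind.eq _ hcL, hcoind.eq _ hcL', hcoind.eq _ hcN, hcoind.eq _ hcR]
  abel

end Squares

end ClusterIso

namespace ClusterIso

/-! ### Objects with local endomorphism ring -/

section LocalObjects

variable {A : Type u} [Category.{v} A] [Preadditive A]

/-- Objects with local endomorphism ring. -/
structure IsLocalObj (Z : A) : Prop where
  id_ne_zero : 𝟙 Z ≠ 0
  isIso_or : ∀ f : Z ⟶ Z, IsIso f ∨ IsIso (𝟙 Z - f)

lemma isLocalObj_of_isLocalRing {Z : A} [IsLocalRing (End Z)] : IsLocalObj Z where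
  id_ne_zero := one_ne_zero (α := End Z)
  isIso_or f := by
    rcases IsLocalRing.isUnit_or_isUnit_of_add_one (R := End Z) (a := f) (b := 𝟙 Z - f)
      (add_sub_cancel _ _) with h | h
    · exact Or.inl ((isUnit_iff_isIso _).1 h)
    · exact Or.inr ((isUnit_iff_isIso _).1 h)

lemma not_isZero_iff {X : A} : ¬ IsZero X ↔ 𝟙 X ≠ 0 := by
  rw [ne_eq, IsZero.iff_id_eq_zero]

namespace IsLocalObj

lemma not_isIso_zero {Z : A} (hZ : IsLocalObj Z) : ¬ IsIso (0 : Z ⟶ Z) := fun h => by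
  apply hZ.id_ne_zero
  rw [← IsIso.hom_inv_id (0 : Z ⟶ Z), zero_comp]

lemma isIso_of_add {Z : A} (hZ : IsLocalObj Z) {f g : Z ⟶ Z} (h : IsIso (f + g)) :
    IsIso f ∨ IsIso g := by
  rcases hZ.isIso_or (f ≫ inv (f + g)) with h' | h'
  · exact Or.inl (IsIso.of_isIso_comp_right f (inv (f + g)))
  · have : 𝟙 Z - f ≫ inv (f + g) = g ≫ inv (f + g) := by
      rw [← IsIso.hom_inv_id (f + g), Preadditive.add_comp, add_sub_cancel_left]
    rw [this] at h'
    exact Or.inr (IsIso.of_isIso_comp_right g (inv (f + g)))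

lemma exists_isIso_of_sum {Z : A} (hZ : IsLocalObj Z) {ι : Type*} {s : Finset ι} {φ : ι → (Z ⟶ Z)}
    (h : IsIso (∑ i ∈ s, φ i)) : ∃ i ∈ s, IsIso (φ i) := by
  classical
  induction s using Finset.induction_on with
  | empty => exact absurd (by simpa using h) hZ.not_isIso_zero
  | insert i s hi ih =>
    rw [Finset.sum_insert hi] at h
    rcases hZ.isIso_of_add h with h | h
    · exact ⟨i, Finset.mem_insert_self i s, h⟩
    · obtain ⟨j, hj, hj'⟩ := ih h
      exact ⟨j, Finset.mem_insert_of_mem hj, hj'⟩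

/-- Nonzero retracts of local objects are isomorphic to them. -/
lemma nonempty_iso_of_retract {X Z : A} (hZ : IsLocalObj Z) (i : X ⟶ Z) (r : Z ⟶ X)
    (hir : i ≫ r = 𝟙 X) (hX : 𝟙 X ≠ 0) : Nonempty (X ≅ Z) := by
  have hidem : (r ≫ i) ≫ (r ≫ i) = r ≫ i := by
    rw [Category.assoc, ← Category.assoc i, hir, Category.id_comp]
  rcases hZ.isIso_or (r ≫ i) with h | h
  · exact ⟨⟨i, r, hir, by rwa [← cancel_epi (r ≫ i), Category.comp_id]⟩⟩
  · have h0 : i ≫ (𝟙 Z - r ≫ i) = 0 := by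
      rw [Preadditive.comp_sub, ← Category.assoc, hir, Category.id_comp, Category.comp_id, sub_self]
    have hi : i = 0 := by rwa [← cancel_mono (𝟙 Z - r ≫ i), zero_comp]
    exact absurd (by rw [← hir, hi, zero_comp]) hX

lemma nonempty_iso_of_isIso {X Z : A} (hX : IsLocalObj X) (hZ : 𝟙 Z ≠ 0) {g : Z ⟶ X} {f : X ⟶ Z}
    (h : IsIso (g ≫ f)) : Nonempty (Z ≅ X) :=
  hX.nonempty_iso_of_retract g (f ≫ inv (g ≫ f))
    (by rw [← Category.assoc, IsIso.hom_inv_id]) hZ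

lemma of_iso {X Z : A} (hZ : IsLocalObj Z) (e : X ≅ Z) : IsLocalObj X where
  id_ne_zero h := hZ.id_ne_zero (by
    rw [← e.inv_hom_id, ← Category.id_comp e.hom, h, zero_comp, Limits.comp_zero])
  isIso_or f := by
    have h₁ : f = e.hom ≫ (e.inv ≫ f ≫ e.hom) ≫ e.inv := by simp
    have h₂ : 𝟙 X - f = e.hom ≫ (𝟙 Z - e.inv ≫ f ≫ e.hom) ≫ e.inv := by simp
    rcases hZ.isIso_or (e.inv ≫ f ≫ e.hom) with h | h
    · left
      rw [h₁]
      infer_instance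
    · right
      rw [h₂]
      infer_instance

end IsLocalObj

/-- `X` is a finite direct sum of objects with local endomorphism rings. -/
def LocalDecomp (X : A) : Prop :=
  ∃ (n : ℕ) (f : Fin n → A) (i : ∀ j, f j ⟶ X) (p : ∀ j, X ⟶ f j) (s : Finset (Fin n)),
    (∀ j ∈ s, IsLocalObj (f j)) ∧ (∀ j ∈ s, i j ≫ p j = 𝟙 (f j)) ∧ ∑ j ∈ s, p j ≫ i j = 𝟙 X

/-- Up to isomorphism, only finitely many local objects are retracts of a direct sum of local
objects. -/
lemma LocalDecomp.exists_finset {V : A} (hV : LocalDecomp V) : ∃ s : Finset A,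
    ∀ (Z : A) (φ : Z ⟶ V) (ψ : V ⟶ Z), IsLocalObj Z → IsIso (φ ≫ ψ) →
      ∃ W ∈ s, Nonempty (Z ≅ W) := by
  classical
  obtain ⟨n, f, i, p, s, hs, -, hsum⟩ := hV
  refine ⟨s.image f, fun Z φ ψ hZ h => ?_⟩
  -- An isomorphism of a local object written as a sum has an invertible summand, so Z is a retract
  -- of one `f j`, hence isomorphic to it.
  have hφψ : φ ≫ ψ = ∑ j ∈ s, (φ ≫ p j) ≫ (i j ≫ ψ) := by
    conv_lhs => rw [← Category.id_comp ψ, ← hsum]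
    simp [Preadditive.sum_comp, Preadditive.comp_sum]
  rw [hφψ] at h
  obtain ⟨j, hj, h⟩ := hZ.exists_isIso_of_sum h
  exact ⟨f j, Finset.mem_image_of_mem f hj, (hs j hj).nonempty_iso_of_isIso hZ.id_ne_zero h⟩

lemma LocalDecomp.exists_local {X : A} (hX : LocalDecomp X) (h0 : 𝟙 X ≠ 0) :
    ∃ (Z : A) (i : Z ⟶ X) (p : X ⟶ Z), IsLocalObj Z ∧ i ≫ p = 𝟙 Z := by
  obtain ⟨n, f, i, p, s, hs, hip, hsum⟩ := hX
  obtain ⟨j, hj⟩ : s.Nonempty := by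
    rw [Finset.nonempty_iff_ne_empty]
    rintro rfl
    exact h0 (by simpa using hsum.symm)
  exact ⟨f j, i j, p j, hs j hj, hip j hj⟩

/-- A direct sum of finitely many given local objects. -/
lemma exists_sum_of_local [HasZeroObject A] [HasBinaryBiproducts A] (s : Finset A)
    (hs : ∀ W ∈ s, IsLocalObj W) : ∃ V : A,
    (∀ W ∈ s, ∃ (i : W ⟶ V) (p : V ⟶ W), i ≫ p = 𝟙 W) ∧
    ∀ (Z : A) (φ : Z ⟶ V) (ψ : V ⟶ Z), IsLocalObj Z → IsIso (φ ≫ ψ) →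
      ∃ W ∈ s, Nonempty (Z ≅ W) := by
  classical
  induction s using Finset.induction_on with
  | empty =>
    obtain ⟨O, hO⟩ := HasZeroObject.zero (C := A)
    refine ⟨O, by simp, fun Z φ ψ hZ h => absurd ?_ hZ.not_isIso_zero⟩
    rwa [hO.eq_of_tgt φ 0, zero_comp] at h
  | insert W s hW ih =>
    obtain ⟨V, h₁, h₂⟩ := ih fun W hW => hs W (Finset.mem_insert_of_mem hW)
    refine ⟨V ⊞ W, fun W' hW' => ?_, fun Z φ ψ hZ h => ?_⟩
    · rcases Finset.mem_insert.1 hW' with rfl | hW'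
      · exact ⟨biprod.inr, biprod.snd, biprod.inr_snd⟩
      · obtain ⟨i, p, hip⟩ := h₁ W' hW'
        exact ⟨i ≫ biprod.inl, biprod.fst ≫ p, by simp [hip]⟩
    · have : φ ≫ ψ = (φ ≫ biprod.fst) ≫ (biprod.inl ≫ ψ) + (φ ≫ biprod.snd) ≫ (biprod.inr ≫ ψ) := by
        conv_lhs => rw [← Category.id_comp ψ, ← biprod.total, Preadditive.add_comp,
          Preadditive.comp_add]
        simp only [Category.assoc]
      rw [this] at h
      rcases hZ.isIso_of_add h with h | h
      · obtain ⟨W', hW', e⟩ := h₂ Z _ _ hZ h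
        exact ⟨W', Finset.mem_insert_of_mem hW', e⟩
      · exact ⟨W, Finset.mem_insert_self W s,
          (hs W (Finset.mem_insert_self W s)).nonempty_iso_of_isIso hZ.id_ne_zero h⟩

lemma exists_isIso_of_addClosure {V Z : A} (hZ : IsLocalObj Z)
    (h : AddClosure (fun Y => Y = V) Z) : ∃ (φ : Z ⟶ V) (ψ : V ⟶ Z), IsIso (φ ≫ ψ) := by
  obtain ⟨n, f, b, ⟨hb⟩, hf, ⟨ρ⟩⟩ := h
  have h : 𝟙 Z = ∑ j, (ρ.i ≫ b.π j) ≫ (b.ι j ≫ ρ.r) := by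
    have := IsBilimit.total hb
    rw [← ρ.retract]
    conv_lhs => rw [← Category.id_comp ρ.r, ← this]
    simp [Preadditive.sum_comp, Preadditive.comp_sum]
  obtain ⟨j, -, hj⟩ := hZ.exists_isIso_of_sum (s := Finset.univ)
    (φ := fun j => (ρ.i ≫ b.π j) ≫ (b.ι j ≫ ρ.r)) (by rw [← h]; infer_instance)
  obtain rfl := hf j
  exact ⟨_, _, hj⟩

end LocalObjects

/-! ### Finite-dimensional modules -/

section FiniteDimensional

variable {K : Type k} [Field K] {A : Type u} [Category.{v} A] [Preadditive A] [Linear K A]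

/-- Up to isomorphism, finitely many local objects are in the support of `M`. -/
def HasFiniteSupport (M : Aᵒᵖ ⥤ ModuleCat.{w} K) : Prop :=
  ∃ s : Finset A, ∀ Z, IsLocalObj Z → Nontrivial (M.obj (op Z)) → ∃ W ∈ s, Nonempty (Z ≅ W)

omit [Preadditive A] [Linear K A] in
lemma nontrivial_of_retract (M : Aᵒᵖ ⥤ ModuleCat.{w} K) {X Y : A} (i : X ⟶ Y) (r : Y ⟶ X)
    (hir : i ≫ r = 𝟙 X) (h : Nontrivial (M.obj (op X))) : Nontrivial (M.obj (op Y)) := by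
  have hinj : Function.Injective (M.map r.op).hom := fun m m' hm => by
    have := congrArg (M.map i.op).hom hm
    rwa [← map_comp_apply, ← map_comp_apply, hir, map_id_apply, map_id_apply] at this
  exact hinj.nontrivial

omit [Preadditive A] [Linear K A] in
lemma nontrivial_of_iso (M : Aᵒᵖ ⥤ ModuleCat.{w} K) {X Y : A} (e : X ≅ Y)
    (h : Nontrivial (M.obj (op X))) : Nontrivial (M.obj (op Y)) :=
  nontrivial_of_retract M e.hom e.inv e.hom_inv_id h

lemma subsingleton_of_local {M : Aᵒᵖ ⥤ ModuleCat.{w} K} (hM : IsModule M)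
    (hA : ∀ X : A, LocalDecomp X) (h : ∀ Z, IsLocalObj Z → Subsingleton (M.obj (op Z))) (X : A) :
    Subsingleton (M.obj (op X)) := by
  obtain ⟨n, f, i, p, s, hs, -, hsum⟩ := hA X
  refine subsingleton_of_forall_eq 0 fun m => ?_
  have key : ∀ t : Finset (Fin n), t ⊆ s → (M.map (∑ j ∈ t, p j ≫ i j).op).hom m = 0 := by
    intro t ht
    classical
    induction t using Finset.induction_on with
    | empty => exact hM.zero_apply m
    | insert j t hj ih =>
      rw [Finset.sum_insert hj, hM.add_apply, ih fun x hx => ht (Finset.mem_insert_of_mem hx),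
        map_comp_apply]
      have := h (f j) (hs j (ht (Finset.mem_insert_self j t)))
      rw [Subsingleton.elim ((M.map (i j).op).hom m) 0, map_zero, add_zero]
  rw [← map_id_apply M m, ← hsum, key s subset_rfl]

/-- Replaces the condition that the support is add V by a finite list of local objects, a condition
that visibly passes to submodules and quotients. -/
theorem fdMod_iff (hA : ∀ X : A, LocalDecomp X) [HasZeroObject A] [HasBinaryBiproducts A]
    (M : Aᵒᵖ ⥤ ModuleCat.{v} K) : fdMod M ↔ lfdMod M ∧ HasFiniteSupport M := by
  classical
  refine and_congr_right fun hM => ⟨?_, ?_⟩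
  · rintro ⟨V, hV⟩
    obtain ⟨s, hs⟩ := (hA V).exists_finset
    refine ⟨s, fun Z hZ hMZ => ?_⟩
    -- Every nonzero retract of a local object is isomorphic to it, so M nonzero at Z already puts Z
    -- in the support.
    obtain ⟨φ, ψ, h⟩ := exists_isIso_of_addClosure hZ ((hV Z).1 fun X' ⟨ρ⟩ hX' => by
      obtain ⟨e⟩ := hZ.nonempty_iso_of_retract ρ.i ρ.r ρ.retract (not_isZero_iff.1 hX')
      exact nontrivial_of_iso M e.symm hMZ)
    exact hs Z φ ψ hZ h
  · rintro ⟨s, hs⟩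
    have : HasFiniteProducts A := hasFiniteProducts_of_has_binary_and_terminal
    have : HasFiniteBiproducts A := HasFiniteBiproducts.of_hasFiniteProducts
    -- The list may contain superfluous objects; only local ones at which M is nonzero are allowed
    -- in V, as add V must not exceed the support.
    obtain ⟨V, hV₁, hV₂⟩ := exists_sum_of_local
      (s.filter fun W => IsLocalObj W ∧ Nontrivial (M.obj (op W)))
      fun W hW => (Finset.mem_filter.1 hW).2.1
    refine ⟨V, fun X => ⟨fun hX => ?_, ?_⟩⟩
    · obtain ⟨n, f, i, p, t, ht, hip, hsum⟩ := hA X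
      have h : ∀ j, ∃ (a : f j ⟶ V) (a' : V ⟶ f j), j ∈ t → a ≫ a' = 𝟙 _ := by
        intro j
        by_cases hj : j ∈ t
        · have hMj := hX (f j) ⟨⟨i j, p j, hip j hj⟩⟩ (not_isZero_iff.2 (ht j hj).id_ne_zero)
          obtain ⟨W, hW, ⟨e⟩⟩ := hs (f j) (ht j hj) hMj
          obtain ⟨a, a', haa⟩ := hV₁ W (Finset.mem_filter.2 ⟨hW, (ht j hj).of_iso e.symm,
            nontrivial_of_iso M e hMj⟩)
          exact ⟨e.hom ≫ a, a' ≫ e.inv, fun _ => by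
            rw [Category.assoc, ← Category.assoc a, haa, Category.id_comp, e.hom_inv_id]⟩
        · exact ⟨0, 0, fun h => absurd h hj⟩
      choose a a' haa using h
      refine ⟨n, fun _ => V, biproduct.bicone _, ⟨biproduct.isBilimit _⟩, fun _ => rfl,
        ⟨⟨biproduct.lift fun j => p j ≫ a j,
          biproduct.desc fun j => if j ∈ t then a' j ≫ i j else 0, ?_⟩⟩⟩
      have hj : ∀ j, (p j ≫ a j) ≫ (if j ∈ t then a' j ≫ i j else 0) =
          if j ∈ t then p j ≫ i j else 0 := by
        intro j
        split_ifs with hj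
        · rw [Category.assoc, ← Category.assoc (a j), haa j hj, Category.id_comp]
        · exact Limits.comp_zero
      rw [biproduct.lift_desc, Finset.sum_congr rfl fun j _ => hj j, Finset.sum_ite_mem,
        Finset.univ_inter, hsum]
    · rintro ⟨n, f, b, ⟨hb⟩, hf, ⟨ρ⟩⟩ X' ⟨ρ'⟩ hX'
      obtain ⟨Z, i, p, hZ, hip⟩ := (hA X').exists_local (not_isZero_iff.1 hX')
      have hadd : AddClosure (fun Y => Y = V) Z := ⟨n, f, b, ⟨hb⟩, hf, ⟨⟨i ≫ ρ'.i ≫ ρ.i,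
        ρ.r ≫ ρ'.r ≫ p, by
          have h₁ := ρ.retract
          have h₂ := ρ'.retract
          simp only [Category.assoc]
          rw [← Category.assoc ρ.i, h₁, Category.id_comp, ← Category.assoc ρ'.i, h₂,
            Category.id_comp, hip]⟩⟩⟩
      obtain ⟨φ, ψ, h⟩ := exists_isIso_of_addClosure hZ hadd
      obtain ⟨W, hW, ⟨e⟩⟩ := hV₂ Z φ ψ hZ h
      exact nontrivial_of_retract M i p hip
        (nontrivial_of_iso M e.symm (Finset.mem_filter.1 hW).2.2)

end FiniteDimensional

end ClusterIso

namespace ClusterIso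

/-! ### Simple modules and dévissage -/

section Radical

variable {K : Type k} [Field K] {A : Type u} [Category.{v} A] [Preadditive A] [Linear K A]

/-- Morphisms which are not retractions onto `Z` (radical morphisms, for `Z` local). -/
def NonRetraction {X Z : A} (f : X ⟶ Z) : Prop := ∀ g : Z ⟶ X, ¬ IsIso (g ≫ f)

omit [Preadditive A] in
lemma NonRetraction.comp {X Y Z : A} {f : X ⟶ Z} (hf : NonRetraction f) (h : Y ⟶ X) :
    NonRetraction (h ≫ f) := fun g => by
  rw [← Category.assoc]
  exact hf _

lemma NonRetraction.desc [HasBinaryBiproducts A] {X Y Z : A} (hZ : IsLocalObj Z) {f : X ⟶ Z}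
    {f' : Y ⟶ Z} (hf : NonRetraction f) (hf' : NonRetraction f') :
    NonRetraction (biprod.desc f f') := fun g h => by
  have : g ≫ biprod.desc f f' = (g ≫ biprod.fst) ≫ f + (g ≫ biprod.snd) ≫ f' := by
    rw [biprod.desc_eq, Preadditive.comp_add, Category.assoc, Category.assoc]
  rw [this] at h
  exact (hZ.isIso_of_add h).elim (hf _) (hf' _)

lemma nonRetraction_of_not_iso {X Z : A} (hX : IsLocalObj X) (hZ : IsLocalObj Z)
    (h : IsEmpty (X ≅ Z)) (f : X ⟶ Z) : NonRetraction f := fun _ hg =>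
  h.elim (hX.nonempty_iso_of_isIso hZ.id_ne_zero hg).some.symm

/-- `A` has sink maps up to radical endomorphisms: a morphism to `Z`, not a retraction, through
which all morphisms from other local objects factor. -/
def HasSinkMaps (A : Type u) [Category.{v} A] [Preadditive A] : Prop :=
  ∀ Z : A, IsLocalObj Z → ∃ (B : A) (b : B ⟶ Z), NonRetraction b ∧
    ∀ X : A, IsLocalObj X → IsEmpty (X ≅ Z) → ∀ f : X ⟶ Z, ∃ g : X ⟶ B, g ≫ b = f

variable (K) in
/-- The morphisms which are not retractions onto `Z` are those factoring through a fixed one. -/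
lemma HasSinkMaps.exists_generator [HasBinaryBiproducts A] (h : HasSinkMaps A)
    (hA : ∀ X : A, LocalDecomp X) (hfin : ∀ X Y : A, Module.Finite K (X ⟶ Y)) {Z : A}
    (hZ : IsLocalObj Z) : ∃ (W : A) (w : W ⟶ Z), ∀ (X : A) (f : X ⟶ Z),
      NonRetraction f ↔ ∃ g : X ⟶ W, g ≫ w = f := by
  classical
  obtain ⟨B, b, hb, hfac⟩ := h Z hZ
  -- The sink map says nothing about maps from objects isomorphic to Z. These are governed by R, the
  -- non-invertible endomorphisms of Z; it is finite-dimensional, and a finite spanning set is added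
  -- to `b` one element at a time.
  let R : Submodule K (Z ⟶ Z) :=
    { carrier := {f | NonRetraction f}
      add_mem' := fun {f f'} hf hf' g hg => by
        rw [Preadditive.comp_add] at hg
        exact (hZ.isIso_of_add hg).elim (hf g) (hf' g)
      zero_mem' := fun g hg => hZ.not_isIso_zero (by simpa using hg)
      smul_mem' := fun a f hf g hg => hf (a • g) (by
        rwa [Linear.smul_comp, ← Linear.comp_smul]) }
  have hR : R.FG := by
    have := hfin Z Z
    exact IsNoetherian.noetherian R
  obtain ⟨t, ht⟩ := hR
  have key : ∀ s : Finset (Z ⟶ Z), s ⊆ t → ∃ (W : A) (w : W ⟶ Z), NonRetraction w ∧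
      (∃ g : B ⟶ W, g ≫ w = b) ∧ ∀ f ∈ s, ∃ g : Z ⟶ W, g ≫ w = f := by
    intro s hs
    induction s using Finset.induction_on with
    | empty => exact ⟨B, b, hb, ⟨𝟙 B, Category.id_comp b⟩, by simp⟩
    | insert f s hf ih =>
      obtain ⟨W, w, hw, ⟨g, hg⟩, hW⟩ := ih fun x hx => hs (Finset.mem_insert_of_mem hx)
      have hfR : f ∈ R := ht ▸ Submodule.subset_span (hs (Finset.mem_insert_self f s))
      refine ⟨W ⊞ Z, biprod.desc w f, hw.desc hZ hfR, ⟨g ≫ biprod.inl, by simp [hg]⟩,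
        fun f' hf' => ?_⟩
      rcases Finset.mem_insert.1 hf' with rfl | hf'
      · exact ⟨biprod.inr, biprod.inr_desc _ _⟩
      · obtain ⟨g', hg'⟩ := hW f' hf'
        exact ⟨g' ≫ biprod.inl, by simp [hg']⟩
  obtain ⟨W, w, hw, ⟨g, hg⟩, hW⟩ := key t subset_rfl
  have hRW : R ≤ LinearMap.range (Linear.rightComp K Z w) := by
    rw [← ht, Submodule.span_le]
    exact hW
  refine ⟨W, w, fun X f => ⟨fun hf => ?_, ?_⟩⟩
  · obtain ⟨n, Y, i, p, s, hs, -, hsum⟩ := hA X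
    -- The factorisation is found on local summands of X: those isomorphic to Z use R, the others
    -- use the sink map.
    have hj : ∀ j ∈ s, ∃ l : Y j ⟶ W, l ≫ w = i j ≫ f := fun j hj => by
      by_cases he : Nonempty (Y j ≅ Z)
      · obtain ⟨e⟩ := he
        obtain ⟨l, hl⟩ := hRW ((hf.comp (i j)).comp e.inv : _ ∈ R)
        refine ⟨e.hom ≫ l, ?_⟩
        have hl' : l ≫ w = e.inv ≫ i j ≫ f := hl
        rw [Category.assoc, hl', e.hom_inv_id_assoc]
      · obtain ⟨l, hl⟩ := hfac (Y j) (hs j hj) (not_nonempty_iff.1 he) (i j ≫ f)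
        exact ⟨l ≫ g, by rw [Category.assoc, hg, hl]⟩
    choose! l hl using hj
    refine ⟨∑ j ∈ s, p j ≫ l j, ?_⟩
    rw [Preadditive.sum_comp, ← Category.id_comp f, ← hsum, Preadditive.sum_comp]
    exact Finset.sum_congr rfl fun j hj => by rw [Category.assoc, hl j hj, Category.assoc]
  · rintro ⟨l, rfl⟩
    exact hw.comp l

/-- `S` is the simple module concentrated at the local object `Z`. -/
def IsSimpleAt (Z : A) (S : Aᵒᵖ ⥤ ModuleCat.{v} K) : Prop :=
  IsModule S ∧ ∃ s : S.obj (op Z), Generates s ∧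
    ∀ (X : A) (f : X ⟶ Z), (S.map f.op).hom s = 0 ↔ NonRetraction f

namespace IsSimpleAt

variable {Z : A} {S : Aᵒᵖ ⥤ ModuleCat.{v} K}

lemma nonempty_iso (hS : IsSimpleAt Z S) {S' : Aᵒᵖ ⥤ ModuleCat.{v} K} (hS' : IsSimpleAt Z S') :
    Nonempty (S ≅ S') := by
  obtain ⟨hS, s, hs, h⟩ := hS
  obtain ⟨hS', s', hs', h'⟩ := hS'
  exact exists_iso_of_generates hS hS' hs hs' fun X g => by rw [h, h']

lemma of_iso (hS : IsSimpleAt Z S) {Z' : A} (e : Z' ≅ Z) : IsSimpleAt Z' S := by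
  obtain ⟨hS, s, hs, h⟩ := hS
  refine ⟨hS, (S.map e.hom.op).hom s, fun X n => ?_, fun X f => ?_⟩
  · obtain ⟨g, rfl⟩ := hs X n
    exact ⟨g ≫ e.inv, by rw [← map_comp_apply, Category.assoc, e.inv_hom_id, Category.comp_id]⟩
  · rw [← map_comp_apply, h]
    refine ⟨fun hf g hg => hf (e.inv ≫ g) ?_, fun hf g hg => hf (e.hom ≫ g) ?_⟩
    · have : (e.inv ≫ g) ≫ f ≫ e.hom = e.inv ≫ (g ≫ f) ≫ e.hom := by simp
      rw [this]
      infer_instance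
    · have : (e.hom ≫ g) ≫ f = e.hom ≫ (g ≫ f ≫ e.hom) ≫ e.inv := by simp
      rw [this]
      infer_instance

lemma nontrivial (hS : IsSimpleAt Z S) : Nontrivial (S.obj (op Z)) := by
  obtain ⟨hS, s, hs, h⟩ := hS
  refine nontrivial_of_ne s 0 fun h0 => ?_
  have := (h Z (𝟙 Z)).1 (by rw [map_id_apply, h0]) (𝟙 Z)
  exact this (by rw [Category.comp_id]; infer_instance)

lemma subsingleton (hS : IsSimpleAt Z S) (hZ : IsLocalObj Z) {X : A} (hX : IsLocalObj X)
    (h : IsEmpty (X ≅ Z)) : Subsingleton (S.obj (op X)) := by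
  obtain ⟨hS, s, hs, h'⟩ := hS
  refine subsingleton_of_forall_eq 0 fun n => ?_
  obtain ⟨g, rfl⟩ := hs X n
  exact (h' X g).2 (nonRetraction_of_not_iso hX hZ h g)

lemma fpMod [HasBinaryBiproducts A] (hS : IsSimpleAt Z S) (h : HasSinkMaps A)
    (hA : ∀ X : A, LocalDecomp X) (hfin : ∀ X Y : A, Module.Finite K (X ⟶ Y))
    (hZ : IsLocalObj Z) : fpMod S := by
  obtain ⟨W, w, hw⟩ := h.exists_generator K hA hfin hZ
  obtain ⟨hS, s, hs, h'⟩ := hS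
  exact (fpMod_iff S).2 ⟨hS, Z, W, w, s, hs, fun X f => (h' X f).trans (hw X f)⟩

end IsSimpleAt

/-- The submodule generated by an element, and its quotient. -/
lemma exists_generated_submodule {M : Aᵒᵖ ⥤ ModuleCat.{v} K} (hM : IsModule M) {Z : A}
    (m : M.obj (op Z)) : ∃ (N L : Aᵒᵖ ⥤ ModuleCat.{v} K) (i : N ⟶ M) (p : M ⟶ L)
      (n : N.obj (op Z)), (∀ X, Function.Injective (i.app X).hom) ∧
      (∀ X, Function.Surjective (p.app X).hom) ∧
      (∀ X, Function.Exact (i.app X).hom (p.app X).hom) ∧ (i.app (op Z)).hom n = m ∧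
      Generates n := by
  have hfac : ∀ (X : A) (g : X ⟶ Z), ((Abelian.image.ι (yonedaMap hM m)).app (op X)).hom
      (((Abelian.factorThruImage (yonedaMap hM m)).app (op X)).hom g) = (M.map g.op).hom m :=
    fun X g => congrArg (fun φ => (φ.app (op X)).hom g) (Abelian.image.fac (yonedaMap hM m))
  refine ⟨Abelian.image (yonedaMap hM m), cokernel (yonedaMap hM m), Abelian.image.ι _,
    cokernel.π _, ((Abelian.factorThruImage (yonedaMap hM m)).app (op Z)).hom (𝟙 Z),
    injective_app _, surjective_app _, exact_kernel_app _, (hfac Z (𝟙 Z)).trans (map_id_apply M m),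
    fun X n => ?_⟩
  obtain ⟨(g : X ⟶ Z), rfl⟩ :=
    surjective_app (Abelian.factorThruImage (yonedaMap hM m)) (op X) n
  refine ⟨g, injective_app (Abelian.image.ι (yonedaMap hM m)) (op X) ?_⟩
  refine (naturality_apply _ g _).trans
    ((congrArg (M.map g.op).hom (hfac Z (𝟙 Z))).trans ?_)
  rw [map_id_apply]
  exact (hfac X g).symm

/-- A nonzero module with finite support has an element of a local object which is annihilated
exactly by the non-retractions. -/
lemma exists_socle_element {M : Aᵒᵖ ⥤ ModuleCat.{v} K} (hM : lfdMod M)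
    (hA : ∀ X : A, LocalDecomp X) (hs : HasFiniteSupport M) (h0 : ∃ X, Nontrivial (M.obj (op X))) :
    ∃ (Z : A) (m : M.obj (op Z)), IsLocalObj Z ∧ m ≠ 0 ∧
      ∀ (X : A) (f : X ⟶ Z), (M.map f.op).hom m = 0 ↔ NonRetraction f := by
  classical
  obtain ⟨s, hs⟩ := hs
  let ev : ∀ {Z : A} (m : M.obj (op Z)) (W : A), (W ⟶ Z) →ₗ[K] M.obj (op W) := fun {Z} m W =>
    { toFun := fun g => (M.map g.op).hom m
      map_add' := fun f g => hM.1.add_apply f g m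
      map_smul' := fun a f => hM.1.smul_apply a f m }
  -- The dimension, counted over the list `s`, of the submodule generated by `m`. A nonzero element
  -- at a local object minimising it will generate a simple submodule.
  let d : ∀ {Z : A} (m : M.obj (op Z)), ℕ := fun m =>
    ∑ W ∈ s, Module.finrank K (LinearMap.range (ev m W))
  have hex : ∃ (n : ℕ) (Z : A) (m : M.obj (op Z)), IsLocalObj Z ∧ m ≠ 0 ∧ d m = n := by
    by_contra hcon
    push Not at hcon
    obtain ⟨X, hX⟩ := h0
    refine not_subsingleton _ (subsingleton_of_local hM.1 hA (fun Z hZ => ?_) X)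
    exact subsingleton_of_forall_eq 0 fun m => by
      by_contra hm
      exact hcon _ Z m hZ hm rfl
  obtain ⟨Z, m, hZ, hm, hd⟩ := Nat.find_spec hex
  refine ⟨Z, m, hZ, hm, fun X f => ⟨fun h g hg => hm ?_, fun hf => ?_⟩⟩
  · rw [← map_id_apply M m, ← IsIso.inv_hom_id (g ≫ f), map_comp_apply, map_comp_apply, h,
      map_zero, map_zero]
  -- By minimality, a nonzero restriction of `m` along `f` generates the same submodule over `s`, so
  -- `m` is fixed by an endomorphism factoring through `f`. In a local ring that endomorphism is
  -- invertible, excluded by `f`, or its difference from 1 is, which would kill `m`.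
  · have hloc : ∀ (Y : A), IsLocalObj Y → ∀ f : Y ⟶ Z, NonRetraction f →
        (M.map f.op).hom m = 0 := by
      intro Y hY f hf
      by_contra hfm
      have hle : ∀ W, LinearMap.range (ev ((M.map f.op).hom m) W) ≤ LinearMap.range (ev m W) := by
        rintro W _ ⟨g, rfl⟩
        exact ⟨g ≫ f, map_comp_apply M g f m⟩
      have hrank : ∀ W ∈ s, Module.finrank K (LinearMap.range (ev ((M.map f.op).hom m) W)) ≤
          Module.finrank K (LinearMap.range (ev m W)) := fun W _ => by
        have := hM.2 W
        exact Submodule.finrank_mono (hle W)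
      have hmin : d m ≤ d ((M.map f.op).hom m) := by
        rw [hd]
        exact Nat.find_min' hex ⟨Y, _, hY, hfm, rfl⟩
      have heq := (Finset.sum_eq_sum_iff_of_le hrank).1 (le_antisymm (Finset.sum_le_sum hrank) hmin)
      obtain ⟨W, hW, ⟨e⟩⟩ := hs Z hZ (nontrivial_of_ne m 0 hm)
      have := hM.2 W
      have hr := Submodule.eq_of_le_of_finrank_eq (hle W) (heq W hW)
      obtain ⟨g, hg⟩ : (M.map e.inv.op).hom m ∈ LinearMap.range (ev ((M.map f.op).hom m) W) := by
        rw [hr]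
        exact ⟨e.inv, rfl⟩
      have hg' : (M.map ((e.hom ≫ g) ≫ f).op).hom m = m := by
        have hg : (M.map g.op).hom ((M.map f.op).hom m) = (M.map e.inv.op).hom m := hg
        rw [map_comp_apply, map_comp_apply, hg, ← map_comp_apply, e.hom_inv_id, map_id_apply]
      rcases hZ.isIso_or ((e.hom ≫ g) ≫ f) with h | h
      · exact hf _ h
      · apply hm
        have h1 : (M.map (𝟙 Z - (e.hom ≫ g) ≫ f).op).hom m = 0 := by
          rw [hM.1.sub_apply, hg', map_id_apply, sub_self]
        rw [← map_id_apply M m, ← IsIso.inv_hom_id (𝟙 Z - (e.hom ≫ g) ≫ f), map_comp_apply, h1,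
          map_zero]
    obtain ⟨n, Y, i, p, t, ht, -, hsum⟩ := hA X
    have key : ∀ t' : Finset (Fin n), t' ⊆ t →
        (M.map ((∑ j ∈ t', p j ≫ i j) ≫ f).op).hom m = 0 := by
      intro t' ht'
      induction t' using Finset.induction_on with
      | empty =>
        rw [Finset.sum_empty, zero_comp]
        exact hM.1.zero_apply m
      | insert j t' hj ih =>
        rw [Finset.sum_insert hj, Preadditive.add_comp, hM.1.add_apply,
          ih fun x hx => ht' (Finset.mem_insert_of_mem hx), Category.assoc, map_comp_apply,
          hloc (Y j) (ht j (ht' (Finset.mem_insert_self j t'))) _ (hf.comp (i j)), map_zero,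
          add_zero]
    have := key t subset_rfl
    rwa [hsum, Category.id_comp] at this

lemma lfdMod.of_injective {M N : Aᵒᵖ ⥤ ModuleCat.{v} K} (hM : lfdMod M) (j : N ⟶ M)
    (hj : ∀ X, Function.Injective (j.app X).hom) : lfdMod N :=
  ⟨hM.1.of_injective j hj, fun X => by
    have := hM.2 X
    exact Module.Finite.of_injective (j.app (op X)).hom (hj _)⟩

lemma lfdMod.of_surjective {M N : Aᵒᵖ ⥤ ModuleCat.{v} K} (hM : lfdMod M) (q : M ⟶ N)
    (hq : ∀ X, Function.Surjective (q.app X).hom) : lfdMod N :=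
  ⟨hM.1.of_surjective q hq, fun X => by
    have := hM.2 X
    exact Module.Finite.of_surjective (q.app (op X)).hom (hq _)⟩

omit [Linear K A] in
lemma HasFiniteSupport.of_injective {M N : Aᵒᵖ ⥤ ModuleCat.{w} K} (hM : HasFiniteSupport M)
    (j : N ⟶ M) (hj : ∀ X, Function.Injective (j.app X).hom) : HasFiniteSupport N := by
  obtain ⟨s, hs⟩ := hM
  exact ⟨s, fun Z hZ h => hs Z hZ (hj (op Z)).nontrivial⟩

omit [Linear K A] in
lemma HasFiniteSupport.of_surjective {M N : Aᵒᵖ ⥤ ModuleCat.{w} K} (hM : HasFiniteSupport M)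
    (q : M ⟶ N) (hq : ∀ X, Function.Surjective (q.app X).hom) : HasFiniteSupport N := by
  obtain ⟨s, hs⟩ := hM
  exact ⟨s, fun Z hZ h => hs Z hZ (hq (op Z)).nontrivial⟩

/-- Dévissage: induction over the finite-dimensional modules. -/
theorem fdMod_induction (hA : ∀ X : A, LocalDecomp X) {P : (Aᵒᵖ ⥤ ModuleCat.{v} K) → Prop}
    (zero : ∀ M, (∀ X, Subsingleton (M.obj X)) → P M)
    (step : ∀ (Z : A) (S M L : Aᵒᵖ ⥤ ModuleCat.{v} K) (i : S ⟶ M) (p : M ⟶ L), IsLocalObj Z →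
      IsSimpleAt Z S → lfdMod M → HasFiniteSupport M → (∀ X, Function.Injective (i.app X).hom) →
      (∀ X, Function.Surjective (p.app X).hom) →
      (∀ X, Function.Exact (i.app X).hom (p.app X).hom) → P L → P M)
    (M : Aᵒᵖ ⥤ ModuleCat.{v} K) (hM : lfdMod M) (hM' : HasFiniteSupport M) : P M := by
  obtain ⟨s, hs⟩ := hM'
  -- Induction on the total dimension over the list `s`, which also serves all quotients of M. The
  -- simple submodule is nonzero at some member of `s`, so the dimension drops.
  generalize hn : ∑ W ∈ s, Module.finrank K (M.obj (op W)) = n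
  induction n using Nat.strong_induction_on generalizing M with
  | _ n ih =>
    by_cases h0 : ∃ X, Nontrivial (M.obj (op X))
    · obtain ⟨Z, m, hZ, hm, hrel⟩ := exists_socle_element hM hA ⟨s, hs⟩ h0
      obtain ⟨S, L, i, p, x, hi, hp, hex, hx, hgen⟩ := exists_generated_submodule hM.1 m
      have hS : IsSimpleAt Z S := ⟨hM.1.of_injective i hi, x, hgen, fun X f => by
        rw [← hrel X f, ← hx, ← naturality_apply, map_eq_zero_iff _ (hi (op X))]⟩
      have hL : lfdMod L := hM.of_surjective p hp
      refine step Z S M L i p hZ hS hM ⟨s, hs⟩ hi hp hex (ih _ ?_ L hL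
        (fun Z hZ h => hs Z hZ (hp (op Z)).nontrivial) rfl)
      rw [← hn]
      have hdim : ∀ W, Module.finrank K (M.obj (op W)) = Module.finrank K (S.obj (op W)) +
          Module.finrank K (L.obj (op W)) := fun W => by
        have := hM.2 W
        exact finrank_of_exact _ _ (hi (op W)) (hp (op W)) (hex (op W))
      obtain ⟨W, hW, ⟨e⟩⟩ := hs Z hZ (nontrivial_of_ne m 0 hm)
      refine Finset.sum_lt_sum (fun W _ => by rw [hdim]; omega) ⟨W, hW, ?_⟩
      have := nontrivial_of_iso S e hS.nontrivial
      have := (hM.of_injective i hi).2 W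
      have : 0 < Module.finrank K (S.obj (op W)) := Module.finrank_pos
      rw [hdim]
      omega
    · exact zero M fun X => not_nontrivial_iff_subsingleton.1 fun h => h0 ⟨X.unop, h⟩

end Radical

end ClusterIso

namespace ClusterIso

/-! ### Grothendieck groups of finite-dimensional modules. -/

section FdClasses

variable {K : Type k} [Field K] {A : Type u} [Category.{v} A] [Preadditive A] [Linear K A]

lemma isAbelianClass_lfdMod : IsAbelianClass (lfdMod (K := K) (A := A)) where
  of_isZero {M} hM := ⟨⟨fun f g => by ext m; exact @Subsingleton.elim _ (hM _) _ _,
    fun a f => by ext m; exact @Subsingleton.elim _ (hM _) _ _⟩, fun X => by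
      have := hM (op X)
      infer_instance⟩
  ker j _ hM _ hj _ := hM.of_injective j hj
  coker _ q _ hN hq _ := hN.of_surjective q hq

lemma isAbelianClass_fdMod [HasZeroObject A] [HasBinaryBiproducts A]
    (hA : ∀ X : A, LocalDecomp X) : IsAbelianClass (fdMod (K := K) (A := A)) where
  of_isZero {M} hM := (fdMod_iff hA M).2 ⟨isAbelianClass_lfdMod.of_isZero hM, ∅, fun Z _ h =>
    absurd (hM (op Z)) (not_subsingleton_iff_nontrivial.2 h)⟩
  ker {L M _} j _ hM _ hj _ := by
    have h := (fdMod_iff hA M).1 hM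
    exact (fdMod_iff hA L).2 ⟨h.1.of_injective j hj, h.2.of_injective j hj⟩
  coker {L _ N} _ q _ hN hq _ := by
    have h := (fdMod_iff hA N).1 hN
    exact (fdMod_iff hA L).2 ⟨h.1.of_surjective q hq, h.2.of_surjective q hq⟩

/-- Finite-dimensional modules are finitely presented if the simple ones are. -/
theorem fdMod_le_fpMod [HasZeroObject A] [HasBinaryBiproducts A] (hA : ∀ X : A, LocalDecomp X)
    (hfin : ∀ X Y : A, Module.Finite K (X ⟶ Y)) (hsink : HasSinkMaps A) :
    fdMod (K := K) (A := A) ≤ fpMod := fun M hM => by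
  have h := (fdMod_iff hA M).1 hM
  refine fdMod_induction hA (P := fun M => fpMod M) (fun M => fpMod.of_isZero)
    (fun Z S M L i p hZ hS hM _ hi hp hex hL => ?_) M h.1 h.2
  exact (hS.fpMod hsink hA hfin hZ).ext_closed hL hM.1 i p hi hp hex

lemma dimAt_cls (X : A) (M : Aᵒᵖ ⥤ ModuleCat.{v} K) (hM : lfdMod M) :
    dimAt X (K0Mod.cls M hM) = Module.finrank K (M.obj (op X)) := by
  change FreeAbelianGroup.lift _ (FreeAbelianGroup.of _) = _
  simp

/-- Classes of finite-dimensional modules are determined by their dimensions. -/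
theorem eq_zero_of_dimAt_eq_zero [HasZeroObject A] [HasBinaryBiproducts A]
    (hA : ∀ X : A, LocalDecomp X) (x : K0Mod (fdMod (K := K) (A := A)))
    (hx : ∀ X, dimAt X (K0Mod.map (fun _ h => h.1) x) = 0) : x = 0 := by
  classical
  let I := Quotient (isIsomorphicSetoid A)
  let H : I → Prop := fun c => ∃ S, IsLocalObj c.out ∧ IsSimpleAt (K := K) c.out S ∧ fdMod S
  -- The class of the simple module at an isomorphism class of local objects, and the default 0
  -- where no finite-dimensional simple module exists.
  let σ : I → K0Mod (fdMod (K := K) (A := A)) := fun c =>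
    if h : H c then K0Mod.cls h.choose h.choose_spec.2.2 else 0
  let Ψ : (I →₀ ℤ) →+ K0Mod (fdMod (K := K) (A := A)) :=
    Finsupp.liftAddHom fun c => zmultiplesHom _ (σ c)
  have hΨ : ∀ c n, Ψ (Finsupp.single c n) = n • σ c := fun c n => by
    simp [Ψ]
  have hQ := isAbelianClass_fdMod (K := K) hA
  -- By dévissage the simple classes generate the group.
  have hcls : ∀ M, lfdMod M → HasFiniteSupport M → ∀ h : fdMod M, K0Mod.cls M h ∈ Ψ.range := by
    refine fdMod_induction hA (fun M hM h => ?_) (fun Z S M L i p hZ hS hM hM' hi hp hex hL h => ?_)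
    · rw [K0Mod.cls_isZero h ((Functor.isZero_iff _).2 fun X => by
        have := hM X
        exact ModuleCat.isZero_of_subsingleton _)]
      exact zero_mem _
    · have hSfd : fdMod S := (fdMod_iff hA S).2 ⟨hM.of_injective i hi, hM'.of_injective i hi⟩
      have hLfd : fdMod L := (fdMod_iff hA L).2 ⟨hM.of_surjective p hp, hM'.of_surjective p hp⟩
      rw [K0Mod.cls_of_app hSfd h hLfd i p hi hp hex]
      refine add_mem ⟨Finsupp.single ⟦Z⟧ 1, ?_⟩ (hL hLfd)
      obtain ⟨e⟩ : IsIsomorphic (⟦Z⟧ : I).out Z := Quotient.mk_out (s := isIsomorphicSetoid A) Z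
      have hH : H ⟦Z⟧ := ⟨S, hZ.of_iso e, hS.of_iso e, hSfd⟩
      rw [hΨ, one_smul]
      simp only [σ, dif_pos hH]
      obtain ⟨e'⟩ := hH.choose_spec.2.1.nonempty_iso (hS.of_iso e)
      exact hQ.cls_eq _ hSfd e'
  have hsurj : ∀ x, x ∈ Ψ.range := fun x => by
    obtain ⟨y, rfl⟩ := QuotientAddGroup.mk'_surjective _ x
    induction y using FreeAbelianGroup.induction_on with
    | zero => simp
    | of M => exact hcls M.1 ((fdMod_iff hA _).1 M.2).1 ((fdMod_iff hA _).1 M.2).2 M.2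
    | neg M ih => exact neg_mem ih
    | add a b iha ihb => exact add_mem iha ihb
  obtain ⟨n, rfl⟩ := hsurj x
  have hsum : Ψ n = ∑ c ∈ n.support, n c • σ c := by
    simp [Ψ, Finsupp.liftAddHom_apply, Finsupp.sum]
  -- A simple module vanishes at every local object outside its isomorphism class. Hence the
  -- dimension at `c.out` is the coefficient of `σ c` times a nonzero integer, which need not be 1.
  have hdim : ∀ c c', c ≠ c' → H c → dimAt c.out (K0Mod.map (fun _ h => h.1) (σ c')) = 0 := by
    intro c c' hcc' hc
    by_cases hc' : H c'
    · simp only [σ, dif_pos hc', K0Mod.map_cls, dimAt_cls]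
      have := hc'.choose_spec.2.1.subsingleton hc'.choose_spec.1 hc.choose_spec.1
        ⟨fun e => hcc' (by rw [← c.out_eq, ← c'.out_eq]; exact Quotient.sound ⟨e⟩)⟩
      simp [Module.finrank_zero_of_subsingleton]
    · simp [σ, dif_neg hc']
  rw [hsum]
  refine Finset.sum_eq_zero fun c hc => ?_
  by_cases h : H c
  · have hd := hx c.out
    rw [hsum, map_sum, map_sum, Finset.sum_eq_single c (fun c' _ hne => by
      rw [map_zsmul, map_zsmul, hdim c c' hne.symm h, smul_zero]) (fun h => absurd hc h),
      map_zsmul, map_zsmul] at hd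
    have hpos : dimAt c.out (K0Mod.map (fun _ h => h.1) (σ c)) ≠ 0 := by
      simp only [σ, dif_pos h, K0Mod.map_cls, dimAt_cls]
      have := h.choose_spec.2.1.nontrivial
      have := h.choose_spec.2.2.1.2 c.out
      exact_mod_cast (Module.finrank_pos (R := K) (M := h.choose.obj (op c.out))).ne'
    rw [(smul_eq_zero.1 hd).resolve_right hpos, zero_smul]
  · simp only [σ, dif_neg h, smul_zero]

end FdClasses

end ClusterIso

namespace ClusterIso

/-! ### Adjoints on numerical Grothendieck groups -/

section Numerical

variable {K : Type k} [Field K] {A : Type u} [Category.{v} A] [Preadditive A] [Linear K A]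
  {B : Type u'} [Category.{v} B] [Preadditive B] [Linear K B] (S : TwoTerm K A B)

lemma TwoTerm.lfdMod_kerMod {M : Bᵒᵖ ⥤ ModuleCat.{v} K} (hM : lfdMod M) :
    lfdMod (S.kerMod hM.1) :=
  ⟨S.isModule_kerMod hM.1, fun t => by
    have := hM.2 (S.Q t)
    exact Module.Finite.of_injective (S.kerι hM.1 t) (S.kerι_injective hM.1 t)⟩

lemma TwoTerm.lfdMod_cokerMod {M : Bᵒᵖ ⥤ ModuleCat.{v} K} (hM : lfdMod M) :
    lfdMod (S.cokerMod hM.1) :=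
  ⟨S.isModule_cokerMod hM.1, fun t => by
    have := hM.2 (S.P t)
    exact Module.Finite.of_surjective (S.cokerπ hM.1 t) (S.cokerπ_surjective hM.1 t)⟩

/-- The homomorphism of Grothendieck groups of locally finite-dimensional modules given by a
two-term complex. -/
def TwoTerm.lfdEulerMap : K0Mod (lfdMod (K := K) (A := B)) →+ K0Mod (lfdMod (K := K) (A := A)) :=
  S.eulerMap isAbelianClass_lfdMod (fun _ h => h.1) (fun _ => S.lfdMod_kerMod)
    (fun _ => S.lfdMod_cokerMod)

lemma finrank_coker_sub_finrank_ker {V₁ V₂ V₃ V₄ : Type*} [AddCommGroup V₁] [Module K V₁]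
    [AddCommGroup V₂] [Module K V₂] [AddCommGroup V₃] [Module K V₃] [AddCommGroup V₄] [Module K V₄]
    [Module.Finite K V₂] [Module.Finite K V₃] (i : V₁ →ₗ[K] V₂) (f : V₂ →ₗ[K] V₃)
    (q : V₃ →ₗ[K] V₄) (hi : Function.Injective i) (hif : Function.Exact i f)
    (hfq : Function.Exact f q) (hq : Function.Surjective q) :
    (Module.finrank K V₄ : ℤ) - Module.finrank K V₁ =
      Module.finrank K V₃ - Module.finrank K V₂ := by
  have h₁ := LinearMap.finrank_range_add_finrank_ker f
  have h₂ := LinearMap.finrank_range_add_finrank_ker q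
  rw [LinearMap.range_eq_top.2 hq, finrank_top, LinearMap.exact_iff.1 hfq] at h₂
  rw [LinearMap.exact_iff.1 hif, LinearMap.finrank_range_of_inj hi] at h₁
  omega

/-- The Euler characteristic of the complex M(Q t) → M(P t). This is the whole content of the
adjunction with the split Grothendieck groups. -/
lemma TwoTerm.dimAt_lfdEulerMap (t : A) (x : K0Mod (lfdMod (K := K) (A := B))) :
    dimAt t (S.lfdEulerMap x) = dimAt (S.P t) x - dimAt (S.Q t) x := by
  have : (dimAt t).comp S.lfdEulerMap = dimAt (S.P t) - dimAt (S.Q t) := by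
    refine K0Mod.hom_ext fun M hM => ?_
    have h₁ := hM.2 (S.P t)
    have h₂ := hM.2 (S.Q t)
    rw [AddMonoidHom.comp_apply, lfdEulerMap, S.eulerMap_cls, map_sub, AddMonoidHom.sub_apply,
      dimAt_cls, dimAt_cls, dimAt_cls, dimAt_cls]
    exact finrank_coker_sub_finrank_ker (S.kerι hM.1 t) (M.map (S.p t).op).hom (S.cokerπ hM.1 t)
      (S.kerι_injective hM.1 t) (S.exact_kerι hM.1 t) (S.exact_cokerπ hM.1 t)
      (S.cokerπ_surjective hM.1 t)
  exact DFunLike.congr_fun this x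

lemma pairing_cls (X : A) (x : K0Mod (lfdMod (K := K) (A := A))) :
    pairing (K0Split.cls X) (QuotientAddGroup.mk' _ x : KNum K A) = dimAt X x := by
  have : (pairing (K0Split.cls X) : KNum K A →+ ℤ) = KNum.dim X := by
    change FreeAbelianGroup.lift _ (FreeAbelianGroup.of X) = _
    simp
  rw [this]
  rfl

/-- The numerical Grothendieck group is separated by the pairing. -/
lemma KNum.eq_of_pairing {x y : KNum K A}
    (h : ∀ t : K0Split A, pairing t x = pairing t y) : x = y := by
  obtain ⟨x, rfl⟩ := QuotientAddGroup.mk'_surjective _ x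
  obtain ⟨y, rfl⟩ := QuotientAddGroup.mk'_surjective _ y
  rw [← sub_eq_zero, ← map_sub]
  refine (QuotientAddGroup.eq_zero_iff _).2 (AddSubgroup.mem_iInf.2 fun X => ?_)
  rw [AddMonoidHom.mem_ker, map_sub, ← pairing_cls, ← pairing_cls, h, sub_self]

/-- The adjoint of the homomorphism of split Grothendieck groups given by a two-term complex. -/
lemma TwoTerm.exists_adjoint (g : K0Split A →+ K0Split B)
    (hg : ∀ t, g (K0Split.cls t) = K0Split.cls (S.P t) - K0Split.cls (S.Q t)) :
    ∃ F : KNum K B →+ KNum K A, (∀ m t, pairing t (F m) = pairing (g t) m) ∧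
      ∀ x, F (QuotientAddGroup.mk' _ x) = QuotientAddGroup.mk' _ (S.lfdEulerMap x) := by
  -- Dimensions of the image are differences of dimensions of the argument, so numerically trivial
  -- classes are preserved.
  have hle : (⨅ X : B, (dimAt (K := K) X).ker) ≤
      (⨅ X : A, (dimAt (K := K) X).ker).comap S.lfdEulerMap := fun x hx => by
    rw [AddSubgroup.mem_iInf] at hx
    refine AddSubgroup.mem_iInf.2 fun t => ?_
    rw [AddMonoidHom.mem_ker, S.dimAt_lfdEulerMap, (hx (S.P t) : dimAt _ _ = 0),
      (hx (S.Q t) : dimAt _ _ = 0), sub_zero]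
  refine ⟨QuotientAddGroup.map _ _ S.lfdEulerMap hle, fun m t => ?_, fun x => rfl⟩
  obtain ⟨x, rfl⟩ := QuotientAddGroup.mk'_surjective _ m
  have : (AddMonoidHom.eval (QuotientAddGroup.mk' _ (S.lfdEulerMap x))).comp
        (pairing (K := K) (A := A)) =
      ((AddMonoidHom.eval (QuotientAddGroup.mk' _ x)).comp (pairing (K := K) (A := B))).comp g := by
    refine K0Split.hom_ext fun t => ?_
    refine (pairing_cls t _).trans ((S.dimAt_lfdEulerMap t x).trans ?_)
    rw [AddMonoidHom.comp_apply, hg, map_sub]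
    exact congrArg₂ (· - ·) (pairing_cls _ x).symm (pairing_cls _ x).symm
  exact DFunLike.congr_fun this t

end Numerical

/-! ### Finite-dimensionality of the kernels and cokernels -/

section FdComplexes

variable {K : Type k} [Field K] {C : Type u} [Category.{v} C] [Preadditive C] [Linear K C]

omit [Linear K C] [Field K] in
lemma isLocalObj_fullSubcategory_iff {T : ObjectProperty C} (z : T.FullSubcategory) :
    IsLocalObj z ↔ IsLocalObj z.obj := by
  have hiso : ∀ f : z ⟶ z, IsIso f ↔ IsIso f.hom := fun f => by
    constructor
    · intro h
      exact inferInstanceAs (IsIso (T.ι.map f))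
    · intro h
      have : IsIso (T.ι.map f) := h
      exact isIso_of_reflects_iso f T.ι
  refine ⟨fun h => ⟨fun h0 => h.id_ne_zero (ObjectProperty.hom_ext _ h0), fun f => ?_⟩,
    fun h => ⟨fun h0 => h.id_ne_zero (congrArg (fun f => f.hom) h0), fun f => ?_⟩⟩
  · have := h.isIso_or (ObjectProperty.homMk f)
    rwa [hiso, hiso] at this
  · rw [hiso, hiso]
    exact h.isIso_or f.hom

/-- Up to isomorphism, all but finitely many local objects of `T` are in `U`. -/
def AlmostContained (T U : ObjectProperty C) : Prop :=
  ∃ s : Finset T.FullSubcategory, ∀ z : T.FullSubcategory, IsLocalObj z →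
    U z.obj ∨ ∃ W ∈ s, Nonempty (z ≅ W)

-- The support of N is covered by the exceptional objects of T and by those objects in the support
-- list of M that happen to lie in T.
omit [Linear K C] in
lemma AlmostContained.hasFiniteSupport {T U : ObjectProperty C} (h : AlmostContained T U)
    (hTiso : ∀ {X Y : C}, (X ≅ Y) → T X → T Y)
    {N : T.FullSubcategoryᵒᵖ ⥤ ModuleCat.{v} K} {M : U.FullSubcategoryᵒᵖ ⥤ ModuleCat.{v} K}
    (hM : HasFiniteSupport M) (hNM : ∀ (z : T.FullSubcategory) (hz : U z.obj),
      Nontrivial (N.obj (op z)) → Nontrivial (M.obj (op ⟨z.obj, hz⟩))) : HasFiniteSupport N := by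
  classical
  obtain ⟨s, hs⟩ := h
  obtain ⟨s', hs'⟩ := hM
  have hinj : Function.Injective (fun z : T.FullSubcategory => z.obj) := by
    rintro ⟨z, hz⟩ ⟨z', hz'⟩ rfl
    rfl
  have hfin : ((fun z : T.FullSubcategory => z.obj) ⁻¹' ((fun z : U.FullSubcategory => z.obj) ''
      s')).Finite := (s'.finite_toSet.image _).preimage hinj.injOn
  refine ⟨s ∪ hfin.toFinset, fun z hz hN => ?_⟩
  rcases hs z hz with hzU | ⟨W, hW, e⟩
  · obtain ⟨W, hW, ⟨e⟩⟩ := hs' ⟨z.obj, hzU⟩ ((isLocalObj_fullSubcategory_iff _).2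
      ((isLocalObj_fullSubcategory_iff z).1 hz)) (hNM z hzU hN)
    have e' : z.obj ≅ W.obj := U.ι.mapIso e
    refine ⟨⟨W.obj, hTiso e' z.2⟩, Finset.mem_union_right _ ?_, ⟨ObjectProperty.isoMk _ e'⟩⟩
    rw [Set.Finite.mem_toFinset]
    exact ⟨W, hW, rfl⟩
  · exact ⟨W, Finset.mem_union_left _ hW, e⟩

variable {D : ExtData K C} {T U : ObjectProperty C} (hD : HasExactConfl D)
  (hU : ClusterTilting D U) (h : AlmostContained T U)
  (hTiso : ∀ {X Y : C}, (X ≅ Y) → T X → T Y) {M : U.FullSubcategoryᵒᵖ ⥤ ModuleCat.{v} K}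

include h hTiso

/-- For z also in U the conflation z → L → L' splits. Then M(L') → M(L) is injective and the kernel
vanishes at z. -/
lemma hasFiniteSupport_kerMod_coindexComplex
    (c : ∀ t : T.FullSubcategory, Coresolution D U t.obj) (hM : IsModule M)
    (hM' : HasFiniteSupport M) :
    HasFiniteSupport ((coindexComplex hD hU c).kerMod hM) := by
  refine h.hasFiniteSupport hTiso hM' fun z hz hN => absurd hN (not_nontrivial_iff_subsingleton.2 ?_)
  obtain ⟨s, hs⟩ := hD.lift_mid (c z).real (𝟙 _) (hU.ext_eq_zero (c z).L'.2 hz _)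
  refine subsingleton_of_forall_eq 0 fun n => (coindexComplex hD hU c).kerι_injective hM z ?_
  rw [map_zero]
  have h0 := ((coindexComplex hD hU c).exact_kerι hM z).apply_apply_eq_zero n
  generalize (coindexComplex hD hU c).kerι hM z n = m at h0
  change M.obj (op (c z).L') at m
  have h0 : (M.map (ObjectProperty.homMk (c z).p : (c z).L ⟶ (c z).L').op).hom m = 0 := h0
  have h1 := congrArg (M.map (ObjectProperty.homMk s : (c z).L' ⟶ (c z).L).op).hom h0
  rw [← map_comp_apply, map_zero] at h1
  have : (ObjectProperty.homMk s ≫ ObjectProperty.homMk (c z).p : (c z).L' ⟶ (c z).L') = 𝟙 _ :=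
    ObjectProperty.hom_ext _ hs
  rw [this, map_id_apply] at h1
  exact h1

/-- For z also in U the splitting exhibits L as the sum of z and L', so the cokernel at z can be
nonzero only if M(z) is. -/
lemma hasFiniteSupport_cokerMod_coindexComplex
    (c : ∀ t : T.FullSubcategory, Coresolution D U t.obj) (hM : IsModule M)
    (hM' : HasFiniteSupport M) :
    HasFiniteSupport ((coindexComplex hD hU c).cokerMod hM) := by
  refine h.hasFiniteSupport hTiso hM' fun z hz hN => ?_
  by_contra hMz
  rw [not_nontrivial_iff_subsingleton] at hMz
  refine not_subsingleton_iff_nontrivial.2 hN (subsingleton_of_forall_eq 0 fun n => ?_)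
  obtain ⟨(m : M.obj (op (c z).L)), rfl⟩ := (coindexComplex hD hU c).cokerπ_surjective hM z n
  obtain ⟨r, hr⟩ := (c z).extend hD hU hz (𝟙 z.obj)
  obtain ⟨l, hl⟩ := hD.desc_right (c z).real (𝟙 _ - r ≫ (c z).i) (by
    rw [Preadditive.comp_sub, ← Category.assoc, hr, Category.id_comp, Category.comp_id, sub_self])
  let i' : (⟨z.obj, hz⟩ : U.FullSubcategory) ⟶ (c z).L := ObjectProperty.homMk (c z).i
  let r' : (c z).L ⟶ (⟨z.obj, hz⟩ : U.FullSubcategory) := ObjectProperty.homMk r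
  let p' : (c z).L ⟶ (c z).L' := ObjectProperty.homMk (c z).p
  let l' : (c z).L' ⟶ (c z).L := ObjectProperty.homMk l
  have hsum : 𝟙 (c z).L = r' ≫ i' + p' ≫ l' := ObjectProperty.hom_ext _ (by
    change 𝟙 _ = r ≫ (c z).i + (c z).p ≫ l
    rw [hl]
    abel)
  refine ((coindexComplex hD hU c).exact_cokerπ hM z m).2 ⟨(M.map l'.op).hom m, ?_⟩
  change (M.map p'.op).hom _ = m
  conv_rhs => rw [← map_id_apply M m, hsum, hM.add_apply, map_comp_apply,
    Subsingleton.elim ((M.map i'.op).hom m) 0, map_zero, zero_add]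
  rw [map_comp_apply]

/-- For z also in U the conflation N → R → z splits. Then M(R) → M(N) is surjective and the cokernel
vanishes at z. -/
lemma hasFiniteSupport_cokerMod_indexComplex
    (r : ∀ t : T.FullSubcategory, Resolution D U t.obj) (hM : IsModule M)
    (hM' : HasFiniteSupport M) :
    HasFiniteSupport ((indexComplex hD hU r).cokerMod hM) := by
  refine h.hasFiniteSupport hTiso hM' fun z hz hN => absurd hN (not_nontrivial_iff_subsingleton.2 ?_)
  obtain ⟨s, hs⟩ := hD.desc_mid (r z).real (𝟙 _) (hU.ext_eq_zero hz (r z).N.2 _)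
  refine subsingleton_of_forall_eq 0 fun n => ?_
  obtain ⟨(m : M.obj (op (r z).N)), rfl⟩ := (indexComplex hD hU r).cokerπ_surjective hM z n
  let s' : (r z).R ⟶ (r z).N := ObjectProperty.homMk s
  let i' : (r z).N ⟶ (r z).R := ObjectProperty.homMk (r z).i
  have hs' : i' ≫ s' = 𝟙 _ := ObjectProperty.hom_ext _ hs
  refine ((indexComplex hD hU r).exact_cokerπ hM z m).2 ⟨(M.map s'.op).hom m, ?_⟩
  change (M.map i'.op).hom _ = m
  rw [← map_comp_apply, hs', map_id_apply]

/-- For z also in U, R is the sum of z and N, so the kernel at z can be nonzero only if M(z) is. -/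
lemma hasFiniteSupport_kerMod_indexComplex
    (r : ∀ t : T.FullSubcategory, Resolution D U t.obj) (hM : IsModule M)
    (hM' : HasFiniteSupport M) :
    HasFiniteSupport ((indexComplex hD hU r).kerMod hM) := by
  refine h.hasFiniteSupport hTiso hM' fun z hz hN => ?_
  by_contra hMz
  rw [not_nontrivial_iff_subsingleton] at hMz
  refine not_subsingleton_iff_nontrivial.2 hN (subsingleton_of_forall_eq 0 fun n =>
    (indexComplex hD hU r).kerι_injective hM z ?_)
  rw [map_zero]
  have h0 := ((indexComplex hD hU r).exact_kerι hM z).apply_apply_eq_zero n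
  generalize (indexComplex hD hU r).kerι hM z n = m at h0
  change M.obj (op (r z).R) at m
  obtain ⟨s, hs⟩ := (r z).factor hD hU hz (𝟙 z.obj)
  obtain ⟨l, hl⟩ := hD.lift_left (r z).real (𝟙 _ - (r z).p ≫ s) (by
    rw [Preadditive.sub_comp, Category.assoc, hs, Category.id_comp, Category.comp_id, sub_self])
  let i' : (r z).N ⟶ (r z).R := ObjectProperty.homMk (r z).i
  let s' : (⟨z.obj, hz⟩ : U.FullSubcategory) ⟶ (r z).R := ObjectProperty.homMk s
  let p' : (r z).R ⟶ (⟨z.obj, hz⟩ : U.FullSubcategory) := ObjectProperty.homMk (r z).p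
  let l' : (r z).R ⟶ (r z).N := ObjectProperty.homMk l
  have h0 : (M.map i'.op).hom m = 0 := h0
  have hsum : 𝟙 (r z).R = p' ≫ s' + l' ≫ i' := ObjectProperty.hom_ext _ (by
    change 𝟙 _ = (r z).p ≫ s + l ≫ (r z).i
    rw [hl]
    abel)
  have : m = 0 := by
    rw [← map_id_apply M m, hsum, hM.add_apply, map_comp_apply, map_comp_apply,
      Subsingleton.elim ((M.map s'.op).hom m) 0, h0, map_zero, map_zero, zero_add]
  exact this

end FdComplexes

end ClusterIso

namespace ClusterIso

/-! ### Index and coindex in the stable category -/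

section StableIndex

variable {K : Type k} [Field K] {C : Type u} [Category.{v} C] [Preadditive C] [Linear K C]
  {D : ExtData K C}

lemma isZero_stab_of_projInj {P : C} (hP : ProjInj D P) : IsZero ((stabπ D).obj P) := by
  rw [IsZero.iff_id_eq_zero, ← CategoryTheory.Functor.map_id, ← (stabπ D).map_zero,
    AddQuot.map_eq_iff]
  exact Submodule.subset_span ⟨P, 𝟙 P, 𝟙 P, hP, by simp⟩

variable [HasZeroObject C] [HasBinaryBiproducts C] (hD : IsExtriangulated D) (hF : IsFrobenius D)

include hD in
lemma exists_factor_of_mem_idealHom {X V I : C} {i : X ⟶ I} (hi : Infl D i) {h : X ⟶ V}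
    (hh : h ∈ idealHom K (ProjInj D) X V) : ∃ g : I ⟶ V, i ≫ g = h := by
  obtain ⟨Z, p, δ, hr⟩ := hi
  induction hh using Submodule.span_induction with
  | mem h hh =>
    obtain ⟨Q, a, b, hQ, rfl⟩ := hh
    have := hQ.2 Z
    obtain ⟨g, rfl⟩ := hD.hasExactConfl.desc_mid hr a (Subsingleton.elim _ _)
    exact ⟨g ≫ b, by rw [Category.assoc]⟩
  | zero => exact ⟨0, Limits.comp_zero⟩
  | add _ _ _ _ h₁ h₂ =>
    obtain ⟨g, rfl⟩ := h₁
    obtain ⟨g', rfl⟩ := h₂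
    exact ⟨g + g', Preadditive.comp_add _ _ _ _ _ _⟩
  | smul a _ _ h =>
    obtain ⟨g, rfl⟩ := h
    exact ⟨a • g, Linear.comp_smul _ _ _ _ _ _⟩

include hD hF in
/-- Stably isomorphic objects are isomorphic up to projective-injective summands. -/
lemma exists_iso_of_stab_iso {X Y : C} (e : (stabπ D).obj X ≅ (stabπ D).obj Y) :
    ∃ I W : C, ProjInj D I ∧ ProjInj D W ∧ Nonempty (X ⊞ W ≅ Y ⊞ I) := by
  obtain ⟨(f : X ⟶ Y), hf⟩ := AddQuot.map_surj e.hom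
  obtain ⟨(g : Y ⟶ X), hg⟩ := AddQuot.map_surj e.inv
  obtain ⟨I, i, hI, hi⟩ := hF.enough_inj X
  -- The map (f, i) : X → Y ⊕ I is an inflation. Once its cokernel W is shown to be projective, the
  -- conflation splits and yields the isomorphism.
  obtain ⟨W, p, δ, hr⟩ := hD.infl_lift f hi
  have hfg : f ≫ g - 𝟙 X ∈ idealHom K (ProjInj D) X X :=
    (AddQuot.map_eq_iff _ _).1 (by
      rw [Functor.map_comp, hf, hg, e.hom_inv_id]
      exact ((stabπ D).map_id X).symm)
  have hgf : g ≫ f - 𝟙 Y ∈ idealHom K (ProjInj D) Y Y :=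
    (AddQuot.map_eq_iff _ _).1 (by
      rw [Functor.map_comp, hf, hg, e.inv_hom_id]
      exact ((stabπ D).map_id Y).symm)
  have hIP : ProjInj D I := ⟨(hF.proj_iff_inj I).2 hI, hI⟩
  have hW : IsProj D W := fun V => by
    refine subsingleton_of_forall_eq 0 fun ε => ?_
    -- On I the pullback vanishes by projectivity. On Y it is killed by pulling back along `f`,
    -- which is invertible modulo projective-injectives, and Ext cannot see those.
    have hz : D.pull p V ε = 0 := by
      have h₁ : D.pull (biprod.inl ≫ p) V ε = 0 := by
        have hpf : D.pull f V (D.pull (biprod.inl ≫ p) V ε) = 0 := by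
          have h0 : D.pull (biprod.lift f i ≫ p) V ε = 0 := by
            rw [hD.hasExactConfl.comp_zero hr, D.pull_zero]
          have : biprod.lift f i ≫ p = f ≫ biprod.inl ≫ p + i ≫ biprod.inr ≫ p := by
            rw [biprod.lift_eq, Preadditive.add_comp, Category.assoc, Category.assoc]
          rw [this, D.pull_add, D.pull_comp i, @Subsingleton.elim _ (hIP.1 V)
            (D.pull (biprod.inr ≫ p) V ε) 0, map_zero, add_zero, D.pull_comp] at h0
          exact h0
        have := congrArg (D.pull g V) hpf
        rw [map_zero, ← D.pull_comp, pull_congr D le_rfl hgf, D.pull_id] at this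
        exact this
      have : p = biprod.fst ≫ biprod.inl ≫ p + biprod.snd ≫ biprod.inr ≫ p := by
        rw [← Category.assoc, ← Category.assoc, ← Preadditive.add_comp, biprod.total,
          Category.id_comp]
      rw [this, D.pull_add, D.pull_comp, h₁, D.pull_comp biprod.snd, @Subsingleton.elim _
        (hIP.1 V) (D.pull (biprod.inr ≫ p) V ε) 0, map_zero, map_zero, add_zero]
    obtain ⟨h, rfl⟩ := hD.hasExactConfl.eq_push hr ε hz
    have hmem : (f ≫ g - 𝟙 X) ≫ h ∈ idealHom K (ProjInj D) X V := idealHom_comp_right h hfg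
    -- The map `h` agrees with `f ≫ g ≫ h` up to a map through projective-injectives, which extends
    -- over I. So `h` extends over (f, i), and the extension it induces is zero.
    obtain ⟨l, hl⟩ := exists_factor_of_mem_idealHom hD hi hmem
    have hext : h = biprod.lift f i ≫ biprod.desc (g ≫ h) (-l) := by
      rw [biprod.lift_desc, Preadditive.comp_neg, hl, Preadditive.sub_comp, Category.id_comp,
        Category.assoc]
      abel
    rw [hext, D.push_comp, hD.hasExactConfl.push_zero hr, map_zero]
  have hδ : δ = 0 := @Subsingleton.elim _ (hW X) _ _
  subst hδ
  obtain ⟨e', -⟩ := (hD.real_iff _ _ _ _ _ (hD.real_zero X W)).1 hr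
  exact ⟨I, W, hIP, ⟨hW, (hF.proj_iff_inj W).1 hW⟩, ⟨e'⟩⟩

include hD hF in
/-- Additive invariants vanishing on projective-injective objects descend to the stable
category. -/
lemma IsAdditiveRel.stab [HasBinaryBiproducts (Stab D)] {G G' : Type*} [AddCommGroup G]
    [AddCommGroup G'] {R : C → G → Prop} (hR : IsAdditiveRel R) (q : G →+ G')
    (hq : ∀ P c, ProjInj D P → R P c → q c = 0) :
    IsAdditiveRel fun (X : Stab D) c => ∃ c', R X.as c' ∧ q c' = c := by
  have hiso : ∀ {X Y : C} {c d : G}, ((stabπ D).obj X ≅ (stabπ D).obj Y) → R X c → R Y d →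
      q c = q d := fun {X Y c d} e hc hd => by
    obtain ⟨I, W, hI, hW, ⟨e'⟩⟩ := exists_iso_of_stab_iso hD hF e
    obtain ⟨cI, hcI⟩ := hR.exists_rel I
    obtain ⟨cW, hcW⟩ := hR.exists_rel W
    have := congrArg q (hR.unique (hR.of_iso e' (hR.add hc hcW)) (hR.add hd hcI))
    rwa [map_add, map_add, hq I cI hI hcI, hq W cW hW hcW, add_zero, add_zero] at this
  refine ⟨fun X => ?_, ?_, ?_, ?_⟩
  · obtain ⟨c, hc⟩ := hR.exists_rel X.as
    exact ⟨q c, c, hc, rfl⟩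
  · rintro X _ _ ⟨c, hc, rfl⟩ ⟨d, hd, rfl⟩
    rw [hR.unique hc hd]
  · rintro X Y _ e ⟨c, hc, rfl⟩
    obtain ⟨d, hd⟩ := hR.exists_rel Y.as
    exact ⟨d, hd, (hiso e hc hd).symm⟩
  · rintro X Y _ _ ⟨c, hc, rfl⟩ ⟨d, hd, rfl⟩
    obtain ⟨x, hx⟩ := hR.exists_rel (X ⊞ Y).as
    refine ⟨x, hx, ?_⟩
    rw [← map_add]
    have := preservesBinaryBiproducts_of_preservesBiproducts (stabπ D)
    exact hiso ((stabπ D).mapBiprod X.as Y.as).symm hx (hR.add hc hd)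

variable {T U : ObjectProperty C}

variable (D U) in
/-- The projection from `U` to its stable category. -/
def subToStab : U.FullSubcategory ⥤ StabSub D U :=
  (stabProp D U).lift (U.ι ⋙ stabπ D) (fun X => X.property)

omit [HasZeroObject C] [HasBinaryBiproducts C] in
instance : (subToStab D U).Additive where
  map_add {_ _ f g} := ObjectProperty.hom_ext _ ((stabπ D).map_add (f := f.hom) (g := g.hom))

omit [HasZeroObject C] [HasBinaryBiproducts C] in
lemma map_subToStab_cls_eq_zero (P : U.FullSubcategory) (hP : ProjInj D P.obj) :
    K0Split.map (subToStab D U) (K0Split.cls P) = 0 := by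
  rw [K0Split.map_cls]
  apply K0Split.cls_isZero
  rw [IsZero.iff_id_eq_zero]
  exact ObjectProperty.hom_ext _ ((IsZero.iff_id_eq_zero _).1 (isZero_stab_of_projInj hP))

variable (hU : ClusterTilting D U) (hL : Nonempty (ExactLift.{k, u, v, u', v'} D))

include hD hF hU hL

/-- Uniqueness of the stable coindex is inherited from C rather than from an exact lift of the
stable category. The coindex in C, projected to the stable split Grothendieck group, kills
projective-injectives: these lie in U, are their own coindex and become zero. Hence it descends
along stable isomorphisms. -/
theorem existsUnique_isCoindex_stab :
    ∃! g, IsCoindex (stabData D) (stabProp D U) (stabProp D T) g := by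
  have := hasZeroObject_stab (D := D)
  have := hasBinaryBiproducts_addQuot (K := K) (ProjInj D)
  have hU' := clusterTilting_stabProp hU
  have hD' := hD.hasExactConfl.quotData (P := ProjInj D) le_rfl
  have hR := isAdditiveRel_isCoindexOf hU hD hL
  have := hasZeroObject_sub hU'
  refine existsUnique_isCoindex_of_hom hU' hD' ?_
  have hq : ∀ P c, ProjInj D P → IsCoindexOf D U P c → K0Split.map (subToStab D U) c = 0 := by
    intro P c hP hc
    obtain ⟨O, hO⟩ := HasZeroObject.zero (C := C)
    have : IsCoindexOf D U P (K0Split.cls (⟨P, hU.of_projInj hP⟩ : U.FullSubcategory) -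
        K0Split.cls (⟨O, hU.of_isZero hO⟩ : U.FullSubcategory)) :=
      ⟨⟨_, _, _, _, _, hD.real_of_isZero_right P hO⟩, rfl⟩
    rw [hR.unique hc this, K0Split.cls_isZero (X := (⟨O, _⟩ : U.FullSubcategory))
      ((IsZero.iff_id_eq_zero _).2 (ObjectProperty.hom_ext _ (hO.eq_of_src _ _))), sub_zero,
      map_subToStab_cls_eq_zero _ hP]
  obtain ⟨f, hf⟩ := (hR.stab hD hF (K0Split.map (subToStab D U)) hq).exists_hom (stabProp D T)
  refine ⟨f, fun t c hc => hf t c ?_⟩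
  obtain ⟨⟨L, L', i, p, δ, h⟩, rfl⟩ := hc
  -- Every stable conflation comes from one in C with the same ends and a stably isomorphic middle
  -- term.
  obtain ⟨Y, x, y, e, hr, -, -⟩ := (quotData_real_iff D le_rfl _ _ _).1 h
  have hY : U Y := hU'.of_iso L.2 e.symm
  refine ⟨_, ⟨⟨⟨Y, hY⟩, ⟨L'.obj.as, L'.2⟩, x, y, δ, hr⟩, rfl⟩, ?_⟩
  rw [map_sub, K0Split.map_cls, K0Split.map_cls]
  congr 1
  exact K0Split.cls_iso (ObjectProperty.isoMk _ e.symm)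

theorem existsUnique_isIndex_stab :
    ∃! g, IsIndex (stabData D) (stabProp D U) (stabProp D T) g := by
  have := hasZeroObject_stab (D := D)
  have := hasBinaryBiproducts_addQuot (K := K) (ProjInj D)
  have hU' := clusterTilting_stabProp hU
  have hD' := hD.hasExactConfl.quotData (P := ProjInj D) le_rfl
  have hR := isAdditiveRel_isIndexOf hU hD hL
  have := hasZeroObject_sub hU'
  refine existsUnique_isIndex_of_hom hU' hD' ?_
  have hq : ∀ P c, ProjInj D P → IsIndexOf D U P c → K0Split.map (subToStab D U) c = 0 := by
    intro P c hP hc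
    obtain ⟨O, hO⟩ := HasZeroObject.zero (C := C)
    have : IsIndexOf D U P (K0Split.cls (⟨P, hU.of_projInj hP⟩ : U.FullSubcategory) -
        K0Split.cls (⟨O, hU.of_isZero hO⟩ : U.FullSubcategory)) :=
      ⟨_, _, _, _, ⟨_, hD.real_of_isZero_left P hO⟩, rfl⟩
    rw [hR.unique hc this, K0Split.cls_isZero (X := (⟨O, _⟩ : U.FullSubcategory))
      ((IsZero.iff_id_eq_zero _).2 (ObjectProperty.hom_ext _ (hO.eq_of_src _ _))), sub_zero,
      map_subToStab_cls_eq_zero _ hP]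
  obtain ⟨f, hf⟩ := (hR.stab hD hF (K0Split.map (subToStab D U)) hq).exists_hom (stabProp D T)
  refine ⟨f, fun t c hc => hf t c ?_⟩
  obtain ⟨N, R, i, p, ⟨δ, h⟩, rfl⟩ := hc
  obtain ⟨Y, x, y, e, hr, -, -⟩ := (quotData_real_iff D le_rfl _ _ _).1 h
  have hY : U Y := hU'.of_iso R.2 e.symm
  refine ⟨_, ⟨⟨N.obj.as, N.2⟩, ⟨Y, hY⟩, x, y, ⟨δ, hr⟩, rfl⟩, ?_⟩
  rw [map_sub, K0Split.map_cls, K0Split.map_cls]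
  congr 1
  exact K0Split.cls_iso (ObjectProperty.isoMk _ e.symm)

end StableIndex

end ClusterIso

namespace ClusterIso

/-! ### Krull–Schmidt categories and mutation -/

section KrullSchmidt

variable {A : Type u} [Category.{v} A] [Preadditive A]

lemma IsLocalObj.indec {X : A} (hX : IsLocalObj X) : Indec X := by
  refine ⟨not_isZero_iff.2 hX.id_ne_zero, fun Y Z b _ ⟨e⟩ => ?_⟩
  rcases (hX.of_iso e.symm).isIso_or (b.fst ≫ b.inl) with h | h
  · right
    have h0 : b.inr = 0 := by
      rw [← cancel_mono (b.fst ≫ b.inl), ← Category.assoc, b.inr_fst, zero_comp, zero_comp]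
    rw [IsZero.iff_id_eq_zero, ← b.inr_snd, h0, zero_comp]
  · left
    have h0 : b.inl = 0 := by
      rw [← cancel_mono (𝟙 b.pt - b.fst ≫ b.inl), Preadditive.comp_sub, ← Category.assoc,
        b.inl_fst, Category.id_comp, Category.comp_id, sub_self, zero_comp]
    rw [IsZero.iff_id_eq_zero, ← b.inl_fst, h0, zero_comp]

lemma IsKrullSchmidt.localDecomp (h : IsKrullSchmidt A) (X : A) : LocalDecomp X := by
  obtain ⟨n, f, b, ⟨hb⟩, hf, ⟨e⟩⟩ := h.decomp X
  refine ⟨n, f, fun j => b.ι j ≫ e.inv, fun j => e.hom ≫ b.π j, Finset.univ, fun j _ => ?_,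
    fun j _ => ?_, ?_⟩
  · have := h.isLocalRing _ (hf j)
    exact isLocalObj_of_isLocalRing
  · simp
  · have := IsBilimit.total hb
    have h' : e.hom ≫ (∑ j, b.π j ≫ b.ι j) ≫ e.inv = 𝟙 X := by
      rw [this, Category.id_comp, e.hom_inv_id]
    simpa only [Preadditive.sum_comp, Preadditive.comp_sum, Category.assoc] using h'

lemma LocalDecomp.fullSubcategory {T : ObjectProperty A}
    (hT : ∀ {X Y : A} (i : X ⟶ Y) (r : Y ⟶ X), i ≫ r = 𝟙 X → T Y → T X) (X : T.FullSubcategory)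
    (hX : LocalDecomp X.obj) : LocalDecomp X := by
  obtain ⟨n, f, i, p, s, hs, hip, hsum⟩ := hX
  have h : ∀ j, ∃ (Y : T.FullSubcategory) (i' : Y ⟶ X) (p' : X ⟶ Y), j ∈ s →
      IsLocalObj Y ∧ i' ≫ p' = 𝟙 Y ∧ (p' ≫ i').hom = p j ≫ i j := fun j => by
    by_cases hj : j ∈ s
    · exact ⟨⟨f j, hT (i j) (p j) (hip j hj) X.2⟩, ObjectProperty.homMk (i j),
        ObjectProperty.homMk (p j), fun _ => ⟨(isLocalObj_fullSubcategory_iff _).2 (hs j hj),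
          ObjectProperty.hom_ext _ (hip j hj), rfl⟩⟩
    · exact ⟨X, 𝟙 X, 𝟙 X, fun h => absurd h hj⟩
  choose Y i' p' h using h
  refine ⟨n, Y, i', p', s, fun j hj => (h j hj).1, fun j hj => (h j hj).2.1,
    ObjectProperty.hom_ext _ ?_⟩
  refine (T.ι.map_sum _ _).trans (Eq.trans ?_ hsum)
  exact Finset.sum_congr rfl fun j hj => (h j hj).2.2

lemma AddClosure.of_mem {S : ObjectProperty A} {X : A} (hX : S X) : AddClosure S X := by
  refine ⟨1, fun _ => X, { pt := X, π := fun _ => 𝟙 X, ι := fun _ => 𝟙 X, ι_π := fun j j' => ?_ },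
    ⟨isBilimitOfTotal _ (by simp)⟩, fun _ => hX, ⟨⟨𝟙 X, 𝟙 X, Category.comp_id _⟩⟩⟩
  obtain rfl := Subsingleton.elim j j'
  simp

end KrullSchmidt

/-! ### Consequences of mutability and reachability. -/

section Mutation

variable {K : Type k} [Field K] {C : Type u} [Category.{v} C] [Preadditive C] [Linear K C]
  {D : ExtData K C} {T U : ObjectProperty C}

omit [Linear K C] in
lemma removeObj_of_isLocalObj {X Z : C} (hX : IsLocalObj X) (hTX : T X) (hZ : 𝟙 Z ≠ 0)
    (h : IsEmpty (X ≅ Z)) : RemoveObj T Z X :=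
  ⟨hTX, ⟨fun ρ => h.elim (hX.nonempty_iso_of_retract ρ.i ρ.r ρ.retract hZ).some.symm⟩⟩

/-- A mutable local object has a sink map. -/
lemma MaxMutable.exists_sink (h : MaxMutable D T) {Z : C} (hTZ : T Z) (hZ : IsLocalObj Z)
    (hproj : ¬ IsProj D Z) : ∃ (B : C) (b : B ⟶ Z), T B ∧ IsEmpty (Retract Z B) ∧
      ∀ X : C, IsLocalObj X → T X → IsEmpty (X ≅ Z) → ∀ f : X ⟶ Z, ∃ g : X ⟶ B, g ≫ b = f := by
  obtain ⟨Z', hZ'⟩ := h Z hTZ hZ.indec hproj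
  -- The exchange conflation ending in Z provides the sink map: its middle term has no summand Z,
  -- and maps from all other local objects of T factor through it.
  obtain ⟨B, i, p, δ, -, -, hB, hp⟩ := hZ'.exchange_plus
  exact ⟨B, p, hB.1, hB.2, fun X hX hTX hXZ f =>
    hp X f (removeObj_of_isLocalObj hX hTX hZ.id_ne_zero hXZ)⟩

/-- Mutation changes only finitely many local objects. -/
lemma Reachable.exists_finset (h : Reachable D T U) : ∃ s : Finset C, ∀ z, IsLocalObj z → T z →
    U z ∨ ∃ W ∈ s, Nonempty (z ≅ W) := by
  classical
  induction h with
  | refl => exact ⟨∅, fun z _ hz => Or.inl hz⟩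
  | tail _ hstep ih =>
    obtain ⟨s, hs⟩ := ih
    obtain ⟨T₀, T₁, hex, rfl⟩ := hstep
    -- A single mutation loses only the isomorphism class of the exchanged object.
    refine ⟨insert T₀ s, fun z hz hTz => ?_⟩
    rcases hs z hz hTz with h | ⟨W, hW, e⟩
    · by_cases he : Nonempty (z ≅ T₀)
      · exact Or.inr ⟨T₀, Finset.mem_insert_self _ _, he⟩
      · exact Or.inl (AddClosure.of_mem (Or.inl (removeObj_of_isLocalObj hz h
          (not_isZero_iff.1 hex.indec.1) (not_nonempty_iff.1 he))))
    · exact Or.inr ⟨W, Finset.mem_insert_of_mem hW, e⟩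

omit [Linear K C] in
lemma almostContained_of_finset (hTiso : ∀ {X Y : C}, (X ≅ Y) → T X → T Y)
    (h : ∃ s : Finset C, ∀ z, IsLocalObj z → T z → U z ∨ ∃ W ∈ s, Nonempty (z ≅ W)) :
    AlmostContained T U := by
  obtain ⟨s, hs⟩ := h
  have hinj : Function.Injective (fun z : T.FullSubcategory => z.obj) := by
    rintro ⟨z, hz⟩ ⟨z', hz'⟩ rfl
    rfl
  have hfin : ((fun z : T.FullSubcategory => z.obj) ⁻¹' s).Finite :=
    s.finite_toSet.preimage hinj.injOn
  refine ⟨hfin.toFinset, fun z hz => ?_⟩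
  rcases hs z.obj ((isLocalObj_fullSubcategory_iff z).1 hz) z.2 with h | ⟨W, hW, ⟨e⟩⟩
  · exact Or.inl h
  · exact Or.inr ⟨⟨W, hTiso e z.2⟩, (Set.Finite.mem_toFinset _).2 hW, ⟨ObjectProperty.isoMk _ e⟩⟩

-- The exceptional list is allowed to contain all local objects of T, and here they are finitely
-- many.
omit [Linear K C] in
lemma AddFinite.almostContained (h : AddFinite T) (hA : ∀ X : T.FullSubcategory, LocalDecomp X) :
    AlmostContained T U := by
  obtain ⟨V, hV, hadd⟩ := h
  obtain ⟨s, hs⟩ := (hA ⟨V, hV⟩).exists_finset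
  refine ⟨s, fun z hz => Or.inr ?_⟩
  obtain ⟨φ, ψ, h⟩ := exists_isIso_of_addClosure ((isLocalObj_fullSubcategory_iff z).1 hz)
    (hadd z.obj z.2)
  refine hs z (ObjectProperty.homMk φ) (ObjectProperty.homMk ψ) hz ?_
  let φ' : z ⟶ (⟨V, hV⟩ : T.FullSubcategory) := ObjectProperty.homMk φ
  let ψ' : (⟨V, hV⟩ : T.FullSubcategory) ⟶ z := ObjectProperty.homMk ψ
  have : IsIso (T.ι.map (φ' ≫ ψ')) := h
  exact isIso_of_reflects_iso (φ' ≫ ψ') T.ι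

end Mutation

/-! ### Passage of local objects, sink maps and reachability to the stable category. -/

section StableMutation

variable {K : Type k} [Field K] {C : Type u} [Category.{v} C] [Preadditive C] [Linear K C]
  {D : ExtData K C} {T U : ObjectProperty C}

lemma IsLocalObj.stab {Z : C} (hZ : IsLocalObj Z) (h : 𝟙 ((stabπ D).obj Z) ≠ 0) :
    IsLocalObj ((stabπ D).obj Z) where
  id_ne_zero := h
  isIso_or f := by
    obtain ⟨(g : Z ⟶ Z), rfl⟩ := AddQuot.map_surj f
    rcases hZ.isIso_or g with h | h
    · exact Or.inl inferInstance
    · right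
      have : 𝟙 ((stabπ D).obj Z) - (stabπ D).map g = (stabπ D).map (𝟙 Z - g) := by
        rw [(stabπ D).map_sub, CategoryTheory.Functor.map_id]
      rw [this]
      infer_instance

/-- Local objects become local or zero. The zero summands are discarded, which is possible because
`LocalDecomp` sums over a subset of the indices. -/
lemma LocalDecomp.stab {X : C} (hX : LocalDecomp X) : LocalDecomp ((stabπ D).obj X) := by
  classical
  obtain ⟨n, f, i, p, s, hs, hip, hsum⟩ := hX
  refine ⟨n, fun j => (stabπ D).obj (f j), fun j => (stabπ D).map (i j), fun j => (stabπ D).map (p j),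
    s.filter fun j => 𝟙 ((stabπ D).obj (f j)) ≠ 0, fun j hj => ?_, fun j hj => ?_, ?_⟩
  · exact (hs j (Finset.mem_filter.1 hj).1).stab (Finset.mem_filter.1 hj).2
  · rw [← Functor.map_comp, hip j (Finset.mem_filter.1 hj).1]
    exact (stabπ D).map_id _
  · rw [Finset.sum_filter_of_ne]
    · rw [← CategoryTheory.Functor.map_id, ← hsum, (stabπ D).map_sum]
      exact Finset.sum_congr rfl fun j _ => ((stabπ D).map_comp _ _).symm
    · intro j _ hj h0
      apply hj
      change (stabπ D).map (p j) ≫ (stabπ D).map (i j) = 0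
      rw [← Category.comp_id ((stabπ D).map (p j)), h0, Limits.comp_zero, zero_comp]

/-- Local objects of the stable category lift to local objects. -/
lemma exists_local_lift (hC : ∀ X : C, LocalDecomp X) {Z : Stab D} (hZ : IsLocalObj Z) :
    ∃ Z₀ : C, IsLocalObj Z₀ ∧ Nonempty (Z ≅ (stabπ D).obj Z₀) ∧
      ∃ (i : Z₀ ⟶ Z.as) (r : Z.as ⟶ Z₀), i ≫ r = 𝟙 Z₀ := by
  obtain ⟨n, f, i, p, s, hs, hip, hsum⟩ := hC Z.as
  have h : 𝟙 Z = ∑ j ∈ s, (stabπ D).map (p j) ≫ (stabπ D).map (i j) := by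
    refine ((stabπ D).map_id Z.as).symm.trans ?_
    rw [← hsum, (stabπ D).map_sum]
    exact Finset.sum_congr rfl fun j _ => (stabπ D).map_comp _ _
  obtain ⟨j, hj, h⟩ := hZ.exists_isIso_of_sum (s := s)
    (φ := fun j => (stabπ D).map (p j) ≫ (stabπ D).map (i j)) (by rw [← h]; infer_instance)
  have h0 : 𝟙 ((stabπ D).obj (f j)) ≠ 0 := fun h0 => hZ.not_isIso_zero (by
    rwa [← Category.comp_id ((stabπ D).map (p j)), h0, Limits.comp_zero, zero_comp] at h)
  exact ⟨f j, hs j hj, ((hs j hj).stab h0).nonempty_iso_of_isIso hZ.id_ne_zero h, i j, p j,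
    hip j hj⟩

lemma not_isProj_of_ne_zero (hF : IsFrobenius D) {Z : C} (h : 𝟙 ((stabπ D).obj Z) ≠ 0) :
    ¬ IsProj D Z := fun hZ =>
  h ((IsZero.iff_id_eq_zero _).1 (isZero_stab_of_projInj ⟨hZ, (hF.proj_iff_inj Z).1 hZ⟩))

/-- A retract in the stable category of a local object is a retract. -/
lemma retract_of_stab {Z B : C} (hZ : IsLocalObj Z) (h0 : 𝟙 ((stabπ D).obj Z) ≠ 0) {b : B ⟶ Z}
    {g : (stabπ D).obj Z ⟶ (stabπ D).obj B} (h : IsIso (g ≫ (stabπ D).map b)) :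
    Nonempty (Retract Z B) := by
  obtain ⟨(g : Z ⟶ B), rfl⟩ := AddQuot.map_surj g
  obtain ⟨(y : Z ⟶ Z), hy⟩ := AddQuot.map_surj (inv ((stabπ D).map g ≫ (stabπ D).map b))
  have h1 : (stabπ D).map (g ≫ b ≫ y) = 𝟙 _ := by
    rw [Functor.map_comp, Functor.map_comp, hy, ← Category.assoc, IsIso.hom_inv_id]
  -- This endomorphism becomes the identity stably. If its difference from 1 were invertible, zero
  -- would be invertible stably, making Z stably zero; so it is itself invertible.
  rcases hZ.isIso_or (g ≫ b ≫ y) with h | h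
  · exact ⟨⟨g, b ≫ y ≫ inv (g ≫ b ≫ y), by
      rw [← Category.assoc b, ← Category.assoc, IsIso.hom_inv_id]⟩⟩
  · have h2 : (stabπ D).map (𝟙 Z - g ≫ b ≫ y) = 0 := by
      rw [(stabπ D).map_sub, h1, CategoryTheory.Functor.map_id, sub_self]
    have h3 : IsIso ((stabπ D).map (𝟙 Z - g ≫ b ≫ y)) := inferInstance
    rw [h2] at h3
    exact absurd (by rw [← IsIso.hom_inv_id (0 : (stabπ D).obj Z ⟶ (stabπ D).obj Z), zero_comp]) h0

lemma hasSinkMaps_of_maxMutable_stab (hF : IsFrobenius D)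
    (h : MaxMutable (stabData D) (stabProp D T)) : HasSinkMaps (StabSub D T) := fun z hz => by
  have hz' := (isLocalObj_fullSubcategory_iff z).1 hz
  -- Extension groups of the stable category are those of C, so an object projective there is
  -- projective in C, hence stably zero and not local.
  obtain ⟨B, b, hB, hret, hfac⟩ := h.exists_sink z.2 hz' fun hp =>
    not_isProj_of_ne_zero (Z := z.obj.as) hF hz'.id_ne_zero
      fun X => hp ((stabπ D).obj X)
  refine ⟨⟨B, hB⟩, ObjectProperty.homMk b, fun g hg => ?_, fun X hX hXz f => ?_⟩
  · have : IsIso (g.hom ≫ b) := (stabProp D T).ι.map_isIso (f := g ≫ ObjectProperty.homMk b)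
    exact hret.elim ⟨g.hom, b ≫ inv (g.hom ≫ b), by rw [← Category.assoc, IsIso.hom_inv_id]⟩
  · obtain ⟨g, hg⟩ := hfac X.obj ((isLocalObj_fullSubcategory_iff X).1 hX) X.2
      ⟨fun e => hXz.elim (ObjectProperty.isoMk _ e)⟩ f.hom
    exact ⟨ObjectProperty.homMk g, ObjectProperty.hom_ext _ hg⟩

/-- Stable local objects lift to local objects of T in C, non-projective since stably nonzero. The
sink maps of C remain sink maps because, by `retract_of_stab`, no new retractions appear stably. -/
lemma hasSinkMaps_of_maxMutable (hF : IsFrobenius D) (hT : ClusterTilting D T)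
    (hC : ∀ X : C, LocalDecomp X) (h : MaxMutable D T) : HasSinkMaps (StabSub D T) := fun z hz => by
  have hz' := (isLocalObj_fullSubcategory_iff z).1 hz
  obtain ⟨Z, hZ, ⟨e⟩, i, r, hir⟩ := exists_local_lift hC hz'
  have h0 := (hz'.of_iso e.symm).id_ne_zero
  obtain ⟨B, b, hB, hret, hfac⟩ := h.exists_sink (hT.of_retract z.2 i r hir) hZ
    (not_isProj_of_ne_zero hF h0)
  refine ⟨⟨(stabπ D).obj B, hB⟩, ObjectProperty.homMk ((stabπ D).map b ≫ e.inv), fun g hg => ?_,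
    fun X hX hXz f => ?_⟩
  · have : IsIso (g.hom ≫ (stabπ D).map b ≫ e.inv) :=
      (stabProp D T).ι.map_isIso (f := g ≫ ObjectProperty.homMk ((stabπ D).map b ≫ e.inv))
    refine not_nonempty_iff.2 hret (retract_of_stab hZ h0 (g := e.inv ≫ g.hom) (b := b) ?_)
    have h1 : (e.inv ≫ g.hom) ≫ (stabπ D).map b =
        e.inv ≫ (g.hom ≫ (stabπ D).map b ≫ e.inv) ≫ e.hom := by
      simp
    rw [h1]
    infer_instance
  · obtain ⟨X₀, hX₀, ⟨e'⟩, i', r', hir'⟩ :=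
      exists_local_lift hC ((isLocalObj_fullSubcategory_iff X).1 hX)
    obtain ⟨(f' : X₀ ⟶ Z), hf'⟩ := AddQuot.map_surj (e'.inv ≫ f.hom ≫ e.hom)
    obtain ⟨g, hg⟩ := hfac X₀ hX₀ (hT.of_retract X.2 i' r' hir')
      ⟨fun e'' => hXz.elim (ObjectProperty.isoMk _ (e' ≪≫ (stabπ D).mapIso e'' ≪≫ e.symm))⟩ f'
    refine ⟨ObjectProperty.homMk (e'.hom ≫ (stabπ D).map g), ObjectProperty.hom_ext _ ?_⟩
    change (e'.hom ≫ (stabπ D).map g) ≫ (stabπ D).map b ≫ e.inv = f.hom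
    have : (stabπ D).map g ≫ (stabπ D).map b = e'.inv ≫ f.hom ≫ e.hom := by
      rw [← Functor.map_comp, hg, hf']
    rw [Category.assoc, ← Category.assoc ((stabπ D).map g), this]
    simp

lemma almostContained_of_reachable (hT : ClusterTilting D T) (hU : ClusterTilting D U)
    (hC : ∀ X : C, LocalDecomp X) (h : Reachable D T U) :
    AlmostContained (stabProp D T) (stabProp D U) := by
  classical
  obtain ⟨s, hs⟩ := h.exists_finset
  refine almostContained_of_finset
    (fun e h => (clusterTilting_stabProp hT).of_iso h e.symm)
    ⟨s.image (stabπ D).obj, fun z hz hTz => ?_⟩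
  obtain ⟨Z, hZ, ⟨e⟩, i, r, hir⟩ := exists_local_lift hC hz
  rcases hs Z hZ (hT.of_retract hTz i r hir) with h | ⟨W, hW, ⟨e'⟩⟩
  · exact Or.inl ((clusterTilting_stabProp hU).of_iso (Y := (stabπ D).obj Z) h e)
  · exact Or.inr ⟨_, Finset.mem_image_of_mem _ hW, ⟨e ≪≫ (stabπ D).mapIso e'⟩⟩

end StableMutation

end ClusterIso

namespace ClusterIso

/-! ### The maps on finite-dimensional modules -/

section FdMaps

variable {K : Type k} [Field K] {C : Type u} [Category.{v} C] [Preadditive C] [Linear K C]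
  {D : ExtData K C} {T U : ObjectProperty C}

lemma IsAdjointPair.eq {F F' : KNum K (StabSub D U) →+ KNum K (StabSub D T)}
    {g : K0Split (StabSub D T) →+ K0Split (StabSub D U)} (h : IsAdjointPair D F g)
    (h' : IsAdjointPair D F' g) : F = F' := by
  refine AddMonoidHom.ext fun m => ?_
  exact KNum.eq_of_pairing fun t => by rw [h, h']

lemma fdToNum_injective [HasZeroObject (StabSub D T)] [HasBinaryBiproducts (StabSub D T)]
    (hA : ∀ X : StabSub D T, LocalDecomp X) : Function.Injective (fdToNum D T) := by
  rw [injective_iff_map_eq_zero]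
  refine fun x hx => eq_zero_of_dimAt_eq_zero hA x fun X => ?_
  have hx' : K0Mod.map (fun _ h => h.1) x ∈ (⨅ X : StabSub D T, (dimAt (K := K) X).ker) :=
    (QuotientAddGroup.eq_zero_iff _).1 hx
  exact AddSubgroup.mem_iInf.1 hx' X

lemma fdToNum_eulerMap (S : TwoTerm K (StabSub D T) (StabSub D U))
    (hQ : IsAbelianClass (stabFd D T))
    (hker : ∀ M (hM : stabFd D U M), stabFd D T (S.kerMod hM.1.1))
    (hcoker : ∀ M (hM : stabFd D U M), stabFd D T (S.cokerMod hM.1.1)) (x) :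
    fdToNum D T (S.eulerMap hQ (fun _ h => h.1.1) hker hcoker x) =
      QuotientAddGroup.mk' _ (S.lfdEulerMap (K0Mod.map (fun _ h => h.1) x)) := by
  have : (fdToNum D T).comp (S.eulerMap hQ (fun _ h => h.1.1) hker hcoker) =
      (QuotientAddGroup.mk' _).comp (S.lfdEulerMap.comp (K0Mod.map (fun _ h => h.1))) := by
    refine K0Mod.hom_ext fun M hM => ?_
    rw [AddMonoidHom.comp_apply, S.eulerMap_cls, AddMonoidHom.comp_apply, AddMonoidHom.comp_apply,
      K0Mod.map_cls, TwoTerm.lfdEulerMap, S.eulerMap_cls, fdToNum, AddMonoidHom.comp_apply, map_sub,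
      K0Mod.map_cls, K0Mod.map_cls]
  exact DFunLike.congr_fun this x

variable [HasZeroObject C] [HasBinaryBiproducts C] (hD : IsExtriangulated D) (hF : IsFrobenius D)
  (hT : ClusterTilting D T) (hU : ClusterTilting D U)

lemma indBar_cls (c : ∀ t : StabSub D T, Coresolution (stabData D) (stabProp D U) t.obj)
    {M : (StabSub D U)ᵒᵖ ⥤ ModuleCat.{v} K} (hM : stabFp D U M) (hM' : IsModule M)
    (hc : stabFp D T ((coindexComplex (hD.hasExactConfl.quotData le_rfl)
      (clusterTilting_stabProp hU) c).cokerMod hM'))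
    (hk : stabFp D T ((coindexComplex (hD.hasExactConfl.quotData le_rfl)
      (clusterTilting_stabProp hU) c).kerMod hM')) :
    indBar hD hF hT hU c (K0Mod.cls M hM) = K0Mod.cls _ hc - K0Mod.cls _ hk := by
  rw [indBar, fpIndBar]
  exact TwoTerm.eulerMap_cls _ _ _ _ _ M hM

lemma coindBar_cls (r : ∀ t : StabSub D T, Resolution (stabData D) (stabProp D U) t.obj)
    {M : (StabSub D U)ᵒᵖ ⥤ ModuleCat.{v} K} (hM : stabFp D U M) (hM' : IsModule M)
    (hc : stabFp D T ((indexComplex (hD.hasExactConfl.quotData le_rfl)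
      (clusterTilting_stabProp hU) r).cokerMod hM'))
    (hk : stabFp D T ((indexComplex (hD.hasExactConfl.quotData le_rfl)
      (clusterTilting_stabProp hU) r).kerMod hM')) :
    coindBar hD hF hT hU r (K0Mod.cls M hM) = -(K0Mod.cls _ hc - K0Mod.cls _ hk) := by
  rw [coindBar, fpCoindBar]
  exact congrArg (fun z => -z)
    (TwoTerm.eulerMap_cls _ (isAbelianClass_stabFp hD hF hT) _ _ _ M hM)

variable
  (hL : Nonempty (ExactLift.{k, u, v, u', v'} D))
  (hAT : ∀ X : StabSub D T, LocalDecomp X) (hAU : ∀ X : StabSub D U, LocalDecomp X)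
  (halm : AlmostContained (stabProp D T) (stabProp D U))
  (jT : stabFd D T ≤ stabFp D T) (jU : stabFd D U ≤ stabFp D U)

include hD hF hT hU hL hAT hAU halm

/-- One two-term complex computes everything: Ind on finitely presented modules, the adjoint of the
coindex on locally finite-dimensional ones, and their common restriction. Uniqueness combines
nondegeneracy of the pairing with injectivity of `fdToNum`. -/
theorem existsUnique_isFdIndBar {Ind : K0Mod (stabFp D U) →+ K0Mod (stabFp D T)}
    (hInd : IsIndBar D T U Ind) : ∃ f, IsFdIndBar D T U f ∧ (∀ f', IsFdIndBar D T U f' → f' = f) ∧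
      (K0Mod.map jT).comp f = Ind.comp (K0Mod.map jU) := by
  have := hasZeroObject_stab (D := D)
  have := hasBinaryBiproducts_addQuot (K := K) (ProjInj D)
  have hT' := clusterTilting_stabProp hT
  have hU' := clusterTilting_stabProp hU
  have hD' := hD.hasExactConfl.quotData (P := ProjInj D) le_rfl
  have := hasZeroObject_sub hT'
  have := hasZeroObject_sub hU'
  have := hasBinaryBiproducts_fullSubcategory fun _ _ hX hY => hT'.of_biprod hX hY
  have := hasBinaryBiproducts_fullSubcategory fun _ _ hX hY => hU'.of_biprod hX hY
  have hiso : ∀ {X Y : Stab D}, (X ≅ Y) → stabProp D T X → stabProp D T Y :=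
    fun e h => hT'.of_iso h e.symm
  have c := fun t : StabSub D T => Classical.choice (nonempty_coresolution hD' hU' t.obj)
  let S := coindexComplex hD' hU' c
  have hker : ∀ M (hM : stabFd D U M), stabFd D T (S.kerMod hM.1.1) := fun M hM =>
    (fdMod_iff hAT _).2 ⟨S.lfdMod_kerMod hM.1, hasFiniteSupport_kerMod_coindexComplex hD' hU' halm
      hiso c _ ((fdMod_iff hAU M).1 hM).2⟩
  have hcoker : ∀ M (hM : stabFd D U M), stabFd D T (S.cokerMod hM.1.1) := fun M hM =>
    (fdMod_iff hAT _).2 ⟨S.lfdMod_cokerMod hM.1, hasFiniteSupport_cokerMod_coindexComplex hD' hU'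
      halm hiso c _ ((fdMod_iff hAU M).1 hM).2⟩
  obtain ⟨g, hg, hg'⟩ := existsUnique_isCoindex_stab (T := T) hD hF hU hL
  obtain ⟨F, hFg, hFS⟩ := S.exists_adjoint g fun t => hg.eq t ⟨c t, rfl⟩
  have hf : ∀ m, fdToNum D T (S.eulerMap (isAbelianClass_fdMod hAT) (fun _ h => h.1.1) hker hcoker m)
      = F (fdToNum D U m) := fun m =>
    (fdToNum_eulerMap S _ hker hcoker m).trans (hFS _).symm
  refine ⟨_, ⟨F, g, hg, hFg, hf⟩, ?_, ?_⟩
  · rintro f' ⟨F', g₁, hg₁, hFg', hf'⟩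
    obtain rfl := hg' g₁ hg₁
    obtain rfl := IsAdjointPair.eq hFg hFg'
    refine AddMonoidHom.ext fun m => ?_
    exact fdToNum_injective hAT ((hf' m).trans (hf m).symm)
  · rw [(existsUnique_isIndBar hD hF hT hU).unique hInd (isIndBar_indBar hD hF hT hU c)]
    refine K0Mod.hom_ext fun M hM => ?_
    rw [AddMonoidHom.comp_apply, S.eulerMap_cls, AddMonoidHom.comp_apply, map_sub, K0Mod.map_cls,
      K0Mod.map_cls, K0Mod.map_cls]
    exact (indBar_cls hD hF hT hU c (jU M hM) hM.1.1 _ _).symm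

/-- The argument of `existsUnique_isFdIndBar` for the complexes of resolutions. -/
theorem existsUnique_isFdCoindBar {Coind : K0Mod (stabFp D U) →+ K0Mod (stabFp D T)}
    (hCoind : IsCoindBar D T U Coind) : ∃ f, IsFdCoindBar D T U f ∧
      (∀ f', IsFdCoindBar D T U f' → f' = f) ∧
      (K0Mod.map jT).comp f = Coind.comp (K0Mod.map jU) := by
  have := hasZeroObject_stab (D := D)
  have := hasBinaryBiproducts_addQuot (K := K) (ProjInj D)
  have hT' := clusterTilting_stabProp hT
  have hU' := clusterTilting_stabProp hU
  have hD' := hD.hasExactConfl.quotData (P := ProjInj D) le_rfl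
  have := hasZeroObject_sub hT'
  have := hasZeroObject_sub hU'
  have := hasBinaryBiproducts_fullSubcategory fun _ _ hX hY => hT'.of_biprod hX hY
  have := hasBinaryBiproducts_fullSubcategory fun _ _ hX hY => hU'.of_biprod hX hY
  have hiso : ∀ {X Y : Stab D}, (X ≅ Y) → stabProp D T X → stabProp D T Y :=
    fun e h => hT'.of_iso h e.symm
  have r := fun t : StabSub D T => Classical.choice (nonempty_resolution hD' hU' t.obj)
  let S := indexComplex hD' hU' r
  have hker : ∀ M (hM : stabFd D U M), stabFd D T (S.kerMod hM.1.1) := fun M hM =>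
    (fdMod_iff hAT _).2 ⟨S.lfdMod_kerMod hM.1, hasFiniteSupport_kerMod_indexComplex hD' hU' halm
      hiso r _ ((fdMod_iff hAU M).1 hM).2⟩
  have hcoker : ∀ M (hM : stabFd D U M), stabFd D T (S.cokerMod hM.1.1) := fun M hM =>
    (fdMod_iff hAT _).2 ⟨S.lfdMod_cokerMod hM.1, hasFiniteSupport_cokerMod_indexComplex hD' hU'
      halm hiso r _ ((fdMod_iff hAU M).1 hM).2⟩
  obtain ⟨g, hg, hg'⟩ := existsUnique_isIndex_stab (T := T) hD hF hU hL
  -- The complex N_t → R_t has class [N_t] - [R_t], which is minus the index of t; the signs are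
  -- restored below.
  obtain ⟨F, hFg, hFS⟩ := S.exists_adjoint (-g) fun t => by
    rw [AddMonoidHom.neg_apply, hg.eq t ⟨_, _, _, _, ⟨_, (r t).real⟩, rfl⟩, neg_sub]
    rfl
  have hf : ∀ m, fdToNum D T
      ((-S.eulerMap (isAbelianClass_fdMod hAT) (fun _ h => h.1.1) hker hcoker) m) =
      (-F) (fdToNum D U m) := fun m => by
    rw [AddMonoidHom.neg_apply, AddMonoidHom.neg_apply, map_neg]
    exact congrArg (fun z => -z) ((fdToNum_eulerMap S _ hker hcoker m).trans (hFS _).symm)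
  have hFg : IsAdjointPair D (-F) g := fun m t => by
    rw [AddMonoidHom.neg_apply, map_neg, hFg, AddMonoidHom.neg_apply, map_neg,
      AddMonoidHom.neg_apply, neg_neg]
  refine ⟨_, ⟨-F, g, hg, hFg, hf⟩, ?_, ?_⟩
  · rintro f' ⟨F', g₁, hg₁, hFg', hf'⟩
    obtain rfl := hg' g₁ hg₁
    obtain rfl := IsAdjointPair.eq hFg hFg'
    refine AddMonoidHom.ext fun m => ?_
    exact fdToNum_injective hAT ((hf' m).trans (hf m).symm)
  · rw [(existsUnique_isCoindBar hD hF hT hU).unique hCoind (isCoindBar_coindBar hD hF hT hU r)]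
    refine K0Mod.hom_ext fun M hM => ?_
    rw [AddMonoidHom.comp_apply, AddMonoidHom.neg_apply, S.eulerMap_cls, AddMonoidHom.comp_apply,
      map_neg, map_sub, K0Mod.map_cls, K0Mod.map_cls, K0Mod.map_cls]
    exact (coindBar_cls hD hF hT hU r (jU M hM) hM.1.1 _ _).symm

end FdMaps

/-- Finite-dimensional modules over the stable category of `T` are finitely presented. -/
lemma stabFd_le_stabFp {K : Type k} [Field K] {C : Type u} [Category.{v} C] [Preadditive C]
    [Linear K C] [HasZeroObject C] [HasBinaryBiproducts C] {D : ExtData K C} {T : ObjectProperty C}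
    (hT : ClusterTilting D T) (hfin : ∀ X Y : Stab D, Module.Finite K (X ⟶ Y))
    (hA : ∀ X : StabSub D T, LocalDecomp X) (hsink : HasSinkMaps (StabSub D T)) :
    stabFd D T ≤ stabFp D T := by
  have := hasZeroObject_stab (D := D)
  have := hasBinaryBiproducts_addQuot (K := K) (ProjInj D)
  have hT' := clusterTilting_stabProp hT
  have := hasZeroObject_sub hT'
  have := hasBinaryBiproducts_fullSubcategory fun _ _ hX hY => hT'.of_biprod hX hY
  refine fdMod_le_fpMod hA (fun X Y => ?_) hsink
  have := hfin X.obj Y.obj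
  let φ : (X ⟶ Y) →ₗ[K] (X.obj ⟶ Y.obj) :=
    { toFun := fun f => f.hom
      map_add' := fun _ _ => rfl
      map_smul' := fun _ _ => rfl }
  exact Module.Finite.of_injective φ fun f g h => ObjectProperty.hom_ext _ h

/-- Under the mutability hypotheses, the stable categories of `T` and `U` are direct sums of local
objects and have sink maps, and almost all of `T` is in `U`. -/
lemma exists_fd_setting {K : Type k} [Field K] {C : Type u} [Category.{v} C] [Preadditive C]
    [Linear K C] {D : ExtData K C} (hF : IsFrobenius D) {T U : ObjectProperty C}
    (hT : ClusterTilting D T) (hU : ClusterTilting D U)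
    (h : (IsKrullSchmidt C ∧ MaxMutable D T ∧ MaxMutable D U ∧
            (FiniteRank D ∨ Reachable D T U)) ∨
          (IsKrullSchmidt (Stab D) ∧ MaxMutable (stabData D) (stabProp D T) ∧
            MaxMutable (stabData D) (stabProp D U) ∧
            (FiniteRank D ∨ Reachable (stabData D) (stabProp D T) (stabProp D U)))) :
    (∀ X : StabSub D T, LocalDecomp X) ∧ (∀ X : StabSub D U, LocalDecomp X) ∧
      HasSinkMaps (StabSub D T) ∧ HasSinkMaps (StabSub D U) ∧
      AlmostContained (stabProp D T) (stabProp D U) := by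
  have hdec : ∀ {V : ObjectProperty C}, ClusterTilting D V → (∀ X : Stab D, LocalDecomp X) →
      ∀ X : StabSub D V, LocalDecomp X := fun hV h X =>
    LocalDecomp.fullSubcategory
      (fun i r hir hY => (clusterTilting_stabProp hV).of_retract hY i r hir) X (h X.obj)
  rcases h with ⟨hKS, hmT, hmU, h⟩ | ⟨hKS, hmT, hmU, h⟩
  · have hS : ∀ X : Stab D, LocalDecomp X := fun X => (hKS.localDecomp X.as).stab
    refine ⟨hdec hT hS, hdec hU hS, hasSinkMaps_of_maxMutable hF hT hKS.localDecomp hmT,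
      hasSinkMaps_of_maxMutable hF hU hKS.localDecomp hmU, ?_⟩
    rcases h with h | h
    · exact (h T hT).almostContained (hdec hT hS)
    · exact almostContained_of_reachable hT hU hKS.localDecomp h
  · have hS := hKS.localDecomp
    refine ⟨hdec hT hS, hdec hU hS, hasSinkMaps_of_maxMutable_stab hF hmT,
      hasSinkMaps_of_maxMutable_stab hF hmU, ?_⟩
    rcases h with h | h
    · exact (h T hT).almostContained (hdec hT hS)
    · exact almostContained_of_finset (fun e h => (clusterTilting_stabProp hT).of_iso h e.symm)
        h.exists_finset

end ClusterIso

end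

/-! ### The theorem and its corollary. -/

open ClusterIso in
theorem theoremt {K : Type k} [Field K] [PerfectField K]
    {C : Type u} [Category.{v} C] [Preadditive C] [Linear K C]
    [HasZeroObject C] [HasBinaryBiproducts C]
    (D : ExtData K C) (hC : IsClusterCategory.{k, u, v, u', v'} D)
    (hstab : IsCompactCat (stabData D) ∨ IsSkewSymmetric K (Stab D))
    (T U : ObjectProperty C) (hT : ClusterTilting D T) (hU : ClusterTilting D U) :
    -- all maps in the diagrams are well defined
    (∃! βT, IsExchangeMap.{k, u, v, u', v'} D T βT) ∧
    (∃! βU, IsExchangeMap.{k, u, v, u', v'} D U βU) ∧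
    (∃! ind, IsIndex D T U ind) ∧ (∃! coind, IsCoindex D T U coind) ∧
    (∃! Ind, IsIndBar D T U Ind) ∧ (∃! Coind, IsCoindBar D T U Coind) ∧
    ∀ (βT : K0Mod (stabFp D T) →+ K0Split T.FullSubcategory)
      (βU : K0Mod (stabFp D U) →+ K0Split U.FullSubcategory)
      (ind coind : K0Split U.FullSubcategory →+ K0Split T.FullSubcategory)
      (Ind Coind : K0Mod (stabFp D U) →+ K0Mod (stabFp D T)),
      IsExchangeMap.{k, u, v, u', v'} D T βT → IsExchangeMap.{k, u, v, u', v'} D U βU →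
      IsIndex D T U ind → IsCoindex D T U coind → IsIndBar D T U Ind → IsCoindBar D T U Coind →
      -- the two squares on finitely presented modules
      (βT.comp Ind = ind.comp βU ∧ βT.comp Coind = coind.comp βU) ∧
      -- the two squares on finite-dimensional modules
      ((IsKrullSchmidt C ∧ MaxMutable D T ∧ MaxMutable D U ∧
            (FiniteRank D ∨ Reachable D T U)) ∨
          (IsKrullSchmidt (Stab D) ∧ MaxMutable (stabData D) (stabProp D T) ∧
            MaxMutable (stabData D) (stabProp D U) ∧
            (FiniteRank D ∨ Reachable (stabData D) (stabProp D T) (stabProp D U))) →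
        ∃ (jT : stabFd D T ≤ stabFp D T) (jU : stabFd D U ≤ stabFp D U),
          (∃! f, IsFdIndBar D T U f) ∧ (∃! g, IsFdCoindBar D T U g) ∧
          ∀ f g : K0Mod (stabFd D U) →+ K0Mod (stabFd D T),
            IsFdIndBar D T U f → IsFdCoindBar D T U g →
            (βT.comp (K0Mod.map jT)).comp f = ind.comp (βU.comp (K0Mod.map jU)) ∧
            (βT.comp (K0Mod.map jT)).comp g = coind.comp (βU.comp (K0Mod.map jU))) := by
  have hD := hC.extriangulated
  have hF := hC.frobenius
  have hL := hC.algebraic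
  refine ⟨existsUnique_isExchangeMap hT hL hD hF, existsUnique_isExchangeMap hU hL hD hF,
    existsUnique_isIndex hT hD hL U, existsUnique_isCoindex hT hD hL U,
    existsUnique_isIndBar hD hF hT hU, existsUnique_isCoindBar hD hF hT hU, ?_⟩
  intro βT βU ind coind Ind Coind hβT hβU hind hcoind hInd hCoind
  have h₁ := exchange_comp_indBar hD hF hT hU hL hβT hβU hind hInd
  have h₂ := exchange_comp_coindBar hD hF hT hU hL hβT hβU hcoind hCoind
  refine ⟨⟨h₁, h₂⟩, fun h => ?_⟩
  -- The corollary follows by pasting: the maps on finite-dimensional modules are restrictions of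
  -- Ind and Coind, whose squares already commute.
  obtain ⟨hAT, hAU, hsT, hsU, halm⟩ := exists_fd_setting hF hT hU h
  have jT := stabFd_le_stabFp hT hC.stably2CY.1 hAT hsT
  have jU := stabFd_le_stabFp hU hC.stably2CY.1 hAU hsU
  obtain ⟨f, hf, hf', hfI⟩ := existsUnique_isFdIndBar hD hF hT hU hL hAT hAU halm jT jU hInd
  obtain ⟨g, hg, hg', hgC⟩ := existsUnique_isFdCoindBar hD hF hT hU hL hAT hAU halm jT jU hCoind
  refine ⟨jT, jU, ⟨f, hf, hf'⟩, ⟨g, hg, hg'⟩, fun f₁ g₁ hf₁ hg₁ => ⟨?_, ?_⟩⟩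
  · rw [hf' f₁ hf₁, AddMonoidHom.comp_assoc, hfI, ← AddMonoidHom.comp_assoc, h₁,
      AddMonoidHom.comp_assoc]
  · rw [hg' g₁ hg₁, AddMonoidHom.comp_assoc, hgC, ← AddMonoidHom.comp_assoc, h₂,
      AddMonoidHom.comp_assoc]
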